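/- **Setting.** Let $d\in\mathbb N$, $d\ge 1$, $\alpha\ge 0$, and let $p\in C([0,\infty))\cap C^1((0,\infty))$ with $p'>0$ on $(0,\infty)$. Let $h\in C([0,\infty))$ be differentiable on $(0,\infty)$ with $p(z)=zh'(z)-h(z)$ for $z>0$; $h'(0)$ denotes the one-sided derivative. Put $h(r|\bar r)=h(r)-h(\bar r)-h'(\bar r)(r-\bar r)$, $p(r|\bar r)=p(r)-p(\bar r)-p'(\bar r)(r-\bar r)$, $\frac00:=0$, and $$\mathcal E(\tau;\rho,n\,|\,\bar\rho,\bar n)=\int_{\mathbb R^d}\tfrac12 e^{-d\tau}\rho\Big|\frac n\rho-\frac{\bar n}{\bar\rho}\Big|^2+h(\rho|\bar\rho)\,dy\in[0,\infty],$$ where the integrand is $+\infty$ if $\rho<0$, or if $\rho=0$ and $n\ne0$. Either $\hat\rho\in C^1(\mathbb R^d\setminus\{0\};(0,\infty))$ with $\hat\rho(\lambda y)=\hat\rho(y)$ for all $\lambda>0$, $y\neq 0$, or $\hat\rho\equiv0$. **Solutions.** Consider the scaled damped Euler system $$\rho_\tau=\tfrac y2\cdot\nabla\rho-\operatorname{div}n,\qquad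 n_\tau=\tfrac y2\cdot\nabla n+\tfrac d2 n-\operatorname{div}\Big(\frac{n\otimes n}{\rho}\Big)-e^{d\tau}\big(\nabla p(\rho)+\alpha n\big)$$ on $(0,\infty)\times\mathbb R^d$. Let $(\rho_0,n_0)\in L^1_{\rm loc}(\mathbb R^d)\times L^1_{\rm loc}(\mathbb R^d;\mathbb R^d)$ with $\mathcal E(0;\rho_0,n_0|\hat\rho,0)<\infty$. Then $(\rho,n,E)\in L^1_{\rm loc}([0,\infty)\times\mathbb R^d)\times L^1_{\rm loc}([0,\infty)\times\mathbb R^d;\mathbb R^d)\times BV([0,\infty))$ is an energy-variational solution with initial data $(\rho_0,n_0)$, reference density $\rho_\infty$ and regularity weight $\mathcal K$ if the following holds. * $0\le\rho_\infty\in C^1([0,\infty)\times\mathbb R^d)$, $h'(\rho_\infty)$ is well defined and $C^1$ on $[0,\infty)\times\mathbb R^d$, and for every $T>0$ there is $R>0$ with $\rho_\infty(\tau,y)=\hat\rho(y)$ for $\tau\in[0,T]$, $|y|>R$. * $\mathcal K\colon C^1_c(\mathbb R^d;\mathbb R^d)\to[0,\infty)$ satisfies $\mathcal K(\lambda\psi)=\lambda\mathcal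 K(\psi)$ for $\lambda>0$. * $\mathcal E(\tau;\rho,n|\rho_\infty,0)\le E(\tau)$ for a.a. $\tau>0$. * For all $\phi\in C_c^1([0,\infty)\times\mathbb R^d)$, $\psi\in C_c^1([0,\infty)\times\mathbb R^d;\mathbb R^d)$ and a.a. $0\le\sigma<\tau$, including $\sigma=0$ with $(\rho,n)(0)=(\rho_0,n_0)$, $$\begin{aligned}&\Big[E+\int_{\mathbb R^d}\phi\rho+\psi\cdot n\,dy\Big]\Big|_\sigma^\tau+\int_\sigma^\tau\tfrac d2E\,d\tau'+\int_\sigma^\tau\!\!\int_{\mathbb R^d}\alpha\frac{|n|^2}{\rho}\,dy\,d\tau'-\int_\sigma^\tau\!\!\int_{\mathbb R^d}\phi_\tau\rho-\nabla\phi\cdot\big(\tfrac y2\rho-n\big)-\tfrac d2\phi\rho\,dy\,d\tau'\\&-\int_\sigma^\tau\!\!\int_{\mathbb R^d}\psi_\tau\cdot n+\nabla\psi:\Big(-n\otimes\tfrac y2+\frac{n\otimes n}{\rho}+e^{d\tau'}p(\rho)\mathbb I\Big)-e^{d\tau'}\alpha\,\psi\cdot n\,dy\,d\tau'\\&\le\int_\sigma^\tau\!\!\int_{\mathbb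 R^d}-\Big(h'(\rho_\infty)_\tau-\tfrac y2\cdot\nabla h'(\rho_\infty)\Big)(\rho-\rho_\infty)-\nabla h'(\rho_\infty)\cdot n\,dy\,d\tau'+\int_\sigma^\tau e^{d\tau'}\mathcal K(\psi)\big(E-\mathcal E(\tau';\rho,n|\rho_\infty,0)\big)\,d\tau',\end{aligned}$$ where all integrands are required to be integrable; in particular $p(\rho),\frac{|n|^2}{\rho}\in L^1_{\rm loc}([0,\infty)\times\mathbb R^d)$, the integrand of the first integral on the right is in $L^1((0,T)\times\mathbb R^d)$ for every $T>0$, and so is the integrand of the last one in $L^1(0,T)$ for every $\psi$. **Reference pairs.** Let $\bar\rho\in C^1((0,\infty)\times\mathbb R^d)\cap C([0,\infty)\times\mathbb R^d)$ and $\bar n\in C^1((0,\infty)\times\mathbb R^d;\mathbb R^d)\cap C([0,\infty)\times\mathbb R^d;\mathbb R^d)$, and set $$\begin{aligned}\bar R_1&=\bar\rho_\tau-\tfrac y2\cdot\nabla\bar\rho+\operatorname{div}\bar n,\qquad \bar R_2=\bar n_\tau-\tfrac y2\cdot\nabla\bar n-\tfrac d2\bar n+\operatorname{div}\Big(\frac{\bar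 n\otimes\bar n}{\bar\rho}\Big)+e^{d\tau}\big(\nabla p(\bar\rho)+\alpha\bar n\big),\qquad\bar R=\frac{\bar n}{\bar\rho}\bar R_1-\bar R_2,\\ \xi_1&=-\nabla\Big(\frac{\bar n}{\bar\rho}\Big):e^{-d\tau}\rho\Big(\frac n\rho-\frac{\bar n}{\bar\rho}\Big)\otimes\Big(\frac n\rho-\frac{\bar n}{\bar\rho}\Big)-\operatorname{div}\Big(\frac{\bar n}{\bar\rho}\Big)p(\rho|\bar\rho),\\ \xi_2&=e^{-d\tau}\frac{\rho}{\bar\rho}\Big(\frac n\rho-\frac{\bar n}{\bar\rho}\Big)\cdot\bar R,\qquad \xi_3=-(\rho-\bar\rho)h''(\bar\rho)\bar R_1,\qquad\Xi=\int_{\mathbb R^d}\xi_1+\xi_2+\xi_3\,dy,\\ \mathcal D_\alpha&(\rho,n|\bar\rho,\bar n)=\alpha\int_{\mathbb R^d}\rho\Big|\frac n\rho-\frac{\bar n}{\bar\rho}\Big|^2dy\end{aligned}$$ (all error terms are $0$ if $(\bar\rho,\bar n)\equiv(0,0)$). **Theorem.** Let $(\rho,n,E)$ be an energy-variational solution with initial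 data $(\rho_0,n_0)$, regularity weight $\mathcal K$ and reference density $\rho_\infty$. Assume one of the following: (a) Either $\hat\rho>0$, $\bar\rho>0$ on $[0,\infty)\times\mathbb R^d$, $\bar\rho-\hat\rho$ and $\bar n$ have compact support in space, uniformly for $\tau\in[0,T]$ for every $T>0$, and, for some $\delta>0$, $\xi_1+\xi_2+\xi_3\in L^1((0,\delta)\times\mathbb R^d)$ and $\mathcal K(-\bar n/\bar\rho)(E-\mathcal E(\tau;\rho,n|\rho_\infty,0))\in L^1(0,\delta)$; or $\hat\rho\equiv0$, $(\bar\rho,\bar n)\equiv(0,0)$, and there is $c>0$ with $p'(z)\le c\,p(z)/z$ for $z>0$, and $\int_0^1p(z)z^{-2}\,dz<\infty$. (b) $p(z)=kz^\gamma$ with $\gamma\ge1$, $k>0$; $\inf\bar\rho>0$; $$|\nabla\bar\rho|,\ |\nabla\bar n|,\ \bar\rho_\tau,\ |\bar n_\tau|,\ |y|(\bar\rho-\hat\rho),\ |y||\bar n|,\ y\cdot\nabla\bar\rho,\ |y\cdot\nabla\bar n|\ \in L^\infty_{\rm loc}([0,\infty);L^1(\mathbb R^d)\cap L^\infty(\mathbb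 R^d));$$ and $\mathcal K$ is defined also on all $\psi\in C^1(\mathbb R^d;\mathbb R^d)$ for which $\psi$ and $\nabla\psi$ are bounded, such that $\mathcal K(\psi)\le C\max\{\|\psi\|_\infty,\|\nabla\psi\|_\infty\}$ on $C^1_c(\mathbb R^d;\mathbb R^d)$ for some $C$, and $\mathcal K(\chi(\cdot/j)\psi)\to\mathcal K(\psi)$ as $\mathbb N\ni j\to\infty$ for all such $\psi$ and all $\chi\in C_c^\infty(\mathbb R^d;[0,1])$ with $\chi=1$ near $0$. Set $$\begin{aligned}\mathcal R(\tau)&=E(\tau)-\mathcal E(\tau;\rho(\tau),n(\tau)|\rho_\infty(\tau),0)+\mathcal E(\tau;\rho(\tau),n(\tau)|\bar\rho(\tau),\bar n(\tau)),\\ \mathcal R_0&=E(0)-\mathcal E(0;\rho_0,n_0|\rho_\infty(0),0)+\mathcal E(0;\rho_0,n_0|\bar\rho(0),\bar n(0)).\end{aligned}$$ Then the relative entropies in $\mathcal R_0$ are finite, $\mathcal E(\tau;\rho,n|\bar\rho,\bar n)<\infty$ for a.a. $\tau>0$, for every $T>0$ the functions $\mathcal R$ and $\mathcal K(-\bar n/\bar\rho)(E-\mathcal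 E(\tau;\rho,n|\rho_\infty,0))$ are in $L^1(0,T)$, the functions $\rho|\frac n\rho-\frac{\bar n}{\bar\rho}|^2$ and $\xi_1+\xi_2+\xi_3$ are in $L^1((0,T)\times\mathbb R^d)$, and $$\int_0^\infty-\varphi'\mathcal R+\varphi\Big(\frac d2\mathcal R+\mathcal D_\alpha(\rho,n|\bar\rho,\bar n)\Big)d\tau\le\varphi(0)\mathcal R_0+\int_0^\infty\varphi\Big[\Xi+\mathcal K\Big(-\frac{\bar n}{\bar\rho}\Big)\big(E-\mathcal E(\tau;\rho,n|\rho_\infty,0)\big)\Big]d\tau$$ for all $\varphi\in C_c^1([0,\infty))$ with $\varphi\ge0$. -/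

import Mathlib

open MeasureTheory Set Filter Topology
open scoped ENNReal NNReal

noncomputable section

namespace DampedEuler

/-- The Euclidean space `ℝ^d`. -/
abbrev Space (d : ℕ) : Type := EuclideanSpace ℝ (Fin d)

/-! ### Pressure laws and internal energy -/

/-- `p ∈ C([0,∞)) ∩ C¹((0,∞))` with `p' > 0` in `(0,∞)`. -/
structure IsPressureLaw (p : ℝ → ℝ) : Prop where
  continuousOn : ContinuousOn p (Ici 0)
  contDiffOn : ContDiffOn ℝ 1 p (Ioi 0)
  deriv_pos : ∀ z, 0 < z → 0 < deriv p z

/-- The `γ`-law `p(z) = k z^γ` for some `γ ≥ 1`, `k > 0`. -/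
def IsGammaLaw (p : ℝ → ℝ) : Prop :=
  ∃ γ k : ℝ, 1 ≤ γ ∧ 0 < k ∧ ∀ z, 0 ≤ z → p z = k * z ^ γ

/-- `p'(z) ≤ c p(z) / z` for some `c > 0`, and `∫₀¹ p(z) / z² dz < ∞`. -/
def IsVacuumRegular (p : ℝ → ℝ) : Prop :=
  (∃ c : ℝ, 0 < c ∧ ∀ z, 0 < z → deriv p z ≤ c * (p z / z)) ∧
    IntegrableOn (fun z => p z / z ^ 2) (Ioc 0 1)

/-- `h` is an internal energy belonging to the pressure `p`: `p(z) = z h'(z) - h(z)` for `z > 0`,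
with `h` continuous up to the vacuum `z = 0`. This determines `h` up to a term `c z`, which does not
affect any of the quantities below. -/
structure IsPressurePotential (p h : ℝ → ℝ) : Prop where
  continuousOn : ContinuousOn h (Ici 0)
  differentiableAt : ∀ z, 0 < z → DifferentiableAt ℝ h z
  pressure_eq : ∀ z, 0 < z → p z = z * deriv h z - h z

/-- `h'` on `[0,∞)`; at `0` this is the one-sided derivative. -/
def enthalpy (h : ℝ → ℝ) (z : ℝ) : ℝ := derivWithin h (Ici 0) z

/-- `h(r | r') = h(r) - h(r') - h'(r') (r - r')`. -/
def relPotential (h : ℝ → ℝ) (r r' : ℝ) : ℝ := h r - h r' - enthalpy h r' * (r - r')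

/-- `p(r | r') = p(r) - p(r') - p'(r') (r - r')`. -/
def relPressure (p : ℝ → ℝ) (r r' : ℝ) : ℝ := p r - p r' - deriv p r' * (r - r')

/-! ### Relative entropy -/

variable {d : ℕ}

/-- The quotient `m / r`, with `0 / 0 = 0`. -/
def velocity (r : ℝ) (m : Space d) : Space d := r⁻¹ • m

open Classical in
/-- `η(τ; r, m | r', m') = ½ e^{-dτ} r |m/r - m'/r'|² + h(r | r')`, with the value `∞` if `r < 0`,
or if `r = 0` and `m ≠ 0`. -/
def relEntropyDensity (h : ℝ → ℝ) (τ : ℝ) (r : ℝ) (m : Space d) (r' : ℝ) (m' : Space d) : ℝ≥0∞ :=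
  if 0 < r ∨ (r = 0 ∧ m = 0) then
    ENNReal.ofReal (1 / 2 * Real.exp (-(d * τ)) * r * ‖velocity r m - velocity r' m'‖ ^ 2
      + relPotential h r r')
  else ⊤

/-- The total relative entropy `ℰ(τ; r, m | r', m') = ∫ η(τ; r, m | r', m') dy ∈ [0,∞]`. -/
def relEntropy (h : ℝ → ℝ) (τ : ℝ) (r : Space d → ℝ) (m : Space d → Space d)
    (r' : Space d → ℝ) (m' : Space d → Space d) : ℝ≥0∞ :=
  ∫⁻ y, relEntropyDensity h τ (r y) (m y) (r' y) (m' y)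

/-! ### Vector calculus -/

/-- `div v = ∂_j v_j`. -/
def divergence (v : Space d → Space d) (y : Space d) : ℝ :=
  ∑ j, (fderiv ℝ v y (EuclideanSpace.single j 1)) j

/-- `div (a ⊗ b)`, with components `(div (a ⊗ b))_i = ∂_j (a_i b_j)`. -/
def tensorDivergence (a b : Space d → Space d) (y : Space d) : Space d :=
  WithLp.toLp 2 fun i => divergence (fun z => a z i • b z) y

/-! ### Limit densities, test functions and regularity weights -/

/-- `ρ̂ ∈ C¹(ℝ^d ∖ {0}; (0,∞))` is positively homogeneous of degree zero. -/
structure IsAngularLimit (ρhat : Space d → ℝ) : Prop where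
  contDiffOn : ContDiffOn ℝ 1 ρhat {0}ᶜ
  pos : ∀ y, y ≠ 0 → 0 < ρhat y
  homogeneous : ∀ c : ℝ, 0 < c → ∀ y, y ≠ 0 → ρhat (c • y) = ρhat y

/-- `C_c¹([0,∞) × ℝ^d; F)`, as restrictions to `τ ≥ 0` of functions in `C_c¹(ℝ × ℝ^d; F)`. -/
def IsSpaceTimeTest {F : Type*} [NormedAddCommGroup F] [NormedSpace ℝ F]
    (φ : ℝ → Space d → F) : Prop :=
  ContDiff ℝ 1 (Function.uncurry φ) ∧ HasCompactSupport (Function.uncurry φ)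

/-- `C_c¹(ℝ^d; ℝ^d)`. -/
def IsTestField (ψ : Space d → Space d) : Prop := ContDiff ℝ 1 ψ ∧ HasCompactSupport ψ

/-- `K` is a nonnegative, 1-homogeneous functional on `C_c¹(ℝ^d; ℝ^d)`. -/
structure IsRegularityWeight (K : (Space d → Space d) → ℝ) : Prop where
  nonneg : ∀ ψ, IsTestField ψ → 0 ≤ K ψ
  homogeneous : ∀ c : ℝ, 0 < c → ∀ ψ, IsTestField ψ → K (fun y => c • ψ y) = c * K ψ

/-- `K` is controlled by the `C¹`-norm, and its values on `C¹` fields which are bounded with bounded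
gradient, but need not have compact support, are the limits of its values on truncations. -/
structure IsTruncationStable (K : (Space d → Space d) → ℝ) : Prop where
  bounded : ∃ C : ℝ, ∀ ψ, IsTestField ψ → ∀ M : ℝ,
    (∀ y, ‖ψ y‖ ≤ M ∧ ‖fderiv ℝ ψ y‖ ≤ M) → K ψ ≤ C * M
  tendsto : ∀ ψ : Space d → Space d, ContDiff ℝ 1 ψ →
    (∃ M : ℝ, ∀ y, ‖ψ y‖ ≤ M ∧ ‖fderiv ℝ ψ y‖ ≤ M) →
    ∀ χ : Space d → ℝ, ContDiff ℝ (⊤ : ℕ∞) χ → HasCompactSupport χ →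
      (∀ y, 0 ≤ χ y ∧ χ y ≤ 1) → (∀ᶠ y in 𝓝 0, χ y = 1) →
      Tendsto (fun j : ℕ => K fun y => χ (((j : ℝ) + 1)⁻¹ • y) • ψ y) atTop (𝓝 (K ψ))

/-! ### Energy-variational solutions -/

/-- `E(τ) - ℰ(τ; ρ(τ), n(τ) | ρ_∞(τ), 0)`. -/
def energyDefect (h : ℝ → ℝ) (ρinf ρ : ℝ → Space d → ℝ) (n : ℝ → Space d → Space d) (E : ℝ → ℝ)
    (τ : ℝ) : ℝ :=
  E τ - (relEntropy h τ (ρ τ) (n τ) (ρinf τ) 0).toReal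

/-- `-(h'(ρ_∞)_τ - y/2 · ∇h'(ρ_∞)) (ρ - ρ_∞) - ∇h'(ρ_∞) · n`. -/
def referenceForcing (h : ℝ → ℝ) (ρinf ρ : ℝ → Space d → ℝ) (n : ℝ → Space d → Space d)
    (τ : ℝ) (y : Space d) : ℝ :=
  -(deriv (fun s => enthalpy h (ρinf s y)) τ
      - fderiv ℝ (fun z => enthalpy h (ρinf τ z)) y ((1 / 2 : ℝ) • y)) * (ρ τ y - ρinf τ y)
    - fderiv ℝ (fun z => enthalpy h (ρinf τ z)) y (n τ y)

/-- The energy-variational inequality between the times `σ` and `τ`, for the test functions `φ`, `ψ`;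
`rσ`, `mσ` are the density and momentum at time `σ`. With `(∇ψ)_{ij} = ∂_j ψ_i`, one has
`∇ψ : (a ⊗ b) = a · (Dψ b)` and `∇ψ : I = div ψ`. -/
def EnvarInequality (α : ℝ) (p h : ℝ → ℝ) (K : (Space d → Space d) → ℝ)
    (ρinf ρ : ℝ → Space d → ℝ) (n : ℝ → Space d → Space d) (E : ℝ → ℝ)
    (φ : ℝ → Space d → ℝ) (ψ : ℝ → Space d → Space d)
    (σ : ℝ) (rσ : Space d → ℝ) (mσ : Space d → Space d) (τ : ℝ) : Prop :=
  (E τ + ∫ y, (φ τ y * ρ τ y + inner ℝ (ψ τ y) (n τ y)))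
    - (E σ + ∫ y, (φ σ y * rσ y + inner ℝ (ψ σ y) (mσ y)))
    + (∫ s in σ..τ, (d : ℝ) / 2 * E s)
    + (∫ s in σ..τ, ∫ y, α * (‖n s y‖ ^ 2 / ρ s y))
    - (∫ s in σ..τ, ∫ y,
        (deriv (fun s' => φ s' y) s * ρ s y
          - fderiv ℝ (φ s) y ((ρ s y / 2) • y - n s y)
          - (d : ℝ) / 2 * φ s y * ρ s y))
    - (∫ s in σ..τ, ∫ y,
        (inner ℝ (deriv (fun s' => ψ s' y) s) (n s y)
          + (-(inner ℝ (n s y) (fderiv ℝ (ψ s) y ((1 / 2 : ℝ) • y)))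
            + (ρ s y)⁻¹ * inner ℝ (n s y) (fderiv ℝ (ψ s) y (n s y))
            + Real.exp (d * s) * p (ρ s y) * divergence (ψ s) y)
          - Real.exp (d * s) * α * inner ℝ (ψ s y) (n s y)))
  ≤ (∫ s in σ..τ, ∫ y, referenceForcing h ρinf ρ n s y)
    + (∫ s in σ..τ, Real.exp (d * s) * K (ψ s) * energyDefect h ρinf ρ n E s)

/-- `(ρ, n, E)` is an energy-variational solution of the scaled damped Euler system
`ρ_τ = y/2 · ∇ρ - div n`,
`n_τ = y/2 · ∇n + d/2 n - div (n ⊗ n / ρ) - e^{dτ} (∇p(ρ) + α n)`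
with initial data `(ρ₀, n₀)`, limit density `ρ̂`, reference density `ρ_∞` and regularity weight `K`.
The fields `enthalpy_contDiffOn`, `refdens_vacuum`, `pressure_locallyIntegrable`,
`kinetic_locallyIntegrable`, `forcing_integrable` and `weight_integrable` say that all terms of the
inequality are well defined. -/
structure IsEnergyVariationalSolution (α : ℝ) (p h : ℝ → ℝ) (ρhat : Space d → ℝ)
    (ρ₀ : Space d → ℝ) (n₀ : Space d → Space d) (K : (Space d → Space d) → ℝ)
    (ρinf ρ : ℝ → Space d → ℝ) (n : ℝ → Space d → Space d) (E : ℝ → ℝ) : Prop where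
  init_density : LocallyIntegrable ρ₀
  init_momentum : LocallyIntegrable n₀
  init_entropy : relEntropy h 0 ρ₀ n₀ ρhat 0 ≠ ⊤
  density : LocallyIntegrableOn (Function.uncurry ρ) (Ici 0 ×ˢ univ)
  momentum : LocallyIntegrableOn (Function.uncurry n) (Ici 0 ×ˢ univ)
  energy : BoundedVariationOn E (Ici 0)
  refdens_nonneg : ∀ τ, 0 ≤ τ → ∀ y, 0 ≤ ρinf τ y
  refdens_contDiffOn : ContDiffOn ℝ 1 (Function.uncurry ρinf) (Ici 0 ×ˢ univ)
  refdens_limit : ∀ T : ℝ, ∃ R : ℝ, 0 < R ∧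
    ∀ τ ∈ Icc 0 T, ∀ y, R < ‖y‖ → ρinf τ y = ρhat y
  enthalpy_contDiffOn :
    ContDiffOn ℝ 1 (fun z : ℝ × Space d => enthalpy h (ρinf z.1 z.2)) (Ici 0 ×ˢ univ)
  refdens_vacuum : ∀ τ, 0 ≤ τ → ∀ y, ρinf τ y = 0 → DifferentiableWithinAt ℝ h (Ici 0) 0
  pressure_locallyIntegrable :
    LocallyIntegrableOn (fun z : ℝ × Space d => p (ρ z.1 z.2)) (Ici 0 ×ˢ univ)
  kinetic_locallyIntegrable :
    LocallyIntegrableOn (fun z : ℝ × Space d => ‖n z.1 z.2‖ ^ 2 / ρ z.1 z.2) (Ici 0 ×ˢ univ)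
  forcing_integrable : ∀ T : ℝ,
    IntegrableOn (Function.uncurry (referenceForcing h ρinf ρ n)) (Ioc 0 T ×ˢ univ)
  weight : IsRegularityWeight K
  weight_integrable : ∀ ψ : ℝ → Space d → Space d, IsSpaceTimeTest ψ → ∀ T : ℝ,
    IntegrableOn (fun s => Real.exp (d * s) * K (ψ s) * energyDefect h ρinf ρ n E s) (Ioc 0 T)
  entropy_le : ∀ᵐ τ ∂(volume.restrict (Ioi (0 : ℝ))),
    relEntropy h τ (ρ τ) (n τ) (ρinf τ) 0 ≠ ⊤ ∧
      (relEntropy h τ (ρ τ) (n τ) (ρinf τ) 0).toReal ≤ E τ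
  inequality : ∀ (φ : ℝ → Space d → ℝ) (ψ : ℝ → Space d → Space d),
    IsSpaceTimeTest φ → IsSpaceTimeTest ψ →
    ∀ᵐ σ ∂(volume.restrict (Ioi (0 : ℝ))), ∀ᵐ τ ∂(volume.restrict (Ioi σ)),
      EnvarInequality α p h K ρinf ρ n E φ ψ σ (ρ σ) (n σ) τ
  inequality_init : ∀ (φ : ℝ → Space d → ℝ) (ψ : ℝ → Space d → Space d),
    IsSpaceTimeTest φ → IsSpaceTimeTest ψ →
    ∀ᵐ τ ∂(volume.restrict (Ioi (0 : ℝ))),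
      EnvarInequality α p h K ρinf ρ n E φ ψ 0 ρ₀ n₀ τ

/-! ### Residuals, error terms and dissipation for a reference pair `(ρ̄, n̄)` -/

/-- `R̄₁ = ρ̄_τ - y/2 · ∇ρ̄ + div n̄`. -/
def residualMass (ρb : ℝ → Space d → ℝ) (nb : ℝ → Space d → Space d) (τ : ℝ) (y : Space d) : ℝ :=
  deriv (fun s => ρb s y) τ - fderiv ℝ (ρb τ) y ((1 / 2 : ℝ) • y) + divergence (nb τ) y

/-- `R̄₂ = n̄_τ - y/2 · ∇n̄ - d/2 n̄ + div (n̄ ⊗ n̄ / ρ̄) + e^{dτ} (∇p(ρ̄) + α n̄)`. -/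
def residualMomentum (α : ℝ) (p : ℝ → ℝ) (ρb : ℝ → Space d → ℝ) (nb : ℝ → Space d → Space d)
    (τ : ℝ) (y : Space d) : Space d :=
  deriv (fun s => nb s y) τ - fderiv ℝ (nb τ) y ((1 / 2 : ℝ) • y) - ((d : ℝ) / 2) • nb τ y
    + tensorDivergence (fun z => velocity (ρb τ z) (nb τ z)) (nb τ) y
    + Real.exp (d * τ) • (gradient (fun z => p (ρb τ z)) y + α • nb τ y)

/-- `R̄ = R̄₁ n̄/ρ̄ - R̄₂`. -/
def residual (α : ℝ) (p : ℝ → ℝ) (ρb : ℝ → Space d → ℝ) (nb : ℝ → Space d → Space d)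
    (τ : ℝ) (y : Space d) : Space d :=
  residualMass ρb nb τ y • velocity (ρb τ y) (nb τ y) - residualMomentum α p ρb nb τ y

/-- `n/ρ - n̄/ρ̄`. -/
def relVelocity (ρ : ℝ → Space d → ℝ) (n : ℝ → Space d → Space d)
    (ρb : ℝ → Space d → ℝ) (nb : ℝ → Space d → Space d) (τ : ℝ) (y : Space d) : Space d :=
  velocity (ρ τ y) (n τ y) - velocity (ρb τ y) (nb τ y)

/-- `ξ₁ = -∇(n̄/ρ̄) : e^{-dτ} ρ (n/ρ - n̄/ρ̄) ⊗ (n/ρ - n̄/ρ̄) - div (n̄/ρ̄) p(ρ | ρ̄)`. -/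
def xiOne (p : ℝ → ℝ) (ρ : ℝ → Space d → ℝ) (n : ℝ → Space d → Space d)
    (ρb : ℝ → Space d → ℝ) (nb : ℝ → Space d → Space d) (τ : ℝ) (y : Space d) : ℝ :=
  -(Real.exp (-(d * τ)) * ρ τ y *
      inner ℝ (relVelocity ρ n ρb nb τ y)
        (fderiv ℝ (fun z => velocity (ρb τ z) (nb τ z)) y (relVelocity ρ n ρb nb τ y)))
    - divergence (fun z => velocity (ρb τ z) (nb τ z)) y * relPressure p (ρ τ y) (ρb τ y)

/-- `ξ₂ = e^{-dτ} (ρ/ρ̄) (n/ρ - n̄/ρ̄) · R̄`. -/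
def xiTwo (α : ℝ) (p : ℝ → ℝ) (ρ : ℝ → Space d → ℝ) (n : ℝ → Space d → Space d)
    (ρb : ℝ → Space d → ℝ) (nb : ℝ → Space d → Space d) (τ : ℝ) (y : Space d) : ℝ :=
  Real.exp (-(d * τ)) * (ρ τ y / ρb τ y) *
    inner ℝ (relVelocity ρ n ρb nb τ y) (residual α p ρb nb τ y)

/-- `ξ₃ = -(ρ - ρ̄) h''(ρ̄) R̄₁`. -/
def xiThree (h : ℝ → ℝ) (ρ : ℝ → Space d → ℝ) (ρb : ℝ → Space d → ℝ)
    (nb : ℝ → Space d → Space d) (τ : ℝ) (y : Space d) : ℝ :=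
  -(ρ τ y - ρb τ y) * deriv (enthalpy h) (ρb τ y) * residualMass ρb nb τ y

/-- `ξ = ξ₁ + ξ₂ + ξ₃`. -/
def xi (α : ℝ) (p h : ℝ → ℝ) (ρ : ℝ → Space d → ℝ) (n : ℝ → Space d → Space d)
    (ρb : ℝ → Space d → ℝ) (nb : ℝ → Space d → Space d) (τ : ℝ) (y : Space d) : ℝ :=
  xiOne p ρ n ρb nb τ y + xiTwo α p ρ n ρb nb τ y + xiThree h ρ ρb nb τ y

/-- `Ξ = ∫ ξ dy`. -/
def bigXi (α : ℝ) (p h : ℝ → ℝ) (ρ : ℝ → Space d → ℝ) (n : ℝ → Space d → Space d)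
    (ρb : ℝ → Space d → ℝ) (nb : ℝ → Space d → Space d) (τ : ℝ) : ℝ :=
  ∫ y, xi α p h ρ n ρb nb τ y

/-- `𝒟_α(ρ, n | ρ̄, n̄) = α ∫ ρ |n/ρ - n̄/ρ̄|² dy`. -/
def dissipation (α : ℝ) (ρ : ℝ → Space d → ℝ) (n : ℝ → Space d → Space d)
    (ρb : ℝ → Space d → ℝ) (nb : ℝ → Space d → Space d) (τ : ℝ) : ℝ :=
  α * ∫ y, ρ τ y * ‖relVelocity ρ n ρb nb τ y‖ ^ 2

/-- `K(-n̄/ρ̄) (E - ℰ(τ; ρ, n | ρ_∞, 0))`. -/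
def weightedDefect (h : ℝ → ℝ) (K : (Space d → Space d) → ℝ) (ρinf ρ : ℝ → Space d → ℝ)
    (n : ℝ → Space d → Space d) (E : ℝ → ℝ)
    (ρb : ℝ → Space d → ℝ) (nb : ℝ → Space d → Space d) (τ : ℝ) : ℝ :=
  K (fun y => -velocity (ρb τ y) (nb τ y)) * energyDefect h ρinf ρ n E τ

/-- `ℛ(τ) = E(τ) - ℰ(τ; ρ(τ), n(τ) | ρ_∞(τ), 0) + ℰ(τ; ρ(τ), n(τ) | ρ̄(τ), n̄(τ))`. -/
def modifiedEntropy (h : ℝ → ℝ) (ρinf ρ : ℝ → Space d → ℝ) (n : ℝ → Space d → Space d)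
    (E : ℝ → ℝ) (ρb : ℝ → Space d → ℝ) (nb : ℝ → Space d → Space d) (τ : ℝ) : ℝ :=
  energyDefect h ρinf ρ n E τ + (relEntropy h τ (ρ τ) (n τ) (ρb τ) (nb τ)).toReal

/-- `ℛ₀ = E(0) - ℰ(0; ρ₀, n₀ | ρ_∞(0), 0) + ℰ(0; ρ₀, n₀ | ρ̄(0), n̄(0))`. -/
def initialModifiedEntropy (h : ℝ → ℝ) (ρ₀ : Space d → ℝ) (n₀ : Space d → Space d)
    (ρinf : ℝ → Space d → ℝ) (E : ℝ → ℝ) (ρb : ℝ → Space d → ℝ) (nb : ℝ → Space d → Space d) : ℝ :=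
  E 0 - (relEntropy h 0 ρ₀ n₀ (ρinf 0) 0).toReal + (relEntropy h 0 ρ₀ n₀ (ρb 0) (nb 0)).toReal

/-! ### Admissible reference pairs -/

/-- `C¹((0,∞) × ℝ^d; F) ∩ C([0,∞) × ℝ^d; F)`. -/
def IsReferenceRegular {F : Type*} [NormedAddCommGroup F] [NormedSpace ℝ F]
    (f : ℝ → Space d → F) : Prop :=
  ContDiffOn ℝ 1 (Function.uncurry f) (Ioi 0 ×ˢ univ) ∧
    ContinuousOn (Function.uncurry f) (Ici 0 ×ˢ univ)

/-- `ρ̄ > 0`, and `ρ̄ - ρ̂` and `n̄` have compact support in space, locally uniformly in time. -/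
structure IsCompactPerturbation (ρhat : Space d → ℝ) (ρb : ℝ → Space d → ℝ)
    (nb : ℝ → Space d → Space d) : Prop where
  pos : ∀ τ, 0 ≤ τ → ∀ y, 0 < ρb τ y
  support : ∀ T : ℝ, ∃ R : ℝ, ∀ τ ∈ Icc 0 T, ∀ y, R < ‖y‖ → ρb τ y = ρhat y ∧ nb τ y = 0

/-- `f ∈ L^∞_loc([0,∞); L¹(ℝ^d) ∩ L^∞(ℝ^d))`. -/
def IsLocBoundedL1Linfty {F : Type*} [NormedAddCommGroup F] (f : ℝ → Space d → F) : Prop :=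
  ∀ T : ℝ, ∃ C : ℝ≥0, ∀ᵐ τ ∂(volume.restrict (Ioo 0 T)),
    AEStronglyMeasurable (f τ) volume ∧ eLpNorm (f τ) 1 volume ≤ C ∧ eLpNorm (f τ) ⊤ volume ≤ C

/-- `inf ρ̄ > 0` and the decay conditions at spatial infinity. -/
structure HasReferenceDecay (ρhat : Space d → ℝ) (ρb : ℝ → Space d → ℝ)
    (nb : ℝ → Space d → Space d) : Prop where
  inf_pos : ∃ c : ℝ, 0 < c ∧ ∀ τ, 0 ≤ τ → ∀ y, c ≤ ρb τ y
  grad_density : IsLocBoundedL1Linfty fun τ y => fderiv ℝ (ρb τ) y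
  grad_momentum : IsLocBoundedL1Linfty fun τ y => fderiv ℝ (nb τ) y
  deriv_density : IsLocBoundedL1Linfty fun τ y => deriv (fun s => ρb s y) τ
  deriv_momentum : IsLocBoundedL1Linfty fun τ y => deriv (fun s => nb s y) τ
  density : IsLocBoundedL1Linfty fun τ y => ‖y‖ * (ρb τ y - ρhat y)
  momentum : IsLocBoundedL1Linfty fun τ y => ‖y‖ • nb τ y
  radial_density : IsLocBoundedL1Linfty fun τ y => fderiv ℝ (ρb τ) y y
  radial_momentum : IsLocBoundedL1Linfty fun τ y => fderiv ℝ (nb τ) y y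

end DampedEuler

end

open DampedEuler

noncomputable section

namespace DampedEuler

variable {d : ℕ}

section

/-! ### The pressure potential -/

section Potential

variable {p h : ℝ → ℝ}

/-! This is the relative entropy method, carried out for a solution concept whose inequality already
contains the test functions. Write U = n̄/ρ̄, u = n/ρ and P(z) = z h'(z) - h(z). The nonlinear terms
h(ρ) and |n|²/ρ enter every relative entropy density in the same way. Passing from the reference
state (ρ_∞, 0) to (ρ̄, n̄) therefore changes the density only by a function affine in the state,
namely φρ + ψ·n + P(ρ̄) - P(ρ_∞) with φ = h'(ρ_∞) - h'(ρ̄) + ½ e^{-dτ}|U|² and ψ = -e^{-dτ}U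
(`IsState.entropyValue_sub`). Consequently ℛ is E plus the integral of this affine function, and the
energy-variational inequality with test functions (φ, ψ) is, up to the state-independent term, an
inequality for ℛ. The regularity weight contributes e^{dτ}K(ψ) = K(-U) by homogeneity.

The rest of the formal computation is pointwise. When the tested integrands, the forcing, the
dissipation and the time derivative of P(ρ̄) - P(ρ_∞) are added, they collapse to -d/2 times the
affine function, plus ξ - αρ|u - U|², plus a divergence that integrates to zero
(`relative_entropy_algebra`, `massBracket_add_momentumBracket`). The identity dP(ρ̄) = ρ̄ dh'(ρ̄)
makes P differentiable even where ρ̄ touches the vacuum and only h'(ρ̄) is known to be C¹.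

The pair (φ, ψ) is not an admissible test function: it need not have compact support, and it is C¹
only for τ > 0. A time cut-off away from zero and a spatial cut-off give a localized inequality
(`localized_inequality`). Dilating the spatial cut-off then removes it, because its gradient is of
order 1/(j+1) and is paired with an integrable flux; this integrability is the purpose of the weight
1 + |y| in `HasMultiplierDecay`. At τ = 0 the multipliers are merely continuous. There, C¹
approximations frozen in time are tested instead, and they yield that ℛ is asymptotically at most ℛ₀
(`modifiedEntropy_le_initial`). Finally, an inequality between almost all pairs of times together
with this initial bound is equivalent to monotonicity of ℛ minus a primitive, which gives the weak
form by difference quotients (`weak_inequality_of_ae_le`).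

All of this is done once for reference pairs satisfying `IsAdmissible`; the hypotheses (a) and (b)
serve to verify that structure. For compact perturbations the error term equals the integrable
forcing far from the origin. For the vacuum, h is differentiable at 0 and all error terms vanish.
For decaying perturbations the γ-law lets the relative potential control the pressure globally, so
that coefficients in L¹ ∩ L^∞ give integrable error terms. -/

lemma enthalpy_eq_deriv {z : ℝ} (hz : 0 < z) : enthalpy h z = deriv h z :=
  derivWithin_of_mem_nhds (Ici_mem_nhds hz)

lemma IsPressurePotential.enthalpy_eq (hh : IsPressurePotential p h) {z : ℝ} (hz : 0 < z) :
    enthalpy h z = (p z + h z) / z := by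
  rw [enthalpy_eq_deriv hz, eq_div_iff hz.ne', hh.pressure_eq z hz]; ring

lemma IsPressurePotential.mul_enthalpy_sub (hh : IsPressurePotential p h) {z : ℝ} (hz : 0 < z) :
    z * enthalpy h z - h z = p z := by
  rw [enthalpy_eq_deriv hz, hh.pressure_eq z hz]

lemma IsPressurePotential.hasDerivAt (hh : IsPressurePotential p h) {z : ℝ} (hz : 0 < z) :
    HasDerivAt h (enthalpy h z) z := by
  rw [enthalpy_eq_deriv hz]; exact (hh.differentiableAt z hz).hasDerivAt

lemma IsPressureLaw.hasDerivAt (hp : IsPressureLaw p) {z : ℝ} (hz : 0 < z) :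
    HasDerivAt p (deriv p z) z :=
  (((hp.contDiffOn.differentiableOn (by norm_num)) z hz).differentiableAt
    (Ioi_mem_nhds hz)).hasDerivAt

/-- The pressure relation expresses h' as (p + h)/z, a quotient of differentiable functions. Thus h'
gains a derivative although h is only assumed differentiable. -/
lemma hasDerivAt_enthalpy (hp : IsPressureLaw p) (hh : IsPressurePotential p h) {z : ℝ}
    (hz : 0 < z) : HasDerivAt (enthalpy h) (deriv p z / z) z := by
  have h1 : HasDerivAt (fun z => (p z + h z) / z)
      (((deriv p z + enthalpy h z) * z - (p z + h z) * 1) / z ^ 2) z :=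
    ((hp.hasDerivAt hz).add (hh.hasDerivAt hz)).div (hasDerivAt_id z) hz.ne'
  have h2 : enthalpy h =ᶠ[𝓝 z] fun z => (p z + h z) / z := by
    filter_upwards [Ioi_mem_nhds hz] with w hw using hh.enthalpy_eq hw
  refine (h1.congr_of_eventuallyEq h2).congr_deriv ?_
  rw [hh.enthalpy_eq hz]; field_simp; ring

lemma contDiffOn_enthalpy (hp : IsPressureLaw p) (hh : IsPressurePotential p h) :
    ContDiffOn ℝ 1 (enthalpy h) (Ioi 0) := by
  rw [show (1 : WithTop ℕ∞) = 0 + 1 from rfl, contDiffOn_succ_iff_deriv_of_isOpen isOpen_Ioi]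
  refine ⟨fun z hz => (hasDerivAt_enthalpy hp hh hz).differentiableAt.differentiableWithinAt,
    by simp, ?_⟩
  rw [contDiffOn_zero]
  have h1 : ContinuousOn (deriv p) (Ioi 0) :=
    hp.contDiffOn.continuousOn_deriv_of_isOpen isOpen_Ioi le_rfl
  refine (h1.div continuousOn_id fun z hz => (ne_of_gt hz)).congr fun z hz =>
    (hasDerivAt_enthalpy hp hh hz).deriv

lemma enthalpy_strictMonoOn (hp : IsPressureLaw p) (hh : IsPressurePotential p h) :
    StrictMonoOn (enthalpy h) (Ioi 0) := by
  refine strictMonoOn_of_deriv_pos (convex_Ioi 0) (contDiffOn_enthalpy hp hh).continuousOn ?_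
  intro z hz
  rw [interior_Ioi] at hz
  rw [(hasDerivAt_enthalpy hp hh hz).deriv]
  exact div_pos (hp.deriv_pos z hz) hz

lemma convexOn_potential (hp : IsPressureLaw p) (hh : IsPressurePotential p h) :
    ConvexOn ℝ (Ici 0) h := by
  refine MonotoneOn.convexOn_of_deriv (convex_Ici 0) hh.continuousOn ?_ ?_
  · intro z hz
    rw [interior_Ici] at hz
    exact (hh.differentiableAt z hz).differentiableWithinAt
  · rw [interior_Ici]
    exact (enthalpy_strictMonoOn hp hh).monotoneOn.congr fun z hz => enthalpy_eq_deriv hz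

/-- A convex function lies above its tangents. Differentiability within [0,∞) is what admits the
vacuum a = 0 as the base point. -/
lemma relPotential_nonneg (hp : IsPressureLaw p) (hh : IsPressurePotential p h) {a r : ℝ}
    (ha : 0 ≤ a) (hr : 0 ≤ r) (hd : DifferentiableWithinAt ℝ h (Ici 0) a) :
    0 ≤ relPotential h r a := by
  have hc := convexOn_potential hp hh
  have hd' : HasDerivWithinAt h (enthalpy h a) (Ici 0) a := hd.hasDerivWithinAt
  unfold relPotential
  rcases lt_trichotomy a r with har | rfl | har
  · have := hc.le_slope_of_hasDerivWithinAt (mem_Ici.2 ha) (mem_Ici.2 hr) har hd'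
    rw [slope_def_field, le_div_iff₀ (by linarith)] at this
    linarith
  · simp
  · have := hc.slope_le_of_hasDerivWithinAt (mem_Ici.2 hr) (mem_Ici.2 ha) har hd'
    rw [slope_def_field, div_le_iff₀ (by linarith)] at this
    linarith

lemma IsPressurePotential.differentiableWithinAt (hh : IsPressurePotential p h) {z : ℝ}
    (hz : 0 < z) : DifferentiableWithinAt ℝ h (Ici 0) z :=
  (hh.differentiableAt z hz).differentiableWithinAt

/-- The relative potential controls the density, uniformly for bounded reference densities. -/
lemma exists_le_mul_one_add_relPotential (hp : IsPressureLaw p) (hh : IsPressurePotential p h)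
    (M : ℝ) : ∃ C : ℝ, 1 ≤ C ∧ ∀ a r, 0 ≤ a → a ≤ M → 0 ≤ r →
      DifferentiableWithinAt ℝ h (Ici 0) a → r ≤ C * (1 + relPotential h r a) := by
  wlog hM : 0 < M generalizing M
  · obtain ⟨C, hC, H⟩ := this 1 one_pos
    exact ⟨C, hC, fun a r ha haM => H a r ha (by linarith)⟩
  -- The gain of slope of h between M and M + 1. Beyond M + 1 the relative potential grows at least
  -- at this rate, uniformly in a ≤ M, and this produces the summand 1/κ of the constant; below M +
  -- 1 the summand M + 1 suffices.
  set κ := enthalpy h (M + 1) - enthalpy h M with hκ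
  have hκ0 : 0 < κ := sub_pos.2 (enthalpy_strictMonoOn hp hh hM
    (mem_Ioi.2 (by linarith : (0:ℝ) < M + 1)) (by linarith))
  refine ⟨(M + 1) + 1 / κ, by have := one_div_pos.2 hκ0; linarith, fun a r ha haM hr hd => ?_⟩
  have h0 := relPotential_nonneg hp hh ha hr hd
  have hk := one_div_pos.2 hκ0
  rcases le_or_gt r (M + 1) with hrM | hrM
  · nlinarith [mul_nonneg (add_pos (by linarith : 0 < M + 1) hk).le h0]
  have h1 := relPotential_nonneg hp hh ha hM.le hd
  have h2 := relPotential_nonneg hp hh hM.le ha (hh.differentiableWithinAt hM)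
  have h3 := relPotential_nonneg hp hh (by linarith : 0 ≤ M + 1) hr
    (hh.differentiableWithinAt (by linarith))
  have h4 := relPotential_nonneg hp hh hM.le (by linarith : 0 ≤ M + 1)
    (hh.differentiableWithinAt hM)
  -- Adding the two tangent inequalities between a and M gives monotonicity of the slope also for a
  -- = 0, where `enthalpy_strictMonoOn` says nothing.
  have h5 : enthalpy h a ≤ enthalpy h M := by
    rcases haM.eq_or_lt with rfl | haM'
    · exact le_rfl
    · unfold relPotential at h1 h2
      nlinarith
  have h6 : κ * (r - (M + 1)) ≤ relPotential h r a := by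
    unfold relPotential at *
    nlinarith [mul_nonneg (sub_nonneg.2 h5) (by linarith : 0 ≤ r - M)]
  have h7 : r - (M + 1) ≤ 1 / κ * relPotential h r a := by
    rw [one_div, ← div_eq_inv_mul, le_div_iff₀ hκ0]; linarith
  nlinarith

/-- For a `γ`-law, the pressure is controlled by the relative potential. -/
lemma exists_pressure_le (hp : IsPressureLaw p) (hh : IsPressurePotential p h)
    (hγ : IsGammaLaw p) (M : ℝ) : ∃ C : ℝ, 0 ≤ C ∧ ∀ a r, 0 ≤ a → a ≤ M → |h a| ≤ M →
      |enthalpy h a| ≤ M → 0 ≤ r → DifferentiableWithinAt ℝ h (Ici 0) a →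
      |p r| ≤ C * (1 + relPotential h r a) := by
  obtain ⟨γ, k, hγ1, hk, hpk⟩ := hγ
  obtain ⟨C₀, hC₀, hlin⟩ := exists_le_mul_one_add_relPotential hp hh M
  have hderiv : ∀ z, 0 < z → deriv p z = γ * p z / z := by
    intro z hz
    have h1 : HasDerivAt (fun z => k * z ^ γ) (k * (γ * z ^ (γ - 1))) z :=
      (Real.hasDerivAt_rpow_const (Or.inl hz.ne')).const_mul k
    have h2 : p =ᶠ[𝓝 z] fun z => k * z ^ γ := by
      filter_upwards [Ioi_mem_nhds hz] with w hw using hpk w (le_of_lt hw)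
    rw [(h1.congr_of_eventuallyEq h2).deriv, hpk z hz.le, Real.rpow_sub_one hz.ne']
    ring
  -- For the γ-law, p' = γp/z, so (p - (γ-1)h)/z has zero derivative. The pressure is then a
  -- multiple of h plus a linear term, both of which the relative potential controls; for γ = 1 only
  -- the linear term survives.
  obtain ⟨c, hc⟩ : ∃ c : ℝ, ∀ z, 0 < z → p z = (γ - 1) * h z + c * z := by
    have hD : ∀ z, 0 < z → HasDerivAt (fun z => (p z - (γ - 1) * h z) / z) 0 z := by
      intro z hz
      refine (((hp.hasDerivAt hz).sub ((hh.hasDerivAt hz).const_mul (γ - 1))).div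
        (hasDerivAt_id z) hz.ne').congr_deriv ?_
      rw [hderiv z hz, hh.enthalpy_eq hz]
      simp only [Pi.sub_apply, id]
      field_simp; ring
    refine ⟨(p 1 - (γ - 1) * h 1) / 1, fun z hz => ?_⟩
    have key := (convex_Ioi (0:ℝ)).is_const_of_fderivWithin_eq_zero (𝕜 := ℝ)
      (f := fun z => (p z - (γ - 1) * h z) / z)
      (fun w hw => (hD w hw).differentiableAt.differentiableWithinAt)
      (fun w hw => by
        rw [fderivWithin_of_isOpen isOpen_Ioi hw, (hD w hw).hasFDerivAt.fderiv]
        ext; simp) hz (mem_Ioi.2 one_pos)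
    rw [← key]; field_simp; ring
  -- The summand |p 0| takes care of r = 0, which the representation of p on (0,∞) does not reach.
  refine ⟨|γ - 1| * (1 + |M| + |M| * (C₀ + |M|)) + |c| * C₀ + |p 0|, by positivity,
    fun a r ha haM h1 h2 hr hd => ?_⟩
  have hM0 : 0 ≤ M := ha.trans haM
  rw [abs_of_nonneg hM0]
  have h0 := relPotential_nonneg hp hh ha hr hd
  have hl := hlin a r ha haM hr hd
  set R := relPotential h r a with hR
  rcases hr.eq_or_lt with rfl | hr0
  · have : |p 0| * 1 ≤ |p 0| * (1 + R) := by gcongr; linarith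
    have e2 : 0 ≤ (|γ - 1| * (1 + M + M * (C₀ + M)) + |c| * C₀) * (1 + R) := by positivity
    linarith
  rw [hc r hr0]
  have hhr : h r = R + h a + enthalpy h a * (r - a) := by rw [hR, relPotential]; ring
  have b1 : |enthalpy h a * (r - a)| ≤ M * (C₀ * (1 + R) + M) := by
    rw [abs_mul]
    have : |r - a| ≤ r + a := by rw [abs_le]; constructor <;> linarith
    exact mul_le_mul h2 (by linarith) (abs_nonneg _) hM0
  have b2 : |h r| ≤ R + M + M * (C₀ * (1 + R) + M) := by
    rw [hhr]
    calc _ ≤ |R| + |h a| + |enthalpy h a * (r - a)| := abs_add_three _ _ _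
      _ ≤ _ := by rw [abs_of_nonneg h0]; linarith
  have b3 : R + M + M * (C₀ * (1 + R) + M) ≤ (1 + M + M * (C₀ + M)) * (1 + R) := by
    nlinarith [mul_nonneg hM0 h0, mul_nonneg (mul_nonneg hM0 hM0) h0]
  calc |(γ - 1) * h r + c * r| ≤ |γ - 1| * |h r| + |c| * |r| := by
        rw [← abs_mul, ← abs_mul]; exact abs_add_le _ _
    _ ≤ |γ - 1| * ((1 + M + M * (C₀ + M)) * (1 + R)) + |c| * (C₀ * (1 + R)) := by
        rw [abs_of_nonneg hr]
        gcongr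
        exact b2.trans b3
    _ ≤ _ := by
        have e2 : 0 ≤ |p 0| * (1 + R) := by positivity
        linarith

end Potential

end

section

/-! ### Almost everywhere monotone functions and weak differential inequalities -/

lemma exists_mem_Ioo_of_ae {P : ℝ → Prop} (hP : ∀ᵐ x, P x) {a b : ℝ} (hab : a < b) :
    ∃ x, P x ∧ a < x ∧ x < b := by
  obtain ⟨x, hx, h1⟩ := (Measure.dense_of_ae hP).exists_between hab
  exact ⟨x, hx, h1.1, h1.2⟩

/-- The shear (s, σ) ↦ (σ, σ + s) preserves Lebesgue measure up to the order of the factors. By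
Fubini, a property of almost all pairs σ < τ becomes a property of almost every increment s and
almost every σ. A measurable representative of F makes the exceptional set measurable. -/
lemma ae_shift_of_ae_ae {F : ℝ → ℝ} (hF : AEStronglyMeasurable F volume)
    (hmono : ∀ᵐ σ, ∀ᵐ τ, σ < τ → F τ ≤ F σ) :
    ∀ᵐ s, 0 < s → ∀ᵐ σ, F (σ + s) ≤ F σ := by
  set F' := hF.mk F
  have hF' : Measurable F' := hF.stronglyMeasurable_mk.measurable
  have hFF' : F =ᵐ[volume] F' := hF.ae_eq_mk
  have h1 : ∀ᵐ σ, ∀ᵐ τ, σ < τ → F' τ ≤ F' σ := by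
    filter_upwards [hmono, hFF'] with σ h1 h2
    filter_upwards [h1, hFF'] with τ h3 h4 h5
    rw [← h2, ← h4]; exact h3 h5
  have hm : MeasurableSet {z : ℝ × ℝ | z.1 < z.2 → F' z.2 ≤ F' z.1} := by
    have : {z : ℝ × ℝ | z.1 < z.2 → F' z.2 ≤ F' z.1}
        = {z : ℝ × ℝ | z.1 < z.2}ᶜ ∪ {z | F' z.2 ≤ F' z.1} := by
      ext z; simp [imp_iff_not_or]
    rw [this]
    exact (measurableSet_lt measurable_fst measurable_snd).compl.union
      (measurableSet_le (hF'.comp measurable_snd) (hF'.comp measurable_fst))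
  have h2 : ∀ᵐ z : ℝ × ℝ ∂(volume.prod volume), z.1 < z.2 → F' z.2 ≤ F' z.1 :=
    (Measure.ae_prod_iff_ae_ae hm).2 h1
  have h3 := (measurePreserving_prod_add_swap (volume : Measure ℝ)
    (volume : Measure ℝ)).quasiMeasurePreserving.ae h2
  have h4 := Measure.ae_ae_of_ae_prod h3
  filter_upwards [h4] with s hs hs0
  filter_upwards [hs, hFF', (measurePreserving_add_right volume s).quasiMeasurePreserving.ae hFF']
    with σ h5 h6 h7
  rw [h6, h7]
  exact h5 (by simpa using hs0)

/-- An almost everywhere nonincreasing function has nonpositive distributional derivative. The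
derivative of θ is the limit of difference quotients along good increments, and translation
invariance moves each quotient onto F, where it has a sign. -/
lemma integral_deriv_mul_nonneg_of_ae_antitone {F θ : ℝ → ℝ} {Q₀ : ℝ}
    (hF : LocallyIntegrable F volume) (hmono : ∀ᵐ σ, ∀ᵐ τ, σ < τ → F τ ≤ F σ)
    (hF0 : ∀ τ ≤ 0, F τ = Q₀) (hθ : ContDiff ℝ 1 θ) (hθc : HasCompactSupport θ)
    (hθ0 : ∀ τ, 0 ≤ τ → 0 ≤ θ τ) : 0 ≤ ∫ τ, deriv θ τ * F τ := by
  have hgood := ae_shift_of_ae_ae hF.aestronglyMeasurable hmono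
  choose s hs using fun k : ℕ =>
    exists_mem_Ioo_of_ae hgood (Nat.one_div_pos_of_nat (α := ℝ) (n := k))
  have hs0 : ∀ k, 0 < s k := fun k => (hs k).2.1
  have hslim : Tendsto s atTop (𝓝 0) :=
    squeeze_zero (fun k => (hs0 k).le) (fun k => (hs k).2.2.le)
      tendsto_one_div_add_atTop_nhds_zero_nat
  obtain ⟨L, hL⟩ := hθ.lipschitzWith_of_hasCompactSupport hθc (by norm_num)
  obtain ⟨A, hA⟩ := hθc.isBounded.subset_closedBall 0
  have hA' : ∀ x, A < |x| → θ x = 0 := fun x hx => by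
    by_contra h0
    have := hA (subset_tsupport _ (Function.mem_support.2 h0))
    rw [mem_closedBall_zero_iff, Real.norm_eq_abs] at this
    linarith
  have hFint : ∀ B, IntegrableOn F (Icc (-B) B) := fun B =>
    (hF.integrableOn_isCompact isCompact_Icc)
  have hint : ∀ k, Integrable (fun τ => θ (τ + s k) * F τ) := fun k => by
    have := hF.integrable_smul_left_of_hasCompactSupport
      (g := fun τ => θ (τ + s k)) (hθ.continuous.comp (by fun_prop))
      (hθc.comp_homeomorph (Homeomorph.addRight (s k)))
    simpa [smul_eq_mul] using this
  have hint0 : Integrable (fun τ => θ τ * F τ) := by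
    simpa [smul_eq_mul] using
      hF.integrable_smul_left_of_hasCompactSupport (g := θ) hθ.continuous hθc
  have hle : ∀ k, 0 ≤ ∫ τ, (s k)⁻¹ * (θ (τ + s k) - θ τ) * F τ := by
    intro k
    have h1 : ∫ τ, θ (τ + s k) * F (τ + s k) = ∫ τ, θ τ * F τ :=
      integral_add_right_eq_self (fun τ => θ τ * F τ) (s k)
    have hint1 : Integrable fun τ => θ (τ + s k) * F (τ + s k) := hint0.comp_add_right (s k)
    -- Discrete integration by parts: the unshifted product is replaced by the product with both
    -- factors shifted, leaving the difference F(τ) - F(τ + s).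
    have h2 : ∫ τ, (s k)⁻¹ * (θ (τ + s k) - θ τ) * F τ
        = (s k)⁻¹ * ∫ τ, (θ (τ + s k) * F τ - θ (τ + s k) * F (τ + s k)) := by
      rw [integral_sub (hint k) hint1, h1, ← integral_sub (hint k) hint0, ← integral_const_mul]
      congr 1; ext τ; ring
    rw [h2]
    refine mul_nonneg (inv_nonneg.2 (hs0 k).le) (integral_nonneg_of_ae ?_)
    filter_upwards [(hs k).1 (hs0 k)] with τ hτ
    simp only [Pi.zero_apply]
    -- The sign of θ is known only for nonnegative arguments; for negative ones F is constant and
    -- the difference vanishes.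
    rcases le_or_gt (τ + s k) 0 with h3 | h3
    · rw [hF0 _ h3, hF0 _ (by have := hs0 k; linarith)]; simp
    · rw [← mul_sub]
      exact mul_nonneg (hθ0 _ h3.le) (sub_nonneg.2 hτ)
  refine ge_of_tendsto' (x := atTop) (f := fun k => ∫ τ, (s k)⁻¹ * (θ (τ + s k) - θ τ) * F τ) ?_ hle
  -- The Lipschitz constant of θ bounds all quotients. The support interval is enlarged by 1 because
  -- every increment is at most 1.
  refine tendsto_integral_of_dominated_convergence
    (fun τ => (Icc (-(|A| + 1)) (|A| + 1)).indicator (fun τ => L * |F τ|) τ) ?_ ?_ ?_ ?_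
  · intro k
    have : Integrable fun τ => (s k)⁻¹ * (θ (τ + s k) * F τ - θ τ * F τ) :=
      ((hint k).sub hint0).const_mul _
    refine this.aestronglyMeasurable.congr (ae_of_all _ fun τ => ?_)
    simp only; ring
  · rw [integrable_indicator_iff measurableSet_Icc]
    exact (hFint _).abs.const_mul _
  · intro k
    refine ae_of_all _ fun τ => ?_
    have hsk : s k ≤ 1 := (hs k).2.2.le.trans (by
      rw [div_le_one (by positivity)]; linarith [Nat.cast_nonneg (α := ℝ) k])
    by_cases hτ : τ ∈ Icc (-(|A| + 1)) (|A| + 1)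
    · rw [indicator_of_mem hτ, norm_mul, norm_mul, Real.norm_eq_abs (F τ)]
      gcongr
      have := hL.dist_le_mul (τ + s k) τ
      rw [Real.dist_eq, Real.dist_eq, add_sub_cancel_left, abs_of_pos (hs0 k)] at this
      rw [norm_inv, Real.norm_eq_abs, Real.norm_eq_abs, abs_of_pos (hs0 k),
        inv_mul_le_iff₀ (hs0 k)]
      linarith
    · rw [indicator_of_notMem hτ]
      have h1 : |A| + 1 < |τ| := by
        rw [mem_Icc, not_and_or, not_le, not_le] at hτ
        rw [lt_abs]
        rcases hτ with h | h
        · right; linarith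
        · left; linarith
      have h2 : A < |τ| := by linarith [le_abs_self A]
      have h3 : A < |τ + s k| := by
        have := abs_sub_abs_le_abs_sub τ (-(s k))
        rw [abs_neg, sub_neg_eq_add, abs_of_pos (hs0 k)] at this
        linarith [le_abs_self A]
      rw [hA' _ h2, hA' _ h3]; simp
  · refine ae_of_all _ fun τ => ?_
    have h1 : HasDerivAt θ (deriv θ τ) τ := (hθ.differentiable (by norm_num) τ).hasDerivAt
    have h2 : Tendsto s atTop (𝓝[≠] 0) :=
      tendsto_nhdsWithin_iff.2 ⟨hslim, Eventually.of_forall fun k => (hs0 k).ne'⟩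
    have h3 := (hasDerivAt_iff_tendsto_slope_zero.1 h1).comp h2
    simpa [smul_eq_mul] using h3.mul_const (F τ)

/-- Integration by parts for absolutely continuous functions, since g is only integrable. The
boundary terms vanish: the primitive is zero at 0 and θ is zero at B. -/
lemma integral_Ioi_deriv_mul_primitive {g θ : ℝ → ℝ} (hg : ∀ T, IntegrableOn g (Ioo 0 T))
    (hθ : ContDiff ℝ 1 θ) (hθc : HasCompactSupport θ) :
    ∫ τ in Ioi (0:ℝ), deriv θ τ * (∫ s in (0:ℝ)..τ, g s) = -∫ τ in Ioi (0:ℝ), θ τ * g τ := by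
  obtain ⟨A, hA⟩ := hθc.isBounded.subset_closedBall 0
  set B := |A| + 1 with hB
  have hB0 : 0 < B := by positivity
  have hA' : ∀ x, B ≤ x → θ x = 0 := fun x hx => by
    by_contra h0
    have := hA (subset_tsupport _ (Function.mem_support.2 h0))
    rw [mem_closedBall_zero_iff, Real.norm_eq_abs] at this
    linarith [le_abs_self x, le_abs_self A]
  have hA'' : ∀ x, B < x → deriv θ x = 0 := fun x hx => by
    have : θ =ᶠ[𝓝 x] fun _ => 0 := by
      filter_upwards [Ioi_mem_nhds hx] with y hy using hA' y (le_of_lt hy)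
    rw [this.deriv_eq]; simp
  have hgi : IntervalIntegrable g volume 0 B := by
    rw [intervalIntegrable_iff_integrableOn_Ioo_of_le hB0.le]; exact hg B
  have hAC := hgi.absolutelyContinuousOnInterval_intervalIntegral (c := 0) (by simp)
  have hθAC : AbsolutelyContinuousOnInterval θ 0 B := by
    obtain ⟨L, hL⟩ := hθ.lipschitzWith_of_hasCompactSupport hθc (by norm_num)
    exact (hL.lipschitzOnWith (s := uIcc 0 B)).absolutelyContinuousOnInterval
  have key := hθAC.integral_mul_deriv_eq_deriv_mul hAC
  simp only [intervalIntegral.integral_same, hA' B le_rfl, zero_mul, mul_zero, sub_zero,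
    zero_sub] at key
  have e1 : ∫ x in (0:ℝ)..B, θ x * deriv (fun x => ∫ s in (0:ℝ)..x, g s) x
      = ∫ x in (0:ℝ)..B, θ x * g x := by
    refine intervalIntegral.integral_congr_ae ?_
    filter_upwards [hgi.ae_hasDerivAt_integral] with x hx hx2
    rw [(hx (uIoc_subset_uIcc hx2) 0 (by simp)).deriv]
  rw [e1, intervalIntegral.integral_of_le hB0.le, intervalIntegral.integral_of_le hB0.le] at key
  have h2 : ∀ f : ℝ → ℝ, (∀ x, B < x → f x = 0) →
      ∫ x in Ioi (0:ℝ), f x = ∫ x in Ioc 0 B, f x := by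
    intro f hf
    refine (setIntegral_eq_of_subset_of_forall_sdiff_eq_zero measurableSet_Ioi
      Ioc_subset_Ioi_self ?_)
    intro x hx
    exact hf x (by by_contra h; exact hx.2 ⟨hx.1, not_lt.1 h⟩)
  rw [h2 _ fun x hx => by rw [hA'' x hx, zero_mul], h2 _ fun x hx => by rw [hA' x hx.le, zero_mul],
    key, neg_neg]

lemma integrableOn_Ioi_mul_of_hasCompactSupport {f η : ℝ → ℝ}
    (hf : ∀ T, IntegrableOn f (Ioo 0 T)) (hη : Continuous η) (hηc : HasCompactSupport η) :
    IntegrableOn (fun τ => η τ * f τ) (Ioi 0) := by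
  obtain ⟨A, hA⟩ := hηc.isBounded.subset_closedBall 0
  obtain ⟨L, hL⟩ := hηc.exists_bound_of_continuous hη
  have hi : IntegrableOn (fun τ => η τ * f τ) (Ioo 0 (A + 1)) :=
    (hf (A + 1)).bdd_mul hη.aestronglyMeasurable (ae_of_all _ hL)
  refine hi.of_forall_sdiff_eq_zero measurableSet_Ioi fun x hx => ?_
  suffices η x = 0 by rw [this, zero_mul]
  by_contra h0
  have := hA (subset_tsupport _ (Function.mem_support.2 h0))
  rw [mem_closedBall_zero_iff, Real.norm_eq_abs] at this
  exact hx.2 ⟨hx.1, by linarith [le_abs_self x]⟩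

/-- Subtracting a primitive G of g turns the hypothesis into monotonicity of F = Q - G, and the
initial condition turns into F ≤ Q₀. Extended by the constant Q₀ to negative times, F stays
monotone, and the integral of θ' Q₀ over the negative half-line produces the term θ(0) Q₀. -/
lemma weak_inequality_of_ae_le {Q g θ : ℝ → ℝ} {Q₀ : ℝ}
    (hQ : ∀ T, IntegrableOn Q (Ioo 0 T)) (hg : ∀ T, IntegrableOn g (Ioo 0 T))
    (hmono : ∀ᵐ σ ∂(volume.restrict (Ioi (0 : ℝ))), ∀ᵐ τ ∂(volume.restrict (Ioi σ)),
      Q τ - Q σ ≤ ∫ s in σ..τ, g s)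
    (hinit : ∀ ε > 0, ∃ t > 0, ∀ᵐ τ ∂(volume.restrict (Ioo (0:ℝ) t)), Q τ ≤ Q₀ + ε)
    (hθ : ContDiff ℝ 1 θ) (hθc : HasCompactSupport θ) (hθ0 : ∀ τ, 0 ≤ τ → 0 ≤ θ τ) :
    ∫ τ in Ioi (0:ℝ), -deriv θ τ * Q τ ≤ θ 0 * Q₀ + ∫ τ in Ioi (0:ℝ), θ τ * g τ := by
  set G : ℝ → ℝ := fun τ => ∫ s in (0:ℝ)..τ, g s with hG
  have hgi : ∀ a b, 0 ≤ a → 0 ≤ b → IntervalIntegrable g volume a b := by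
    have h0 : ∀ b, 0 ≤ b → IntervalIntegrable g volume 0 b := fun b hb => by
      rw [intervalIntegrable_iff_integrableOn_Ioo_of_le hb]; exact hg b
    exact fun a b ha hb => (h0 a ha).symm.trans (h0 b hb)
  have hGcont : ∀ T, 0 ≤ T → ContinuousOn G (Icc 0 T) := fun T hT => by
    have := intervalIntegral.continuousOn_primitive_interval (μ := volume) (f := g) (a := 0) (b := T)
      (by rw [uIcc_of_le hT, integrableOn_Icc_iff_integrableOn_Ioo]; exact hg T)
    rwa [uIcc_of_le hT] at this
  set F : ℝ → ℝ := fun τ => Q τ - G τ with hF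
  have hFmono : ∀ᵐ σ ∂(volume.restrict (Ioi (0 : ℝ))), ∀ᵐ τ ∂(volume.restrict (Ioi σ)),
      F τ ≤ F σ := by
    filter_upwards [hmono, ae_restrict_mem measurableSet_Ioi] with σ h1 hσ
    filter_upwards [h1, ae_restrict_mem measurableSet_Ioi] with τ h2 hτ
    have hσ' : (0:ℝ) ≤ σ := le_of_lt hσ
    have hτ' : (0:ℝ) ≤ τ := hσ'.trans (le_of_lt hτ)
    have h3 : G σ + ∫ s in σ..τ, g s = G τ :=
      intervalIntegral.integral_add_adjacent_intervals (hgi _ _ le_rfl hσ') (hgi _ _ hσ' hτ')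
    simp only [hF]; linarith
  have hFle : ∀ᵐ τ ∂(volume.restrict (Ioi (0 : ℝ))), F τ ≤ Q₀ := by
    -- Arbitrarily early times σ exist at which F is almost at most Q₀ and which dominate almost all
    -- later times. Letting σ and ε tend to zero along a sequence gives F ≤ Q₀.
    have hk : ∀ ε > 0, ∀ t > 0, ∃ σ, 0 < σ ∧ σ < t ∧ F σ ≤ Q₀ + ε ∧
        ∀ᵐ τ ∂(volume.restrict (Ioi σ)), F τ ≤ F σ := by
      intro ε hε t ht
      obtain ⟨t₁, ht₁, h1⟩ := hinit (ε / 2) (half_pos hε)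
      have hc : Tendsto G (𝓝[Icc 0 1] 0) (𝓝 (G 0)) := hGcont 1 zero_le_one 0 (by simp)
      have hG0 : G 0 = 0 := by simp [hG]
      rw [hG0] at hc
      have h2 := hc.eventually (Ioi_mem_nhds (show -(ε / 2) < 0 by linarith))
      rw [eventually_nhdsWithin_iff, Metric.eventually_nhds_iff] at h2
      obtain ⟨t₂, ht₂, h2⟩ := h2
      rw [ae_restrict_iff' measurableSet_Ioo] at h1
      rw [ae_restrict_iff' measurableSet_Ioi] at hFmono
      obtain ⟨σ, ⟨h3, h4⟩, h5, h6⟩ := exists_mem_Ioo_of_ae (h1.and hFmono)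
        (show (0:ℝ) < min (min t t₁) (min t₂ 1) by positivity)
      simp only [lt_min_iff] at h6
      have h7 := h2 (y := σ) (by rw [Real.dist_eq, sub_zero, abs_of_pos h5]; exact h6.2.1)
        ⟨h5.le, h6.2.2.le⟩
      refine ⟨σ, h5, h6.1.1, ?_, h4 h5⟩
      have h8 := h3 ⟨h5, h6.1.2⟩
      have h7' : -(ε / 2) < G σ := h7
      simp only [hF]; linarith
    choose σ hσ using fun k : ℕ => hk _ (Nat.one_div_pos_of_nat (α := ℝ) (n := k)) _
      (Nat.one_div_pos_of_nat (α := ℝ) (n := k))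
    have h1 : ∀ᵐ τ, ∀ k, σ k < τ → F τ ≤ F (σ k) := by
      rw [ae_all_iff]
      intro k
      exact (ae_restrict_iff' measurableSet_Ioi).1 (hσ k).2.2.2
    rw [ae_restrict_iff' measurableSet_Ioi]
    filter_upwards [h1] with τ h1 hτ
    have hl := tendsto_one_div_add_atTop_nhds_zero_nat (𝕜 := ℝ)
    have hl2 : Tendsto (fun k : ℕ => Q₀ + 1 / ((k:ℝ) + 1)) atTop (𝓝 (Q₀ + 0)) := hl.const_add _
    rw [add_zero] at hl2
    refine ge_of_tendsto hl2 ?_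
    filter_upwards [hl.eventually (Iio_mem_nhds hτ)] with k hk
    exact (h1 k ((hσ k).2.1.trans hk)).trans (hσ k).2.2.1
  set Ft : ℝ → ℝ := fun τ => if τ ≤ 0 then Q₀ else F τ with hFt
  have hFi : ∀ T, IntegrableOn F (Ioo 0 T) := fun T => by
    rcases le_or_gt 0 T with hT | hT
    · exact (hQ T).sub (((hGcont T hT).integrableOn_Icc).mono_set Ioo_subset_Icc_self)
    · rw [Ioo_eq_empty (by linarith)]; exact integrableOn_empty
  have hFtloc : LocallyIntegrable Ft volume := by
    rw [locallyIntegrable_iff]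
    intro k hk
    obtain ⟨B, hB⟩ := hk.isBounded.subset_closedBall 0
    rw [Real.closedBall_eq_Icc, zero_sub, zero_add] at hB
    have h1 : IntegrableOn Ft (Icc (-B) 0) := by
      refine (integrableOn_const (C := Q₀) (by simp)).congr_fun (fun x hx => ?_)
        measurableSet_Icc
      simp [hFt, hx.2]
    have h2 : IntegrableOn Ft (Ioo 0 (B + 1)) :=
      (hFi (B + 1)).congr_fun (fun x hx => by simp [hFt, not_le.2 hx.1]) measurableSet_Ioo
    refine (h1.union h2).mono_set fun x hx => ?_
    have := hB hx
    rcases le_or_gt x 0 with h | h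
    · exact Or.inl ⟨this.1, h⟩
    · exact Or.inr ⟨h, by linarith [this.2]⟩
  have hFtmono : ∀ᵐ σ, ∀ᵐ τ, σ < τ → Ft τ ≤ Ft σ := by
    rw [ae_restrict_iff' measurableSet_Ioi] at hFmono hFle
    filter_upwards [hFmono] with σ h1
    rcases le_or_gt σ 0 with hσ | hσ
    · filter_upwards [hFle] with τ h2 _
      simp only [hFt, hσ, if_true]
      split_ifs with h
      · exact le_rfl
      · exact h2 (not_le.1 h)
    · have h3 := (ae_restrict_iff' measurableSet_Ioi).1 (h1 hσ)
      filter_upwards [h3] with τ h4 h5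
      simp only [hFt, not_le.2 hσ, if_false, not_le.2 (hσ.trans h5)]
      exact h4 h5
  have key := integral_deriv_mul_nonneg_of_ae_antitone hFtloc hFtmono (Q₀ := Q₀)
    (fun τ hτ => by simp [hFt, hτ]) hθ hθc hθ0
  have hint : Integrable fun τ => deriv θ τ * Ft τ := by
    simpa [smul_eq_mul] using hFtloc.integrable_smul_left_of_hasCompactSupport
      (hθ.continuous_deriv le_rfl) hθc.deriv
  have hs : ∫ τ, deriv θ τ * Ft τ
      = (∫ τ in Iic (0:ℝ), deriv θ τ * Ft τ) + ∫ τ in Ioi (0:ℝ), deriv θ τ * Ft τ := by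
    rw [← setIntegral_union (Iic_disjoint_Ioi le_rfl) measurableSet_Ioi hint.integrableOn
      hint.integrableOn, Iic_union_Ioi, setIntegral_univ]
  have h1 : ∫ τ in Iic (0:ℝ), deriv θ τ * Ft τ = θ 0 * Q₀ := by
    rw [← hθc.integral_Iic_deriv_eq hθ 0, ← integral_mul_const]
    exact setIntegral_congr_fun measurableSet_Iic fun τ hτ => by simp [hFt, mem_Iic.1 hτ]
  have h2 : ∫ τ in Ioi (0:ℝ), deriv θ τ * Ft τ
      = (∫ τ in Ioi (0:ℝ), deriv θ τ * Q τ) - ∫ τ in Ioi (0:ℝ), deriv θ τ * G τ := by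
    have hGi : ∀ T, IntegrableOn G (Ioo 0 T) := fun T => by
      rcases le_or_gt 0 T with hT | hT
      · exact ((hGcont T hT).integrableOn_Icc).mono_set Ioo_subset_Icc_self
      · rw [Ioo_eq_empty (by linarith)]; exact integrableOn_empty
    rw [← integral_sub (integrableOn_Ioi_mul_of_hasCompactSupport hQ (hθ.continuous_deriv le_rfl) hθc.deriv)
      (integrableOn_Ioi_mul_of_hasCompactSupport hGi (hθ.continuous_deriv le_rfl) hθc.deriv)]
    exact setIntegral_congr_fun measurableSet_Ioi fun τ hτ => by
      simp [hFt, not_le.2 (mem_Ioi.1 hτ), hF, mul_sub]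
  rw [hs, h1, h2, integral_Ioi_deriv_mul_primitive hg hθ hθc] at key
  simp only [neg_mul, integral_neg]
  linarith

end

section

/-! ### Relative entropies with respect to two reference states -/

/-- States at which the relative entropy density is finite. -/
def IsState (r : ℝ) (m : Space d) : Prop := 0 < r ∨ (r = 0 ∧ m = 0)

lemma IsState.nonneg {r : ℝ} {m : Space d} (hs : IsState r m) : 0 ≤ r := by
  rcases hs with h | h
  · exact h.le
  · exact h.1.ge

lemma IsState.smul_velocity {r : ℝ} {m : Space d} (hs : IsState r m) : r • velocity r m = m := by
  rcases hs with h | ⟨rfl, rfl⟩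
  · rw [velocity, smul_smul, mul_inv_cancel₀ h.ne', one_smul]
  · simp [velocity]

lemma velocity_zero (r : ℝ) : velocity r (0 : Space d) = 0 := by simp [velocity]

lemma mul_norm_velocity_sq {r : ℝ} (m : Space d) : r * ‖velocity r m‖ ^ 2 = ‖m‖ ^ 2 / r := by
  rcases eq_or_ne r 0 with rfl | hr
  · simp
  · rw [velocity, norm_smul, mul_pow, norm_inv, Real.norm_eq_abs, inv_pow, sq_abs]
    field_simp

/-- Expanding the square isolates |m|²/r, which does not involve U. Changing the reference velocity
thus changes the kinetic term by an affine function of (r, m), also in the vacuum because a state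
with r = 0 has m = 0. -/
lemma IsState.mul_norm_sub_sq {r : ℝ} {m : Space d} (hs : IsState r m) (U : Space d) :
    r * ‖velocity r m - U‖ ^ 2 = ‖m‖ ^ 2 / r - 2 * inner ℝ m U + r * ‖U‖ ^ 2 := by
  rw [norm_sub_sq_real, mul_add, mul_sub, mul_norm_velocity_sq]
  have : inner ℝ m U = r * inner ℝ (velocity r m) U := by
    rw [← real_inner_smul_left, hs.smul_velocity]
  rw [this]; ring

variable {h p : ℝ → ℝ}

/-- The entropy density as a real number. -/
def entropyValue (h : ℝ → ℝ) (τ : ℝ) (r : ℝ) (m : Space d) (r' : ℝ) (m' : Space d) : ℝ :=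
  1 / 2 * Real.exp (-(d * τ)) * r * ‖velocity r m - velocity r' m'‖ ^ 2 + relPotential h r r'

lemma IsState.relEntropyDensity_eq {r : ℝ} {m : Space d} (hs : IsState r m) (τ r' : ℝ)
    (m' : Space d) :
    relEntropyDensity h τ r m r' m' = ENNReal.ofReal (entropyValue h τ r m r' m') :=
  if_pos hs

lemma isState_of_relEntropyDensity_ne_top {τ r r' : ℝ} {m m' : Space d}
    (hne : relEntropyDensity h τ r m r' m' ≠ ⊤) : IsState r m := by
  by_contra hc
  exact hne (if_neg hc)

lemma IsState.entropyValue_nonneg (hp : IsPressureLaw p) (hh : IsPressurePotential p h)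
    {r r' : ℝ} {m : Space d} (hs : IsState r m) (τ : ℝ) (m' : Space d) (hr' : 0 ≤ r')
    (hd : DifferentiableWithinAt ℝ h (Ici 0) r') : 0 ≤ entropyValue h τ r m r' m' :=
  add_nonneg (by have := hs.nonneg; positivity) (relPotential_nonneg hp hh hr' hs.nonneg hd)

lemma IsState.toReal_relEntropyDensity (hp : IsPressureLaw p) (hh : IsPressurePotential p h)
    {r r' : ℝ} {m : Space d} (hs : IsState r m) (τ : ℝ) (m' : Space d) (hr' : 0 ≤ r')
    (hd : DifferentiableWithinAt ℝ h (Ici 0) r') :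
    (relEntropyDensity h τ r m r' m').toReal = entropyValue h τ r m r' m' := by
  rw [hs.relEntropyDensity_eq, ENNReal.toReal_ofReal (hs.entropyValue_nonneg hp hh τ m' hr' hd)]

/-- `z h'(z) - h(z)`, which is the pressure for `z > 0`. -/
def legendre (h : ℝ → ℝ) (z : ℝ) : ℝ := z * enthalpy h z - h z

/-- The multiplier of the density in the difference of two relative entropies. -/
def densityMultiplier (h : ℝ → ℝ) (τ a r' : ℝ) (m' : Space d) : ℝ :=
  enthalpy h a - enthalpy h r' + 1 / 2 * Real.exp (-(d * τ)) * ‖velocity r' m'‖ ^ 2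

/-- The multiplier of the momentum in the difference of two relative entropies. -/
def momentumMultiplier (τ r' : ℝ) (m' : Space d) : Space d :=
  -(Real.exp (-(d * τ)) • velocity r' m')

/-- The terms h(r) and |m|²/r cancel in the difference of two relative entropies. The constants
-h(r') + r' h'(r') combine into Legendre values. This affine difference is what makes the
multipliers usable as test functions. -/
lemma IsState.entropyValue_sub {r : ℝ} {m : Space d} (hs : IsState r m) (τ a r' : ℝ)
    (m' : Space d) :
    entropyValue h τ r m r' m' = entropyValue h τ r m a 0 + (densityMultiplier h τ a r' m' * r
      + inner ℝ (momentumMultiplier τ r' m') m + (legendre h r' - legendre h a)) := by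
  have h1 := hs.mul_norm_sub_sq (velocity r' m')
  have h2 := hs.mul_norm_sub_sq (velocity a (0 : Space d))
  rw [velocity_zero] at h2
  have h3 : inner ℝ (momentumMultiplier τ r' m') m
      = -(Real.exp (-(d * τ)) * inner ℝ m (velocity r' m')) := by
    rw [momentumMultiplier, inner_neg_left, real_inner_smul_left, real_inner_comm]
  simp only [entropyValue, velocity_zero, mul_assoc, h1, h2, densityMultiplier,
    legendre, relPotential, inner_zero_right, norm_zero, h3]
  ring

/-- Since h is continuous only on [0,∞), measurability goes through h(max r 0), and the finite and
infinite values are glued along the measurable set of states. The compositions with r' are assumed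
measurable so that r' may reach 0. -/
lemma aemeasurable_relEntropyDensity {X : Type*} [MeasurableSpace X] {μ : Measure X}
    (hh : IsPressurePotential p h) {t r r' : X → ℝ} {m m' : X → Space d} (ht : AEMeasurable t μ)
    (hr : AEMeasurable r μ) (hm : AEMeasurable m μ) (hr' : AEMeasurable r' μ)
    (hhr' : AEMeasurable (fun x => h (r' x)) μ) (hH : AEMeasurable (fun x => enthalpy h (r' x)) μ)
    (hv : AEMeasurable (fun x => velocity (r' x) (m' x)) μ) :
    AEMeasurable (fun x => relEntropyDensity h (t x) (r x) (m x) (r' x) (m' x)) μ := by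
  have hc : Continuous fun z => h (max z 0) :=
    hh.continuousOn.comp_continuous (by fun_prop) fun z => mem_Ici.2 (le_max_right _ _)
  have h1 : AEMeasurable (fun x => 1 / 2 * Real.exp (-(d * t x)) * r x *
      ‖velocity (r x) (m x) - velocity (r' x) (m' x)‖ ^ 2 +
      (h (max (r x) 0) - h (r' x) - enthalpy h (r' x) * (r x - r' x))) μ := by
    have e1 : AEMeasurable (fun x => velocity (r x) (m x)) μ := hr.inv.smul hm
    have e2 : AEMeasurable (fun x => h (max (r x) 0)) μ := hc.measurable.comp_aemeasurable hr
    have e3 : AEMeasurable (fun x => ‖velocity (r x) (m x) - velocity (r' x) (m' x)‖ ^ 2) μ :=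
      (e1.sub hv).norm.pow_const 2
    have e4 : AEMeasurable (fun x => Real.exp (-(d * t x))) μ :=
      Real.measurable_exp.comp_aemeasurable (ht.const_mul _).neg
    exact (((e4.const_mul _).mul hr).mul e3).add ((e2.sub hhr').sub (hH.mul (hr.sub hr')))
  have h2 : MeasurableSet {z : ℝ × Space d | IsState z.1 z.2} :=
    (measurableSet_lt measurable_const measurable_fst).union
      ((measurable_fst (measurableSet_singleton 0)).inter
        (measurable_snd (measurableSet_singleton 0)))
  have h3 : Measurable ({z : ℝ × Space d | IsState z.1 z.2}ᶜ.indicator fun _ => (⊤ : ℝ≥0∞)) :=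
    measurable_const.indicator h2.compl
  have h4 : Measurable ({z : ℝ × Space d | IsState z.1 z.2}.indicator fun _ => (1 : ℝ≥0∞)) :=
    measurable_const.indicator h2
  have h5 := ((h4.comp_aemeasurable (hr.prodMk hm)).mul h1.ennreal_ofReal).add
    (h3.comp_aemeasurable (hr.prodMk hm))
  refine h5.congr (ae_of_all _ fun x => ?_)
  by_cases hs : IsState (r x) (m x)
  · have : max (r x) 0 = r x := max_eq_left hs.nonneg
    simp only [Pi.add_apply, Pi.mul_apply, Function.comp]
    rw [indicator_of_mem (show (r x, m x) ∈ {z : ℝ × Space d | IsState z.1 z.2} from hs),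
      indicator_of_notMem (show (r x, m x) ∉ {z : ℝ × Space d | IsState z.1 z.2}ᶜ from
        fun hc => hc hs), hs.relEntropyDensity_eq, this, one_mul, add_zero]
    rfl
  · simp only [Pi.add_apply, Pi.mul_apply, Function.comp]
    rw [indicator_of_notMem (show (r x, m x) ∉ {z : ℝ × Space d | IsState z.1 z.2} from hs),
      indicator_of_mem (show (r x, m x) ∈ {z : ℝ × Space d | IsState z.1 z.2}ᶜ from hs),
      zero_mul, zero_add]
    exact (if_neg hs).symm

/-- The entropy density controls the state, uniformly for bounded reference densities. -/
lemma exists_state_bounds (hp : IsPressureLaw p) (hh : IsPressurePotential p h) (d : ℕ) (T M : ℝ) :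
    ∃ C : ℝ, 1 ≤ C ∧ ∀ τ ≤ T, ∀ a, 0 ≤ a → a ≤ M → DifferentiableWithinAt ℝ h (Ici 0) a →
      ∀ (r : ℝ) (m : Space d), IsState r m →
        r ≤ C * (1 + entropyValue h τ r m a 0) ∧ ‖m‖ ≤ C * (1 + entropyValue h τ r m a 0) ∧
        ‖m‖ ^ 2 / r ≤ C * entropyValue h τ r m a 0 ∧
        relPotential h r a ≤ entropyValue h τ r m a 0 := by
  obtain ⟨C₀, hC₀, H⟩ := exists_le_mul_one_add_relPotential hp hh M
  set C₁ := 2 * Real.exp (d * T)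
  have hC₁ : 0 < C₁ := by positivity
  refine ⟨C₀ + C₁, by linarith, fun τ hτ a ha haM hd r m hs => ?_⟩
  have hr := hs.nonneg
  have h0 := relPotential_nonneg hp hh ha hr hd
  have h1 := H a r ha haM hr hd
  have hk : 0 ≤ ‖m‖ ^ 2 / r := by positivity
  have he : entropyValue h τ r m a 0
      = 1 / 2 * Real.exp (-(d * τ)) * (‖m‖ ^ 2 / r) + relPotential h r a := by
    rw [entropyValue, velocity_zero, sub_zero, mul_assoc, mul_norm_velocity_sq]
  have h2 : ‖m‖ ^ 2 / r ≤ C₁ * (1 / 2 * Real.exp (-(d * τ)) * (‖m‖ ^ 2 / r)) := by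
    -- The factor e^{dT} undoes the weight e^{-dτ} for all τ ≤ T.
    have : 1 ≤ Real.exp (d * T) * Real.exp (-(d * τ)) := by
      rw [← Real.exp_add]
      refine Real.one_le_exp ?_
      have := mul_le_mul_of_nonneg_left hτ (Nat.cast_nonneg (α := ℝ) d)
      linarith
    calc _ ≤ (Real.exp (d * T) * Real.exp (-(d * τ))) * (‖m‖ ^ 2 / r) :=
          le_mul_of_one_le_left hk this
      _ = _ := by simp only [C₁]; ring
  have hk' : 0 ≤ 1 / 2 * Real.exp (-(d * τ)) * (‖m‖ ^ 2 / r) := by positivity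
  set k := 1 / 2 * Real.exp (-(d * τ)) * (‖m‖ ^ 2 / r)
  rw [he]
  have h3 : r ≤ C₀ * (1 + (k + relPotential h r a)) := h1.trans (by gcongr; linarith)
  have h4 : ‖m‖ ^ 2 / r ≤ C₁ * (k + relPotential h r a) := h2.trans (by gcongr; linarith)
  -- Young's inequality: the momentum is controlled by density and kinetic energy.
  have h5 : ‖m‖ ≤ r + ‖m‖ ^ 2 / r := by
    rcases hs with hr0 | ⟨rfl, rfl⟩
    · have : ‖m‖ * r ≤ (r + ‖m‖ ^ 2 / r) * r := by
        rw [add_mul, div_mul_cancel₀ _ hr0.ne']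
        nlinarith [sq_nonneg (‖m‖ - r), norm_nonneg m, sq_nonneg (‖m‖ + r)]
      exact le_of_mul_le_mul_right this hr0
    · simp
  have hS : 0 ≤ k + relPotential h r a := by linarith
  refine ⟨?_, ?_, ?_, by linarith⟩
  · nlinarith
  · nlinarith
  · nlinarith

/-- By homogeneity all values off the origin are values on the unit sphere, which is compact and on
which the function is continuous and positive. -/
lemma IsAngularLimit.exists_bounds {ρhat : Space d → ℝ} (hρ : IsAngularLimit ρhat) :
    ∃ c M : ℝ, 0 < c ∧ ∀ y, y ≠ 0 → c ≤ ρhat y ∧ ρhat y ≤ M := by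
  have hc : ContinuousOn ρhat (Metric.sphere 0 1) :=
    hρ.contDiffOn.continuousOn.mono fun y hy => by
      rintro rfl; simp at hy
  have hpt : ∀ y : Space d, y ≠ 0 → ‖y‖⁻¹ • y ∈ Metric.sphere (0 : Space d) 1 ∧
      ρhat (‖y‖⁻¹ • y) = ρhat y := fun y hy => by
    have hn := norm_pos_iff.2 hy
    refine ⟨?_, hρ.homogeneous _ (inv_pos.2 hn) y hy⟩
    rw [mem_sphere_zero_iff_norm, norm_smul, norm_inv, norm_norm, inv_mul_cancel₀ hn.ne']
  rcases (Metric.sphere (0 : Space d) 1).eq_empty_or_nonempty with he | hne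
  · exact ⟨1, 0, one_pos, fun y hy => absurd (hpt y hy).1 (by rw [he]; simp)⟩
  obtain ⟨a, ha, hmin⟩ := (isCompact_sphere (0 : Space d) 1).exists_isMinOn hne hc
  obtain ⟨b, hb, hmax⟩ := (isCompact_sphere (0 : Space d) 1).exists_isMaxOn hne hc
  refine ⟨ρhat a, ρhat b, hρ.pos a (by rintro rfl; simp at ha), fun y hy => ?_⟩
  obtain ⟨h1, h2⟩ := hpt y hy
  rw [← h2]
  exact ⟨hmin h1, hmax h1⟩

end

section

/-! ### Reference pairs and integrability of the entropy -/

lemma restrict_slab (s : Set ℝ) :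
    (volume : Measure (ℝ × Space d)).restrict (s ×ˢ univ) = (volume.restrict s).prod volume := by
  rw [Measure.volume_eq_prod, ← Measure.prod_restrict, Measure.restrict_univ]

/-- Regularity of a reference state `(r, m)`, in terms of its velocity and its enthalpy. -/
structure IsReferencePair (h : ℝ → ℝ) (r : ℝ → Space d → ℝ) (m : ℝ → Space d → Space d) :
    Prop where
  nonneg : ∀ τ, 0 ≤ τ → ∀ y, 0 ≤ r τ y
  differentiableWithinAt : ∀ τ, 0 ≤ τ → ∀ y, DifferentiableWithinAt ℝ h (Ici 0) (r τ y)
  density_continuousOn : ContinuousOn (fun z : ℝ × Space d => r z.1 z.2) (Ici 0 ×ˢ univ)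
  density_contDiffOn : ContDiffOn ℝ 1 (fun z : ℝ × Space d => r z.1 z.2) (Ioi 0 ×ˢ univ)
  enthalpy_continuousOn :
    ContinuousOn (fun z : ℝ × Space d => enthalpy h (r z.1 z.2)) (Ici 0 ×ˢ univ)
  enthalpy_contDiffOn :
    ContDiffOn ℝ 1 (fun z : ℝ × Space d => enthalpy h (r z.1 z.2)) (Ioi 0 ×ˢ univ)
  velocity_continuousOn :
    ContinuousOn (fun z : ℝ × Space d => velocity (r z.1 z.2) (m z.1 z.2)) (Ici 0 ×ˢ univ)
  velocity_contDiffOn :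
    ContDiffOn ℝ 1 (fun z : ℝ × Space d => velocity (r z.1 z.2) (m z.1 z.2)) (Ioi 0 ×ˢ univ)

variable {h p : ℝ → ℝ}

lemma continuous_slice {F : Type*} [TopologicalSpace F] {f : ℝ × Space d → F}
    (hf : ContinuousOn f (Ici 0 ×ˢ univ)) {τ : ℝ} (hτ : 0 ≤ τ) : Continuous fun y => f (τ, y) :=
  hf.comp_continuous (by fun_prop) fun _ => ⟨hτ, mem_univ _⟩

lemma exists_bound_of_continuousOn {F : Type*} [NormedAddCommGroup F] {f : ℝ × Space d → F}
    (hf : ContinuousOn f (Ici 0 ×ˢ univ)) (T R : ℝ) :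
    ∃ C : ℝ, 0 ≤ C ∧ ∀ τ ∈ Icc 0 T, ∀ y, ‖y‖ ≤ R → ‖f (τ, y)‖ ≤ C := by
  obtain ⟨C, hC⟩ := (isCompact_Icc.prod (isCompact_closedBall (0 : Space d) R)).exists_bound_of_continuousOn
    (hf.mono fun z hz => ⟨hz.1.1, mem_univ _⟩ :
      ContinuousOn f (Icc 0 T ×ˢ Metric.closedBall 0 R))
  exact ⟨max C 0, le_max_right _ _, fun τ hτ y hy => (hC (τ, y) ⟨hτ, by simpa using hy⟩).trans
    (le_max_left _ _)⟩

lemma aestronglyMeasurable_slab {F : Type*} [NormedAddCommGroup F] {f : ℝ × Space d → F}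
    (hf : ContinuousOn f (Ici 0 ×ˢ univ)) {s : Set ℝ} (hs : s ⊆ Ici 0) (hsm : MeasurableSet s) :
    AEStronglyMeasurable f (volume.restrict (s ×ˢ univ)) :=
  (hf.mono (prod_mono hs Subset.rfl)).aestronglyMeasurable (hsm.prod MeasurableSet.univ)

namespace IsReferencePair

variable {r : ℝ → Space d → ℝ} {m : ℝ → Space d → Space d}

lemma potential_continuousOn (hh : IsPressurePotential p h) (hr : IsReferencePair h r m) :
    ContinuousOn (fun z : ℝ × Space d => h (r z.1 z.2)) (Ici 0 ×ˢ univ) :=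
  hh.continuousOn.comp hr.density_continuousOn fun z hz => hr.nonneg z.1 hz.1 z.2

lemma legendre_continuousOn (hh : IsPressurePotential p h) (hr : IsReferencePair h r m) :
    ContinuousOn (fun z : ℝ × Space d => legendre h (r z.1 z.2)) (Ici 0 ×ˢ univ) :=
  (hr.density_continuousOn.mul hr.enthalpy_continuousOn).sub (hr.potential_continuousOn hh)

lemma mem_nhds_slab {z : ℝ × Space d} (hz : 0 < z.1) :
    (Ioi 0 ×ˢ univ : Set (ℝ × Space d)) ∈ 𝓝 z :=
  (isOpen_Ioi.prod isOpen_univ).mem_nhds ⟨hz, mem_univ _⟩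

/-- In d(r h'(r) - h(r)) the two contributions h'(r) dr cancel and r dh'(r) remains. Only
differentiability of r and of h'(r) as functions of (τ, y) is used, never that of h' itself, so r
may touch the vacuum. -/
lemma hasFDerivAt_legendre (hr : IsReferencePair h r m) {z : ℝ × Space d} (hz : 0 < z.1) :
    HasFDerivAt (fun z : ℝ × Space d => legendre h (r z.1 z.2))
      (r z.1 z.2 • fderiv ℝ (fun z : ℝ × Space d => enthalpy h (r z.1 z.2)) z) z := by
  have h1 : HasFDerivAt (fun z : ℝ × Space d => r z.1 z.2)
      (fderiv ℝ (fun z : ℝ × Space d => r z.1 z.2) z) z :=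
    (hr.density_contDiffOn.differentiableOn (by norm_num) |>.differentiableAt
      (mem_nhds_slab hz)).hasFDerivAt
  have h2 : HasFDerivAt (fun z : ℝ × Space d => enthalpy h (r z.1 z.2))
      (fderiv ℝ (fun z : ℝ × Space d => enthalpy h (r z.1 z.2)) z) z :=
    (hr.enthalpy_contDiffOn.differentiableOn (by norm_num) |>.differentiableAt
      (mem_nhds_slab hz)).hasFDerivAt
  have h3 : HasFDerivAt (fun z : ℝ × Space d => h (r z.1 z.2))
      (enthalpy h (r z.1 z.2) • fderiv ℝ (fun z : ℝ × Space d => r z.1 z.2) z) z := by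
    have h4 : HasDerivWithinAt h (enthalpy h (r z.1 z.2)) (Ici 0) (r z.1 z.2) :=
      (hr.differentiableWithinAt z.1 hz.le z.2).hasDerivWithinAt
    -- The chain rule is taken within [0,∞), because at the vacuum h has only a one-sided
    -- derivative.
    have h5 := h4.comp_hasFDerivWithinAt (s := Ioi 0 ×ˢ univ) z h1.hasFDerivWithinAt
      (fun w hw => hr.nonneg w.1 (le_of_lt hw.1) w.2)
    exact h5.hasFDerivAt (mem_nhds_slab hz)
  refine ((h1.mul h2).sub h3).congr_fderiv ?_
  ext <;> simp

lemma legendre_contDiffOn (hr : IsReferencePair h r m) :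
    ContDiffOn ℝ 1 (fun z : ℝ × Space d => legendre h (r z.1 z.2)) (Ioi 0 ×ˢ univ) := by
  have ho : IsOpen (Ioi 0 ×ˢ univ : Set (ℝ × Space d)) := isOpen_Ioi.prod isOpen_univ
  rw [show (1 : WithTop ℕ∞) = 0 + 1 from rfl, contDiffOn_succ_iff_fderiv_of_isOpen ho]
  refine ⟨fun z hz => (hr.hasFDerivAt_legendre hz.1).differentiableAt.differentiableWithinAt,
    by simp, ?_⟩
  rw [contDiffOn_zero]
  refine ContinuousOn.congr ?_ fun z hz => (hr.hasFDerivAt_legendre hz.1).fderiv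
  exact hr.density_contDiffOn.continuousOn.smul
    (hr.enthalpy_contDiffOn.continuousOn_fderiv_of_isOpen ho le_rfl)

end IsReferencePair

/-- Consequences of a finite relative entropy at a fixed time. -/
lemma fixed_time_entropy (hp : IsPressureLaw p) (hh : IsPressurePotential p h) {τ : ℝ}
    {r r' : Space d → ℝ} {m m' : Space d → Space d}
    (hr : AEMeasurable r) (hm : AEMeasurable m) (hr' : AEMeasurable r')
    (hhr' : AEMeasurable (fun x => h (r' x))) (hH : AEMeasurable (fun x => enthalpy h (r' x)))
    (hv : AEMeasurable (fun x => velocity (r' x) (m' x)))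
    (h0 : ∀ᵐ y, 0 ≤ r' y) (hd : ∀ᵐ y, DifferentiableWithinAt ℝ h (Ici 0) (r' y))
    (hfin : relEntropy h τ r m r' m' ≠ ⊤) :
    (∀ᵐ y, IsState (r y) (m y)) ∧
      Integrable (fun y => entropyValue h τ (r y) (m y) (r' y) (m' y)) ∧
      ∫ y, entropyValue h τ (r y) (m y) (r' y) (m' y) = (relEntropy h τ r m r' m').toReal := by
  have hmeas : AEMeasurable (fun y => relEntropyDensity h τ (r y) (m y) (r' y) (m' y)) :=
    aemeasurable_relEntropyDensity hh aemeasurable_const hr hm hr' hhr' hH hv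
  have hst : ∀ᵐ y, IsState (r y) (m y) := by
    filter_upwards [ae_lt_top' hmeas hfin] with y hy
    exact isState_of_relEntropyDensity_ne_top hy.ne
  have heq : (fun y => (relEntropyDensity h τ (r y) (m y) (r' y) (m' y)).toReal)
      =ᵐ[volume] fun y => entropyValue h τ (r y) (m y) (r' y) (m' y) := by
    filter_upwards [hst, h0, hd] with y h1 h2 h3
    exact h1.toReal_relEntropyDensity hp hh τ _ h2 h3
  refine ⟨hst, (integrable_toReal_of_lintegral_ne_top hmeas hfin).congr heq, ?_⟩
  rw [← integral_congr_ae heq, integral_toReal hmeas (ae_lt_top' hmeas hfin), relEntropy]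

lemma relEntropy_ne_top_of_integrable {τ : ℝ}
    {r r' : Space d → ℝ} {m m' : Space d → Space d} (hst : ∀ᵐ y, IsState (r y) (m y))
    (hi : Integrable (fun y => entropyValue h τ (r y) (m y) (r' y) (m' y))) :
    relEntropy h τ r m r' m' ≠ ⊤ := by
  have : relEntropy h τ r m r' m'
      = ∫⁻ y, ENNReal.ofReal (entropyValue h τ (r y) (m y) (r' y) (m' y)) := by
    refine lintegral_congr_ae ?_
    filter_upwards [hst] with y hy using hy.relEntropyDensity_eq _ _ _
  rw [this]
  exact hi.lintegral_lt_top.ne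

/-- The size of the multipliers in the difference of the relative entropies with respect to two
reference states. -/
def multiplierSize (h : ℝ → ℝ) (ρinf ρb : ℝ → Space d → ℝ) (nb : ℝ → Space d → Space d)
    (τ : ℝ) (y : Space d) : ℝ :=
  |densityMultiplier h τ (ρinf τ y) (ρb τ y) (nb τ y)| + ‖momentumMultiplier τ (ρb τ y) (nb τ y)‖
    + |legendre h (ρb τ y) - legendre h (ρinf τ y)|

/-- The integrand of the difference of two relative entropies. -/
def entropyShift (h : ℝ → ℝ) (ρinf ρb : ℝ → Space d → ℝ) (nb : ℝ → Space d → Space d)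
    (r : Space d → ℝ) (m : Space d → Space d) (τ : ℝ) (y : Space d) : ℝ :=
  densityMultiplier h τ (ρinf τ y) (ρb τ y) (nb τ y) * r y
    + inner ℝ (momentumMultiplier τ (ρb τ y) (nb τ y)) (m y)
    + (legendre h (ρb τ y) - legendre h (ρinf τ y))

/-- The multipliers are bounded and integrable in space, with a weight, locally uniformly in
time. -/
def HasMultiplierDecay (h : ℝ → ℝ) (ρinf ρb : ℝ → Space d → ℝ) (nb : ℝ → Space d → Space d) :
    Prop :=
  ∀ T : ℝ, ∃ C : ℝ, 0 ≤ C ∧ ∀ τ ∈ Icc 0 T,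
    (∀ y, (1 + ‖y‖) * multiplierSize h ρinf ρb nb τ y ≤ C) ∧
      ∫⁻ y, ENNReal.ofReal ((1 + ‖y‖) * multiplierSize h ρinf ρb nb τ y) ≤ ENNReal.ofReal C

/-! ### Regularity and size of the multipliers. -/

section Multiplier

variable {ρinf ρb : ℝ → Space d → ℝ} {nb : ℝ → Space d → Space d}

lemma multiplierSize_nonneg (τ : ℝ) (y : Space d) : 0 ≤ multiplierSize h ρinf ρb nb τ y := by
  unfold multiplierSize; positivity

lemma contDiff_exp_neg {k : WithTop ℕ∞} :
    ContDiff ℝ k fun z : ℝ × Space d => Real.exp (-(d * z.1)) :=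
  Real.contDiff_exp.comp (contDiff_const.mul contDiff_fst).neg

lemma densityMultiplier_continuousOn (hi : IsReferencePair h ρinf 0)
    (hb : IsReferencePair h ρb nb) :
    ContinuousOn (fun z : ℝ × Space d =>
      densityMultiplier h z.1 (ρinf z.1 z.2) (ρb z.1 z.2) (nb z.1 z.2)) (Ici 0 ×ˢ univ) := by
  refine (hi.enthalpy_continuousOn.sub hb.enthalpy_continuousOn).add ?_
  exact (continuous_const.mul (contDiff_exp_neg (k := 0)).continuous).continuousOn.mul
    (hb.velocity_continuousOn.norm.pow 2)

lemma densityMultiplier_contDiffOn (hi : IsReferencePair h ρinf 0)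
    (hb : IsReferencePair h ρb nb) :
    ContDiffOn ℝ 1 (fun z : ℝ × Space d =>
      densityMultiplier h z.1 (ρinf z.1 z.2) (ρb z.1 z.2) (nb z.1 z.2)) (Ioi 0 ×ˢ univ) := by
  refine (hi.enthalpy_contDiffOn.sub hb.enthalpy_contDiffOn).add ?_
  exact (contDiff_const.mul contDiff_exp_neg).contDiffOn.mul (hb.velocity_contDiffOn.norm_sq ℝ)

lemma momentumMultiplier_continuousOn (hb : IsReferencePair h ρb nb) :
    ContinuousOn (fun z : ℝ × Space d =>
      momentumMultiplier z.1 (ρb z.1 z.2) (nb z.1 z.2)) (Ici 0 ×ˢ univ) := by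
  have h1 := (contDiff_exp_neg (d := d) (k := 0)).continuous.continuousOn (s := Ici 0 ×ˢ univ)
  exact (h1.smul hb.velocity_continuousOn).neg

lemma momentumMultiplier_contDiffOn (hb : IsReferencePair h ρb nb) :
    ContDiffOn ℝ 1 (fun z : ℝ × Space d =>
      momentumMultiplier z.1 (ρb z.1 z.2) (nb z.1 z.2)) (Ioi 0 ×ˢ univ) := by
  have h1 := (contDiff_exp_neg (d := d) (k := 1)).contDiffOn (s := Ioi 0 ×ˢ univ)
  exact (h1.smul hb.velocity_contDiffOn).neg

lemma multiplierSize_continuousOn (hh : IsPressurePotential p h) (hi : IsReferencePair h ρinf 0)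
    (hb : IsReferencePair h ρb nb) :
    ContinuousOn (fun z : ℝ × Space d => multiplierSize h ρinf ρb nb z.1 z.2) (Ici 0 ×ˢ univ) :=
  ((densityMultiplier_continuousOn hi hb).abs.add (momentumMultiplier_continuousOn hb).norm).add
    ((hb.legendre_continuousOn hh).sub (hi.legendre_continuousOn hh)).abs

lemma abs_entropyShift_le {r : Space d → ℝ} {m : Space d → Space d} {τ : ℝ} {y : Space d}
    {A : ℝ} (hA : 1 ≤ A) (hr : |r y| ≤ A) (hm : ‖m y‖ ≤ A) :
    |entropyShift h ρinf ρb nb r m τ y| ≤ multiplierSize h ρinf ρb nb τ y * A := by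
  unfold entropyShift multiplierSize
  rw [add_mul, add_mul]
  refine (abs_add_three _ _ _).trans (add_le_add_three ?_ ?_ ?_)
  · rw [abs_mul]; gcongr
  · exact (abs_real_inner_le_norm _ _).trans (by gcongr)
  · exact le_mul_of_one_le_right (abs_nonneg _) hA

end Multiplier

end

section

/-! ### Bounds for energy-variational solutions -/

section Solution

variable {α : ℝ} {p h : ℝ → ℝ} {ρhat ρ₀ : Space d → ℝ} {n₀ : Space d → Space d}
  {K : (Space d → Space d) → ℝ} {ρinf ρ : ℝ → Space d → ℝ} {n : ℝ → Space d → Space d} {E : ℝ → ℝ}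

lemma IsEnergyVariationalSolution.isReferencePair (hh : IsPressurePotential p h)
    (hsol : IsEnergyVariationalSolution α p h ρhat ρ₀ n₀ K ρinf ρ n E) :
    IsReferencePair h ρinf 0 where
  nonneg := hsol.refdens_nonneg
  differentiableWithinAt τ hτ y := by
    rcases (hsol.refdens_nonneg τ hτ y).eq_or_lt with h0 | h0
    · rw [← h0]; exact hsol.refdens_vacuum τ hτ y h0.symm
    · exact hh.differentiableWithinAt h0
  density_continuousOn := hsol.refdens_contDiffOn.continuousOn
  density_contDiffOn := hsol.refdens_contDiffOn.mono (prod_mono Ioi_subset_Ici_self Subset.rfl)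
  enthalpy_continuousOn := hsol.enthalpy_contDiffOn.continuousOn
  enthalpy_contDiffOn := hsol.enthalpy_contDiffOn.mono (prod_mono Ioi_subset_Ici_self Subset.rfl)
  velocity_continuousOn := by
    simp only [Pi.zero_apply, velocity_zero]; exact continuousOn_const
  velocity_contDiffOn := by
    simp only [Pi.zero_apply, velocity_zero]; exact contDiffOn_const

/-- The values of an angular limit lie in a compact subset of (0,∞), where h and h' are continuous.
The origin is excluded because nothing is assumed about an angular limit there. -/
lemma exists_limit_bound (hp : IsPressureLaw p) (hh : IsPressurePotential p h)
    (hρhat : IsAngularLimit ρhat ∨ ∀ y, ρhat y = 0) :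
    ∃ M : ℝ, 0 ≤ M ∧ ∀ y, y ≠ 0 → 0 ≤ ρhat y ∧ ρhat y ≤ M ∧ |h (ρhat y)| ≤ M ∧
      |enthalpy h (ρhat y)| ≤ M := by
  rcases hρhat with hρ | hρ
  · obtain ⟨c, M, hc, hcM⟩ := hρ.exists_bounds
    obtain ⟨C₁, h1⟩ := (isCompact_Icc (a := c) (b := M)).exists_bound_of_continuousOn
      (hh.continuousOn.mono fun z hz => mem_Ici.2 (hc.le.trans hz.1))
    obtain ⟨C₂, h2⟩ := (isCompact_Icc (a := c) (b := M)).exists_bound_of_continuousOn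
      ((contDiffOn_enthalpy hp hh).continuousOn.mono fun z hz => mem_Ioi.2 (hc.trans_le hz.1))
    refine ⟨|M| + |C₁| + |C₂|, by positivity, fun y hy => ?_⟩
    have h3 := hcM y hy
    have h4 := h1 _ h3
    have h5 := h2 _ h3
    rw [Real.norm_eq_abs] at h4 h5
    have := abs_nonneg M
    have := abs_nonneg C₁
    have := abs_nonneg C₂
    refine ⟨hc.le.trans h3.1, ?_, ?_, ?_⟩
    · linarith [h3.2, le_abs_self M]
    · linarith [le_abs_self C₁]
    · linarith [le_abs_self C₂]
  · refine ⟨|h 0| + |enthalpy h 0|, by positivity, fun y _ => ?_⟩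
    rw [hρ y]
    have := abs_nonneg (h 0)
    have := abs_nonneg (enthalpy h 0)
    refine ⟨le_rfl, ?_, ?_, ?_⟩ <;> linarith

/-- Compactness gives the bounds in a ball; outside it ρ_∞ is the limit density. -/
lemma IsEnergyVariationalSolution.exists_refdens_bound (hp : IsPressureLaw p)
    (hh : IsPressurePotential p h) (hρhat : IsAngularLimit ρhat ∨ ∀ y, ρhat y = 0)
    (hsol : IsEnergyVariationalSolution α p h ρhat ρ₀ n₀ K ρinf ρ n E) (T : ℝ) :
    ∃ M : ℝ, 0 ≤ M ∧ ∀ τ ∈ Icc 0 T, ∀ y, ρinf τ y ≤ M ∧ |h (ρinf τ y)| ≤ M ∧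
      |enthalpy h (ρinf τ y)| ≤ M := by
  have hi := hsol.isReferencePair hh
  obtain ⟨R, hR, hlim⟩ := hsol.refdens_limit T
  obtain ⟨C₁, hC₁, h1⟩ := exists_bound_of_continuousOn hi.density_continuousOn T R
  obtain ⟨C₂, hC₂, h2⟩ := exists_bound_of_continuousOn (hi.potential_continuousOn hh) T R
  obtain ⟨C₃, hC₃, h3⟩ := exists_bound_of_continuousOn hi.enthalpy_continuousOn T R
  obtain ⟨M, hM, h4⟩ := exists_limit_bound hp hh hρhat
  refine ⟨C₁ + C₂ + C₃ + M, by positivity, fun τ hτ y => ?_⟩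
  rcases le_or_gt ‖y‖ R with hy | hy
  · have e1 := h1 τ hτ y hy
    have e2 := h2 τ hτ y hy
    have e3 := h3 τ hτ y hy
    simp only [Real.norm_eq_abs] at e1 e2 e3
    exact ⟨by linarith [le_abs_self (ρinf τ y)], by linarith, by linarith⟩
  · have hy0 : y ≠ 0 := norm_pos_iff.1 (hR.trans hy)
    rw [hlim τ hτ y hy]
    obtain ⟨_, e1, e2, e3⟩ := h4 y hy0
    exact ⟨by linarith, by linarith, by linarith⟩

lemma IsEnergyVariationalSolution.exists_energy_bound
    (hsol : IsEnergyVariationalSolution α p h ρhat ρ₀ n₀ K ρinf ρ n E) :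
    ∃ B : ℝ, 0 ≤ B ∧ ∀ τ, 0 ≤ τ → |E τ| ≤ B := by
  refine ⟨|E 0| + (eVariationOn E (Ici 0)).toReal, by positivity, fun τ hτ => ?_⟩
  have := hsol.energy.dist_le (mem_Ici.2 hτ) (mem_Ici.2 le_rfl)
  rw [Real.dist_eq] at this
  have h2 := abs_add_le (E τ - E 0) (E 0)
  rw [sub_add_cancel] at h2
  linarith

lemma IsEnergyVariationalSolution.aemeasurable_energy
    (hsol : IsEnergyVariationalSolution α p h ρhat ρ₀ n₀ K ρinf ρ n E) :
    AEMeasurable E (volume.restrict (Ici 0)) := by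
  obtain ⟨a, b, ha, hb, hab⟩ :=
    hsol.energy.locallyBoundedVariationOn.exists_monotoneOn_sub_monotoneOn
  rw [hab]
  exact (aemeasurable_restrict_of_monotoneOn measurableSet_Ici ha).sub
    (aemeasurable_restrict_of_monotoneOn measurableSet_Ici hb)

lemma IsEnergyVariationalSolution.integrableOn_energy
    (hsol : IsEnergyVariationalSolution α p h ρhat ρ₀ n₀ K ρinf ρ n E) (T : ℝ) :
    IntegrableOn E (Ioo 0 T) := by
  obtain ⟨B, -, hB⟩ := hsol.exists_energy_bound
  refine Integrable.of_bound (hsol.aemeasurable_energy.mono_measure (Measure.restrict_mono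
    (fun x (hx : x ∈ Ioo 0 T) => mem_Ici.2 hx.1.le) le_rfl)).aestronglyMeasurable B ?_
  filter_upwards [ae_restrict_mem measurableSet_Ioo] with τ hτ using hB τ hτ.1.le

/-- Everything that is needed about the solution at a fixed time. -/
structure IsFiniteSlice (h : ℝ → ℝ) (τ : ℝ) (ρinf : Space d → ℝ) (r : Space d → ℝ)
    (m : Space d → Space d) : Prop where
  aemeasurable_density : AEMeasurable r
  aemeasurable_momentum : AEMeasurable m
  isState : ∀ᵐ y, IsState (r y) (m y)
  integrable : Integrable fun y => entropyValue h τ (r y) (m y) (ρinf y) 0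
  integral_eq : ∫ y, entropyValue h τ (r y) (m y) (ρinf y) 0 = (relEntropy h τ r m ρinf 0).toReal
  ne_top : relEntropy h τ r m ρinf 0 ≠ ⊤

lemma IsReferencePair.isFiniteSlice (hp : IsPressureLaw p) (hh : IsPressurePotential p h)
    (hi : IsReferencePair h ρinf 0) {τ : ℝ} (hτ : 0 ≤ τ) {r : Space d → ℝ} {m : Space d → Space d}
    (hr : AEMeasurable r) (hm : AEMeasurable m) (hfin : relEntropy h τ r m (ρinf τ) 0 ≠ ⊤) :
    IsFiniteSlice h τ (ρinf τ) r m := by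
  obtain ⟨h1, h2, h3⟩ := fixed_time_entropy hp hh hr hm
    (continuous_slice hi.density_continuousOn hτ).aemeasurable
    (continuous_slice (hi.potential_continuousOn hh) hτ).aemeasurable
    (continuous_slice hi.enthalpy_continuousOn hτ).aemeasurable
    (continuous_slice hi.velocity_continuousOn hτ).aemeasurable
    (ae_of_all _ (hi.nonneg τ hτ)) (ae_of_all _ (hi.differentiableWithinAt τ hτ)) hfin
  exact ⟨hr, hm, h1, h2, h3, hfin⟩

lemma IsEnergyVariationalSolution.aestronglyMeasurable_density
    (hsol : IsEnergyVariationalSolution α p h ρhat ρ₀ n₀ K ρinf ρ n E) {s : Set ℝ}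
    (hs : s ⊆ Ici 0) :
    AEStronglyMeasurable (fun z : ℝ × Space d => ρ z.1 z.2) (volume.restrict (s ×ˢ univ)) :=
  hsol.density.aestronglyMeasurable.mono_measure
    (Measure.restrict_mono (prod_mono hs Subset.rfl) le_rfl)

lemma IsEnergyVariationalSolution.aestronglyMeasurable_momentum
    (hsol : IsEnergyVariationalSolution α p h ρhat ρ₀ n₀ K ρinf ρ n E) {s : Set ℝ}
    (hs : s ⊆ Ici 0) :
    AEStronglyMeasurable (fun z : ℝ × Space d => n z.1 z.2) (volume.restrict (s ×ˢ univ)) :=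
  hsol.momentum.aestronglyMeasurable.mono_measure
    (Measure.restrict_mono (prod_mono hs Subset.rfl) le_rfl)

lemma IsEnergyVariationalSolution.ae_isFiniteSlice (hp : IsPressureLaw p)
    (hh : IsPressurePotential p h)
    (hsol : IsEnergyVariationalSolution α p h ρhat ρ₀ n₀ K ρinf ρ n E) :
    ∀ᵐ τ ∂(volume.restrict (Ioi (0 : ℝ))), IsFiniteSlice h τ (ρinf τ) (ρ τ) (n τ) ∧
      (relEntropy h τ (ρ τ) (n τ) (ρinf τ) 0).toReal ≤ E τ := by
  have h1 := hsol.aestronglyMeasurable_density (Ioi_subset_Ici_self (a := (0:ℝ)))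
  have h2 := hsol.aestronglyMeasurable_momentum (Ioi_subset_Ici_self (a := (0:ℝ)))
  rw [restrict_slab] at h1 h2
  filter_upwards [h1.prodMk_left, h2.prodMk_left, hsol.entropy_le, ae_restrict_mem measurableSet_Ioi]
    with τ e1 e2 e3 hτ
  exact ⟨(hsol.isReferencePair hh).isFiniteSlice hp hh (le_of_lt hτ) e1.aemeasurable
    e2.aemeasurable e3.1, e3.2⟩

/-- The entropy of almost every slice is at most E, which is bounded as a function of bounded
variation. By Tonelli the density has a finite space-time integral, and finite density forces (ρ, n)
to be a state. -/
lemma IsEnergyVariationalSolution.ae_isState_and_integrableOn (hp : IsPressureLaw p)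
    (hh : IsPressurePotential p h)
    (hsol : IsEnergyVariationalSolution α p h ρhat ρ₀ n₀ K ρinf ρ n E) (T : ℝ) :
    (∀ᵐ z ∂(volume.restrict (Ioo 0 T ×ˢ univ) : Measure (ℝ × Space d)),
      IsState (ρ z.1 z.2) (n z.1 z.2)) ∧
    IntegrableOn (fun z : ℝ × Space d =>
      entropyValue h z.1 (ρ z.1 z.2) (n z.1 z.2) (ρinf z.1 z.2) 0) (Ioo 0 T ×ˢ univ) := by
  have hi := hsol.isReferencePair hh
  have hsub : Ioo 0 T ⊆ Ici (0:ℝ) := fun x hx => mem_Ici.2 hx.1.le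
  have hmeas : AEMeasurable (fun z : ℝ × Space d =>
      relEntropyDensity h z.1 (ρ z.1 z.2) (n z.1 z.2) (ρinf z.1 z.2) ((0 : ℝ → Space d → Space d) z.1 z.2))
      (volume.restrict (Ioo 0 T ×ˢ univ)) :=
    aemeasurable_relEntropyDensity hh measurable_fst.aemeasurable
      (hsol.aestronglyMeasurable_density hsub).aemeasurable
      (hsol.aestronglyMeasurable_momentum hsub).aemeasurable
      (aestronglyMeasurable_slab hi.density_continuousOn hsub measurableSet_Ioo).aemeasurable
      (aestronglyMeasurable_slab (hi.potential_continuousOn hh) hsub measurableSet_Ioo).aemeasurable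
      (aestronglyMeasurable_slab hi.enthalpy_continuousOn hsub measurableSet_Ioo).aemeasurable
      (aestronglyMeasurable_slab hi.velocity_continuousOn hsub measurableSet_Ioo).aemeasurable
  obtain ⟨B, hB, hEB⟩ := hsol.exists_energy_bound
  have hfin : ∫⁻ z in Ioo 0 T ×ˢ (univ : Set (Space d)),
      relEntropyDensity h z.1 (ρ z.1 z.2) (n z.1 z.2) (ρinf z.1 z.2) ((0 : ℝ → Space d → Space d) z.1 z.2) ≠ ⊤ := by
    rw [restrict_slab] at hmeas ⊢
    rw [lintegral_prod _ hmeas]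
    have h1 : ∫⁻ τ in Ioo 0 T, ∫⁻ y, relEntropyDensity h τ (ρ τ y) (n τ y) (ρinf τ y)
        ((0 : ℝ → Space d → Space d) τ y) ≤ ∫⁻ _ in Ioo 0 T, ENNReal.ofReal B := by
      refine lintegral_mono_ae ?_
      filter_upwards [ae_restrict_of_ae_restrict_of_subset Ioo_subset_Ioi_self hsol.entropy_le,
        ae_restrict_mem measurableSet_Ioo] with τ e1 e2
      change relEntropy h τ (ρ τ) (n τ) (ρinf τ) 0 ≤ _
      rw [← ENNReal.ofReal_toReal e1.1]
      exact ENNReal.ofReal_le_ofReal (e1.2.trans ((le_abs_self _).trans (hEB τ e2.1.le)))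
    refine ne_top_of_le_ne_top ?_ h1
    rw [lintegral_const]
    exact ENNReal.mul_ne_top ENNReal.ofReal_ne_top (by simp)
  have hst : ∀ᵐ z ∂(volume.restrict (Ioo 0 T ×ˢ univ) : Measure (ℝ × Space d)),
      IsState (ρ z.1 z.2) (n z.1 z.2) := by
    filter_upwards [ae_lt_top' hmeas hfin] with z hz
    exact isState_of_relEntropyDensity_ne_top hz.ne
  refine ⟨hst, (integrable_toReal_of_lintegral_ne_top hmeas hfin).congr ?_⟩
  filter_upwards [hst, ae_restrict_mem (measurableSet_Ioo.prod MeasurableSet.univ)] with z h1 h2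
  exact h1.toReal_relEntropyDensity hp hh _ _ (hi.nonneg _ h2.1.1.le _)
    (hi.differentiableWithinAt _ h2.1.1.le _)

/-- The data have finite entropy relative to ρ̂, and ρ_∞(0) differs from ρ̂ only in a ball. There
the change of entropy is affine in ρ₀ with bounded coefficients, hence integrable by local
integrability of ρ₀. -/
lemma IsEnergyVariationalSolution.isFiniteSlice_init (hd : 1 ≤ d) (hp : IsPressureLaw p)
    (hh : IsPressurePotential p h) (hρhat : IsAngularLimit ρhat ∨
      (∀ y, ρhat y = 0) ∧ DifferentiableWithinAt ℝ h (Ici 0) 0)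
    (hsol : IsEnergyVariationalSolution α p h ρhat ρ₀ n₀ K ρinf ρ n E) :
    IsFiniteSlice h 0 (ρinf 0) ρ₀ n₀ := by
  have hi := hsol.isReferencePair hh
  -- In positive dimension the origin, where ρ̂ is uncontrolled, is a null set.
  have : Nonempty (Fin d) := ⟨⟨0, hd⟩⟩
  have hne : ∀ᵐ y : Space d, y ≠ 0 := by
    rw [ae_iff]; simp
  have hr := hsol.init_density.aestronglyMeasurable.aemeasurable
  have hm := hsol.init_momentum.aestronglyMeasurable.aemeasurable
  have hρhat' : IsAngularLimit ρhat ∨ ∀ y, ρhat y = 0 := hρhat.imp_right And.left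
  obtain ⟨M, hM, hbd⟩ := exists_limit_bound hp hh hρhat'
  have hmeas : ∀ f : ℝ → ℝ, ContinuousOn f (Ioi 0) → AEMeasurable (fun y => f (ρhat y)) := by
    intro f hf
    rcases hρhat with hρ | ⟨hρ, -⟩
    · have h1 : ContinuousOn (fun y => f (ρhat y)) {0}ᶜ :=
        hf.comp hρ.contDiffOn.continuousOn fun y hy => hρ.pos y hy
      have h2 := h1.aemeasurable (μ := volume) (measurableSet_singleton (0 : Space d)).compl
      rwa [Measure.restrict_eq_self_of_ae_mem (by simpa using hne)] at h2
    · simp only [hρ]; exact aemeasurable_const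
  have hd0 : ∀ᵐ y, DifferentiableWithinAt ℝ h (Ici 0) (ρhat y) := by
    rcases hρhat with hρ | ⟨hρ, h0⟩
    · filter_upwards [hne] with y hy using hh.differentiableWithinAt (hρ.pos y hy)
    · simp only [hρ]; exact ae_of_all _ fun _ => h0
  obtain ⟨hst, hint, -⟩ := fixed_time_entropy (m' := 0) hp hh hr hm (hmeas id continuousOn_id)
    (hmeas h (hh.continuousOn.mono Ioi_subset_Ici_self))
    (hmeas _ (contDiffOn_enthalpy hp hh).continuousOn)
    (by simp only [Pi.zero_apply, velocity_zero]; exact aemeasurable_const)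
    (by filter_upwards [hne] with y hy using (hbd y hy).1) hd0 hsol.init_entropy
  refine hi.isFiniteSlice hp hh le_rfl hr hm (relEntropy_ne_top_of_integrable hst ?_)
  obtain ⟨M', hM', hbd'⟩ := hsol.exists_refdens_bound hp hh hρhat' 0
  obtain ⟨R, hR, hlim⟩ := hsol.refdens_limit 0
  -- The affine change of entropy from (ρ̂, 0) to (ρ_∞(0), 0). Both velocities vanish, so n₀ does
  -- not enter.
  set q : Space d → ℝ := fun y => (enthalpy h (ρhat y) - enthalpy h (ρinf 0 y)) * ρ₀ y +
    (legendre h (ρinf 0 y) - legendre h (ρhat y)) with hq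
  have hqi : Integrable q := by
    have hqm : AEStronglyMeasurable q volume := by
      have e1 := hmeas _ (contDiffOn_enthalpy hp hh).continuousOn
      have e2 := (continuous_slice hi.enthalpy_continuousOn le_rfl).aemeasurable (μ := volume)
      have e3 := (continuous_slice (hi.legendre_continuousOn hh) le_rfl).aemeasurable (μ := volume)
      have e4 := hmeas (legendre h) (ContinuousOn.sub (continuousOn_id.mul
        (contDiffOn_enthalpy hp hh).continuousOn) (hh.continuousOn.mono Ioi_subset_Ici_self))
      exact (((e1.sub e2).mul hr).add (e3.sub e4)).aestronglyMeasurable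
    have hball : IntegrableOn (fun y => (M + M') * |ρ₀ y| + (M * M + M + (M' * M' + M')))
        (Metric.closedBall 0 R) :=
      (((hsol.init_density.integrableOn_isCompact (isCompact_closedBall 0 R)).abs).const_mul _).add
        (integrableOn_const (isCompact_closedBall (0 : Space d) R).measure_lt_top.ne)
    refine Integrable.mono' (hball.integrable_indicator measurableSet_closedBall) hqm ?_
    filter_upwards [hne] with y hy
    by_cases hyR : y ∈ Metric.closedBall (0 : Space d) R
    · rw [indicator_of_mem hyR]
      obtain ⟨a0, a1, a2, a3⟩ := hbd y hy
      obtain ⟨b1, b2, b3⟩ := hbd' 0 (by simp) y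
      have b0 := hsol.refdens_nonneg 0 le_rfl y
      have c1 : |ρhat y * enthalpy h (ρhat y)| ≤ M * M := by
        rw [abs_mul, abs_of_nonneg a0]; gcongr
      have c2 : |ρinf 0 y * enthalpy h (ρinf 0 y)| ≤ M' * M' := by
        rw [abs_mul, abs_of_nonneg b0]; gcongr
      simp only [hq, legendre, Real.norm_eq_abs]
      refine (abs_add_le _ _).trans (add_le_add ?_ ?_)
      · rw [abs_mul]
        gcongr
        exact (abs_sub _ _).trans (add_le_add a3 b3)
      · rw [abs_le] at *
        constructor <;> linarith
    · rw [indicator_of_notMem hyR]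
      have hyR' : R < ‖y‖ := by simpa using hyR
      simp only [hq, hlim 0 (by simp) y hyR', sub_self, zero_mul, add_zero, norm_zero, le_refl]
  refine (hint.add hqi).congr ?_
  filter_upwards [hst] with y hy
  simp only [Pi.add_apply, hq]
  have := hy.entropyValue_sub (h := h) 0 (ρhat y) (ρinf 0 y) (0 : Space d)
  simp only [densityMultiplier, momentumMultiplier, velocity_zero] at this
  simp only [Pi.zero_apply]
  rw [this]; simp

/-- A common bound for the density and the momentum in terms of the entropy. -/
lemma IsEnergyVariationalSolution.exists_state_bounds (hp : IsPressureLaw p)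
    (hh : IsPressurePotential p h) (hρhat : IsAngularLimit ρhat ∨ ∀ y, ρhat y = 0)
    (hsol : IsEnergyVariationalSolution α p h ρhat ρ₀ n₀ K ρinf ρ n E) (T : ℝ) :
    ∃ C : ℝ, 1 ≤ C ∧ ∀ τ ∈ Icc 0 T, ∀ y, ∀ (r : ℝ) (m : Space d), IsState r m →
        r ≤ C * (1 + entropyValue h τ r m (ρinf τ y) 0) ∧
        ‖m‖ ≤ C * (1 + entropyValue h τ r m (ρinf τ y) 0) ∧
        ‖m‖ ^ 2 / r ≤ C * entropyValue h τ r m (ρinf τ y) 0 ∧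
        relPotential h r (ρinf τ y) ≤ entropyValue h τ r m (ρinf τ y) 0 ∧
        0 ≤ entropyValue h τ r m (ρinf τ y) 0 := by
  have hi := hsol.isReferencePair hh
  obtain ⟨M, -, hM⟩ := hsol.exists_refdens_bound hp hh hρhat T
  obtain ⟨C, hC, H⟩ := DampedEuler.exists_state_bounds hp hh d T M
  refine ⟨C, hC, fun τ hτ y r m hs => ?_⟩
  obtain ⟨h1, h2, h3, h4⟩ := H τ hτ.2 _ (hi.nonneg τ hτ.1 y) (hM τ hτ y).1
    (hi.differentiableWithinAt τ hτ.1 y) r m hs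
  exact ⟨h1, h2, h3, h4, hs.entropyValue_nonneg hp hh τ 0 (hi.nonneg τ hτ.1 y)
    (hi.differentiableWithinAt τ hτ.1 y)⟩

end Solution

end

section

/-! ### Change of the reference state -/

section Shift

variable {α : ℝ} {p h : ℝ → ℝ} {ρhat ρ₀ : Space d → ℝ} {n₀ : Space d → Space d}
  {K : (Space d → Space d) → ℝ} {ρinf ρ : ℝ → Space d → ℝ} {n : ℝ → Space d → Space d} {E : ℝ → ℝ}
  {ρb : ℝ → Space d → ℝ} {nb : ℝ → Space d → Space d}

/-- The dominating function for all terms that are linear in the multipliers. -/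
def shiftBound (h : ℝ → ℝ) (ρinf ρb : ℝ → Space d → ℝ) (nb : ℝ → Space d → Space d)
    (r : Space d → ℝ) (m : Space d → Space d) (τ : ℝ) (y : Space d) : ℝ :=
  multiplierSize h ρinf ρb nb τ y * (1 + entropyValue h τ (r y) (m y) (ρinf τ y) 0)

lemma integrable_weighted_multiplierSize (hh : IsPressurePotential p h)
    (hi : IsReferencePair h ρinf 0) (hb : IsReferencePair h ρb nb) {τ C : ℝ} (hτ : 0 ≤ τ)
    (hC : 0 ≤ C)
    (hfin : ∫⁻ y, ENNReal.ofReal ((1 + ‖y‖) * multiplierSize h ρinf ρb nb τ y)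
      ≤ ENNReal.ofReal C) :
    Integrable (fun y => (1 + ‖y‖) * multiplierSize h ρinf ρb nb τ y) ∧
      ∫ y, (1 + ‖y‖) * multiplierSize h ρinf ρb nb τ y ≤ C := by
  have hc : Continuous fun y : Space d => (1 + ‖y‖) * multiplierSize h ρinf ρb nb τ y :=
    (by fun_prop : Continuous fun y : Space d => 1 + ‖y‖).mul
      (continuous_slice (multiplierSize_continuousOn hh hi hb) hτ)
  have h0 : ∀ y : Space d, 0 ≤ (1 + ‖y‖) * multiplierSize h ρinf ρb nb τ y := fun y =>
    mul_nonneg (by positivity) (multiplierSize_nonneg τ y)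
  refine ⟨⟨hc.aestronglyMeasurable, ?_⟩, ?_⟩
  · rw [hasFiniteIntegral_iff_ofReal (ae_of_all _ h0)]
    exact hfin.trans_lt ENNReal.ofReal_lt_top
  · rw [integral_eq_lintegral_of_nonneg_ae (ae_of_all _ h0) hc.aestronglyMeasurable]
    exact ENNReal.toReal_le_of_le_ofReal hC hfin

/-- Outside the ball of radius R the weight 1 + |y| is at least 1 + R, which gains the factor (1 +
R)⁻¹. The L¹ bound on the weighted multipliers is paired with the constant 1, the sup bound with the
entropy. -/
lemma exists_shiftBound_tail (hp : IsPressureLaw p) (hh : IsPressurePotential p h)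
    (hi : IsReferencePair h ρinf 0) (hb : IsReferencePair h ρb nb)
    (hdec : HasMultiplierDecay h ρinf ρb nb) (T : ℝ) :
    ∃ C : ℝ, 0 ≤ C ∧ ∀ τ ∈ Icc 0 T, ∀ r m, IsFiniteSlice h τ (ρinf τ) r m →
      Integrable (shiftBound h ρinf ρb nb r m τ) ∧ ∀ R : ℝ, 0 ≤ R →
        ∫ y in (Metric.closedBall 0 R)ᶜ, shiftBound h ρinf ρb nb r m τ y
          ≤ (1 + R)⁻¹ * (C * (1 + (relEntropy h τ r m (ρinf τ) 0).toReal)) := by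
  obtain ⟨C, hC, hdec⟩ := hdec T
  refine ⟨C, hC, fun τ hτ r m hsl => ?_⟩
  obtain ⟨hsup, hfin⟩ := hdec τ hτ
  obtain ⟨hwi, hw⟩ := integrable_weighted_multiplierSize hh hi hb hτ.1 hC hfin
  have hent : ∀ᵐ y, 0 ≤ entropyValue h τ (r y) (m y) (ρinf τ y) 0 := by
    filter_upwards [hsl.isState] with y hy using hy.entropyValue_nonneg hp hh τ 0
      (hi.nonneg τ hτ.1 y) (hi.differentiableWithinAt τ hτ.1 y)
  have hD : Integrable fun y => (1 + ‖y‖) * multiplierSize h ρinf ρb nb τ y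
      + C * entropyValue h τ (r y) (m y) (ρinf τ y) 0 := hwi.add (hsl.integrable.const_mul C)
  have hmS : AEStronglyMeasurable (shiftBound h ρinf ρb nb r m τ) volume :=
    (continuous_slice (multiplierSize_continuousOn hh hi hb) hτ.1).aestronglyMeasurable.mul
      (aestronglyMeasurable_const.add hsl.integrable.aestronglyMeasurable)
  have hle : ∀ᵐ y, ∀ R : ℝ, 0 ≤ R → R ≤ ‖y‖ → shiftBound h ρinf ρb nb r m τ y ≤
      (1 + R)⁻¹ * ((1 + ‖y‖) * multiplierSize h ρinf ρb nb τ y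
      + C * entropyValue h τ (r y) (m y) (ρinf τ y) 0) := by
    filter_upwards [hent] with y hy R hR hyR
    have h0 := multiplierSize_nonneg (h := h) (ρinf := ρinf) (ρb := ρb) (nb := nb) τ y
    have h1 : (1 + R) * multiplierSize h ρinf ρb nb τ y ≤
      (1 + ‖y‖) * multiplierSize h ρinf ρb nb τ y := by gcongr
    rw [← div_eq_inv_mul, le_div_iff₀ (by linarith), shiftBound]
    nlinarith [mul_le_mul_of_nonneg_right (h1.trans (hsup y)) hy]
  have hnn : ∀ᵐ y, 0 ≤ shiftBound h ρinf ρb nb r m τ y := by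
    filter_upwards [hent] with y hy
    exact mul_nonneg (multiplierSize_nonneg τ y) (by linarith)
  have hSi : Integrable (shiftBound h ρinf ρb nb r m τ) := by
    refine Integrable.mono' hD hmS ?_
    filter_upwards [hle, hnn] with y hy h0
    rw [Real.norm_eq_abs, abs_of_nonneg h0]
    -- Radius 0 turns the tail estimate into global domination.
    simpa using hy 0 le_rfl (norm_nonneg y)
  refine ⟨hSi, fun R hR => ?_⟩
  calc ∫ y in (Metric.closedBall 0 R)ᶜ, shiftBound h ρinf ρb nb r m τ y
      ≤ ∫ y in (Metric.closedBall 0 R)ᶜ, (1 + R)⁻¹ *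
        ((1 + ‖y‖) * multiplierSize h ρinf ρb nb τ y
          + C * entropyValue h τ (r y) (m y) (ρinf τ y) 0) := by
        refine integral_mono_ae hSi.integrableOn (hD.const_mul _).integrableOn ?_
        filter_upwards [ae_restrict_of_ae hle,
          ae_restrict_mem measurableSet_closedBall.compl] with y hy hyR
        refine hy R hR ?_
        simp only [mem_compl_iff, mem_closedBall_zero_iff, not_le] at hyR
        exact hyR.le
    _ ≤ ∫ y, (1 + R)⁻¹ * ((1 + ‖y‖) * multiplierSize h ρinf ρb nb τ y
          + C * entropyValue h τ (r y) (m y) (ρinf τ y) 0) := by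
        refine setIntegral_le_integral (hD.const_mul _) ?_
        filter_upwards [hent] with y hy
        have := multiplierSize_nonneg (h := h) (ρinf := ρinf) (ρb := ρb) (nb := nb) τ y
        simp only [Pi.zero_apply]
        positivity
    _ ≤ _ := by
        rw [integral_const_mul, integral_add hwi (hsl.integrable.const_mul C), integral_const_mul,
          hsl.integral_eq]
        gcongr
        linarith

/-- The affine change of entropy is dominated by a multiple of `shiftBound`, hence integrable. The
relative entropy with respect to (ρ̄, n̄) is therefore finite and the pointwise identity
`IsState.entropyValue_sub` may be integrated. -/
lemma IsFiniteSlice.shift (hp : IsPressureLaw p) (hh : IsPressurePotential p h)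
    (hρhat : IsAngularLimit ρhat ∨ ∀ y, ρhat y = 0)
    (hsol : IsEnergyVariationalSolution α p h ρhat ρ₀ n₀ K ρinf ρ n E)
    (hb : IsReferencePair h ρb nb) (hdec : HasMultiplierDecay h ρinf ρb nb) {τ : ℝ} (hτ : 0 ≤ τ)
    {r : Space d → ℝ} {m : Space d → Space d} (hsl : IsFiniteSlice h τ (ρinf τ) r m) :
    Integrable (entropyShift h ρinf ρb nb r m τ) ∧ relEntropy h τ r m (ρb τ) (nb τ) ≠ ⊤ ∧
      (relEntropy h τ r m (ρb τ) (nb τ)).toReal = (relEntropy h τ r m (ρinf τ) 0).toReal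
        + ∫ y, entropyShift h ρinf ρb nb r m τ y := by
  have hi := hsol.isReferencePair hh
  obtain ⟨C, -, hC⟩ := exists_shiftBound_tail hp hh hi hb hdec τ
  obtain ⟨A, hA, hst⟩ := hsol.exists_state_bounds hp hh hρhat τ
  have hτ' : τ ∈ Icc 0 τ := ⟨hτ, le_rfl⟩
  have hS := (hC τ hτ' r m hsl).1
  have e1 := (continuous_slice (densityMultiplier_continuousOn hi hb) hτ).aemeasurable (μ := volume)
  have e2 := (continuous_slice (momentumMultiplier_continuousOn hb) hτ).aemeasurable (μ := volume)
  have e3 := (continuous_slice (hb.legendre_continuousOn hh) hτ).aemeasurable (μ := volume)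
  have e4 := (continuous_slice (hi.legendre_continuousOn hh) hτ).aemeasurable (μ := volume)
  have hqi : Integrable (entropyShift h ρinf ρb nb r m τ) := by
    refine Integrable.mono' (hS.const_mul A) (((e1.mul hsl.aemeasurable_density).add
      (e2.inner hsl.aemeasurable_momentum)).add (e3.sub e4)).aestronglyMeasurable ?_
    filter_upwards [hsl.isState] with y hy
    obtain ⟨h1, h2, -, -, h3⟩ := hst τ hτ' y _ _ hy
    have h4 : 1 ≤ A * (1 + entropyValue h τ (r y) (m y) (ρinf τ y) 0) := by nlinarith
    have := abs_entropyShift_le (h := h) (ρinf := ρinf) (ρb := ρb) (nb := nb) (τ := τ) h4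
      (by rwa [abs_of_nonneg hy.nonneg]) h2
    rw [Real.norm_eq_abs, shiftBound]
    linarith
  have hcong : (fun y => entropyValue h τ (r y) (m y) (ρinf τ y) 0
      + entropyShift h ρinf ρb nb r m τ y)
      =ᵐ[volume] fun y => entropyValue h τ (r y) (m y) (ρb τ y) (nb τ y) := by
    filter_upwards [hsl.isState] with y hy
    exact (hy.entropyValue_sub τ _ _ _).symm
  have hne := relEntropy_ne_top_of_integrable hsl.isState ((hsl.integrable.add hqi).congr hcong)
  obtain ⟨-, -, h3⟩ := fixed_time_entropy hp hh hsl.aemeasurable_density hsl.aemeasurable_momentum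
    (continuous_slice hb.density_continuousOn hτ).aemeasurable
    (continuous_slice (hb.potential_continuousOn hh) hτ).aemeasurable
    (continuous_slice hb.enthalpy_continuousOn hτ).aemeasurable
    (continuous_slice hb.velocity_continuousOn hτ).aemeasurable
    (ae_of_all _ (hb.nonneg τ hτ)) (ae_of_all _ (hb.differentiableWithinAt τ hτ)) hne
  refine ⟨hqi, hne, ?_⟩
  rw [← h3, ← integral_congr_ae hcong, integral_add hsl.integrable hqi, hsl.integral_eq]

/-- Integrability in space-time of the kinetic energy and of the terms that are controlled by the
multipliers. -/
lemma IsEnergyVariationalSolution.integrableOn_weighted_shiftBound (hp : IsPressureLaw p)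
    (hh : IsPressurePotential p h)
    (hsol : IsEnergyVariationalSolution α p h ρhat ρ₀ n₀ K ρinf ρ n E)
    (hb : IsReferencePair h ρb nb) (hdec : HasMultiplierDecay h ρinf ρb nb) (T : ℝ) :
    IntegrableOn (fun z : ℝ × Space d =>
      (1 + ‖z.2‖) * shiftBound h ρinf ρb nb (ρ z.1) (n z.1) z.1 z.2) (Ioo 0 T ×ˢ univ) := by
  have hi := hsol.isReferencePair hh
  obtain ⟨hst, hent⟩ := hsol.ae_isState_and_integrableOn hp hh T
  obtain ⟨C, hC, hdec⟩ := hdec T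
  have hsub : Ioo 0 T ⊆ Ici (0:ℝ) := fun x hx => mem_Ici.2 hx.1.le
  have hcont : ContinuousOn (fun z : ℝ × Space d => (1 + ‖z.2‖) * multiplierSize h ρinf ρb nb z.1 z.2)
      (Ici 0 ×ˢ univ) :=
    (by fun_prop : Continuous fun z : ℝ × Space d => 1 + ‖z.2‖).continuousOn.mul
      (multiplierSize_continuousOn hh hi hb)
  have hm := aestronglyMeasurable_slab hcont hsub measurableSet_Ioo
  have h0 : ∀ z : ℝ × Space d, 0 ≤ (1 + ‖z.2‖) * multiplierSize h ρinf ρb nb z.1 z.2 := fun z =>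
    mul_nonneg (by positivity) (multiplierSize_nonneg z.1 z.2)
  have hwi : IntegrableOn (fun z : ℝ × Space d => (1 + ‖z.2‖) * multiplierSize h ρinf ρb nb z.1 z.2)
      (Ioo 0 T ×ˢ univ) := by
    refine ⟨hm, ?_⟩
    rw [hasFiniteIntegral_iff_ofReal (ae_of_all _ h0)]
    rw [restrict_slab] at hm ⊢
    rw [lintegral_prod _ hm.aemeasurable.ennreal_ofReal]
    calc _ ≤ ∫⁻ _ in Ioo 0 T, ENNReal.ofReal C := by
          refine lintegral_mono_ae ?_
          filter_upwards [ae_restrict_mem measurableSet_Ioo] with τ hτ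
          exact (hdec τ ⟨hτ.1.le, hτ.2.le⟩).2
      _ < ⊤ := by
          rw [lintegral_const]
          exact ENNReal.mul_lt_top ENNReal.ofReal_lt_top (by simp)
  refine Integrable.mono' (hwi.add (hent.const_mul C)) ((by fun_prop : Continuous fun z : ℝ × Space d =>
    1 + ‖z.2‖).aestronglyMeasurable.mul ((aestronglyMeasurable_slab (multiplierSize_continuousOn hh hi hb)
      hsub measurableSet_Ioo).mul (aestronglyMeasurable_const.add hent.aestronglyMeasurable))) ?_
  filter_upwards [hst, ae_restrict_mem (measurableSet_Ioo.prod MeasurableSet.univ)] with z h1 h2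
  have he := h1.entropyValue_nonneg hp hh z.1 0 (hi.nonneg z.1 h2.1.1.le z.2)
    (hi.differentiableWithinAt z.1 h2.1.1.le z.2)
  have hs := multiplierSize_nonneg (h := h) (ρinf := ρinf) (ρb := ρb) (nb := nb) z.1 z.2
  have hle := (hdec z.1 ⟨h2.1.1.le, h2.1.2.le⟩).1 z.2
  rw [Real.norm_eq_abs, shiftBound, ← mul_assoc,
    abs_of_nonneg (mul_nonneg (h0 z) (by linarith))]
  simp only [Pi.add_apply]
  nlinarith [mul_le_mul_of_nonneg_right hle he]

lemma IsEnergyVariationalSolution.integrableOn_shiftBound (hp : IsPressureLaw p)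
    (hh : IsPressurePotential p h)
    (hsol : IsEnergyVariationalSolution α p h ρhat ρ₀ n₀ K ρinf ρ n E)
    (hb : IsReferencePair h ρb nb) (hdec : HasMultiplierDecay h ρinf ρb nb) (T : ℝ) :
    IntegrableOn (fun z : ℝ × Space d => shiftBound h ρinf ρb nb (ρ z.1) (n z.1) z.1 z.2)
      (Ioo 0 T ×ˢ univ) := by
  have hi := hsol.isReferencePair hh
  obtain ⟨-, hent⟩ := hsol.ae_isState_and_integrableOn hp hh T
  have hsub : Ioo 0 T ⊆ Ici (0:ℝ) := fun x hx => mem_Ici.2 hx.1.le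
  refine Integrable.mono (hsol.integrableOn_weighted_shiftBound hp hh hb hdec T)
    ((aestronglyMeasurable_slab (multiplierSize_continuousOn hh hi hb)
      hsub measurableSet_Ioo).mul (aestronglyMeasurable_const.add hent.aestronglyMeasurable))
    (ae_of_all _ fun z => ?_)
  rw [norm_mul]
  refine le_mul_of_one_le_left (norm_nonneg _) ?_
  rw [Real.norm_eq_abs, abs_of_nonneg (by positivity)]
  linarith [norm_nonneg z.2]

/-- The definition of a solution gives only local integrability; the entropy bounds the kinetic
energy globally in space. -/
lemma IsEnergyVariationalSolution.integrableOn_kinetic (hp : IsPressureLaw p)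
    (hh : IsPressurePotential p h) (hρhat : IsAngularLimit ρhat ∨ ∀ y, ρhat y = 0)
    (hsol : IsEnergyVariationalSolution α p h ρhat ρ₀ n₀ K ρinf ρ n E) (T : ℝ) :
    IntegrableOn (fun z : ℝ × Space d => ‖n z.1 z.2‖ ^ 2 / ρ z.1 z.2) (Ioo 0 T ×ˢ univ) := by
  obtain ⟨hst, hent⟩ := hsol.ae_isState_and_integrableOn hp hh T
  obtain ⟨A, hA, hbd⟩ := hsol.exists_state_bounds hp hh hρhat T
  refine Integrable.mono' (hent.const_mul A) (hsol.kinetic_locallyIntegrable.aestronglyMeasurable.mono_measure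
    (Measure.restrict_mono (prod_mono (fun x (hx : x ∈ Ioo 0 T) => mem_Ici.2 hx.1.le) Subset.rfl)
      le_rfl)) ?_
  filter_upwards [hst, ae_restrict_mem (measurableSet_Ioo.prod MeasurableSet.univ)] with z h1 h2
  have := hbd z.1 ⟨h2.1.1.le, h2.1.2.le⟩ z.2 _ _ h1
  rw [Real.norm_eq_abs, abs_of_nonneg (div_nonneg (by positivity) h1.nonneg)]
  exact this.2.2.1

lemma norm_velocity_le_multiplierSize {τ T : ℝ} (hτ : τ ≤ T) (y : Space d) :
    ‖velocity (ρb τ y) (nb τ y)‖ ≤ Real.exp (d * T) * multiplierSize h ρinf ρb nb τ y := by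
  have h1 : velocity (ρb τ y) (nb τ y)
      = -(Real.exp (d * τ) • momentumMultiplier τ (ρb τ y) (nb τ y)) := by
    rw [momentumMultiplier, smul_neg, neg_neg, smul_smul, ← Real.exp_add]; simp
  rw [h1, norm_neg, norm_smul, Real.norm_eq_abs, abs_of_pos (Real.exp_pos _)]
  gcongr
  unfold multiplierSize
  linarith [abs_nonneg (densityMultiplier h τ (ρinf τ y) (ρb τ y) (nb τ y)),
    abs_nonneg (legendre h (ρb τ y) - legendre h (ρinf τ y))]

lemma IsEnergyVariationalSolution.integrableOn_entropyShift (hp : IsPressureLaw p)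
    (hh : IsPressurePotential p h) (hρhat : IsAngularLimit ρhat ∨ ∀ y, ρhat y = 0)
    (hsol : IsEnergyVariationalSolution α p h ρhat ρ₀ n₀ K ρinf ρ n E)
    (hb : IsReferencePair h ρb nb) (hdec : HasMultiplierDecay h ρinf ρb nb) (T : ℝ) :
    IntegrableOn (fun z : ℝ × Space d => entropyShift h ρinf ρb nb (ρ z.1) (n z.1) z.1 z.2)
      (Ioo 0 T ×ˢ univ) := by
  have hi := hsol.isReferencePair hh
  obtain ⟨hst, -⟩ := hsol.ae_isState_and_integrableOn hp hh T
  obtain ⟨A, hA, hbd⟩ := hsol.exists_state_bounds hp hh hρhat T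
  have hsub : Ioo 0 T ⊆ Ici (0:ℝ) := fun x hx => mem_Ici.2 hx.1.le
  have hS := hsol.integrableOn_shiftBound hp hh hb hdec T
  have e1 := aestronglyMeasurable_slab (densityMultiplier_continuousOn hi hb) hsub measurableSet_Ioo
  have e2 := aestronglyMeasurable_slab (momentumMultiplier_continuousOn hb) hsub measurableSet_Ioo
  have e3 := aestronglyMeasurable_slab (hb.legendre_continuousOn hh) hsub measurableSet_Ioo
  have e4 := aestronglyMeasurable_slab (hi.legendre_continuousOn hh) hsub measurableSet_Ioo
  have e5 := hsol.aestronglyMeasurable_density hsub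
  have e6 := hsol.aestronglyMeasurable_momentum hsub
  refine Integrable.mono' (hS.const_mul A) (((e1.mul e5).add (e2.inner e6)).add (e3.sub e4)) ?_
  filter_upwards [hst, ae_restrict_mem (measurableSet_Ioo.prod MeasurableSet.univ)] with z h1 h2
  obtain ⟨g1, g2, -, -, g3⟩ := hbd z.1 ⟨h2.1.1.le, h2.1.2.le⟩ z.2 _ _ h1
  have g4 : 1 ≤ A * (1 + entropyValue h z.1 (ρ z.1 z.2) (n z.1 z.2) (ρinf z.1 z.2) 0) := by nlinarith
  have := abs_entropyShift_le (h := h) (ρinf := ρinf) (ρb := ρb) (nb := nb) (τ := z.1) g4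
    (by rwa [abs_of_nonneg h1.nonneg]) g2
  rw [Real.norm_eq_abs, shiftBound]
  linarith

/-- By ρ|u - U|² ≤ 2ρ|u|² + 2ρ|U|² it suffices to treat ρ|U|². One factor U is absorbed by the sup
bound, the other by the multiplier size, which leaves `shiftBound`. -/
lemma IsEnergyVariationalSolution.integrableOn_relVelocity (hp : IsPressureLaw p)
    (hh : IsPressurePotential p h) (hρhat : IsAngularLimit ρhat ∨ ∀ y, ρhat y = 0)
    (hsol : IsEnergyVariationalSolution α p h ρhat ρ₀ n₀ K ρinf ρ n E)
    (hb : IsReferencePair h ρb nb) (hdec : HasMultiplierDecay h ρinf ρb nb) (T : ℝ) :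
    IntegrableOn (fun z : ℝ × Space d => ρ z.1 z.2 * ‖relVelocity ρ n ρb nb z.1 z.2‖ ^ 2)
      (Ioo 0 T ×ˢ univ) := by
  have hi := hsol.isReferencePair hh
  obtain ⟨hst, -⟩ := hsol.ae_isState_and_integrableOn hp hh T
  obtain ⟨A, hA, hbd⟩ := hsol.exists_state_bounds hp hh hρhat T
  have hsub : Ioo 0 T ⊆ Ici (0:ℝ) := fun x hx => mem_Ici.2 hx.1.le
  have hS := hsol.integrableOn_shiftBound hp hh hb hdec T
  have hk := hsol.integrableOn_kinetic hp hh hρhat T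
  have e2 := aestronglyMeasurable_slab hb.velocity_continuousOn hsub measurableSet_Ioo
  have e5 := hsol.aestronglyMeasurable_density hsub
  have e6 := hsol.aestronglyMeasurable_momentum hsub
  have e7 : AEStronglyMeasurable (fun z : ℝ × Space d => velocity (ρ z.1 z.2) (n z.1 z.2))
      (volume.restrict (Ioo 0 T ×ˢ univ)) :=
    (e5.aemeasurable.inv.smul e6.aemeasurable).aestronglyMeasurable
  obtain ⟨C, hC, hdec⟩ := hdec T
  set L := Real.exp (d * T)
  have hL : 0 < L := Real.exp_pos _
  refine Integrable.mono' ((hk.const_mul 2).add (hS.const_mul (2 * A * L * (L * C))))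
    (e5.mul ((e7.sub e2).norm.pow 2)) ?_
  filter_upwards [hst, ae_restrict_mem (measurableSet_Ioo.prod MeasurableSet.univ)] with z h1 h2
  have hz : z.1 ∈ Icc 0 T := ⟨h2.1.1.le, h2.1.2.le⟩
  obtain ⟨g1, g2, -, -, g3⟩ := hbd z.1 hz z.2 _ _ h1
  have hU := norm_velocity_le_multiplierSize (h := h) (ρinf := ρinf) (ρb := ρb) (nb := nb) hz.2 z.2
  have hs := multiplierSize_nonneg (h := h) (ρinf := ρinf) (ρb := ρb) (nb := nb) z.1 z.2
  have hle : multiplierSize h ρinf ρb nb z.1 z.2 ≤ C :=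
    (le_mul_of_one_le_left hs (by linarith [norm_nonneg z.2])).trans ((hdec z.1 hz).1 z.2)
  rw [Real.norm_eq_abs, abs_of_nonneg (mul_nonneg h1.nonneg (by positivity))]
  simp only [Pi.add_apply, shiftBound]
  set U := velocity (ρb z.1 z.2) (nb z.1 z.2)
  set u := velocity (ρ z.1 z.2) (n z.1 z.2) with hu
  set s := multiplierSize h ρinf ρb nb z.1 z.2
  set e := entropyValue h z.1 (ρ z.1 z.2) (n z.1 z.2) (ρinf z.1 z.2) 0
  have hq : ‖relVelocity ρ n ρb nb z.1 z.2‖ ^ 2 ≤ 2 * ‖u‖ ^ 2 + 2 * ‖U‖ ^ 2 := by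
    have := norm_sub_le u U
    have h3 : ‖relVelocity ρ n ρb nb z.1 z.2‖ ≤ ‖u‖ + ‖U‖ := this
    have h4 : ‖relVelocity ρ n ρb nb z.1 z.2‖ ^ 2 ≤ (‖u‖ + ‖U‖) ^ 2 := by gcongr
    nlinarith [sq_nonneg (‖u‖ - ‖U‖)]
  have hU2 : ‖U‖ ^ 2 ≤ (L * s) * (L * C) := by
    rw [sq]
    exact mul_le_mul hU (hU.trans (by gcongr)) (norm_nonneg _) (by positivity)
  calc _ ≤ ρ z.1 z.2 * (2 * ‖u‖ ^ 2 + 2 * ‖U‖ ^ 2) := mul_le_mul_of_nonneg_left hq h1.nonneg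
    _ = 2 * (‖n z.1 z.2‖ ^ 2 / ρ z.1 z.2) + 2 * (ρ z.1 z.2 * ‖U‖ ^ 2) := by
        rw [← mul_norm_velocity_sq]; ring
    _ ≤ 2 * (‖n z.1 z.2‖ ^ 2 / ρ z.1 z.2) + 2 * ((A * (1 + e)) * ((L * s) * (L * C))) := by
        gcongr
    _ = _ := by ring

end Shift

end

section

/-! ### The energy-variational inequality on space-time slabs -/

/-! ### Derivatives of slices and iterated integrals. -/

section Slab

variable {F : Type*} [NormedAddCommGroup F] [NormedSpace ℝ F]

lemma hasDerivAt_time {f : ℝ × Space d → F} {s : ℝ} {y : Space d}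
    (hf : DifferentiableAt ℝ f (s, y)) :
    HasDerivAt (fun s' => f (s', y)) (fderiv ℝ f (s, y) (1, 0)) s :=
  hf.hasFDerivAt.comp_hasDerivAt s ((hasDerivAt_id s).prodMk (hasDerivAt_const s y))

lemma hasFDerivAt_space {f : ℝ × Space d → F} {s : ℝ} {y : Space d}
    (hf : DifferentiableAt ℝ f (s, y)) :
    HasFDerivAt (fun y' => f (s, y'))
      ((fderiv ℝ f (s, y)).comp (ContinuousLinearMap.inr ℝ ℝ (Space d))) y :=
  hf.hasFDerivAt.comp y (hasFDerivAt_prodMk_right s y)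

lemma intervalIntegral_integral_eq {f : ℝ → Space d → ℝ} {σ τ : ℝ} (hστ : σ ≤ τ)
    (hf : IntegrableOn (fun z : ℝ × Space d => f z.1 z.2) (Ioc σ τ ×ˢ univ)) :
    ∫ s in σ..τ, ∫ y, f s y = ∫ z in Ioc σ τ ×ˢ (univ : Set (Space d)), f z.1 z.2 := by
  rw [intervalIntegral.integral_of_le hστ, restrict_slab, integral_prod _ (by
    rw [IntegrableOn, restrict_slab] at hf; exact hf)]

end Slab

section Solution

variable {α : ℝ} {p h : ℝ → ℝ} {ρhat ρ₀ : Space d → ℝ} {n₀ : Space d → Space d}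
  {K : (Space d → Space d) → ℝ} {ρinf ρ : ℝ → Space d → ℝ} {n : ℝ → Space d → Space d} {E : ℝ → ℝ}

/-- The integrand of the weak form of the mass balance. -/
def massBracket (φ : ℝ → Space d → ℝ) (ρ : ℝ → Space d → ℝ) (n : ℝ → Space d → Space d)
    (s : ℝ) (y : Space d) : ℝ :=
  deriv (fun s' => φ s' y) s * ρ s y - fderiv ℝ (φ s) y ((ρ s y / 2) • y - n s y)
    - (d : ℝ) / 2 * φ s y * ρ s y

/-- The integrand of the weak form of the momentum balance. -/
def momentumBracket (α : ℝ) (p : ℝ → ℝ) (ψ : ℝ → Space d → Space d) (ρ : ℝ → Space d → ℝ)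
    (n : ℝ → Space d → Space d) (s : ℝ) (y : Space d) : ℝ :=
  inner ℝ (deriv (fun s' => ψ s' y) s) (n s y)
    + (-(inner ℝ (n s y) (fderiv ℝ (ψ s) y ((1 / 2 : ℝ) • y)))
      + (ρ s y)⁻¹ * inner ℝ (n s y) (fderiv ℝ (ψ s) y (n s y))
      + Real.exp (d * s) * p (ρ s y) * divergence (ψ s) y)
    - Real.exp (d * s) * α * inner ℝ (ψ s y) (n s y)

/-- The size of a state, including its kinetic energy and pressure. -/
def stateSize (p : ℝ → ℝ) (ρ : ℝ → Space d → ℝ) (n : ℝ → Space d → Space d) (z : ℝ × Space d) :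
    ℝ :=
  1 + ‖ρ z.1 z.2‖ + ‖n z.1 z.2‖ + ‖‖n z.1 z.2‖ ^ 2 / ρ z.1 z.2‖ + ‖p (ρ z.1 z.2)‖

lemma IsEnergyVariationalSolution.locallyIntegrableOn_stateSize
    (hsol : IsEnergyVariationalSolution α p h ρhat ρ₀ n₀ K ρinf ρ n E) :
    LocallyIntegrableOn (stateSize p ρ n) (Ici 0 ×ˢ univ) := by
  have h1 : LocallyIntegrableOn (fun _ : ℝ × Space d => (1:ℝ)) (Ici 0 ×ˢ univ) :=
    (locallyIntegrable_const 1).locallyIntegrableOn _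
  exact (((h1.add hsol.density.norm).add hsol.momentum.norm).add
    hsol.kinetic_locallyIntegrable.norm).add hsol.pressure_locallyIntegrable.norm

lemma integrableOn_of_le_on_compact {f g : ℝ × Space d → ℝ} {T C : ℝ} {k : Set (ℝ × Space d)}
    (hk : IsCompact k) (hg : LocallyIntegrableOn g (Ici 0 ×ˢ univ))
    (hf : AEStronglyMeasurable f (volume.restrict (Ioo 0 T ×ˢ univ)))
    (hle : ∀ z ∈ k, z.1 ∈ Ioo 0 T → ‖f z‖ ≤ C * ‖g z‖)
    (h0 : ∀ z ∉ k, z.1 ∈ Ioo 0 T → f z = 0) : IntegrableOn f (Ioo 0 T ×ˢ univ) := by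
  have hm : MeasurableSet (Ioo 0 T ×ˢ (univ : Set (Space d))) :=
    measurableSet_Ioo.prod MeasurableSet.univ
  have h1 : IntegrableOn g (k ∩ (Ici 0 ×ˢ univ)) :=
    hg.integrableOn_compact_subset inter_subset_right
      (hk.inter_right (isClosed_Ici.prod isClosed_univ))
  have hsub : k ∩ (Ioo 0 T ×ˢ univ) ⊆ k ∩ (Ici 0 ×ˢ univ) :=
    inter_subset_inter_right _ (prod_mono (fun x hx => mem_Ici.2 hx.1.le) Subset.rfl)
  have h2 : IntegrableOn f (k ∩ (Ioo 0 T ×ˢ univ)) := by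
    refine Integrable.mono' ((h1.mono_set hsub).norm.const_mul C)
      (hf.mono_measure (Measure.restrict_mono inter_subset_right le_rfl)) ?_
    filter_upwards [ae_restrict_mem (hk.measurableSet.inter hm)] with z hz
    exact hle z hz.1 hz.2.1
  exact h2.of_forall_sdiff_eq_zero hm fun z hz => h0 z (fun hc => hz.2 ⟨hc, hz.1⟩) hz.1.1

lemma aestronglyMeasurable_apply {X F G : Type*} [MeasurableSpace X] [NormedAddCommGroup F]
    [NormedSpace ℝ F] [NormedAddCommGroup G] [NormedSpace ℝ G] {μ : Measure X} {A : X → F →L[ℝ] G} {v : X → F}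
    (hA : AEStronglyMeasurable A μ) (hv : AEStronglyMeasurable v μ) :
    AEStronglyMeasurable (fun x => A x (v x)) μ :=
  isBoundedBilinearMap_apply.continuous.comp_aestronglyMeasurable (hA.prodMk hv)

lemma abs_divergence_le (v : Space d → Space d) (y : Space d) :
    |divergence v y| ≤ d * ‖fderiv ℝ v y‖ := by
  unfold divergence
  refine (Finset.abs_sum_le_sum_abs _ _).trans ?_
  calc _ ≤ ∑ _j : Fin d, ‖fderiv ℝ v y‖ := by
        refine Finset.sum_le_sum fun j _ => ?_
        refine (PiLp.norm_apply_le (fderiv ℝ v y (EuclideanSpace.single j 1)) j).trans ?_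
        simpa using (fderiv ℝ v y).le_opNorm (EuclideanSpace.single j 1)
    _ = _ := by simp

/-- The divergence as a linear functional of the derivative. -/
def divergenceForm (d : ℕ) : (Space d →L[ℝ] Space d) →L[ℝ] ℝ :=
  ∑ j, (EuclideanSpace.proj j : Space d →L[ℝ] ℝ).comp
    (ContinuousLinearMap.apply ℝ (Space d) (EuclideanSpace.single j 1))

lemma divergence_eq (v : Space d → Space d) (y : Space d) :
    divergence v y = divergenceForm d (fderiv ℝ v y) := by
  simp [divergence, divergenceForm]

/-- The coefficients are bounded with compact support, so the locally integrable `stateSize`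
dominates. This allows the separate iterated integrals of the inequality to be merged into one. -/
lemma IsSpaceTimeTest.integrableOn_massBracket
    (hsol : IsEnergyVariationalSolution α p h ρhat ρ₀ n₀ K ρinf ρ n E)
    {φ : ℝ → Space d → ℝ} (hφ : IsSpaceTimeTest φ) (T : ℝ) :
    IntegrableOn (fun z : ℝ × Space d => massBracket φ ρ n z.1 z.2) (Ioo 0 T ×ˢ univ) := by
  set F : ℝ × Space d → ℝ := Function.uncurry φ with hF
  have hd : ∀ z, DifferentiableAt ℝ F z := hφ.1.differentiable (by norm_num)
  -- Partial derivatives are rewritten through the joint derivative of φ, whose continuity and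
  -- compact support give measurability and bounds at once.
  have heq : (fun z : ℝ × Space d => massBracket φ ρ n z.1 z.2) = fun z => fderiv ℝ F z (1, 0) * ρ z.1 z.2
      - fderiv ℝ F z (0, (ρ z.1 z.2 / 2) • z.2 - n z.1 z.2) - (d : ℝ) / 2 * F z * ρ z.1 z.2 := by
    ext ⟨s, y⟩
    have h1 := (hasDerivAt_time (hd (s, y))).deriv
    have h2 := (hasFDerivAt_space (hd (s, y))).fderiv
    simp only [hF, Function.uncurry] at h1 h2
    simp only [massBracket, h1]
    rw [show φ s = fun y' => φ s y' from rfl, h2]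
    simp [hF]
  have hsub : Ioo 0 T ⊆ Ici (0:ℝ) := fun x hx => mem_Ici.2 hx.1.le
  have hmρ := hsol.aestronglyMeasurable_density hsub
  have hmn := hsol.aestronglyMeasurable_momentum hsub
  have hcF' := hφ.1.continuous_fderiv (by norm_num)
  have hm : AEStronglyMeasurable (fun z : ℝ × Space d => massBracket φ ρ n z.1 z.2)
      (volume.restrict (Ioo 0 T ×ˢ univ)) := by
    rw [heq]
    have e1 : AEStronglyMeasurable (fderiv ℝ F) (volume.restrict (Ioo 0 T ×ˢ univ)) :=
      hcF'.aestronglyMeasurable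
    have e2 : AEStronglyMeasurable (fun z : ℝ × Space d => ((0:ℝ), (ρ z.1 z.2 / 2) • z.2 - n z.1 z.2))
        (volume.restrict (Ioo 0 T ×ˢ univ)) :=
      aestronglyMeasurable_const.prodMk ((((hmρ.aemeasurable.div_const 2).aestronglyMeasurable).smul
        continuous_snd.aestronglyMeasurable).sub hmn)
    exact (((aestronglyMeasurable_apply e1 aestronglyMeasurable_const).mul hmρ).sub
      (aestronglyMeasurable_apply e1 e2)).sub
      ((hφ.1.continuous.aestronglyMeasurable.const_mul _).mul hmρ)
  obtain ⟨L, hL⟩ := hφ.2.exists_bound_of_continuous hφ.1.continuous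
  obtain ⟨L', hL'⟩ := (hφ.2.fderiv (𝕜 := ℝ)).exists_bound_of_continuous hcF'
  obtain ⟨R, hR⟩ := hφ.2.isBounded.subset_closedBall (0 : ℝ × Space d)
  have hL0 : 0 ≤ L := (norm_nonneg _).trans (hL 0)
  have hL0' : 0 ≤ L' := (norm_nonneg _).trans (hL' 0)
  refine integrableOn_of_le_on_compact (C := L' + L' * (|R| + 1) + d * L) hφ.2
    hsol.locallyIntegrableOn_stateSize hm ?_ ?_
  · intro z hz _
    have hzR : ‖z.2‖ ≤ |R| := by
      have := hR hz
      rw [mem_closedBall_zero_iff] at this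
      exact (norm_snd_le z).trans (this.trans (le_abs_self R))
    rw [congrFun heq z]
    have hS : 1 + ‖ρ z.1 z.2‖ + ‖n z.1 z.2‖ + ‖‖n z.1 z.2‖ ^ 2 / ρ z.1 z.2‖ + ‖p (ρ z.1 z.2)‖
        ≤ ‖stateSize p ρ n z‖ := le_abs_self _
    set S := ‖stateSize p ρ n z‖
    have hρS : ‖ρ z.1 z.2‖ ≤ S := by
      linarith [norm_nonneg (n z.1 z.2), norm_nonneg (‖n z.1 z.2‖ ^ 2 / ρ z.1 z.2), norm_nonneg (p (ρ z.1 z.2))]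
    have hnS : ‖n z.1 z.2‖ ≤ S := by
      linarith [norm_nonneg (ρ z.1 z.2), norm_nonneg (‖n z.1 z.2‖ ^ 2 / ρ z.1 z.2), norm_nonneg (p (ρ z.1 z.2))]
    have hS0 : 0 ≤ S := norm_nonneg _
    have b1 : ‖fderiv ℝ F z (1, 0)‖ ≤ L' := by
      refine ((fderiv ℝ F z).le_opNorm _).trans ?_
      rw [Prod.norm_mk]; simpa using hL' z
    have b2 : ‖fderiv ℝ F z (0, (ρ z.1 z.2 / 2) • z.2 - n z.1 z.2)‖ ≤ L' * ((|R| + 1) * S) := by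
      refine ((fderiv ℝ F z).le_opNorm _).trans (mul_le_mul (hL' z) ?_ (norm_nonneg _) hL0')
      rw [Prod.norm_mk, norm_zero, max_eq_right (norm_nonneg _)]
      refine (norm_sub_le _ _).trans ?_
      rw [norm_smul, norm_div, Real.norm_ofNat]
      have : ‖ρ z.1 z.2‖ / 2 * ‖z.2‖ ≤ S * |R| :=
        mul_le_mul (by linarith [norm_nonneg (ρ z.1 z.2)]) hzR (norm_nonneg _) hS0
      linarith
    have b3 : ‖(d : ℝ) / 2 * F z * ρ z.1 z.2‖ ≤ d * L * S := by
      rw [norm_mul, norm_mul]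
      have : ‖(d : ℝ) / 2‖ ≤ d := by
        rw [Real.norm_eq_abs, abs_of_nonneg (by positivity)]
        linarith [Nat.cast_nonneg (α := ℝ) d]
      exact mul_le_mul (mul_le_mul this (hL z) (norm_nonneg _) (Nat.cast_nonneg _)) hρS
        (norm_nonneg _) (by positivity)
    calc _ ≤ ‖fderiv ℝ F z (1, 0) * ρ z.1 z.2‖ + ‖fderiv ℝ F z (0, (ρ z.1 z.2 / 2) • z.2 - n z.1 z.2)‖
          + ‖(d : ℝ) / 2 * F z * ρ z.1 z.2‖ :=
          (norm_sub_le _ _).trans (add_le_add_left (norm_sub_le _ _) _)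
      _ ≤ L' * S + L' * ((|R| + 1) * S) + d * L * S := by
          gcongr
          rw [norm_mul]
          exact mul_le_mul b1 hρS (norm_nonneg _) hL0'
      _ = _ := by ring
  · intro z hz _
    have e1 : F z = 0 := image_eq_zero_of_notMem_tsupport hz
    have e2 : fderiv ℝ F z = 0 :=
      image_eq_zero_of_notMem_tsupport fun hc => hz (tsupport_fderiv_subset ℝ hc)
    rw [congrFun heq z, e1, e2]
    simp

lemma IsSpaceTimeTest.integrableOn_momentumBracket
    (hsol : IsEnergyVariationalSolution α p h ρhat ρ₀ n₀ K ρinf ρ n E)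
    {ψ : ℝ → Space d → Space d} (hψ : IsSpaceTimeTest ψ) (T : ℝ) :
    IntegrableOn (fun z : ℝ × Space d => momentumBracket α p ψ ρ n z.1 z.2) (Ioo 0 T ×ˢ univ) := by
  set F : ℝ × Space d → Space d := Function.uncurry ψ with hF
  have hd : ∀ z, DifferentiableAt ℝ F z := hψ.1.differentiable (by norm_num)
  -- The trace of the spatial part of the joint derivative, so that the divergence is a continuous
  -- linear image of it.
  set J : (ℝ × Space d →L[ℝ] Space d) →L[ℝ] ℝ := (divergenceForm d).comp
    ((ContinuousLinearMap.compL ℝ (Space d) (ℝ × Space d) (Space d)).flip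
      (ContinuousLinearMap.inr ℝ ℝ (Space d)))
  have heq : (fun z : ℝ × Space d => momentumBracket α p ψ ρ n z.1 z.2) = fun z =>
      inner ℝ (fderiv ℝ F z (1, 0)) (n z.1 z.2)
      + (-(inner ℝ (n z.1 z.2) (fderiv ℝ F z (0, (1 / 2 : ℝ) • z.2)))
        + (ρ z.1 z.2)⁻¹ * inner ℝ (n z.1 z.2) (fderiv ℝ F z (0, n z.1 z.2))
        + Real.exp (d * z.1) * p (ρ z.1 z.2) * J (fderiv ℝ F z))
      - Real.exp (d * z.1) * α * inner ℝ (F z) (n z.1 z.2) := by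
    ext ⟨s, y⟩
    have h1 := (hasDerivAt_time (hd (s, y))).deriv
    have h2 := (hasFDerivAt_space (hd (s, y))).fderiv
    simp only [hF, Function.uncurry] at h1 h2
    simp only [momentumBracket, h1, divergence_eq]
    rw [show ψ s = fun y' => ψ s y' from rfl, h2]
    simp [hF, J, ← map_smul]
  have hsub : Ioo 0 T ⊆ Ici (0:ℝ) := fun x hx => mem_Ici.2 hx.1.le
  have hmρ := hsol.aestronglyMeasurable_density hsub
  have hmn := hsol.aestronglyMeasurable_momentum hsub
  have hmp : AEStronglyMeasurable (fun z : ℝ × Space d => p (ρ z.1 z.2)) (volume.restrict (Ioo 0 T ×ˢ univ)) :=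
    hsol.pressure_locallyIntegrable.aestronglyMeasurable.mono_measure
      (Measure.restrict_mono (prod_mono hsub Subset.rfl) le_rfl)
  have hcF' := hψ.1.continuous_fderiv (by norm_num)
  have hce : Continuous fun z : ℝ × Space d => Real.exp (d * z.1) := by fun_prop
  have hm : AEStronglyMeasurable (fun z : ℝ × Space d => momentumBracket α p ψ ρ n z.1 z.2)
      (volume.restrict (Ioo 0 T ×ˢ univ)) := by
    rw [heq]
    have e1 : AEStronglyMeasurable (fderiv ℝ F) (volume.restrict (Ioo 0 T ×ˢ univ)) :=
      hcF'.aestronglyMeasurable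
    have e2 : AEStronglyMeasurable (fun z : ℝ × Space d => ((0:ℝ), n z.1 z.2))
        (volume.restrict (Ioo 0 T ×ˢ univ)) := aestronglyMeasurable_const.prodMk hmn
    have e3 : AEStronglyMeasurable (fun z : ℝ × Space d => ((0:ℝ), (1 / 2 : ℝ) • z.2))
        (volume.restrict (Ioo 0 T ×ˢ univ)) :=
      (by fun_prop : Continuous fun z : ℝ × Space d =>
        ((0:ℝ), (1 / 2 : ℝ) • z.2)).aestronglyMeasurable
    have e4 : AEStronglyMeasurable (fun z : ℝ × Space d => (ρ z.1 z.2)⁻¹)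
        (volume.restrict (Ioo 0 T ×ˢ univ)) := hmρ.aemeasurable.inv.aestronglyMeasurable
    have f1 := (aestronglyMeasurable_apply e1
      (aestronglyMeasurable_const (b := ((1:ℝ), (0 : Space d))))).inner (𝕜 := ℝ) hmn
    have f2 := hmn.inner (𝕜 := ℝ) (aestronglyMeasurable_apply e1 e3)
    have f3 := e4.mul (hmn.inner (𝕜 := ℝ) (aestronglyMeasurable_apply e1 e2))
    have f4 := (hce.aestronglyMeasurable.mul hmp).mul (J.continuous.comp_aestronglyMeasurable e1)
    have f5 := (hce.aestronglyMeasurable.mul_const α).mul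
      ((hψ.1.continuous.aestronglyMeasurable).inner (𝕜 := ℝ) hmn)
    exact (f1.add ((f2.neg.add f3).add f4)).sub f5
  obtain ⟨L, hL⟩ := hψ.2.exists_bound_of_continuous hψ.1.continuous
  obtain ⟨L', hL'⟩ := (hψ.2.fderiv (𝕜 := ℝ)).exists_bound_of_continuous hcF'
  obtain ⟨R, hR⟩ := hψ.2.isBounded.subset_closedBall (0 : ℝ × Space d)
  have hL0 : 0 ≤ L := (norm_nonneg _).trans (hL 0)
  have hL0' : 0 ≤ L' := (norm_nonneg _).trans (hL' 0)
  set X := Real.exp (d * T)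
  refine integrableOn_of_le_on_compact (C := L' + L' * |R| + L' + X * (‖J‖ * L') + X * |α| * L) hψ.2
    hsol.locallyIntegrableOn_stateSize hm ?_ ?_
  · intro z hz hzT
    have hzR : ‖z.2‖ ≤ |R| := by
      have := hR hz
      rw [mem_closedBall_zero_iff] at this
      exact (norm_snd_le z).trans (this.trans (le_abs_self R))
    rw [congrFun heq z]
    have hS : 1 + ‖ρ z.1 z.2‖ + ‖n z.1 z.2‖ + ‖‖n z.1 z.2‖ ^ 2 / ρ z.1 z.2‖ + ‖p (ρ z.1 z.2)‖
        ≤ ‖stateSize p ρ n z‖ := le_abs_self _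
    set S := ‖stateSize p ρ n z‖
    have a1 := norm_nonneg (n z.1 z.2)
    have a2 := norm_nonneg (‖n z.1 z.2‖ ^ 2 / ρ z.1 z.2)
    have a3 := norm_nonneg (p (ρ z.1 z.2))
    have a4 := norm_nonneg (ρ z.1 z.2)
    have hnS : ‖n z.1 z.2‖ ≤ S := by linarith
    have hkS : ‖‖n z.1 z.2‖ ^ 2 / ρ z.1 z.2‖ ≤ S := by linarith
    have hpS : ‖p (ρ z.1 z.2)‖ ≤ S := by linarith
    have hS0 : 0 ≤ S := norm_nonneg _
    have hX : ‖Real.exp (d * z.1)‖ ≤ X := by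
      rw [Real.norm_eq_abs, abs_of_pos (Real.exp_pos _)]
      exact Real.exp_le_exp.2 (mul_le_mul_of_nonneg_left hzT.2.le (Nat.cast_nonneg _))
    have hX0 : 0 ≤ X := (Real.exp_pos _).le
    have b0 : ∀ v : Space d, ‖fderiv ℝ F z (0, v)‖ ≤ L' * ‖v‖ := fun v => by
      refine ((fderiv ℝ F z).le_opNorm _).trans ?_
      rw [Prod.norm_mk, norm_zero, max_eq_right (norm_nonneg _)]
      gcongr
      exact hL' z
    have b1 : ‖(inner ℝ (fderiv ℝ F z (1, 0)) (n z.1 z.2) : ℝ)‖ ≤ L' * S := by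
      refine (norm_inner_le_norm _ _).trans (mul_le_mul ?_ hnS a1 hL0')
      refine ((fderiv ℝ F z).le_opNorm _).trans ?_
      rw [Prod.norm_mk]; simpa using hL' z
    have b2 : ‖(inner ℝ (n z.1 z.2) (fderiv ℝ F z (0, (1 / 2 : ℝ) • z.2)) : ℝ)‖ ≤ L' * |R| * S := by
      refine (norm_inner_le_norm _ _).trans ?_
      have : ‖(1 / 2 : ℝ) • z.2‖ ≤ |R| := by
        rw [norm_smul]; norm_num; linarith [norm_nonneg z.2]
      rw [mul_comm]
      exact mul_le_mul ((b0 _).trans (by gcongr)) hnS a1 (by positivity)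
    -- The convective term is the one that needs the kinetic energy density rather than ρ or |n|.
    have b3 : ‖(ρ z.1 z.2)⁻¹ * inner ℝ (n z.1 z.2) (fderiv ℝ F z (0, n z.1 z.2))‖ ≤ L' * S := by
      rw [norm_mul]
      calc _ ≤ ‖(ρ z.1 z.2)⁻¹‖ * (‖n z.1 z.2‖ * (L' * ‖n z.1 z.2‖)) := by
            gcongr
            exact (norm_inner_le_norm _ _).trans (by gcongr; exact b0 _)
        _ = L' * ‖‖n z.1 z.2‖ ^ 2 / ρ z.1 z.2‖ := by
            rw [norm_div, norm_pow, norm_norm, norm_inv]; ring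
        _ ≤ _ := by gcongr
    have b4 : ‖Real.exp (d * z.1) * p (ρ z.1 z.2) * J (fderiv ℝ F z)‖ ≤ X * (‖J‖ * L') * S := by
      rw [norm_mul, norm_mul]
      calc _ ≤ X * S * (‖J‖ * L') := by
            gcongr
            exact (J.le_opNorm _).trans (by gcongr; exact hL' z)
        _ = _ := by ring
    have b5 : ‖Real.exp (d * z.1) * α * inner ℝ (F z) (n z.1 z.2)‖ ≤ X * |α| * L * S := by
      rw [norm_mul, norm_mul, Real.norm_eq_abs α, mul_assoc (X * |α|)]
      gcongr
      exact (norm_inner_le_norm _ _).trans (mul_le_mul (hL z) hnS a1 hL0)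
    refine (norm_sub_le _ _).trans ?_
    have := norm_add_le (inner ℝ (fderiv ℝ F z (1, 0)) (n z.1 z.2))
      (-(inner ℝ (n z.1 z.2) (fderiv ℝ F z (0, (1 / 2 : ℝ) • z.2)))
        + (ρ z.1 z.2)⁻¹ * inner ℝ (n z.1 z.2) (fderiv ℝ F z (0, n z.1 z.2))
        + Real.exp (d * z.1) * p (ρ z.1 z.2) * J (fderiv ℝ F z))
    have h3 := norm_add₃_le (a := -(inner ℝ (n z.1 z.2) (fderiv ℝ F z (0, (1 / 2 : ℝ) • z.2))))
      (b := (ρ z.1 z.2)⁻¹ * inner ℝ (n z.1 z.2) (fderiv ℝ F z (0, n z.1 z.2)))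
      (c := Real.exp (d * z.1) * p (ρ z.1 z.2) * J (fderiv ℝ F z))
    rw [norm_neg] at h3
    linarith
  · intro z hz _
    have e1 : F z = 0 := image_eq_zero_of_notMem_tsupport hz
    have e2 : fderiv ℝ F z = 0 :=
      image_eq_zero_of_notMem_tsupport fun hc => hz (tsupport_fderiv_subset ℝ hc)
    rw [congrFun heq z, e1, e2]
    simp

/-- The energy-variational inequality with all integrals over space-time collected. -/
lemma EnvarInequality.slab (hp : IsPressureLaw p)
    (hh : IsPressurePotential p h) (hρhat : IsAngularLimit ρhat ∨ ∀ y, ρhat y = 0)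
    (hsol : IsEnergyVariationalSolution α p h ρhat ρ₀ n₀ K ρinf ρ n E)
    {φ : ℝ → Space d → ℝ} {ψ : ℝ → Space d → Space d} (hφ : IsSpaceTimeTest φ)
    (hψ : IsSpaceTimeTest ψ) {σ τ : ℝ} (hσ : 0 ≤ σ) (hστ : σ ≤ τ) {rσ : Space d → ℝ}
    {mσ : Space d → Space d} (hin : EnvarInequality α p h K ρinf ρ n E φ ψ σ rσ mσ τ) :
    (E τ + ∫ y, (φ τ y * ρ τ y + inner ℝ (ψ τ y) (n τ y)))
      - (E σ + ∫ y, (φ σ y * rσ y + inner ℝ (ψ σ y) (mσ y)))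
    ≤ (∫ z in Ioc σ τ ×ˢ (univ : Set (Space d)),
        (massBracket φ ρ n z.1 z.2 + momentumBracket α p ψ ρ n z.1 z.2
          - α * (‖n z.1 z.2‖ ^ 2 / ρ z.1 z.2) + referenceForcing h ρinf ρ n z.1 z.2))
      + ∫ s in σ..τ, (Real.exp (d * s) * K (ψ s) * energyDefect h ρinf ρ n E s
          - (d : ℝ) / 2 * E s) := by
  have hsub : Ioc σ τ ×ˢ (univ : Set (Space d)) ⊆ Ioo 0 (τ + 1) ×ˢ univ :=
    prod_mono (fun x hx => ⟨hσ.trans_lt hx.1, by linarith [hx.2]⟩) Subset.rfl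
  have i1 := (hφ.integrableOn_massBracket hsol (τ + 1)).mono_set hsub
  have i2 := (hψ.integrableOn_momentumBracket hsol (τ + 1)).mono_set hsub
  have i3 := ((hsol.integrableOn_kinetic hp hh hρhat (τ + 1)).mono_set hsub).const_mul α
  have i4 : IntegrableOn (fun z : ℝ × Space d => referenceForcing h ρinf ρ n z.1 z.2)
      (Ioc σ τ ×ˢ univ) :=
    (hsol.forcing_integrable τ).mono_set
      (prod_mono (fun x hx => ⟨hσ.trans_lt hx.1, hx.2⟩) Subset.rfl)
  have i5 : IntervalIntegrable (fun s => Real.exp (d * s) * K (ψ s) * energyDefect h ρinf ρ n E s)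
      volume σ τ := by
    rw [intervalIntegrable_iff_integrableOn_Ioc_of_le hστ]
    exact (hsol.weight_integrable ψ hψ τ).mono_set (fun x hx => ⟨hσ.trans_lt hx.1, hx.2⟩)
  have i6 : IntervalIntegrable (fun s => (d : ℝ) / 2 * E s) volume σ τ := by
    rw [intervalIntegrable_iff_integrableOn_Ioc_of_le hστ]
    exact ((hsol.integrableOn_energy (τ + 1)).mono_set
      (fun x hx => ⟨hσ.trans_lt hx.1, by linarith [hx.2]⟩)).const_mul _
  unfold EnvarInequality at hin
  have j1 := intervalIntegral_integral_eq hστ i1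
  have j2 := intervalIntegral_integral_eq hστ i2
  have j3 := intervalIntegral_integral_eq (f := fun s y => α * (‖n s y‖ ^ 2 / ρ s y)) hστ i3
  have j4 := intervalIntegral_integral_eq hστ i4
  have hsplit : ∫ z in Ioc σ τ ×ˢ (univ : Set (Space d)),
      (massBracket φ ρ n z.1 z.2 + momentumBracket α p ψ ρ n z.1 z.2
          - α * (‖n z.1 z.2‖ ^ 2 / ρ z.1 z.2) + referenceForcing h ρinf ρ n z.1 z.2) = _ :=
    (integral_add' ((i1.add i2).sub i3) i4).trans (by
      rw [integral_sub' (i1.add i2) i3, integral_add' i1 i2])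
  rw [intervalIntegral.integral_sub i5 i6, hsplit, ← j1, ← j2, ← j3, ← j4]
  simp only [massBracket, momentumBracket]
  linarith

end Solution

end

section

/-! ### Cut-off functions and integration by parts -/

section Calculus

lemma divergenceForm_smulRight (ℓ : Space d →L[ℝ] ℝ) (v : Space d) :
    divergenceForm d (ℓ.smulRight v) = ℓ v := by
  have hv : v = ∑ j, v j • (EuclideanSpace.single j 1 : Space d) := by
    ext i
    simp [Finset.sum_apply, Pi.single_apply]
  conv_rhs => rw [hv]
  simp [divergenceForm, mul_comm]

lemma divergenceForm_id : divergenceForm d (ContinuousLinearMap.id ℝ (Space d)) = d := by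
  simp [divergenceForm]

lemma divergence_smul {f : Space d → ℝ} {v : Space d → Space d} {y : Space d}
    (hf : DifferentiableAt ℝ f y) (hv : DifferentiableAt ℝ v y) :
    divergence (fun z => f z • v z) y = f y * divergence v y + fderiv ℝ f y (v y) := by
  rw [divergence_eq, divergence_eq, fderiv_fun_smul hf hv, map_add, map_smul,
    divergenceForm_smulRight, smul_eq_mul]

/-- Each partial derivative is integrated by parts against the constant function 1. -/
lemma integral_divergence_eq_zero {v : Space d → Space d} (hv : ContDiff ℝ 1 v)
    (hc : HasCompactSupport v) : ∫ y, divergence v y = 0 := by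
  have hcf : Continuous (fderiv ℝ v) := hv.continuous_fderiv (by norm_num)
  have hcs : HasCompactSupport (fderiv ℝ v) := hc.fderiv (𝕜 := ℝ)
  have key : ∀ j : Fin d, Integrable (fun y => (fderiv ℝ v y (EuclideanSpace.single j 1)) j) ∧
      ∫ y, (fderiv ℝ v y (EuclideanSpace.single j 1)) j = 0 := by
    intro j
    set ℓ : Space d →L[ℝ] ℝ := EuclideanSpace.proj j
    have hd : ∀ y, fderiv ℝ (fun z => ℓ (v z)) y (EuclideanSpace.single j 1)
        = (fderiv ℝ v y (EuclideanSpace.single j 1)) j := fun y => by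
      have := ℓ.hasFDerivAt.comp y (hv.differentiable (by norm_num) y).hasFDerivAt
      rw [show (fun z => ℓ (v z)) = ℓ ∘ v from rfl, this.fderiv]
      simp [ℓ]
    have hi : Integrable (fun y => (fderiv ℝ v y (EuclideanSpace.single j 1)) j) := by
      refine Continuous.integrable_of_hasCompactSupport (by fun_prop) ?_
      exact hcs.comp_left (g := fun A : Space d →L[ℝ] Space d => (A (EuclideanSpace.single j 1)) j)
        (by simp)
    have hiv : Integrable (fun y => ℓ (v y)) :=
      Continuous.integrable_of_hasCompactSupport (ℓ.continuous.comp hv.continuous)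
        (hc.comp_left (g := ℓ) (map_zero ℓ))
    refine ⟨hi, ?_⟩
    have h0 := integral_mul_fderiv_eq_neg_fderiv_mul_of_integrable (𝕜 := ℝ) (μ := (volume : Measure (Space d)))
      (f := fun _ => (1:ℝ)) (g := fun z => ℓ (v z)) (v := EuclideanSpace.single j 1)
      (by simp) (by simpa [hd] using hi)
      (by simpa only [one_mul] using hiv)
      (by fun_prop) (fun y _ => ℓ.differentiableAt.comp y (hv.differentiable (by norm_num) y))
    simpa [hd] using h0
  unfold divergence
  rw [integral_finsetSum _ fun j _ => (key j).1]
  exact Finset.sum_eq_zero fun j _ => (key j).2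

lemma integrableOn_slab_of_continuousOn {f : ℝ × Space d → ℝ} (hf : ContinuousOn f (Ioi 0 ×ˢ univ))
    {σ τ R : ℝ} (hσ : 0 < σ) (h0 : ∀ z : ℝ × Space d, R < ‖z.2‖ → f z = 0) :
    IntegrableOn f (Ioc σ τ ×ˢ univ) := by
  have h1 : IntegrableOn f (Icc σ τ ×ˢ Metric.closedBall 0 R) :=
    (hf.mono fun z hz => ⟨hσ.trans_le hz.1.1, mem_univ _⟩).integrableOn_compact
      (isCompact_Icc.prod (isCompact_closedBall _ _))
  have h2 : IntegrableOn f (Ioc σ τ ×ˢ Metric.closedBall 0 R) :=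
    h1.mono_set (prod_mono Ioc_subset_Icc_self Subset.rfl)
  refine h2.of_forall_sdiff_eq_zero (measurableSet_Ioc.prod MeasurableSet.univ) fun z hz => h0 z ?_
  by_contra hc
  exact hz.2 ⟨hz.1.1, by simpa using hc⟩

lemma hasCompactSupport_of_eq_zero {F : Type*} [NormedAddCommGroup F] {f : Space d → F} {R : ℝ}
    (h0 : ∀ y, R < ‖y‖ → f y = 0) : HasCompactSupport f :=
  HasCompactSupport.intro (isCompact_closedBall (0 : Space d) R) fun y hy => h0 y (by simpa using hy)

lemma contDiff_slice {F : Type*} [NormedAddCommGroup F] [NormedSpace ℝ F] {f : ℝ × Space d → F}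
    (hf : ContDiffOn ℝ 1 f (Ioi 0 ×ˢ univ)) {s : ℝ} (hs : 0 < s) :
    ContDiff ℝ 1 fun y => f (s, y) := by
  rw [← contDiffOn_univ]
  exact hf.comp (contDiff_prodMk_right s).contDiffOn fun y _ => ⟨hs, mem_univ _⟩

/-- Fubini reduces to the divergence theorem on each slice. The lower time is positive because G is
regular only there. -/
lemma integral_slab_divergence {G : ℝ × Space d → Space d} (hG : ContDiffOn ℝ 1 G (Ioi 0 ×ˢ univ))
    {σ τ R : ℝ} (hσ : 0 < σ) (h0 : ∀ z : ℝ × Space d, R < ‖z.2‖ → G z = 0) :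
    IntegrableOn (fun z : ℝ × Space d => divergence (fun y => G (z.1, y)) z.2)
        (Ioc σ τ ×ˢ univ) ∧
      ∫ z in Ioc σ τ ×ˢ (univ : Set (Space d)), divergence (fun y => G (z.1, y)) z.2 = 0 := by
  have ho : IsOpen (Ioi 0 ×ˢ univ : Set (ℝ × Space d)) := isOpen_Ioi.prod isOpen_univ
  have hdiff : ∀ z : ℝ × Space d, 0 < z.1 → DifferentiableAt ℝ G z := fun z hz =>
    (hG.differentiableOn (by norm_num)).differentiableAt (IsReferencePair.mem_nhds_slab hz)
  have hc : ContinuousOn (fun z : ℝ × Space d => divergence (fun y => G (z.1, y)) z.2)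
      (Ioi 0 ×ˢ univ) := by
    have h1 : ContinuousOn (fun z => divergenceForm d
        ((fderiv ℝ G z).comp (ContinuousLinearMap.inr ℝ ℝ (Space d)))) (Ioi 0 ×ˢ univ) :=
      (divergenceForm d).continuous.comp_continuousOn
        ((hG.continuousOn_fderiv_of_isOpen ho le_rfl).clm_comp continuousOn_const)
    refine h1.congr fun z hz => ?_
    rw [divergence_eq, (hasFDerivAt_space (hdiff (z.1, z.2) hz.1)).fderiv]
  have hz0 : ∀ s : ℝ, ∀ y : Space d, R < ‖y‖ → divergence (fun y => G (s, y)) y = 0 := by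
    intro s y hy
    have : (fun y => G (s, y)) =ᶠ[𝓝 y] fun _ => 0 := by
      filter_upwards [(isOpen_lt continuous_const continuous_norm).mem_nhds hy] with y' hy'
      exact h0 (s, y') hy'
    rw [divergence_eq, this.fderiv_eq]
    simp
  have hi := integrableOn_slab_of_continuousOn (σ := σ) (τ := τ) hc hσ (fun z hz => hz0 z.1 z.2 hz)
  refine ⟨hi, ?_⟩
  rw [IntegrableOn, restrict_slab] at hi
  rw [restrict_slab, integral_prod _ hi]
  refine setIntegral_eq_zero_of_forall_eq_zero fun s hs => ?_
  exact integral_divergence_eq_zero (contDiff_slice hG (hσ.trans hs.1))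
    (hasCompactSupport_of_eq_zero fun y hy => h0 (s, y) hy)

/-- The fundamental theorem of calculus in time for fixed y, followed by Fubini. -/
lemma integral_sub_integral_eq_slab {g : ℝ × Space d → ℝ} (hg : ContDiffOn ℝ 1 g (Ioi 0 ×ˢ univ))
    {σ τ R : ℝ} (hσ : 0 < σ) (hστ : σ ≤ τ) (h0 : ∀ z : ℝ × Space d, R < ‖z.2‖ → g z = 0) :
    IntegrableOn (fun z : ℝ × Space d => deriv (fun s => g (s, z.2)) z.1) (Ioc σ τ ×ˢ univ) ∧
      (∫ y, g (τ, y)) - ∫ y, g (σ, y)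
        = ∫ z in Ioc σ τ ×ˢ (univ : Set (Space d)), deriv (fun s => g (s, z.2)) z.1 := by
  have ho : IsOpen (Ioi 0 ×ˢ univ : Set (ℝ × Space d)) := isOpen_Ioi.prod isOpen_univ
  have hdiff : ∀ z : ℝ × Space d, 0 < z.1 → DifferentiableAt ℝ g z := fun z hz =>
    (hg.differentiableOn (by norm_num)).differentiableAt (IsReferencePair.mem_nhds_slab hz)
  have hc : ContinuousOn (fun z : ℝ × Space d => deriv (fun s => g (s, z.2)) z.1)
      (Ioi 0 ×ˢ univ) := by
    have h1 : ContinuousOn (fun z => fderiv ℝ g z ((1:ℝ), (0 : Space d))) (Ioi 0 ×ˢ univ) :=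
      (hg.continuousOn_fderiv_of_isOpen ho le_rfl).clm_apply continuousOn_const
    exact h1.congr fun z hz => (hasDerivAt_time (hdiff (z.1, z.2) hz.1)).deriv
  have hz0 : ∀ z : ℝ × Space d, R < ‖z.2‖ → deriv (fun s => g (s, z.2)) z.1 = 0 := by
    intro z hz
    rw [show (fun s => g (s, z.2)) = fun _ => 0 from funext fun s => h0 (s, z.2) hz]
    simp
  have hi := integrableOn_slab_of_continuousOn (σ := σ) (τ := τ) hc hσ hz0
  refine ⟨hi, ?_⟩
  have hsl : ∀ s, 0 < s → Integrable fun y => g (s, y) := fun s hs =>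
    (contDiff_slice hg hs).continuous.integrable_of_hasCompactSupport
      (hasCompactSupport_of_eq_zero fun y hy => h0 (s, y) hy)
  rw [← integral_sub (hsl τ (hσ.trans_le hστ)) (hsl σ hσ)]
  rw [IntegrableOn, restrict_slab] at hi
  rw [restrict_slab, integral_prod_symm _ hi]
  refine integral_congr_ae (Eventually.of_forall fun y => ?_)
  have hcy : ContinuousOn (fun s => deriv (fun s' => g (s', y)) s) (uIcc σ τ) := by
    rw [uIcc_of_le hστ]
    exact hc.comp (f := fun s : ℝ => (s, y)) (by fun_prop) fun s hs =>
      ⟨hσ.trans_le hs.1, mem_univ _⟩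
  show g (τ, y) - g (σ, y) = ∫ s in Ioc σ τ, deriv (fun s' => g (s', y)) s
  rw [← intervalIntegral.integral_of_le hστ, intervalIntegral.integral_eq_sub_of_hasDerivAt
    (f := fun s => g (s, y)) ?_ hcy.intervalIntegrable]
  intro s hs
  rw [uIcc_of_le hστ] at hs
  exact (hasDerivAt_time (hdiff (s, y) (hσ.trans_le hs.1))).differentiableAt.hasDerivAt

/-- Cutting off a function of class `C¹` on `(0,∞) × ℝ^d`. -/
lemma isSpaceTimeTest_cutoff {F : Type*} [NormedAddCommGroup F] [NormedSpace ℝ F]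
    {f : ℝ → Space d → F} (hf : ContDiffOn ℝ 1 (fun z : ℝ × Space d => f z.1 z.2) (Ioi 0 ×ˢ univ))
    {θ : ℝ → ℝ} (hθ : ContDiff ℝ 1 θ) (hθc : HasCompactSupport θ) (hθ0 : tsupport θ ⊆ Ioi 0)
    {χ : Space d → ℝ} (hχ : ContDiff ℝ 1 χ) (hχc : HasCompactSupport χ) :
    IsSpaceTimeTest fun s y => (θ s * χ y) • f s y := by
  set g : ℝ × Space d → F := Function.uncurry fun s y => (θ s * χ y) • f s y with hg
  have hz : ∀ z ∉ tsupport θ ×ˢ tsupport χ, g z = 0 := by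
    rintro ⟨s, y⟩ hz
    simp only [hg, Function.uncurry]
    rw [mem_prod, not_and_or] at hz
    rcases hz with hz | hz
    · rw [image_eq_zero_of_notMem_tsupport hz, zero_mul, zero_smul]
    · rw [image_eq_zero_of_notMem_tsupport hz, mul_zero, zero_smul]
  refine ⟨?_, HasCompactSupport.intro (hθc.isCompact.prod hχc.isCompact) hz⟩
  rw [contDiff_iff_contDiffAt]
  intro z
  by_cases hzm : z.1 ∈ tsupport θ
  · have hpos : 0 < z.1 := hθ0 hzm
    have h1 := hf.contDiffAt (IsReferencePair.mem_nhds_slab hpos)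
    exact ContDiffAt.smul ((hθ.comp contDiff_fst).mul (hχ.comp contDiff_snd)).contDiffAt h1
  · have : g =ᶠ[𝓝 z] fun _ => 0 := by
      filter_upwards [((isClosed_tsupport θ).isOpen_compl.preimage continuous_fst).mem_nhds hzm]
        with w hw
      exact hz w fun hc => hw hc.1
    exact contDiffAt_const.congr_of_eventuallyEq this

lemma exists_time_cutoff {δ T : ℝ} (hδ : 0 < δ) (hδT : δ < T) :
    ∃ θ : ℝ → ℝ, ContDiff ℝ 1 θ ∧ HasCompactSupport θ ∧ tsupport θ ⊆ Ioi 0 ∧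
      ∀ s ∈ Icc δ T, θ =ᶠ[𝓝 s] fun _ => 1 := by
  -- The bump is 1 on [2δ/3, T + δ/3], a neighbourhood of [δ, T], and is supported in [δ/2, T +
  -- δ/2], away from time 0.
  let b : ContDiffBump ((δ + T) / 2 : ℝ) :=
    ⟨(T - δ) / 2 + δ / 3, (T - δ) / 2 + δ / 2, by linarith, by linarith⟩
  refine ⟨b, b.contDiff, b.hasCompactSupport, ?_, ?_⟩
  · rw [b.tsupport_eq, Real.closedBall_eq_Icc]
    intro x hx
    have := hx.1
    simp only [b] at this
    exact mem_Ioi.2 (by linarith)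
  · intro s hs
    refine b.eventuallyEq_one_of_mem_ball ?_
    rw [Real.ball_eq_Ioo]
    simp only [b]
    exact ⟨by linarith [hs.1], by linarith [hs.2]⟩

end Calculus

/-! ### Product rules for cut-off test functions. -/

section Brackets

variable {α : ℝ} {p h : ℝ → ℝ} {ρ : ℝ → Space d → ℝ} {n : ℝ → Space d → Space d}

lemma deriv_cutoff {F : Type*} [NormedAddCommGroup F] [NormedSpace ℝ F] {f : ℝ → Space d → F}
    {θ : ℝ → ℝ} {s : ℝ} (hθ : θ =ᶠ[𝓝 s] fun _ => 1) (χ : Space d → ℝ) (y : Space d)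
    (hf : DifferentiableAt ℝ (fun s' => f s' y) s) :
    deriv (fun s' => (θ s' * χ y) • f s' y) s = χ y • deriv (fun s' => f s' y) s := by
  have : (fun s' => (θ s' * χ y) • f s' y) =ᶠ[𝓝 s] fun s' => χ y • f s' y := by
    filter_upwards [hθ] with s' hs'
    rw [hs', one_mul]
  rw [this.deriv_eq, deriv_fun_const_smul _ hf]

lemma fderiv_cutoff {F : Type*} [NormedAddCommGroup F] [NormedSpace ℝ F] {f : ℝ → Space d → F}
    {θ : ℝ → ℝ} {s : ℝ} (hθ : θ s = 1) {χ : Space d → ℝ} (y : Space d)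
    (hχ : DifferentiableAt ℝ χ y) (hf : DifferentiableAt ℝ (f s) y) :
    fderiv ℝ (fun y' => (θ s * χ y') • f s y') y
      = χ y • fderiv ℝ (f s) y + (fderiv ℝ χ y).smulRight (f s y) := by
  simp only [hθ, one_mul]
  exact fderiv_fun_smul hχ hf

/-- Because θ is 1 near s, only the spatial gradient of χ leaves a trace. -/
lemma massBracket_cutoff {φ : ℝ → Space d → ℝ} {θ : ℝ → ℝ} {s : ℝ}
    (hθ : θ =ᶠ[𝓝 s] fun _ => 1) {χ : Space d → ℝ} (y : Space d) (hχ : DifferentiableAt ℝ χ y)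
    (h1 : DifferentiableAt ℝ (fun s' => φ s' y) s) (h2 : DifferentiableAt ℝ (φ s) y) :
    massBracket (fun s y => (θ s * χ y) • φ s y) ρ n s y
      = χ y * massBracket φ ρ n s y
        - fderiv ℝ χ y ((ρ s y / 2) • y - n s y) * φ s y := by
  unfold massBracket
  rw [deriv_cutoff hθ χ y h1, fderiv_cutoff hθ.eq_of_nhds y hχ h2]
  simp [hθ.eq_of_nhds]
  ring

lemma momentumBracket_cutoff {ψ : ℝ → Space d → Space d} {θ : ℝ → ℝ} {s : ℝ}
    (hθ : θ =ᶠ[𝓝 s] fun _ => 1) {χ : Space d → ℝ} (y : Space d) (hχ : DifferentiableAt ℝ χ y)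
    (h1 : DifferentiableAt ℝ (fun s' => ψ s' y) s) (h2 : DifferentiableAt ℝ (ψ s) y) :
    momentumBracket α p (fun s y => (θ s * χ y) • ψ s y) ρ n s y
      = χ y * momentumBracket α p ψ ρ n s y
        + (-(inner ℝ (n s y) (ψ s y) * fderiv ℝ χ y ((1 / 2 : ℝ) • y))
          + (ρ s y)⁻¹ * inner ℝ (n s y) (ψ s y) * fderiv ℝ χ y (n s y)
          + Real.exp (d * s) * p (ρ s y) * fderiv ℝ χ y (ψ s y)) := by
  unfold momentumBracket
  rw [deriv_cutoff hθ χ y h1, divergence_eq, divergence_eq, fderiv_cutoff hθ.eq_of_nhds y hχ h2,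
    map_add, map_smul, divergenceForm_smulRight]
  simp only [hθ.eq_of_nhds, one_mul, real_inner_smul_left, add_apply,
    smul_apply, ContinuousLinearMap.smulRight_apply, inner_add_right, map_smul,
    real_inner_smul_right, smul_eq_mul]
  ring

end Brackets

end

section

/-! ### The localized relative entropy inequality -/

/-- The error terms of the relative entropy inequality, written in terms of the velocity and the
enthalpy of the reference pair. -/
def xiForm (α : ℝ) (p h : ℝ → ℝ) (ρ : ℝ → Space d → ℝ) (n : ℝ → Space d → Space d)
    (ρb : ℝ → Space d → ℝ) (nb : ℝ → Space d → Space d) (s : ℝ) (y : Space d) : ℝ :=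
  -(Real.exp (-(d * s)) * ρ s y * inner ℝ (relVelocity ρ n ρb nb s y)
      (fderiv ℝ (fun z => velocity (ρb s z) (nb s z)) y (relVelocity ρ n ρb nb s y)))
    - divergence (fun z => velocity (ρb s z) (nb s z)) y * (p (ρ s y) - legendre h (ρb s y))
    - Real.exp (-(d * s)) * ρ s y * inner ℝ (relVelocity ρ n ρb nb s y)
      (deriv (fun s' => velocity (ρb s' y) (nb s' y)) s
        - fderiv ℝ (fun z => velocity (ρb s z) (nb s z)) y ((1 / 2 : ℝ) • y)
        - ((d : ℝ) / 2) • velocity (ρb s y) (nb s y)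
        + fderiv ℝ (fun z => velocity (ρb s z) (nb s z)) y (velocity (ρb s y) (nb s y)))
    - ρ s y * fderiv ℝ (fun z => enthalpy h (ρb s z)) y (relVelocity ρ n ρb nb s y)
    - α * (ρ s y * inner ℝ (relVelocity ρ n ρb nb s y) (velocity (ρb s y) (nb s y)))
    - (ρ s y - ρb s y) * (deriv (fun s' => enthalpy h (ρb s' y)) s
        - fderiv ℝ (fun z => enthalpy h (ρb s z)) y ((1 / 2 : ℝ) • y)
        + fderiv ℝ (fun z => enthalpy h (ρb s z)) y (velocity (ρb s y) (nb s y)))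

/-- The heart of the computation, with all values and derivatives at a point as free variables. Here
e and e' stand for e^{-dτ} and e^{dτ}, r•u for n, a lower s for time derivatives, H for h'(ρ̄) and P
for its Legendre value; the index i refers to ρ_∞. After expanding the inner products, both sides
agree up to the two terms carrying the product e e', namely the damping and the pressure. The last
summand on the right is the divergence of `exactFlux`. -/
lemma relative_entropy_algebra (u U Us y : Space d) (DU : Space d →L[ℝ] Space d)
    (DH DHi : Space d →L[ℝ] ℝ) {e e' : ℝ} (he : e * e' = 1)
    (r rb ri H Hi Hs His P Pi α pr divU D : ℝ) :
    ((His - Hs - D / 2 * e * inner ℝ U U + e * inner ℝ U Us) * r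
        - (DHi ((r / 2) • y - r • u) - DH ((r / 2) • y - r • u)
          + e * inner ℝ U (DU ((r / 2) • y - r • u)))
        - D / 2 * (Hi - H + 1 / 2 * e * inner ℝ U U) * r)
      + (inner ℝ ((D * e) • U - e • Us) (r • u)
        + (-(inner ℝ (r • u) (-(e • DU ((1 / 2 : ℝ) • y)))) + r * inner ℝ u (-(e • DU u))
          + e' * pr * (-(e * divU)))
        - e' * α * inner ℝ (-(e • U)) (r • u))
      - α * (r * inner ℝ u u)
      + (-(His - DHi ((1 / 2 : ℝ) • y)) * (r - ri) - DHi (r • u))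
      + (rb * Hs - ri * His)
    = -D / 2 * ((Hi - H + 1 / 2 * e * inner ℝ U U) * r + inner ℝ (-(e • U)) (r • u) + (P - Pi))
      + (-(e * r * inner ℝ (u - U) (DU (u - U))) - divU * (pr - P)
        - e * r * inner ℝ (u - U) (Us - DU ((1 / 2 : ℝ) • y) - (D / 2) • U + DU U)
        - r * DH (u - U) - α * (r * inner ℝ (u - U) U)
        - (r - rb) * (Hs - DH ((1 / 2 : ℝ) • y) + DH U))
      - α * (r * inner ℝ (u - U) (u - U))
      + (1 / 2 * (D * (P - Pi) + (rb * DH y - ri * DHi y)) - (P * divU + rb * DH U)) := by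
  have c1 : (inner ℝ u U : ℝ) = inner ℝ U u := real_inner_comm _ _
  have c2 : (inner ℝ u Us : ℝ) = inner ℝ Us u := real_inner_comm _ _
  have c3 : (inner ℝ U Us : ℝ) = inner ℝ Us U := real_inner_comm _ _
  simp only [map_sub, map_smul, inner_sub_left, inner_sub_right, inner_add_right,
    real_inner_smul_left, real_inner_smul_right, inner_neg_left, inner_neg_right, smul_eq_mul,
    c1, c2, c3]
  linear_combination (α * r * inner ℝ U u - pr * divU) * he

section

variable {α : ℝ} {p h : ℝ → ℝ} {ρinf ρ : ℝ → Space d → ℝ} {n : ℝ → Space d → Space d}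
  {ρb : ℝ → Space d → ℝ} {nb : ℝ → Space d → Space d}

/-- The vector field tested with the gradient of the cut-off function. -/
def cutoffFlux (p h : ℝ → ℝ) (ρinf ρ : ℝ → Space d → ℝ) (n : ℝ → Space d → Space d)
    (ρb : ℝ → Space d → ℝ) (nb : ℝ → Space d → Space d) (s : ℝ) (y : Space d) : Space d :=
  -(densityMultiplier h s (ρinf s y) (ρb s y) (nb s y) • ((ρ s y / 2) • y - n s y))
    - inner ℝ (n s y) (momentumMultiplier s (ρb s y) (nb s y)) • ((1 / 2 : ℝ) • y)
    + ((ρ s y)⁻¹ * inner ℝ (n s y) (momentumMultiplier s (ρb s y) (nb s y))) • n s y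
    - (p (ρ s y) - legendre h (ρb s y)) • velocity (ρb s y) (nb s y)
    - (1 / 2 * (legendre h (ρb s y) - legendre h (ρinf s y))) • y

/-- The space-time integrand of the localized relative entropy inequality. -/
def localIntegrand (α : ℝ) (p h : ℝ → ℝ) (ρinf ρ : ℝ → Space d → ℝ) (n : ℝ → Space d → Space d)
    (ρb : ℝ → Space d → ℝ) (nb : ℝ → Space d → Space d) (χ : Space d → ℝ) (s : ℝ) (y : Space d) :
    ℝ :=
  -(d : ℝ) / 2 * (χ y * entropyShift h ρinf ρb nb (ρ s) (n s) s y)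
    + χ y * (xiForm α p h ρ n ρb nb s y - α * (ρ s y * ‖relVelocity ρ n ρb nb s y‖ ^ 2))
    + (1 - χ y) * (referenceForcing h ρinf ρ n s y - α * (‖n s y‖ ^ 2 / ρ s y))
    + fderiv ℝ χ y (cutoffFlux p h ρinf ρ n ρb nb s y)

/-- The vector field whose divergence is dropped. -/
def exactFlux (h : ℝ → ℝ) (ρinf ρb : ℝ → Space d → ℝ) (nb : ℝ → Space d → Space d)
    (s : ℝ) (y : Space d) : Space d :=
  (1 / 2 * (legendre h (ρb s y) - legendre h (ρinf s y))) • y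
    - legendre h (ρb s y) • velocity (ρb s y) (nb s y)

/-- This is `relative_entropy_algebra` at a point, once every derivative has been expressed through
the joint derivatives of h'(ρ̄), h'(ρ_∞) and U. The time derivative of P(ρ̄) - P(ρ_∞) has to be
added because the state-independent part of the affine function is not seen by the test functions.
-/
lemma massBracket_add_momentumBracket (hi : IsReferencePair h ρinf 0) (hb : IsReferencePair h ρb nb)
    {s : ℝ} (hs : 0 < s) {y : Space d} (hst : IsState (ρ s y) (n s y)) :
    massBracket (fun s y => densityMultiplier h s (ρinf s y) (ρb s y) (nb s y)) ρ n s y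
      + momentumBracket α p (fun s y => momentumMultiplier s (ρb s y) (nb s y)) ρ n s y
      - α * (‖n s y‖ ^ 2 / ρ s y) + referenceForcing h ρinf ρ n s y
      + deriv (fun s => legendre h (ρb s y) - legendre h (ρinf s y)) s
    = -(d : ℝ) / 2 * entropyShift h ρinf ρb nb (ρ s) (n s) s y
      + xiForm α p h ρ n ρb nb s y - α * (ρ s y * ‖relVelocity ρ n ρb nb s y‖ ^ 2)
      + divergence (exactFlux h ρinf ρb nb s) y := by
  have hn := IsReferencePair.mem_nhds_slab (z := (s, y)) hs
  have dH := (hb.enthalpy_contDiffOn.differentiableOn (by norm_num)).differentiableAt hn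
  have dHi := (hi.enthalpy_contDiffOn.differentiableOn (by norm_num)).differentiableAt hn
  have dU := (hb.velocity_contDiffOn.differentiableOn (by norm_num)).differentiableAt hn
  have tH := hasDerivAt_time dH
  have tHi := hasDerivAt_time dHi
  have tU := hasDerivAt_time dU
  have sH := hasFDerivAt_space dH
  have sHi := hasFDerivAt_space dHi
  have sU := hasFDerivAt_space dU
  have tP := hasDerivAt_time (hb.hasFDerivAt_legendre hs (z := (s, y))).differentiableAt
  have tPi := hasDerivAt_time (hi.hasFDerivAt_legendre hs (z := (s, y))).differentiableAt
  have sP := hasFDerivAt_space (hb.hasFDerivAt_legendre hs (z := (s, y))).differentiableAt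
  have sPi := hasFDerivAt_space (hi.hasFDerivAt_legendre hs (z := (s, y))).differentiableAt
  rw [(hb.hasFDerivAt_legendre hs (z := (s, y))).fderiv] at tP sP
  rw [(hi.hasFDerivAt_legendre hs (z := (s, y))).fderiv] at tPi sPi
  have te : HasDerivAt (fun s' : ℝ => Real.exp (-(d * s'))) (-(d * Real.exp (-(d * s)))) s := by
    have := ((hasDerivAt_id s).const_mul (d : ℝ)).neg.exp
    simpa [mul_comm] using this
  set LH := fderiv ℝ (fun z : ℝ × Space d => enthalpy h (ρb z.1 z.2)) (s, y)
  set LHi := fderiv ℝ (fun z : ℝ × Space d => enthalpy h (ρinf z.1 z.2)) (s, y)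
  set LU := fderiv ℝ (fun z : ℝ × Space d => velocity (ρb z.1 z.2) (nb z.1 z.2)) (s, y)
  set DH := LH.comp (ContinuousLinearMap.inr ℝ ℝ (Space d))
  set DHi := LHi.comp (ContinuousLinearMap.inr ℝ ℝ (Space d))
  set DU := LU.comp (ContinuousLinearMap.inr ℝ ℝ (Space d))
  set U := velocity (ρb s y) (nb s y) with hU
  set e := Real.exp (-(d * s)) with he
  have ee : e * Real.exp (d * s) = 1 := by rw [he, ← Real.exp_add]; simp
  have e1 : deriv (fun s' => enthalpy h (ρb s' y)) s = LH (1, 0) := tH.deriv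
  have e2 : deriv (fun s' => enthalpy h (ρinf s' y)) s = LHi (1, 0) := tHi.deriv
  have e3 : deriv (fun s' => velocity (ρb s' y) (nb s' y)) s = LU (1, 0) := tU.deriv
  have e4 : fderiv ℝ (fun z => enthalpy h (ρb s z)) y = DH := sH.fderiv
  have e5 : fderiv ℝ (fun z => enthalpy h (ρinf s z)) y = DHi := sHi.fderiv
  have e6 : fderiv ℝ (fun z => velocity (ρb s z) (nb s z)) y = DU := sU.fderiv
  have e7 : deriv (fun s => legendre h (ρb s y) - legendre h (ρinf s y)) s
      = ρb s y * LH (1, 0) - ρinf s y * LHi (1, 0) := (tP.sub tPi).deriv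
  have e8 : deriv (fun s' => densityMultiplier h s' (ρinf s' y) (ρb s' y) (nb s' y)) s
      = LHi (1, 0) - LH (1, 0) - d / 2 * e * inner ℝ U U + e * inner ℝ U (LU (1, 0)) := by
    have := (tHi.sub tH).add ((te.const_mul (1 / 2)).mul tU.norm_sq)
    refine (this.deriv).trans ?_
    simp only [real_inner_self_eq_norm_sq]
    ring
  have e9 : fderiv ℝ (fun z => densityMultiplier h s (ρinf s z) (ρb s z) (nb s z)) y
      = DHi - DH + (1 / 2 * e) • (2 • (innerSL ℝ U).comp DU) :=
    ((sHi.sub sH).add (sU.norm_sq.const_mul (1 / 2 * e))).fderiv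
  have e10 : deriv (fun s' => momentumMultiplier s' (ρb s' y) (nb s' y)) s
      = (d * e) • U - e • LU (1, 0) := by
    refine (te.smul tU).neg.deriv.trans ?_
    simp only [neg_add, neg_smul, neg_neg, ← hU]
    abel
  have e11 : fderiv ℝ (fun z => momentumMultiplier s (ρb s z) (nb s z)) y = -(e • DU) :=
    (sU.const_smul e).neg.fderiv
  have e12 : divergence (exactFlux h ρinf ρb nb s) y
      = 1 / 2 * (d * (legendre h (ρb s y) - legendre h (ρinf s y))
          + (ρb s y * DH y - ρinf s y * DHi y))
        - (legendre h (ρb s y) * divergenceForm d DU + ρb s y * DH U) := by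
    have h1 := ((sP.sub sPi).const_mul (1 / 2)).smul (hasFDerivAt_id y)
    have h2 := sP.smul sU
    rw [divergence_eq]
    refine (congrArg (divergenceForm d) (h1.sub h2).fderiv).trans ?_
    rw [map_sub, map_add, map_add, map_smul, map_smul, divergenceForm_smulRight,
      divergenceForm_smulRight, divergenceForm_id]
    simp [DH, DHi, ← hU]
    ring
  have hm : n s y = ρ s y • velocity (ρ s y) (n s y) := hst.smul_velocity.symm
  have e13 : ‖n s y‖ ^ 2 / ρ s y
      = ρ s y * inner ℝ (velocity (ρ s y) (n s y)) (velocity (ρ s y) (n s y)) := by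
    rw [real_inner_self_eq_norm_sq, mul_norm_velocity_sq]
  have key := relative_entropy_algebra (velocity (ρ s y) (n s y)) U (LU (1, 0)) y DU DH DHi ee
    (ρ s y) (ρb s y) (ρinf s y) (enthalpy h (ρb s y)) (enthalpy h (ρinf s y)) (LH (1, 0))
    (LHi (1, 0)) (legendre h (ρb s y)) (legendre h (ρinf s y)) α (p (ρ s y))
    (divergenceForm d DU) d
  -- In the vacuum both sides vanish, by the convention that the inverse of zero is zero.
  have e14 : (ρ s y)⁻¹ * inner ℝ (n s y) (-(e • DU (n s y)))
      = ρ s y * inner ℝ (velocity (ρ s y) (n s y)) (-(e • DU (velocity (ρ s y) (n s y)))) := by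
    by_cases h0 : ρ s y = 0
    · simp [h0]
    · simp only [velocity, map_smul, real_inner_smul_left, real_inner_smul_right, inner_neg_right]
      field_simp
  unfold massBracket momentumBracket referenceForcing xiForm entropyShift
  beta_reduce
  rw [e1, e2, e3, e4, e5, e6, e7, e8, e9, e10, e11, e12, e13, divergence_eq, divergence_eq, e6, e11]
  simp only [relVelocity, ← hU, densityMultiplier, momentumMultiplier, ← he, ← real_inner_self_eq_norm_sq]
  rw [← hm] at key
  simp only [neg_apply, smul_apply, map_neg, sub_apply, add_apply, ContinuousLinearMap.comp_apply, innerSL_apply_apply, smul_eq_mul, nsmul_eq_mul, Nat.cast_ofNat] at key ⊢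
  rw [e14, map_smul (divergenceForm d), smul_eq_mul]
  linarith [key]

lemma exactFlux_contDiffOn (hi : IsReferencePair h ρinf 0) (hb : IsReferencePair h ρb nb) :
    ContDiffOn ℝ 1 (fun z : ℝ × Space d => exactFlux h ρinf ρb nb z.1 z.2) (Ioi 0 ×ˢ univ) :=
  ((contDiffOn_const.mul (hb.legendre_contDiffOn.sub hi.legendre_contDiffOn)).smul
    contDiff_snd.contDiffOn).sub (hb.legendre_contDiffOn.smul hb.velocity_contDiffOn)

/-- The pointwise identity is multiplied by χ. Forcing and kinetic dissipation are not multiplied by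
the test functions, so they leave a remainder with factor 1 - χ. All terms with a derivative on χ
collect into `cutoffFlux` together with the gradient part of the divergence of χ times `exactFlux`.
-/
lemma cutoff_integrand_eq (hi : IsReferencePair h ρinf 0) (hb : IsReferencePair h ρb nb)
    {θ : ℝ → ℝ} {χ : Space d → ℝ} (hχ : ContDiff ℝ 1 χ)
    {s : ℝ} (hs : 0 < s) (hθ : θ =ᶠ[𝓝 s] fun _ => 1) {y : Space d}
    (hst : IsState (ρ s y) (n s y)) :
    massBracket (fun s y => (θ s * χ y) • densityMultiplier h s (ρinf s y) (ρb s y) (nb s y)) ρ n s y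
      + momentumBracket α p (fun s y => (θ s * χ y) • momentumMultiplier s (ρb s y) (nb s y)) ρ n s y
      - α * (‖n s y‖ ^ 2 / ρ s y) + referenceForcing h ρinf ρ n s y
      + deriv (fun s => χ y * (legendre h (ρb s y) - legendre h (ρinf s y))) s
    = localIntegrand α p h ρinf ρ n ρb nb χ s y
      + divergence (fun y => χ y • exactFlux h ρinf ρb nb s y) y := by
  have hn := IsReferencePair.mem_nhds_slab (z := (s, y)) hs
  have dφ := ((densityMultiplier_contDiffOn hi hb).differentiableOn (by norm_num)).differentiableAt hn
  have dψ := ((momentumMultiplier_contDiffOn hb).differentiableOn (by norm_num)).differentiableAt hn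
  have dF := ((exactFlux_contDiffOn hi hb).differentiableOn (by norm_num)).differentiableAt hn
  have dP := hasDerivAt_time (hb.hasFDerivAt_legendre hs (z := (s, y))).differentiableAt
  have dPi := hasDerivAt_time (hi.hasFDerivAt_legendre hs (z := (s, y))).differentiableAt
  have dχ : DifferentiableAt ℝ χ y := hχ.differentiable (by norm_num) y
  have key := massBracket_add_momentumBracket (α := α) (p := p) hi hb hs hst
  have ee : Real.exp (d * s) * Real.exp (-(d * s)) = 1 := by rw [← Real.exp_add]; simp
  have eP : deriv (fun s => χ y * (legendre h (ρb s y) - legendre h (ρinf s y))) s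
      = χ y * deriv (fun s => legendre h (ρb s y) - legendre h (ρinf s y)) s :=
    deriv_const_mul _ (dP.sub dPi).differentiableAt
  rw [massBracket_cutoff (φ := fun s y => densityMultiplier h s (ρinf s y) (ρb s y) (nb s y)) hθ y dχ
      (hasDerivAt_time dφ).differentiableAt (hasFDerivAt_space dφ).differentiableAt,
    momentumBracket_cutoff (ψ := fun s y => momentumMultiplier s (ρb s y) (nb s y)) hθ y dχ
      (hasDerivAt_time dψ).differentiableAt (hasFDerivAt_space dψ).differentiableAt,
    divergence_smul (v := exactFlux h ρinf ρb nb s) dχ (hasFDerivAt_space dF).differentiableAt, eP]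
  have hflux : fderiv ℝ χ y (cutoffFlux p h ρinf ρ n ρb nb s y)
        + fderiv ℝ χ y (exactFlux h ρinf ρb nb s y)
      = -(fderiv ℝ χ y ((ρ s y / 2) • y - n s y)
          * densityMultiplier h s (ρinf s y) (ρb s y) (nb s y))
        + (-(inner ℝ (n s y) (momentumMultiplier s (ρb s y) (nb s y))
              * fderiv ℝ χ y ((1 / 2 : ℝ) • y))
          + (ρ s y)⁻¹ * inner ℝ (n s y) (momentumMultiplier s (ρb s y) (nb s y))
              * fderiv ℝ χ y (n s y)
          + Real.exp (d * s) * p (ρ s y)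
              * fderiv ℝ χ y (momentumMultiplier s (ρb s y) (nb s y))) := by
    have h1 : Real.exp (d * s) * fderiv ℝ χ y (momentumMultiplier s (ρb s y) (nb s y))
        = -fderiv ℝ χ y (velocity (ρb s y) (nb s y)) := by
      rw [momentumMultiplier, map_neg, map_smul, smul_eq_mul]
      linear_combination -(fderiv ℝ χ y (velocity (ρb s y) (nb s y))) * ee
    unfold cutoffFlux exactFlux
    simp only [map_add, map_sub, map_neg, map_smul, smul_eq_mul]
    linear_combination -(p (ρ s y)) * h1
  unfold localIntegrand
  beta_reduce
  linear_combination χ y * key - hflux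

end

section Solution

variable {α : ℝ} {p h : ℝ → ℝ} {ρhat ρ₀ : Space d → ℝ} {n₀ : Space d → Space d}
  {K : (Space d → Space d) → ℝ} {ρinf ρ : ℝ → Space d → ℝ} {n : ℝ → Space d → Space d} {E : ℝ → ℝ}
  {ρb : ℝ → Space d → ℝ} {nb : ℝ → Space d → Space d}

/-- Homogeneity of degree one cancels the factor e^{ds} of the inequality against the factor e^{-ds}
in the momentum multiplier. -/
lemma IsEnergyVariationalSolution.weight_cutoff
    (hsol : IsEnergyVariationalSolution α p h ρhat ρ₀ n₀ K ρinf ρ n E)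
    (hb : IsReferencePair h ρb nb) {χ : Space d → ℝ} (hχ : ContDiff ℝ 1 χ)
    (hχc : HasCompactSupport χ) {s c : ℝ} (hs : 0 < s) (hc : c = 1) :
    Real.exp (d * s) * K (fun y => (c * χ y) • momentumMultiplier s (ρb s y) (nb s y))
      = K fun y => χ y • -velocity (ρb s y) (nb s y) := by
  have hU : ContDiff ℝ 1 fun y => velocity (ρb s y) (nb s y) := contDiff_slice hb.velocity_contDiffOn hs
  have ht : IsTestField fun y => χ y • -velocity (ρb s y) (nb s y) :=
    ⟨hχ.smul hU.neg, hχc.smul_right⟩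
  have h1 := hsol.weight.homogeneous (Real.exp (-(d * s))) (Real.exp_pos _) _ ht
  have h2 : (fun y => (c * χ y) • momentumMultiplier s (ρb s y) (nb s y))
      = fun y => Real.exp (-(d * s)) • χ y • -velocity (ρb s y) (nb s y) := by
    ext1 y
    rw [hc, one_mul, momentumMultiplier, ← smul_neg, smul_comm]
  rw [h2, h1, ← mul_assoc, ← Real.exp_add]
  simp

/-- The relative entropy inequality with a cut-off function in space. -/
lemma IsEnergyVariationalSolution.localized_inequality (hp : IsPressureLaw p)
    (hh : IsPressurePotential p h) (hρhat : IsAngularLimit ρhat ∨ ∀ y, ρhat y = 0)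
    (hsol : IsEnergyVariationalSolution α p h ρhat ρ₀ n₀ K ρinf ρ n E)
    (hb : IsReferencePair h ρb nb) (hdec : HasMultiplierDecay h ρinf ρb nb)
    {χ : Space d → ℝ} (hχ : ContDiff ℝ 1 χ) (hχc : HasCompactSupport χ)
    {δ T : ℝ} (hδ : 0 < δ) (hδT : δ < T) :
    ∀ᵐ σ ∂(volume.restrict (Ioi δ)), ∀ᵐ τ ∂(volume.restrict (Ioi σ)), τ < T →
      (E τ + ∫ y, χ y * entropyShift h ρinf ρb nb (ρ τ) (n τ) τ y)
        - (E σ + ∫ y, χ y * entropyShift h ρinf ρb nb (ρ σ) (n σ) σ y)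
      ≤ (∫ z in Ioc σ τ ×ˢ (univ : Set (Space d)),
          localIntegrand α p h ρinf ρ n ρb nb χ z.1 z.2)
        + ∫ s in σ..τ, (K (fun y => χ y • -velocity (ρb s y) (nb s y))
            * energyDefect h ρinf ρ n E s - (d : ℝ) / 2 * E s) := by
  have hi := hsol.isReferencePair hh
  obtain ⟨θ, hθ, hθc, hθ0, hθ1⟩ := exists_time_cutoff hδ hδT
  obtain ⟨R, hR⟩ := hχc.isBounded.subset_closedBall (0 : Space d)
  have hχR : ∀ y, R < ‖y‖ → χ y = 0 := fun y hy =>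
    image_eq_zero_of_notMem_tsupport fun hc => by
      have := hR hc
      rw [mem_closedBall_zero_iff] at this
      linarith
  obtain ⟨L, hL⟩ := hχc.exists_bound_of_continuous hχ.continuous
  set Φ : ℝ → Space d → ℝ := fun s y =>
    (θ s * χ y) • densityMultiplier h s (ρinf s y) (ρb s y) (nb s y) with hΦ
  set Ψ : ℝ → Space d → Space d := fun s y =>
    (θ s * χ y) • momentumMultiplier s (ρb s y) (nb s y) with hΨ
  have tΦ : IsSpaceTimeTest Φ :=
    isSpaceTimeTest_cutoff (densityMultiplier_contDiffOn hi hb) hθ hθc hθ0 hχ hχc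
  have tΨ : IsSpaceTimeTest Ψ :=
    isSpaceTimeTest_cutoff (momentumMultiplier_contDiffOn hb) hθ hθc hθ0 hχ hχc
  -- The state-independent part of the affine function. It is not tested; its increment between two
  -- times is added by hand as the integral of a time derivative.
  set g : ℝ × Space d → ℝ := fun z =>
    χ z.2 * (legendre h (ρb z.1 z.2) - legendre h (ρinf z.1 z.2))
  have hg : ContDiffOn ℝ 1 g (Ioi 0 ×ˢ univ) := (hχ.comp contDiff_snd).contDiffOn.mul
    (hb.legendre_contDiffOn.sub hi.legendre_contDiffOn)
  have hg0 : ∀ z : ℝ × Space d, R < ‖z.2‖ → g z = 0 := fun z hz => by simp [g, hχR z.2 hz]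
  set G : ℝ × Space d → Space d := fun z => χ z.2 • exactFlux h ρinf ρb nb z.1 z.2
  have hG : ContDiffOn ℝ 1 G (Ioi 0 ×ˢ univ) :=
    (hχ.comp contDiff_snd).contDiffOn.smul (exactFlux_contDiffOn hi hb)
  have hG0 : ∀ z : ℝ × Space d, R < ‖z.2‖ → G z = 0 := fun z hz => by simp [G, hχR z.2 hz]
  have hslice : ∀ s, δ ≤ s → s ≤ T → IsFiniteSlice h s (ρinf s) (ρ s) (n s) →
      ∫ y, (Φ s y * ρ s y + inner ℝ (Ψ s y) (n s y))
        = (∫ y, χ y * entropyShift h ρinf ρb nb (ρ s) (n s) s y) - ∫ y, g (s, y) := by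
    intro s hs hsT hsl
    have hs0 : 0 < s := hδ.trans_le hs
    have i1 : Integrable fun y => χ y * entropyShift h ρinf ρb nb (ρ s) (n s) s y :=
      (hsl.shift hp hh hρhat hsol hb hdec hs0.le).1.bdd_mul hχ.continuous.aestronglyMeasurable
        (Eventually.of_forall hL)
    have i2 : Integrable fun y => g (s, y) :=
      (contDiff_slice hg hs0).continuous.integrable_of_hasCompactSupport
        (hasCompactSupport_of_eq_zero fun y hy => hg0 (s, y) hy)
    rw [← integral_sub i1 i2]
    refine integral_congr_ae (Eventually.of_forall fun y => ?_)
    have : θ s = 1 := (hθ1 s ⟨hs, hsT⟩).eq_of_nhds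
    simp only [hΦ, hΨ, g, this, entropyShift, one_mul, smul_eq_mul, real_inner_smul_left]
    ring
  have hst := (hsol.ae_isState_and_integrableOn hp hh T).1
  have hineq := ae_mono (Measure.restrict_mono (Ioi_subset_Ioi hδ.le) le_rfl)
    (hsol.inequality Φ Ψ tΦ tΨ)
  have hsl := hsol.ae_isFiniteSlice hp hh
  have hslδ := ae_mono (Measure.restrict_mono (Ioi_subset_Ioi hδ.le) le_rfl) hsl
  filter_upwards [hineq, hslδ, ae_restrict_mem measurableSet_Ioi] with σ h1 h2 hσ
  have hσ0 : 0 < σ := hδ.trans hσ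
  filter_upwards [h1, ae_mono (Measure.restrict_mono (Ioi_subset_Ioi hσ0.le) le_rfl) hsl,
    ae_restrict_mem measurableSet_Ioi] with τ h3 h4 hτ hτT
  have hστ : σ ≤ τ := le_of_lt hτ
  have hsub : Ioc σ τ ×ˢ (univ : Set (Space d)) ⊆ Ioo 0 T ×ˢ univ :=
    prod_mono (fun x hx => ⟨hσ0.trans hx.1, hx.2.trans_lt hτT⟩) Subset.rfl
  have key := EnvarInequality.slab hp hh hρhat hsol tΦ tΨ hσ0.le hστ h3
  rw [hslice τ (hσ.le.trans hστ) hτT.le h4.1, hslice σ hσ.le (hστ.trans hτT.le) h2.1] at key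
  obtain ⟨ig, eg⟩ := integral_sub_integral_eq_slab hg hσ0 hστ hg0
  obtain ⟨iG, eG⟩ := integral_slab_divergence (σ := σ) (τ := τ) hG hσ0 hG0
  have i1 := (tΦ.integrableOn_massBracket hsol T).mono_set hsub
  have i2 := (tΨ.integrableOn_momentumBracket hsol T).mono_set hsub
  have i3 := ((hsol.integrableOn_kinetic hp hh hρhat T).mono_set hsub).const_mul α
  have i4 : IntegrableOn (fun z : ℝ × Space d => referenceForcing h ρinf ρ n z.1 z.2)
      (Ioc σ τ ×ˢ univ) :=
    (hsol.forcing_integrable τ).mono_set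
      (prod_mono (fun x hx => ⟨hσ0.trans hx.1, hx.2⟩) Subset.rfl)
  -- The pointwise identity integrated over the slab: the time derivative of g yields its two
  -- slices, and the divergence yields zero.
  have hI : ∫ z in Ioc σ τ ×ˢ (univ : Set (Space d)),
        localIntegrand α p h ρinf ρ n ρb nb χ z.1 z.2
      = (∫ z in Ioc σ τ ×ˢ (univ : Set (Space d)),
          (massBracket Φ ρ n z.1 z.2 + momentumBracket α p Ψ ρ n z.1 z.2
            - α * (‖n z.1 z.2‖ ^ 2 / ρ z.1 z.2) + referenceForcing h ρinf ρ n z.1 z.2))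
        + ((∫ y, g (τ, y)) - ∫ y, g (σ, y)) := by
    have h5 := integral_add' (((i1.add i2).sub i3).add i4) ig
    have h6 := integral_sub' ((((i1.add i2).sub i3).add i4).add ig) iG
    rw [h5, eG, sub_zero] at h6
    rw [eg]
    refine Eq.trans ?_ h6
    refine integral_congr_ae ?_
    have hst' := ae_mono (Measure.restrict_mono hsub le_rfl) hst
    filter_upwards [hst', ae_restrict_mem (measurableSet_Ioc.prod MeasurableSet.univ)] with z hz hzm
    have h7 := cutoff_integrand_eq (α := α) (p := p) hi hb hχ (hσ0.trans hzm.1.1)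
      (hθ1 z.1 ⟨hσ.le.trans hzm.1.1.le, hzm.1.2.trans hτT.le⟩) hz
    exact eq_sub_of_add_eq h7.symm
  have hW : ∫ s in σ..τ, (Real.exp (d * s) * K (Ψ s) * energyDefect h ρinf ρ n E s
        - (d : ℝ) / 2 * E s)
      = ∫ s in σ..τ, (K (fun y => χ y • -velocity (ρb s y) (nb s y))
            * energyDefect h ρinf ρ n E s - (d : ℝ) / 2 * E s) := by
    refine intervalIntegral.integral_congr fun s hs => ?_
    rw [uIcc_of_le hστ] at hs
    have : θ s = 1 := (hθ1 s ⟨hσ.le.trans hs.1, hs.2.trans hτT.le⟩).eq_of_nhds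
    simp only [hΨ, hsol.weight_cutoff hb hχ hχc (hσ0.trans_le hs.1) this]
  rw [hW] at key
  rw [hI]
  linarith

end Solution

end

section

/-! ### Removing the cut-off in space -/

section Truncation

/-- The dilated cut-off functions `χ(y / (j + 1))`. -/
def dilate (χ : Space d → ℝ) (j : ℕ) (y : Space d) : ℝ := χ (((j : ℝ) + 1)⁻¹ • y)

lemma dilate_contDiff {χ : Space d → ℝ} {k : WithTop ℕ∞} (hχ : ContDiff ℝ k χ) (j : ℕ) :
    ContDiff ℝ k (dilate χ j) :=
  hχ.comp (contDiff_const_smul _)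

lemma dilate_hasCompactSupport {χ : Space d → ℝ} (hχ : HasCompactSupport χ) (j : ℕ) :
    HasCompactSupport (dilate χ j) :=
  hχ.comp_smul (c := ((j : ℝ) + 1)⁻¹) (by positivity)

lemma tendsto_inv_smul_zero (y : Space d) :
    Tendsto (fun j : ℕ => ((j : ℝ) + 1)⁻¹ • y) atTop (𝓝 0) := by
  have h1 : Tendsto (fun j : ℕ => ((j : ℝ) + 1)⁻¹) atTop (𝓝 0) := by
    simpa using tendsto_one_div_add_atTop_nhds_zero_nat (𝕜 := ℝ)
  simpa using h1.smul_const y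

lemma eventually_dilate_eq_one {χ : Space d → ℝ} (hχ : ∀ᶠ y in 𝓝 0, χ y = 1) (y : Space d) :
    ∀ᶠ j in atTop, dilate χ j y = 1 :=
  (tendsto_inv_smul_zero y).eventually hχ

lemma fderiv_dilate {χ : Space d → ℝ} (hχ : ContDiff ℝ 1 χ) (j : ℕ) (y : Space d) :
    fderiv ℝ (dilate χ j) y = ((j : ℝ) + 1)⁻¹ • fderiv ℝ χ (((j : ℝ) + 1)⁻¹ • y) := by
  have h1 : HasFDerivAt (fun y : Space d => ((j : ℝ) + 1)⁻¹ • y)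
      (((j : ℝ) + 1)⁻¹ • ContinuousLinearMap.id ℝ (Space d)) y :=
    (((j : ℝ) + 1)⁻¹ • ContinuousLinearMap.id ℝ (Space d)).hasFDerivAt
  have h2 := (hχ.differentiable (by norm_num) (((j : ℝ) + 1)⁻¹ • y)).hasFDerivAt.comp y h1
  refine (h2.fderiv).trans ?_
  ext v
  simp

/-- A smooth cut-off function with values in `[0,1]` which is `1` near the origin. -/
structure IsCutoff (χ : Space d → ℝ) : Prop where
  contDiff : ContDiff ℝ (⊤ : ℕ∞) χ
  hasCompactSupport : HasCompactSupport χ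
  mem_Icc : ∀ y, 0 ≤ χ y ∧ χ y ≤ 1
  eventually_eq_one : ∀ᶠ y in 𝓝 0, χ y = 1

lemma exists_isCutoff : ∃ χ : Space d → ℝ, IsCutoff χ := by
  let b : ContDiffBump (0 : Space d) := ⟨1, 2, by norm_num, by norm_num⟩
  exact ⟨b, b.contDiff, b.hasCompactSupport, fun y => ⟨b.nonneg, b.le_one⟩,
    b.eventuallyEq_one⟩

lemma IsCutoff.contDiff_one {χ : Space d → ℝ} (hχ : IsCutoff χ) : ContDiff ℝ 1 χ :=
  hχ.contDiff.of_le (by exact_mod_cast le_top)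

lemma IsCutoff.exists_fderiv_dilate_le {χ : Space d → ℝ} (hχ : IsCutoff χ) :
    ∃ C : ℝ, 0 ≤ C ∧ ∀ j y, ‖fderiv ℝ (dilate χ j) y‖ ≤ C * ((j : ℝ) + 1)⁻¹ := by
  obtain ⟨C, hC⟩ := (hχ.hasCompactSupport.fderiv (𝕜 := ℝ)).exists_bound_of_continuous
    (hχ.contDiff_one.continuous_fderiv (by norm_num))
  refine ⟨C, (norm_nonneg _).trans (hC 0), fun j y => ?_⟩
  rw [fderiv_dilate hχ.contDiff_one, norm_smul, norm_inv, Real.norm_eq_abs,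
    abs_of_nonneg (by positivity), mul_comm]
  gcongr
  exact hC _

end Truncation

section Solution

variable {α : ℝ} {p h : ℝ → ℝ} {ρhat ρ₀ : Space d → ℝ} {n₀ : Space d → Space d}
  {K : (Space d → Space d) → ℝ} {ρinf ρ : ℝ → Space d → ℝ} {n : ℝ → Space d → Space d} {E : ℝ → ℝ}
  {ρb : ℝ → Space d → ℝ} {nb : ℝ → Space d → Space d}

/-- The transport terms grow like |y|, and the weight in `HasMultiplierDecay` pays for exactly this
growth. Every term except the pressure flux is bounded by a multiple of (1 + |y|) times
`shiftBound`; the pressure flux is integrable by assumption. -/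
lemma IsEnergyVariationalSolution.integrableOn_cutoffFlux (hp : IsPressureLaw p)
    (hh : IsPressurePotential p h) (hρhat : IsAngularLimit ρhat ∨ ∀ y, ρhat y = 0)
    (hsol : IsEnergyVariationalSolution α p h ρhat ρ₀ n₀ K ρinf ρ n E)
    (hb : IsReferencePair h ρb nb) (hdec : HasMultiplierDecay h ρinf ρb nb) {δ T : ℝ} (hδ : 0 < δ)
    (hF : IntegrableOn (fun z : ℝ × Space d =>
      (p (ρ z.1 z.2) - legendre h (ρb z.1 z.2)) • velocity (ρb z.1 z.2) (nb z.1 z.2))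
      (Ioo δ T ×ˢ univ)) :
    IntegrableOn (fun z : ℝ × Space d => cutoffFlux p h ρinf ρ n ρb nb z.1 z.2)
      (Ioo δ T ×ˢ univ) := by
  have hi := hsol.isReferencePair hh
  have hsub2 : Ioo δ T ⊆ Ici (0:ℝ) := fun x hx => mem_Ici.2 (hδ.trans hx.1).le
  have hsub : Ioo δ T ×ˢ (univ : Set (Space d)) ⊆ Ioo 0 T ×ˢ univ :=
    prod_mono (fun x hx => ⟨hδ.trans hx.1, hx.2⟩) Subset.rfl
  obtain ⟨hst, -⟩ := hsol.ae_isState_and_integrableOn hp hh T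
  obtain ⟨A, hA, hbd⟩ := hsol.exists_state_bounds hp hh hρhat T
  have hS := (hsol.integrableOn_weighted_shiftBound hp hh hb hdec T).mono_set hsub
  have e1 := aestronglyMeasurable_slab (densityMultiplier_continuousOn hi hb) hsub2 measurableSet_Ioo
  have e2 := aestronglyMeasurable_slab (momentumMultiplier_continuousOn hb) hsub2 measurableSet_Ioo
  have e3 := aestronglyMeasurable_slab (hb.legendre_continuousOn hh) hsub2 measurableSet_Ioo
  have e4 := aestronglyMeasurable_slab (hi.legendre_continuousOn hh) hsub2 measurableSet_Ioo
  have e5 := hsol.aestronglyMeasurable_density hsub2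
  have e6 := hsol.aestronglyMeasurable_momentum hsub2
  have ey : AEStronglyMeasurable (fun z : ℝ × Space d => z.2) (volume.restrict (Ioo δ T ×ˢ univ)) :=
    continuous_snd.aestronglyMeasurable
  have eh : AEStronglyMeasurable (fun z : ℝ × Space d => (1 / 2 : ℝ) • z.2)
      (volume.restrict (Ioo δ T ×ˢ univ)) := (by fun_prop : Continuous fun z : ℝ × Space d => (1 / 2 : ℝ) • z.2).aestronglyMeasurable
  have e7 : AEStronglyMeasurable (fun z : ℝ × Space d =>
      (inner ℝ (n z.1 z.2) (momentumMultiplier z.1 (ρb z.1 z.2) (nb z.1 z.2)) : ℝ))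
      (volume.restrict (Ioo δ T ×ˢ univ)) := e6.inner e2
  have e8 : AEStronglyMeasurable (fun z : ℝ × Space d => ρ z.1 z.2 / 2)
      (volume.restrict (Ioo δ T ×ˢ univ)) := (e5.aemeasurable.div_const 2).aestronglyMeasurable
  have e9 : AEStronglyMeasurable (fun z : ℝ × Space d => (ρ z.1 z.2)⁻¹)
      (volume.restrict (Ioo δ T ×ˢ univ)) := e5.aemeasurable.inv.aestronglyMeasurable
  have m1 : AEStronglyMeasurable (fun z : ℝ × Space d =>
      -(densityMultiplier h z.1 (ρinf z.1 z.2) (ρb z.1 z.2) (nb z.1 z.2)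
          • ((ρ z.1 z.2 / 2) • z.2 - n z.1 z.2))) (volume.restrict (Ioo δ T ×ˢ univ)) :=
    (e1.smul ((e8.smul ey).sub e6)).neg
  have m2 : AEStronglyMeasurable (fun z : ℝ × Space d =>
      (inner ℝ (n z.1 z.2) (momentumMultiplier z.1 (ρb z.1 z.2) (nb z.1 z.2)) : ℝ)
          • ((1 / 2 : ℝ) • z.2)) (volume.restrict (Ioo δ T ×ˢ univ)) :=
    e7.smul eh
  have m3 : AEStronglyMeasurable (fun z : ℝ × Space d =>
      ((ρ z.1 z.2)⁻¹ * (inner ℝ (n z.1 z.2) (momentumMultiplier z.1 (ρb z.1 z.2) (nb z.1 z.2)) : ℝ))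
          • n z.1 z.2) (volume.restrict (Ioo δ T ×ˢ univ)) :=
    (e9.mul e7).smul e6
  have m4 : AEStronglyMeasurable (fun z : ℝ × Space d =>
      (1 / 2 * (legendre h (ρb z.1 z.2) - legendre h (ρinf z.1 z.2))) • z.2)
      (volume.restrict (Ioo δ T ×ˢ univ)) :=
    ((e3.sub e4).const_mul _).smul ey
  have hrest : IntegrableOn (fun z : ℝ × Space d =>
      -(densityMultiplier h z.1 (ρinf z.1 z.2) (ρb z.1 z.2) (nb z.1 z.2)
          • ((ρ z.1 z.2 / 2) • z.2 - n z.1 z.2))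
        - (inner ℝ (n z.1 z.2) (momentumMultiplier z.1 (ρb z.1 z.2) (nb z.1 z.2)) : ℝ)
          • ((1 / 2 : ℝ) • z.2)
        + ((ρ z.1 z.2)⁻¹
            * (inner ℝ (n z.1 z.2) (momentumMultiplier z.1 (ρb z.1 z.2) (nb z.1 z.2)) : ℝ))
          • n z.1 z.2
        - (1 / 2 * (legendre h (ρb z.1 z.2) - legendre h (ρinf z.1 z.2))) • z.2)
      (Ioo δ T ×ˢ univ) := by
    -- The momentum multiplier occurs in two of the four terms, so the factor 3 is generous.
    refine Integrable.mono' (hS.const_mul (3 * A)) (((m1.sub m2).add m3).sub m4) ?_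
    filter_upwards [ae_mono (Measure.restrict_mono hsub le_rfl) hst,
      ae_restrict_mem (measurableSet_Ioo.prod MeasurableSet.univ)] with z h1 h2
    obtain ⟨g1, g2, g4, -, g3⟩ := hbd z.1 ⟨(hδ.trans h2.1.1).le, h2.1.2.le⟩ z.2 _ _ h1
    set φ := densityMultiplier h z.1 (ρinf z.1 z.2) (ρb z.1 z.2) (nb z.1 z.2) with hφ
    set ψ := momentumMultiplier z.1 (ρb z.1 z.2) (nb z.1 z.2) with hψ
    set Δ := legendre h (ρb z.1 z.2) - legendre h (ρinf z.1 z.2) with hΔ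
    set e := entropyValue h z.1 (ρ z.1 z.2) (n z.1 z.2) (ρinf z.1 z.2) 0 with he
    set B := A * (1 + e) with hB
    have hB1 : 1 ≤ B := by nlinarith
    have hρ := h1.nonneg
    have t1 : ‖-(φ • ((ρ z.1 z.2 / 2) • z.2 - n z.1 z.2))‖ ≤ |φ| * ((1 + ‖z.2‖) * B) := by
      rw [norm_neg, norm_smul, Real.norm_eq_abs]
      gcongr
      refine (norm_sub_le _ _).trans ?_
      rw [norm_smul, Real.norm_eq_abs, abs_of_nonneg (by positivity)]
      have := mul_le_mul_of_nonneg_right g1 (norm_nonneg z.2)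
      nlinarith [norm_nonneg z.2]
    have hin : ‖(inner ℝ (n z.1 z.2) ψ : ℝ)‖ ≤ ‖n z.1 z.2‖ * ‖ψ‖ := norm_inner_le_norm _ _
    have t2 : ‖(inner ℝ (n z.1 z.2) ψ : ℝ) • ((1 / 2 : ℝ) • z.2)‖ ≤ ‖ψ‖ * ((1 + ‖z.2‖) * B) := by
      rw [norm_smul, norm_smul]
      have h3 : ‖(1 / 2 : ℝ)‖ * ‖z.2‖ ≤ 1 + ‖z.2‖ := by
        norm_num; linarith [norm_nonneg z.2]
      calc _ ≤ (B * ‖ψ‖) * (1 + ‖z.2‖) := by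
            gcongr
            exact hin.trans (by gcongr)
        _ = _ := by ring
    have t3 : ‖((ρ z.1 z.2)⁻¹ * inner ℝ (n z.1 z.2) ψ) • n z.1 z.2‖
        ≤ ‖ψ‖ * ((1 + ‖z.2‖) * B) := by
      rw [norm_smul, norm_mul, norm_inv, Real.norm_eq_abs, abs_of_nonneg hρ]
      calc _ ≤ (ρ z.1 z.2)⁻¹ * (‖n z.1 z.2‖ * ‖ψ‖) * ‖n z.1 z.2‖ := by gcongr
        _ = ‖ψ‖ * (‖n z.1 z.2‖ ^ 2 / ρ z.1 z.2) := by ring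
        _ ≤ ‖ψ‖ * B := by gcongr; linarith
        _ ≤ _ := by
          gcongr
          exact le_mul_of_one_le_left (by linarith) (by linarith [norm_nonneg z.2])
    have t4 : ‖(1 / 2 * Δ) • z.2‖ ≤ |Δ| * ((1 + ‖z.2‖) * B) := by
      rw [norm_smul, norm_mul, mul_comm ‖(1/2:ℝ)‖, Real.norm_eq_abs Δ, mul_assoc]
      refine mul_le_mul_of_nonneg_left ?_ (abs_nonneg Δ)
      norm_num
      nlinarith [norm_nonneg z.2]
    have hX : 0 ≤ (1 + ‖z.2‖) * B := by positivity
    calc _ ≤ |φ| * ((1 + ‖z.2‖) * B) + ‖ψ‖ * ((1 + ‖z.2‖) * B) + ‖ψ‖ * ((1 + ‖z.2‖) * B)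
          + |Δ| * ((1 + ‖z.2‖) * B) := by
          refine (norm_sub_le _ _).trans (add_le_add ((norm_add_le _ _).trans
            (add_le_add ((norm_sub_le _ _).trans (add_le_add t1 t2)) t3)) t4)
      _ ≤ 3 * ((|φ| + ‖ψ‖ + |Δ|) * ((1 + ‖z.2‖) * B)) := by
          nlinarith [mul_nonneg (abs_nonneg φ) hX, mul_nonneg (abs_nonneg Δ) hX,
            mul_nonneg (norm_nonneg ψ) hX]
      _ = _ := by
          simp only [shiftBound, multiplierSize, ← hφ, ← hψ, ← hΔ, ← he, hB]
          ring
  refine (hrest.sub hF).congr (ae_of_all _ fun z => ?_)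
  simp only [cutoffFlux, Pi.sub_apply]
  abel

lemma IsEnergyVariationalSolution.norm_localIntegrand_le {χ : Space d → ℝ} {s C : ℝ} {y : Space d}
    (hχ : 0 ≤ χ y ∧ χ y ≤ 1) (hC : ‖fderiv ℝ χ y‖ ≤ C) :
    ‖localIntegrand α p h ρinf ρ n ρb nb χ s y‖ ≤ d * ‖entropyShift h ρinf ρb nb (ρ s) (n s) s y‖
      + ‖xiForm α p h ρ n ρb nb s y‖ + |α| * ‖ρ s y * ‖relVelocity ρ n ρb nb s y‖ ^ 2‖
      + (‖referenceForcing h ρinf ρ n s y‖ + |α| * ‖‖n s y‖ ^ 2 / ρ s y‖)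
      + C * ‖cutoffFlux p h ρinf ρ n ρb nb s y‖ := by
  have h1 : ‖-(d : ℝ) / 2 * (χ y * entropyShift h ρinf ρb nb (ρ s) (n s) s y)‖
      ≤ d * ‖entropyShift h ρinf ρb nb (ρ s) (n s) s y‖ := by
    rw [norm_mul, norm_mul, ← mul_assoc]
    gcongr
    rw [Real.norm_eq_abs, Real.norm_eq_abs, abs_of_nonneg hχ.1, neg_div, abs_neg,
      abs_of_nonneg (by positivity)]
    nlinarith [Nat.cast_nonneg (α := ℝ) d]
  have h2 : ‖χ y * (xiForm α p h ρ n ρb nb s y - α * (ρ s y * ‖relVelocity ρ n ρb nb s y‖ ^ 2))‖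
      ≤ ‖xiForm α p h ρ n ρb nb s y‖ + |α| * ‖ρ s y * ‖relVelocity ρ n ρb nb s y‖ ^ 2‖ := by
    rw [norm_mul, Real.norm_eq_abs (χ y), abs_of_nonneg hχ.1]
    refine (mul_le_of_le_one_left (norm_nonneg _) hχ.2).trans ((norm_sub_le _ _).trans ?_)
    rw [norm_mul α, Real.norm_eq_abs α]
  have h3 : ‖(1 - χ y) * (referenceForcing h ρinf ρ n s y - α * (‖n s y‖ ^ 2 / ρ s y))‖
      ≤ ‖referenceForcing h ρinf ρ n s y‖ + |α| * ‖‖n s y‖ ^ 2 / ρ s y‖ := by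
    rw [norm_mul, Real.norm_eq_abs (1 - χ y), abs_of_nonneg (by linarith [hχ.2])]
    refine (mul_le_of_le_one_left (norm_nonneg _) (by linarith [hχ.1])).trans
      ((norm_sub_le _ _).trans ?_)
    rw [norm_mul α, Real.norm_eq_abs α]
  have h4 : ‖fderiv ℝ χ y (cutoffFlux p h ρinf ρ n ρb nb s y)‖
      ≤ C * ‖cutoffFlux p h ρinf ρ n ρb nb s y‖ :=
    ((fderiv ℝ χ y).le_opNorm _).trans (by gcongr)
  unfold localIntegrand
  refine (norm_add_le _ _).trans (add_le_add ((norm_add_le _ _).trans (add_le_add ?_ h3)) h4)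
  rw [add_assoc]
  exact (norm_add_le _ _).trans (add_le_add h1 h2)

/-- Dominated convergence as the cut-off is dilated: eventually it equals 1 at each point, which
removes the remainder with 1 - χ, while its gradient is of order 1/(j+1) and removes the flux. -/
lemma IsEnergyVariationalSolution.tendsto_integral_localIntegrand (hp : IsPressureLaw p)
    (hh : IsPressurePotential p h) (hρhat : IsAngularLimit ρhat ∨ ∀ y, ρhat y = 0)
    (hsol : IsEnergyVariationalSolution α p h ρhat ρ₀ n₀ K ρinf ρ n E)
    (hb : IsReferencePair h ρb nb) (hdec : HasMultiplierDecay h ρinf ρb nb) {δ T : ℝ} (hδ : 0 < δ)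
    (hF : IntegrableOn (fun z : ℝ × Space d =>
      (p (ρ z.1 z.2) - legendre h (ρb z.1 z.2)) • velocity (ρb z.1 z.2) (nb z.1 z.2))
      (Ioo δ T ×ˢ univ))
    (hX : IntegrableOn (fun z : ℝ × Space d => xiForm α p h ρ n ρb nb z.1 z.2) (Ioo δ T ×ˢ univ))
    {χ : Space d → ℝ} (hχ : IsCutoff χ) {σ τ : ℝ} (hσ : δ < σ) (hτ : τ < T) :
    Tendsto (fun j => ∫ z in Ioc σ τ ×ˢ (univ : Set (Space d)),
        localIntegrand α p h ρinf ρ n ρb nb (dilate χ j) z.1 z.2) atTop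
      (𝓝 (∫ z in Ioc σ τ ×ˢ (univ : Set (Space d)),
        (-(d : ℝ) / 2 * entropyShift h ρinf ρb nb (ρ z.1) (n z.1) z.1 z.2
          + (xiForm α p h ρ n ρb nb z.1 z.2
            - α * (ρ z.1 z.2 * ‖relVelocity ρ n ρb nb z.1 z.2‖ ^ 2))))) := by
  obtain ⟨C, hC0, hC⟩ := hχ.exists_fderiv_dilate_le
  have s1 : Ioc σ τ ×ˢ (univ : Set (Space d)) ⊆ Ioo δ T ×ˢ univ :=
    prod_mono (fun x hx => ⟨hσ.trans hx.1, hx.2.trans_lt hτ⟩) Subset.rfl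
  have s2 : Ioc σ τ ×ˢ (univ : Set (Space d)) ⊆ Ioo 0 T ×ˢ univ :=
    prod_mono (fun x hx => ⟨(hδ.trans hσ).trans hx.1, hx.2.trans_lt hτ⟩) Subset.rfl
  have i1 := (hsol.integrableOn_entropyShift hp hh hρhat hb hdec T).mono_set s2
  have i2 := hX.mono_set s1
  have i3 := (hsol.integrableOn_relVelocity hp hh hρhat hb hdec T).mono_set s2
  have i4 : IntegrableOn (fun z : ℝ × Space d => referenceForcing h ρinf ρ n z.1 z.2)
      (Ioc σ τ ×ˢ univ) :=
    (hsol.forcing_integrable τ).mono_set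
      (prod_mono (fun x hx => ⟨(hδ.trans hσ).trans hx.1, hx.2⟩) Subset.rfl)
  have i5 := (hsol.integrableOn_kinetic hp hh hρhat T).mono_set s2
  have i6 := (hsol.integrableOn_cutoffFlux hp hh hρhat hb hdec hδ hF).mono_set s1
  refine tendsto_integral_of_dominated_convergence _ (fun j => ?_)
    (((((i1.norm.const_mul (d : ℝ)).add i2.norm).add (i3.norm.const_mul |α|)).add
      (i4.norm.add (i5.norm.const_mul |α|))).add (i6.norm.const_mul C))
    (fun j => ae_of_all _ fun z => ?_) (ae_of_all _ fun z => ?_)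
  · have hc : AEStronglyMeasurable (fun z : ℝ × Space d => dilate χ j z.2)
        (volume.restrict (Ioc σ τ ×ˢ univ)) :=
      ((dilate_contDiff hχ.contDiff j).continuous.comp continuous_snd).aestronglyMeasurable
    have hf : AEStronglyMeasurable (fun z : ℝ × Space d => fderiv ℝ (dilate χ j) z.2)
        (volume.restrict (Ioc σ τ ×ˢ univ)) :=
      (((dilate_contDiff hχ.contDiff_one j).continuous_fderiv (by norm_num)).comp
        continuous_snd).aestronglyMeasurable
    have m1 := (hc.mul i1.aestronglyMeasurable).const_mul (-(d : ℝ) / 2)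
    have m2 := hc.mul (i2.aestronglyMeasurable.sub (i3.aestronglyMeasurable.const_mul α))
    have m3 := (aestronglyMeasurable_const (b := (1:ℝ))|>.sub hc).mul
      (i4.aestronglyMeasurable.sub (i5.aestronglyMeasurable.const_mul α))
    have m4 := aestronglyMeasurable_apply hf i6.aestronglyMeasurable
    exact ((m1.add m2).add m3).add m4
  · refine norm_localIntegrand_le (hχ.mem_Icc _) ((hC j z.2).trans ?_)
    exact mul_le_of_le_one_right hC0 (inv_le_one_of_one_le₀ (by linarith [Nat.cast_nonneg (α := ℝ) j]))
  · have t1 : Tendsto (fun j : ℕ => fderiv ℝ (dilate χ j) z.2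
        (cutoffFlux p h ρinf ρ n ρb nb z.1 z.2)) atTop (𝓝 0) := by
      refine squeeze_zero_norm (a := fun j : ℕ => C * ((j : ℝ) + 1)⁻¹
        * ‖cutoffFlux p h ρinf ρ n ρb nb z.1 z.2‖) (fun j => ?_) ?_
      · exact ((fderiv ℝ (dilate χ j) z.2).le_opNorm _).trans (by gcongr; exact hC j z.2)
      · have : Tendsto (fun j : ℕ => ((j : ℝ) + 1)⁻¹) atTop (𝓝 0) := by
          simpa using tendsto_one_div_add_atTop_nhds_zero_nat (𝕜 := ℝ)
        simpa using (this.const_mul C).mul_const ‖cutoffFlux p h ρinf ρ n ρb nb z.1 z.2‖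
    have t2 : Tendsto (fun j => -(d : ℝ) / 2 * entropyShift h ρinf ρb nb (ρ z.1) (n z.1) z.1 z.2
          + (xiForm α p h ρ n ρb nb z.1 z.2
            - α * (ρ z.1 z.2 * ‖relVelocity ρ n ρb nb z.1 z.2‖ ^ 2))
          + fderiv ℝ (dilate χ j) z.2 (cutoffFlux p h ρinf ρ n ρb nb z.1 z.2)) atTop _ :=
      tendsto_const_nhds.add t1
    rw [add_zero] at t2
    refine t2.congr' ?_
    filter_upwards [eventually_dilate_eq_one hχ.eventually_eq_one z.2] with j hj
    simp only [localIntegrand, hj]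
    ring

/-- The weights of the truncated velocities converge, dominated in time. -/
structure IsTruncationControlled (h : ℝ → ℝ) (K : (Space d → Space d) → ℝ)
    (ρinf ρ : ℝ → Space d → ℝ) (n : ℝ → Space d → Space d) (E : ℝ → ℝ) (ρb : ℝ → Space d → ℝ)
    (nb : ℝ → Space d → Space d) (χ : Space d → ℝ) (δ T : ℝ) : Prop where
  tendsto : ∀ᵐ s ∂(volume.restrict (Ioo δ T)), Tendsto
    (fun j => K fun y => dilate χ j y • -velocity (ρb s y) (nb s y)) atTop
    (𝓝 (K fun y => -velocity (ρb s y) (nb s y)))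
  dominated : ∃ G : ℝ → ℝ, IntegrableOn G (Ioo δ T) ∧ ∃ N : ℕ, ∀ j ≥ N,
    ∀ᵐ s ∂(volume.restrict (Ioo δ T)),
      ‖K (fun y => dilate χ j y • -velocity (ρb s y) (nb s y)) * energyDefect h ρinf ρ n E s‖ ≤ G s

/-- A solution provides integrability only for weights of test fields. It is applied to the cut-off
momentum multiplier, and homogeneity removes the exponential factor. -/
lemma IsEnergyVariationalSolution.integrableOn_truncatedDefect
    (hsol : IsEnergyVariationalSolution α p h ρhat ρ₀ n₀ K ρinf ρ n E)
    (hb : IsReferencePair h ρb nb) {χ : Space d → ℝ} (hχ : ContDiff ℝ 1 χ)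
    (hχc : HasCompactSupport χ) {δ T : ℝ} (hδ : 0 < δ) (hδT : δ < T) :
    IntegrableOn (fun s => K (fun y => χ y • -velocity (ρb s y) (nb s y))
      * energyDefect h ρinf ρ n E s) (Ioo δ T) := by
  obtain ⟨θ, hθ, hθc, hθ0, hθ1⟩ := exists_time_cutoff hδ hδT
  have h1 := hsol.weight_integrable _
    (isSpaceTimeTest_cutoff (f := fun s y => momentumMultiplier s (ρb s y) (nb s y)) (momentumMultiplier_contDiffOn hb) hθ hθc hθ0 hχ hχc) T
  refine (h1.mono_set (fun x (hx : x ∈ Ioo δ T) =>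
    (⟨hδ.trans hx.1, hx.2.le⟩ : x ∈ Ioc 0 T))).congr ?_
  filter_upwards [ae_restrict_mem measurableSet_Ioo] with s hs
  rw [hsol.weight_cutoff hb hχ hχc (hδ.trans hs.1) (hθ1 s ⟨hs.1.le, hs.2.le⟩).eq_of_nhds]

/-- The weight of the full velocity is an almost everywhere limit in time of the weights of its
truncations. This supplies measurability, since no regularity of K is assumed, and the common bound
passes to the limit. -/
lemma IsTruncationControlled.integrableOn_weightedDefect
    (hsol : IsEnergyVariationalSolution α p h ρhat ρ₀ n₀ K ρinf ρ n E)
    (hb : IsReferencePair h ρb nb) {χ : Space d → ℝ} (hχ : IsCutoff χ) {δ T : ℝ} (hδ : 0 < δ)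
    (hδT : δ < T) (hW : IsTruncationControlled h K ρinf ρ n E ρb nb χ δ T) :
    IntegrableOn (weightedDefect h K ρinf ρ n E ρb nb) (Ioo δ T) := by
  obtain ⟨G, hG, N, hN⟩ := hW.dominated
  have hm := fun j => (hsol.integrableOn_truncatedDefect hb (dilate_contDiff hχ.contDiff_one j)
    (dilate_hasCompactSupport hχ.hasCompactSupport j) hδ hδT).aestronglyMeasurable
  have ht : ∀ᵐ s ∂(volume.restrict (Ioo δ T)), Tendsto
      (fun j => K (fun y => dilate χ j y • -velocity (ρb s y) (nb s y))
        * energyDefect h ρinf ρ n E s) atTop (𝓝 (weightedDefect h K ρinf ρ n E ρb nb s)) := by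
    filter_upwards [hW.tendsto] with s hs using hs.mul_const _
  refine Integrable.mono' hG (aestronglyMeasurable_of_tendsto_ae _ hm ht) ?_
  have hall : ∀ᵐ s ∂(volume.restrict (Ioo δ T)), ∀ j : ℕ, N ≤ j →
      ‖K (fun y => dilate χ j y • -velocity (ρb s y) (nb s y)) * energyDefect h ρinf ρ n E s‖
        ≤ G s := by
    rw [ae_all_iff]
    intro j
    by_cases hj : N ≤ j
    · filter_upwards [hN j hj] with s hs _ using hs
    · exact ae_of_all _ fun s h => absurd h hj
  filter_upwards [hall, ht] with s h1 h2
  exact le_of_tendsto h2.norm (eventually_atTop.2 ⟨N, h1⟩)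

/-- The entropy relative to ρ_∞ cancels in ℛ by `IsFiniteSlice.shift`. What remains is the quantity
whose increments the tested inequality bounds. -/
lemma IsEnergyVariationalSolution.ae_modifiedEntropy_eq (hp : IsPressureLaw p)
    (hh : IsPressurePotential p h) (hρhat : IsAngularLimit ρhat ∨ ∀ y, ρhat y = 0)
    (hsol : IsEnergyVariationalSolution α p h ρhat ρ₀ n₀ K ρinf ρ n E)
    (hb : IsReferencePair h ρb nb) (hdec : HasMultiplierDecay h ρinf ρb nb) :
    ∀ᵐ τ ∂(volume.restrict (Ioi (0 : ℝ))), modifiedEntropy h ρinf ρ n E ρb nb τ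
      = E τ + ∫ y, entropyShift h ρinf ρb nb (ρ τ) (n τ) τ y := by
  filter_upwards [hsol.ae_isFiniteSlice hp hh, ae_restrict_mem measurableSet_Ioi] with τ h1 h2
  have := (h1.1.shift hp hh hρhat hsol hb hdec (le_of_lt h2)).2.2
  rw [modifiedEntropy, energyDefect, this]
  ring

lemma IsEnergyVariationalSolution.integrableOn_modifiedEntropy (hp : IsPressureLaw p)
    (hh : IsPressurePotential p h) (hρhat : IsAngularLimit ρhat ∨ ∀ y, ρhat y = 0)
    (hsol : IsEnergyVariationalSolution α p h ρhat ρ₀ n₀ K ρinf ρ n E)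
    (hb : IsReferencePair h ρb nb) (hdec : HasMultiplierDecay h ρinf ρb nb) (T : ℝ) :
    IntegrableOn (modifiedEntropy h ρinf ρ n E ρb nb) (Ioo 0 T) := by
  have h1 := hsol.integrableOn_entropyShift hp hh hρhat hb hdec T
  rw [IntegrableOn, restrict_slab] at h1
  refine ((hsol.integrableOn_energy T).add h1.integral_prod_left).congr ?_
  filter_upwards [ae_mono (Measure.restrict_mono (Ioo_subset_Ioi_self) le_rfl)
    (hsol.ae_modifiedEntropy_eq hp hh hρhat hb hdec)] with τ hτ using hτ.symm

/-- The relative entropy inequality between two positive times. -/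
lemma IsEnergyVariationalSolution.relative_entropy_le (hp : IsPressureLaw p)
    (hh : IsPressurePotential p h) (hρhat : IsAngularLimit ρhat ∨ ∀ y, ρhat y = 0)
    (hsol : IsEnergyVariationalSolution α p h ρhat ρ₀ n₀ K ρinf ρ n E)
    (hb : IsReferencePair h ρb nb) (hdec : HasMultiplierDecay h ρinf ρb nb) {δ T : ℝ} (hδ : 0 < δ)
    (hδT : δ < T)
    (hF : IntegrableOn (fun z : ℝ × Space d =>
      (p (ρ z.1 z.2) - legendre h (ρb z.1 z.2)) • velocity (ρb z.1 z.2) (nb z.1 z.2))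
      (Ioo δ T ×ˢ univ))
    (hX : IntegrableOn (fun z : ℝ × Space d => xi α p h ρ n ρb nb z.1 z.2) (Ioo δ T ×ˢ univ))
    (hxi : ∀ s, 0 < s → ∀ y, IsState (ρ s y) (n s y) →
      xi α p h ρ n ρb nb s y = xiForm α p h ρ n ρb nb s y)
    {χ : Space d → ℝ} (hχ : IsCutoff χ)
    (hW : IsTruncationControlled h K ρinf ρ n E ρb nb χ δ T) :
    ∀ᵐ σ ∂(volume.restrict (Ioi δ)), ∀ᵐ τ ∂(volume.restrict (Ioi σ)), τ < T →
      modifiedEntropy h ρinf ρ n E ρb nb τ - modifiedEntropy h ρinf ρ n E ρb nb σ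
        ≤ ∫ s in σ..τ, (bigXi α p h ρ n ρb nb s + weightedDefect h K ρinf ρ n E ρb nb s
          - ((d : ℝ) / 2 * modifiedEntropy h ρinf ρ n E ρb nb s + dissipation α ρ n ρb nb s)) := by
  have hst := (hsol.ae_isState_and_integrableOn hp hh T).1
  have hsubδ : Ioo δ T ×ˢ (univ : Set (Space d)) ⊆ Ioo 0 T ×ˢ univ :=
    prod_mono (fun x hx => ⟨hδ.trans hx.1, hx.2⟩) Subset.rfl
  have hxi' : ∀ᵐ z ∂((volume : Measure (ℝ × Space d)).restrict (Ioo δ T ×ˢ univ)),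
      xi α p h ρ n ρb nb z.1 z.2 = xiForm α p h ρ n ρb nb z.1 z.2 := by
    filter_upwards [ae_mono (Measure.restrict_mono hsubδ le_rfl) hst,
      ae_restrict_mem (measurableSet_Ioo.prod MeasurableSet.univ)] with z h1 h2
    exact hxi z.1 (hδ.trans h2.1.1) z.2 h1
  have hX' : IntegrableOn (fun z : ℝ × Space d => xiForm α p h ρ n ρb nb z.1 z.2)
      (Ioo δ T ×ˢ univ) := hX.congr hxi'
  have hWi := hW.integrableOn_weightedDefect hsol hb hχ hδ hδT
  obtain ⟨G, hG, N, hN⟩ := hW.dominated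
  have hQ := hsol.ae_modifiedEntropy_eq hp hh hρhat hb hdec
  have hQδ := ae_mono (Measure.restrict_mono (Ioi_subset_Ioi hδ.le) le_rfl) hQ
  have hsl := hsol.ae_isFiniteSlice hp hh
  have hslδ := ae_mono (Measure.restrict_mono (Ioi_subset_Ioi hδ.le) le_rfl) hsl
  have hloc := fun j => hsol.localized_inequality hp hh hρhat hb hdec
    (dilate_contDiff hχ.contDiff_one j) (dilate_hasCompactSupport hχ.hasCompactSupport j) hδ hδT
  filter_upwards [ae_all_iff.2 hloc, hQδ, hslδ, ae_restrict_mem measurableSet_Ioi] with σ h1 h2 h3 hσ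
  have hσ0 : 0 < σ := hδ.trans hσ
  have hres : volume.restrict (Ioi σ) ≤ volume.restrict (Ioi (0:ℝ)) :=
    Measure.restrict_mono (Ioi_subset_Ioi hσ0.le) le_rfl
  filter_upwards [ae_all_iff.2 h1, ae_mono hres hQ, ae_mono hres hsl,
    ae_restrict_mem measurableSet_Ioi] with τ h4 h5 h6 hτ hτT
  have hστ : σ ≤ τ := le_of_lt hτ
  have s1 : Ioc σ τ ⊆ Ioo δ T := fun x hx => ⟨hσ.trans hx.1, hx.2.trans_lt hτT⟩
  have s2 : Ioc σ τ ⊆ Ioo 0 T := fun x hx => ⟨hσ0.trans hx.1, hx.2.trans_lt hτT⟩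
  -- convergence of the left-hand side
  have hleft : ∀ s, 0 < s → IsFiniteSlice h s (ρinf s) (ρ s) (n s) →
      Tendsto (fun j => ∫ y, dilate χ j y * entropyShift h ρinf ρb nb (ρ s) (n s) s y) atTop
        (𝓝 (∫ y, entropyShift h ρinf ρb nb (ρ s) (n s) s y)) := by
    intro s hs hsl
    have hi := (hsl.shift hp hh hρhat hsol hb hdec hs.le).1
    refine tendsto_integral_of_dominated_convergence _ (fun j =>
      (dilate_contDiff hχ.contDiff j).continuous.aestronglyMeasurable.mul hi.aestronglyMeasurable)
      hi.norm (fun j => ae_of_all _ fun y => ?_) (ae_of_all _ fun y => ?_)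
    · have h01 : 0 ≤ dilate χ j y ∧ dilate χ j y ≤ 1 := hχ.mem_Icc _
      rw [norm_mul, Real.norm_eq_abs, abs_of_nonneg h01.1]
      exact mul_le_of_le_one_left (norm_nonneg _) h01.2
    · refine tendsto_const_nhds.congr' ?_
      filter_upwards [eventually_dilate_eq_one hχ.eventually_eq_one y] with j hj
      rw [hj, one_mul]
  have hE : IntegrableOn (fun s => (d : ℝ) / 2 * E s) (Ioc σ τ) :=
    ((hsol.integrableOn_energy T).mono_set s2).const_mul _
  -- For the weight both the pointwise limit and the dominating function come from the truncation
  -- hypothesis, since K need not be continuous.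
  have hweight : Tendsto (fun j => ∫ s in σ..τ,
      (K (fun y => dilate χ j y • -velocity (ρb s y) (nb s y)) * energyDefect h ρinf ρ n E s
        - (d : ℝ) / 2 * E s)) atTop
      (𝓝 (∫ s in σ..τ, (weightedDefect h K ρinf ρ n E ρb nb s - (d : ℝ) / 2 * E s))) := by
    simp only [intervalIntegral.integral_of_le hστ]
    refine tendsto_integral_filter_of_dominated_convergence
      (fun s => G s + ‖(d : ℝ) / 2 * E s‖) (Eventually.of_forall fun j => ?_) ?_
      ((hG.mono_set s1).add hE.norm) ?_
    · exact ((hsol.integrableOn_truncatedDefect hb (dilate_contDiff hχ.contDiff_one j)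
        (dilate_hasCompactSupport hχ.hasCompactSupport j) hδ hδT).aestronglyMeasurable.mono_measure
          (Measure.restrict_mono s1 le_rfl)).sub hE.aestronglyMeasurable
    · refine eventually_atTop.2 ⟨N, fun j hj => ?_⟩
      filter_upwards [ae_mono (Measure.restrict_mono s1 le_rfl) (hN j hj)] with s hs
      exact (norm_sub_le _ _).trans (by gcongr)
    · filter_upwards [ae_mono (Measure.restrict_mono s1 le_rfl) hW.tendsto] with s hs
      exact (hs.mul_const _).sub_const _
  -- The exceptional sets of the countably many cut-offs were united beforehand, so the limit can be
  -- taken at fixed σ and τ.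
  have hlim := le_of_tendsto_of_tendsto'
    (((hleft τ (hσ0.trans_le hστ) h6.1).const_add (E τ)).sub
      ((hleft σ hσ0 h3.1).const_add (E σ)))
    ((hsol.tendsto_integral_localIntegrand hp hh hρhat hb hdec hδ hF hX' hχ hσ hτT).add hweight)
    (fun j => h4 j hτT)
  rw [h5, h2]
  refine hlim.trans (le_of_eq ?_)
  have r1 := (hsol.integrableOn_entropyShift hp hh hρhat hb hdec T).mono_set
    (prod_mono s2 (Subset.refl (univ : Set (Space d))))
  have r2 := hX.mono_set (prod_mono s1 (Subset.refl (univ : Set (Space d))))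
  have r3 := (hsol.integrableOn_relVelocity hp hh hρhat hb hdec T).mono_set
    (prod_mono s2 (Subset.refl (univ : Set (Space d))))
  have hcongr : ∫ z in Ioc σ τ ×ˢ (univ : Set (Space d)),
        (-(d : ℝ) / 2 * entropyShift h ρinf ρb nb (ρ z.1) (n z.1) z.1 z.2
          + (xiForm α p h ρ n ρb nb z.1 z.2
            - α * (ρ z.1 z.2 * ‖relVelocity ρ n ρb nb z.1 z.2‖ ^ 2)))
      = ∫ z in Ioc σ τ ×ˢ (univ : Set (Space d)),
        (-(d : ℝ) / 2 * entropyShift h ρinf ρb nb (ρ z.1) (n z.1) z.1 z.2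
          + (xi α p h ρ n ρb nb z.1 z.2
            - α * (ρ z.1 z.2 * ‖relVelocity ρ n ρb nb z.1 z.2‖ ^ 2))) := by
    refine integral_congr_ae ?_
    filter_upwards [ae_mono (Measure.restrict_mono (prod_mono s1 Subset.rfl) le_rfl) hxi'] with z hz
    rw [hz]
  have hsplit : ∫ z in Ioc σ τ ×ˢ (univ : Set (Space d)),
        (-(d : ℝ) / 2 * entropyShift h ρinf ρb nb (ρ z.1) (n z.1) z.1 z.2
          + (xi α p h ρ n ρb nb z.1 z.2
            - α * (ρ z.1 z.2 * ‖relVelocity ρ n ρb nb z.1 z.2‖ ^ 2)))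
      = ∫ s in σ..τ, (-(d : ℝ) / 2 * (∫ y, entropyShift h ρinf ρb nb (ρ s) (n s) s y)
          + (bigXi α p h ρ n ρb nb s - dissipation α ρ n ρb nb s)) := by
    have r4 : IntegrableOn (fun z : ℝ × Space d =>
        -(d : ℝ) / 2 * entropyShift h ρinf ρb nb (ρ z.1) (n z.1) z.1 z.2
          + (xi α p h ρ n ρb nb z.1 z.2
            - α * (ρ z.1 z.2 * ‖relVelocity ρ n ρb nb z.1 z.2‖ ^ 2))) (Ioc σ τ ×ˢ univ) :=
      (r1.const_mul (-(d : ℝ) / 2)).add (r2.sub (r3.const_mul α))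
    rw [← intervalIntegral_integral_eq (f := fun s y =>
        -(d : ℝ) / 2 * entropyShift h ρinf ρb nb (ρ s) (n s) s y
          + (xi α p h ρ n ρb nb s y - α * (ρ s y * ‖relVelocity ρ n ρb nb s y‖ ^ 2))) hστ r4,
      intervalIntegral.integral_of_le hστ, intervalIntegral.integral_of_le hστ]
    rw [IntegrableOn, restrict_slab] at r1 r2 r3
    refine integral_congr_ae ?_
    filter_upwards [r1.prod_right_ae, r2.prod_right_ae, r3.prod_right_ae] with s q1 q2 q3
    have e1 := integral_add' (q1.const_mul (-(d : ℝ) / 2)) (q2.sub (q3.const_mul α))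
    refine e1.trans ?_
    rw [integral_sub' q2 (q3.const_mul α), integral_const_mul, integral_const_mul]
    rfl
  rw [IntegrableOn, restrict_slab] at r1 r2 r3
  have j1 : IntervalIntegrable (fun s => -(d : ℝ) / 2 *
      (∫ y, entropyShift h ρinf ρb nb (ρ s) (n s) s y)
      + (bigXi α p h ρ n ρb nb s - dissipation α ρ n ρb nb s)) volume σ τ := by
    rw [intervalIntegrable_iff_integrableOn_Ioc_of_le hστ]
    exact (r1.integral_prod_left.const_mul _).add
      (r2.integral_prod_left.sub (r3.integral_prod_left.const_mul α))
  have j2 : IntervalIntegrable (fun s => weightedDefect h K ρinf ρ n E ρb nb s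
      - (d : ℝ) / 2 * E s) volume σ τ := by
    rw [intervalIntegrable_iff_integrableOn_Ioc_of_le hστ]
    exact (hWi.mono_set s1).sub hE
  rw [hcongr, hsplit, ← intervalIntegral.integral_add j1 j2, intervalIntegral.integral_of_le hστ,
    intervalIntegral.integral_of_le hστ]
  refine integral_congr_ae ?_
  -- The factor d/2 in front of E and the one in front of the affine integral combine into d/2 times
  -- ℛ.
  filter_upwards [ae_mono (Measure.restrict_mono (fun x hx => (s2 hx).1) le_rfl) hQ] with s hs
  rw [hs]
  ring

end Solution

end

section

/-! ### The initial time -/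

section Approximation

lemma exists_ball_cutoff {R : ℝ} (hR : 0 ≤ R) : ∃ χ : Space d → ℝ, ContDiff ℝ 1 χ ∧
    HasCompactSupport χ ∧ (∀ y, 0 ≤ χ y ∧ χ y ≤ 1) ∧ (∀ y, ‖y‖ ≤ R → χ y = 1) ∧
    ∀ y, R + 1 < ‖y‖ → χ y = 0 := by
  let b : ContDiffBump (0 : Space d) := ⟨R + 1 / 2, R + 1, by linarith, by linarith⟩
  refine ⟨b, b.contDiff, b.hasCompactSupport, fun y => ⟨b.nonneg, b.le_one⟩, fun y hy => ?_,
    fun y hy => ?_⟩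
  · refine b.one_of_mem_closedBall ?_
    rw [mem_closedBall_zero_iff]
    simp only [b]
    linarith
  · refine b.zero_of_le_dist ?_
    rw [dist_zero_right]
    exact hy.le

/-- Multiplication by a cut-off which is 1 on the ball makes the function uniformly continuous, and
uniformly continuous functions have uniform smooth approximations. -/
lemma exists_contDiff_approx {F : Type*} [NormedAddCommGroup F] [NormedSpace ℝ F] [CompleteSpace F]
    {f : Space d → F} (hf : Continuous f) {R η : ℝ} (hR : 0 ≤ R) (hη : 0 < η) :
    ∃ g : Space d → F, ContDiff ℝ 1 g ∧ ∀ y, ‖y‖ ≤ R → ‖g y - f y‖ ≤ η := by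
  obtain ⟨χ, hχ, hχc, -, h1, -⟩ := exists_ball_cutoff (d := d) hR
  have hu : UniformContinuous fun y => χ y • f y :=
    (hχc.smul_right (f' := f)).uniformContinuous_of_continuous (hχ.continuous.smul hf)
  obtain ⟨g, hg, hgd⟩ := hu.exists_contDiff_dist_le hη
  refine ⟨g, hg.of_le (by exact_mod_cast le_top), fun y hy => ?_⟩
  have := hgd y
  rw [h1 y hy, one_smul, dist_eq_norm] at this
  exact this.le

lemma exists_time_modulus {F : Type*} [NormedAddCommGroup F] {f : ℝ × Space d → F}
    (hf : ContinuousOn f (Ici 0 ×ˢ univ)) (R : ℝ) {η : ℝ} (hη : 0 < η) :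
    ∃ t > 0, ∀ τ ∈ Ico 0 t, ∀ y, ‖y‖ ≤ R → ‖f (τ, y) - f (0, y)‖ ≤ η := by
  have hc : IsCompact (Icc (0:ℝ) 1 ×ˢ Metric.closedBall (0 : Space d) R) :=
    isCompact_Icc.prod (isCompact_closedBall _ _)
  have hu := hc.uniformContinuousOn_of_continuous
    (hf.mono fun z hz => ⟨hz.1.1, mem_univ _⟩ :
      ContinuousOn f (Icc 0 1 ×ˢ Metric.closedBall 0 R))
  obtain ⟨t, ht, h⟩ := Metric.uniformContinuousOn_iff_le.1 hu η hη
  refine ⟨min t 1, lt_min ht one_pos, fun τ hτ y hy => ?_⟩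
  rw [← dist_eq_norm]
  have hy' : y ∈ Metric.closedBall (0 : Space d) R := by simpa using hy
  have h1 : τ < t := hτ.2.trans_le (min_le_left _ _)
  have h2 : τ < 1 := hτ.2.trans_le (min_le_right _ _)
  refine h (τ, y) ⟨⟨hτ.1, h2.le⟩, hy'⟩ (0, y) ⟨⟨le_rfl, zero_le_one⟩, hy'⟩ ?_
  rw [Prod.dist_eq, dist_self, Real.dist_eq, sub_zero, abs_of_nonneg hτ.1]
  exact max_le h1.le ht.le

lemma isSpaceTimeTest_initial {F : Type*} [NormedAddCommGroup F] [NormedSpace ℝ F]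
    {g : Space d → F} (hg : ContDiff ℝ 1 g) {θ : ℝ → ℝ} (hθ : ContDiff ℝ 1 θ)
    (hθc : HasCompactSupport θ) {χ : Space d → ℝ} (hχ : ContDiff ℝ 1 χ)
    (hχc : HasCompactSupport χ) : IsSpaceTimeTest fun s y => (θ s * χ y) • g y := by
  refine ⟨((hθ.comp contDiff_fst).mul (hχ.comp contDiff_snd)).smul (hg.comp contDiff_snd),
    HasCompactSupport.intro (hθc.isCompact.prod hχc.isCompact) ?_⟩
  rintro ⟨s, y⟩ hz
  simp only [Function.uncurry]
  rw [mem_prod, not_and_or] at hz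
  rcases hz with hz | hz
  · rw [image_eq_zero_of_notMem_tsupport hz, zero_mul, zero_smul]
  · rw [image_eq_zero_of_notMem_tsupport hz, mul_zero, zero_smul]

end Approximation

section Solution

variable {α : ℝ} {p h : ℝ → ℝ} {ρhat ρ₀ : Space d → ℝ} {n₀ : Space d → Space d}
  {K : (Space d → Space d) → ℝ} {ρinf ρ : ℝ → Space d → ℝ} {n : ℝ → Space d → Space d} {E : ℝ → ℝ}
  {ρb : ℝ → Space d → ℝ} {nb : ℝ → Space d → Space d}

/-- The difference of relative entropies depends continuously on the multipliers. -/
lemma IsEnergyVariationalSolution.exists_entropyShift_approx (hp : IsPressureLaw p)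
    (hh : IsPressurePotential p h) (hρhat : IsAngularLimit ρhat ∨ ∀ y, ρhat y = 0)
    (hsol : IsEnergyVariationalSolution α p h ρhat ρ₀ n₀ K ρinf ρ n E)
    (hb : IsReferencePair h ρb nb) (hdec : HasMultiplierDecay h ρinf ρb nb) {B ε : ℝ}
    (hB : 0 ≤ B) (hε : 0 < ε) :
    ∃ R η : ℝ, 0 ≤ R ∧ 0 < η ∧ ∀ (χ gφ gΔ : Space d → ℝ) (gψ : Space d → Space d),
      Continuous χ → Continuous gφ → Continuous gψ → Continuous gΔ → (∀ y, 0 ≤ χ y ∧ χ y ≤ 1) →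
      (∀ y, ‖y‖ ≤ R → χ y = 1) → (∀ y, R + 1 < ‖y‖ → χ y = 0) →
      ∀ τ ∈ Icc (0:ℝ) 1, ∀ r m, IsFiniteSlice h τ (ρinf τ) r m →
      (relEntropy h τ r m (ρinf τ) 0).toReal ≤ B →
      (∀ y, ‖y‖ ≤ R + 1 →
        ‖gφ y - densityMultiplier h τ (ρinf τ y) (ρb τ y) (nb τ y)‖ ≤ η ∧
        ‖gψ y - momentumMultiplier τ (ρb τ y) (nb τ y)‖ ≤ η ∧
        ‖gΔ y - (legendre h (ρb τ y) - legendre h (ρinf τ y))‖ ≤ η) →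
      Integrable (fun y => χ y * (gφ y * r y + inner ℝ (gψ y) (m y) + gΔ y)) ∧
      |(∫ y, entropyShift h ρinf ρb nb r m τ y)
        - ∫ y, χ y * (gφ y * r y + inner ℝ (gψ y) (m y) + gΔ y)| ≤ ε := by
  have hi := hsol.isReferencePair hh
  obtain ⟨C, hC, htail⟩ := exists_shiftBound_tail hp hh hi hb hdec 1
  obtain ⟨A, hA, hbd⟩ := hsol.exists_state_bounds hp hh hρhat 1
  have hA0 : 0 < A := by linarith
  -- The tail outside radius R costs at most D/(1 + R). With R = 2D/ε this is at most ε/2.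
  set D := A * (C * (1 + B)) with hD
  have hD0 : 0 ≤ D := by positivity
  set R := 2 * D / ε with hR
  have hR0 : 0 ≤ R := by positivity
  set V := (volume (Metric.closedBall (0 : Space d) (R + 1))).toReal with hV
  have hV0 : 0 ≤ V := ENNReal.toReal_nonneg
  -- Three multiplier errors of size η, each against A(1 + entropy), cost at most 3Aη(V + B) on the
  -- ball of volume V; this η makes the cost at most ε/2, with 1 added to keep the denominator
  -- positive.
  refine ⟨R, ε / (6 * A * (V + B + 1)), hR0, by positivity, ?_⟩
  set η := ε / (6 * A * (V + B + 1)) with hη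
  have hη0 : 0 < η := by positivity
  intro χ gφ gΔ gψ cχ cφ cψ cΔ hχ hχ1 hχ0 τ hτ r m hsl hEB hclose
  obtain ⟨hS, hS2⟩ := htail τ hτ r m hsl
  have hq := (hsl.shift hp hh hρhat hsol hb hdec hτ.1).1
  set k := Metric.closedBall (0 : Space d) R
  set k' := Metric.closedBall (0 : Space d) (R + 1)
  have hk : MeasurableSet k := measurableSet_closedBall
  have hk' : MeasurableSet k' := measurableSet_closedBall
  set e := fun y => entropyValue h τ (r y) (m y) (ρinf τ y) 0 with he
  have hconst : IntegrableOn (fun _ : Space d => (1:ℝ)) k' :=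
    integrableOn_const (measure_closedBall_lt_top.ne)
  -- Outside radius R the whole affine function may be lost; inside radius R + 1 only the
  -- approximation error occurs. On the annulus both are counted.
  set bnd : Space d → ℝ := fun y => kᶜ.indicator (fun y => A * shiftBound h ρinf ρb nb r m τ y) y
    + k'.indicator (fun y => (3 * A * η) * (1 + e y)) y with hbnd
  have b1 : Integrable (kᶜ.indicator fun y => A * shiftBound h ρinf ρb nb r m τ y) :=
    (hS.const_mul A).indicator hk.compl
  have b2 : Integrable (k'.indicator fun y => (3 * A * η) * (1 + e y)) :=
    (integrable_indicator_iff hk').2 ((hconst.add hsl.integrable.integrableOn).const_mul _)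
  have hm : AEStronglyMeasurable (fun y => χ y * (gφ y * r y + inner ℝ (gψ y) (m y) + gΔ y)) :=
    cχ.aestronglyMeasurable.mul (((cφ.aestronglyMeasurable.mul
      hsl.aemeasurable_density.aestronglyMeasurable).add (cψ.aestronglyMeasurable.inner
        hsl.aemeasurable_momentum.aestronglyMeasurable)).add cΔ.aestronglyMeasurable)
  have hpt : ∀ᵐ y, ‖entropyShift h ρinf ρb nb r m τ y
      - χ y * (gφ y * r y + inner ℝ (gψ y) (m y) + gΔ y)‖ ≤ bnd y := by
    filter_upwards [hsl.isState] with y hy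
    obtain ⟨g1, g2, -, -, g3⟩ := hbd τ hτ y _ _ hy
    have he0 : 0 ≤ e y := g3
    set A' := A * (1 + e y) with hA'
    have hA1 : 1 ≤ A' := by nlinarith
    have hr : |r y| ≤ A' := by rwa [abs_of_nonneg hy.nonneg]
    have hq1 := abs_entropyShift_le (h := h) (ρinf := ρinf) (ρb := ρb) (nb := nb) (τ := τ) hA1 hr g2
    have n1 : (1 - χ y) * |entropyShift h ρinf ρb nb r m τ y|
        ≤ kᶜ.indicator (fun y => A * shiftBound h ρinf ρb nb r m τ y) y := by
      by_cases hyk : y ∈ k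
      · rw [indicator_of_notMem (by simpa using hyk), hχ1 y (by simpa [k] using hyk)]
        simp
      · rw [indicator_of_mem (by simpa using hyk)]
        refine (mul_le_of_le_one_left (abs_nonneg _) (by linarith [(hχ y).1])).trans
          (hq1.trans (le_of_eq ?_))
        rw [shiftBound, hA', he]
        ring
    have n2 : χ y * |entropyShift h ρinf ρb nb r m τ y
        - (gφ y * r y + inner ℝ (gψ y) (m y) + gΔ y)|
        ≤ k'.indicator (fun y => (3 * A * η) * (1 + e y)) y := by
      by_cases hyk : y ∈ k'
      · rw [indicator_of_mem hyk]
        refine (mul_le_of_le_one_left (abs_nonneg _) (hχ y).2).trans ?_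
        obtain ⟨c1, c2, c3⟩ := hclose y (by simpa [k'] using hyk)
        set φ := densityMultiplier h τ (ρinf τ y) (ρb τ y) (nb τ y) with hφ
        set ψ := momentumMultiplier τ (ρb τ y) (nb τ y) with hψ
        set Δ := legendre h (ρb τ y) - legendre h (ρinf τ y) with hΔ
        have e1 : entropyShift h ρinf ρb nb r m τ y - (gφ y * r y + inner ℝ (gψ y) (m y) + gΔ y)
            = -((gφ y - φ) * r y + inner ℝ (gψ y - ψ) (m y) + (gΔ y - Δ)) := by
          rw [entropyShift, ← hφ, ← hψ, ← hΔ, inner_sub_left]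
          ring
        rw [e1, abs_neg]
        refine (abs_add_three _ _ _).trans ?_
        have d1 : |(gφ y - φ) * r y| ≤ η * A' := by
          rw [abs_mul]; exact mul_le_mul c1 hr (abs_nonneg _) hη0.le
        have d2 : |(inner ℝ (gψ y - ψ) (m y) : ℝ)| ≤ η * A' :=
          (abs_real_inner_le_norm _ _).trans (mul_le_mul c2 g2 (norm_nonneg _) hη0.le)
        have d3 : |gΔ y - Δ| ≤ η * A' := le_trans c3 (le_mul_of_one_le_right hη0.le hA1)
        calc _ ≤ η * A' + η * A' + η * A' := add_le_add (add_le_add d1 d2) d3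
          _ = _ := by rw [hA']; ring
      · rw [indicator_of_notMem hyk, hχ0 y (by simpa [k'] using hyk)]
        simp
    rw [Real.norm_eq_abs]
    have e2 : entropyShift h ρinf ρb nb r m τ y
        - χ y * (gφ y * r y + inner ℝ (gψ y) (m y) + gΔ y)
        = (1 - χ y) * entropyShift h ρinf ρb nb r m τ y + χ y * (entropyShift h ρinf ρb nb r m τ y
          - (gφ y * r y + inner ℝ (gψ y) (m y) + gΔ y)) := by ring
    rw [e2]
    refine (abs_add_le _ _).trans (add_le_add ?_ ?_)
    · rwa [abs_mul, abs_of_nonneg (by linarith [(hχ y).2])]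
    · rwa [abs_mul, abs_of_nonneg (hχ y).1]
  have hdiff : Integrable fun y => entropyShift h ρinf ρb nb r m τ y
      - χ y * (gφ y * r y + inner ℝ (gψ y) (m y) + gΔ y) :=
    Integrable.mono' (b1.add b2) (hq.aestronglyMeasurable.sub hm) hpt
  have hint : Integrable (fun y => χ y * (gφ y * r y + inner ℝ (gψ y) (m y) + gΔ y)) := by
    refine (hq.sub hdiff).congr (ae_of_all _ fun y => ?_)
    simp
  refine ⟨hint, ?_⟩
  rw [← integral_sub hq hint]
  refine (norm_integral_le_of_norm_le (b1.add b2) hpt).trans ?_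
  have t1 : ∫ y, kᶜ.indicator (fun y => A * shiftBound h ρinf ρb nb r m τ y) y ≤ ε / 2 := by
    rw [integral_indicator hk.compl, integral_const_mul]
    have h1 := hS2 R hR0
    have h2 : (1 + R)⁻¹ * (C * (1 + (relEntropy h τ r m (ρinf τ) 0).toReal))
        ≤ (1 + R)⁻¹ * (C * (1 + B)) := by gcongr
    calc _ ≤ A * ((1 + R)⁻¹ * (C * (1 + B))) := by gcongr; exact h1.trans h2
      _ = D / (1 + R) := by rw [hD]; ring
      _ ≤ ε / 2 := by
        rw [div_le_iff₀ (by positivity)]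
        have : ε * R = 2 * D := by rw [hR]; field_simp
        nlinarith
  have t2 : ∫ y, k'.indicator (fun y => (3 * A * η) * (1 + e y)) y ≤ ε / 2 := by
    rw [integral_indicator hk', integral_const_mul,
      integral_add hconst hsl.integrable.integrableOn]
    have h1 : ∫ y in k', e y ≤ B := by
      refine (setIntegral_le_integral hsl.integrable ?_).trans (hsl.integral_eq.le.trans hEB)
      filter_upwards [hsl.isState] with y hy
      exact (hbd τ hτ y _ _ hy).2.2.2.2
    have h2 : ∫ _ in k', (1:ℝ) = V := by simp [hV, k', Measure.real]
    rw [h2]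
    calc _ ≤ 3 * A * η * (V + B) := by gcongr
      _ ≤ 3 * A * η * (V + B + 1) :=
          mul_le_mul_of_nonneg_left (by linarith) (by positivity)
      _ = ε / 2 := by rw [hη]; field_simp; ring
  calc _ = (∫ y, kᶜ.indicator (fun y => A * shiftBound h ρinf ρb nb r m τ y) y)
        + ∫ y, k'.indicator (fun y => (3 * A * η) * (1 + e y)) y := integral_add b1 b2
    _ ≤ ε := by linarith

/-- The relative entropy attains its initial value in the limit of vanishing time. -/
lemma IsEnergyVariationalSolution.modifiedEntropy_le_initial (hp : IsPressureLaw p)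
    (hh : IsPressurePotential p h) (hρhat : IsAngularLimit ρhat ∨ ∀ y, ρhat y = 0)
    (hsol : IsEnergyVariationalSolution α p h ρhat ρ₀ n₀ K ρinf ρ n E)
    (hb : IsReferencePair h ρb nb) (hdec : HasMultiplierDecay h ρinf ρb nb)
    (hsl0 : IsFiniteSlice h 0 (ρinf 0) ρ₀ n₀) {ε : ℝ} (hε : 0 < ε) :
    ∃ t > 0, ∀ᵐ τ ∂(volume.restrict (Ioo (0:ℝ) t)), modifiedEntropy h ρinf ρ n E ρb nb τ
      ≤ initialModifiedEntropy h ρ₀ n₀ ρinf E ρb nb + ε := by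
  have hi := hsol.isReferencePair hh
  obtain ⟨B, hB, hEB⟩ := hsol.exists_energy_bound
  obtain ⟨R, η, hR, hη, happ⟩ := hsol.exists_entropyShift_approx hp hh hρhat hb hdec
    (B := max B (relEntropy h 0 ρ₀ n₀ (ρinf 0) 0).toReal) (le_max_of_le_left hB)
    (show 0 < ε / 4 by positivity)
  have cφ := densityMultiplier_continuousOn hi hb
  have cψ := momentumMultiplier_continuousOn hb
  have cΔ := (hb.legendre_continuousOn hh).sub (hi.legendre_continuousOn hh)
  have hR1 : 0 ≤ R + 1 := by linarith
  have hη2 : 0 < η / 2 := by positivity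
  -- At time 0 the multipliers are only continuous, so frozen C¹ approximations are tested. Half of
  -- η is spent on smoothing and half on the modulus of continuity in time.
  obtain ⟨gφ, hgφ, aφ⟩ := exists_contDiff_approx (continuous_slice cφ le_rfl) hR1 hη2
  obtain ⟨gψ, hgψ, aψ⟩ := exists_contDiff_approx (continuous_slice cψ le_rfl) hR1 hη2
  obtain ⟨t1, ht1, m1⟩ := exists_time_modulus cφ (R + 1) hη2
  obtain ⟨t2, ht2, m2⟩ := exists_time_modulus cψ (R + 1) hη2
  obtain ⟨t3, ht3, m3⟩ := exists_time_modulus cΔ (R + 1) hη2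
  obtain ⟨χ, hχ, hχc, hχ01, hχ1, hχ0⟩ := exists_ball_cutoff (d := d) hR
  -- This part is not tested and needs no smoothing. Being frozen in time, it cancels between the
  -- two slices.
  set gΔ : Space d → ℝ := fun y => legendre h (ρb 0 y) - legendre h (ρinf 0 y) with hgΔ
  have cgΔ : Continuous gΔ := continuous_slice cΔ le_rfl
  obtain ⟨θ, hθ, hθc, hθ1⟩ : ∃ θ : ℝ → ℝ, ContDiff ℝ 1 θ ∧ HasCompactSupport θ ∧
      ∀ s ∈ Icc (0:ℝ) 1, θ s = 1 := by
    let b : ContDiffBump (0 : ℝ) := ⟨2, 3, by norm_num, by norm_num⟩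
    refine ⟨b, b.contDiff, b.hasCompactSupport, fun s hs => b.one_of_mem_closedBall ?_⟩
    rw [mem_closedBall_zero_iff, Real.norm_eq_abs, abs_of_nonneg hs.1]
    simp only [b]
    linarith [hs.2]
  set Φ : ℝ → Space d → ℝ := fun s y => (θ s * χ y) • gφ y with hΦ
  set Ψ : ℝ → Space d → Space d := fun s y => (θ s * χ y) • gψ y with hΨ
  have tΦ : IsSpaceTimeTest Φ := isSpaceTimeTest_initial hgφ hθ hθc hχ hχc
  have tΨ : IsSpaceTimeTest Ψ := isSpaceTimeTest_initial hgψ hθ hθc hχ hχc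
  -- the value of the test functions on a slice
  have hval : ∀ s ∈ Icc (0:ℝ) 1, ∀ (r : Space d → ℝ) (m : Space d → Space d),
      Integrable (fun y => χ y * (gφ y * r y + inner ℝ (gψ y) (m y) + gΔ y)) →
      ∫ y, (Φ s y * r y + inner ℝ (Ψ s y) (m y))
        = (∫ y, χ y * (gφ y * r y + inner ℝ (gψ y) (m y) + gΔ y)) - ∫ y, χ y * gΔ y := by
    intro s hs r m hint
    have i2 : Integrable fun y => χ y * gΔ y :=
      (hχ.continuous.mul cgΔ).integrable_of_hasCompactSupport hχc.mul_right
    rw [← integral_sub hint i2]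
    refine integral_congr_ae (ae_of_all _ fun y => ?_)
    simp only [hΦ, hΨ, hθ1 s hs, one_mul, smul_eq_mul, real_inner_smul_left]
    ring
  obtain ⟨int0, app0⟩ := happ χ gφ gΔ gψ hχ.continuous hgφ.continuous hgψ.continuous cgΔ hχ01 hχ1 hχ0
    0 ⟨le_rfl, zero_le_one⟩ ρ₀ n₀ hsl0 (le_max_right _ _) fun y hy =>
      ⟨(aφ y hy).trans (by linarith), (aψ y hy).trans (by linarith), by simpa [hgΔ] using hη.le⟩
  -- the right-hand side of the inequality vanishes in the limit
  set f : ℝ → ℝ := fun s => (∫ y, (massBracket Φ ρ n s y + momentumBracket α p Ψ ρ n s y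
      - α * (‖n s y‖ ^ 2 / ρ s y) + referenceForcing h ρinf ρ n s y))
    + (Real.exp (d * s) * K (Ψ s) * energyDefect h ρinf ρ n E s - (d : ℝ) / 2 * E s) with hf
  have s1 : Ioc (0:ℝ) 1 ⊆ Ioo 0 2 := fun x hx => ⟨hx.1, by linarith [hx.2]⟩
  have i1 : IntegrableOn (fun z : ℝ × Space d => massBracket Φ ρ n z.1 z.2
      + momentumBracket α p Ψ ρ n z.1 z.2 - α * (‖n z.1 z.2‖ ^ 2 / ρ z.1 z.2)
      + referenceForcing h ρinf ρ n z.1 z.2) (Ioc 0 1 ×ˢ univ) := by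
    have s2 := prod_mono s1 (Subset.refl (univ : Set (Space d)))
    exact ((((tΦ.integrableOn_massBracket hsol 2).mono_set s2).add
      ((tΨ.integrableOn_momentumBracket hsol 2).mono_set s2)).sub
      (((hsol.integrableOn_kinetic hp hh hρhat 2).mono_set s2).const_mul α)).add
      (hsol.forcing_integrable 1)
  have i2 : IntegrableOn (fun s => Real.exp (d * s) * K (Ψ s) * energyDefect h ρinf ρ n E s
      - (d : ℝ) / 2 * E s) (Ioc 0 1) :=
    (hsol.weight_integrable Ψ tΨ 1).sub (((hsol.integrableOn_energy 2).mono_set s1).const_mul _)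
  have i1' : IntegrableOn (fun s => ∫ y, (massBracket Φ ρ n s y + momentumBracket α p Ψ ρ n s y
      - α * (‖n s y‖ ^ 2 / ρ s y) + referenceForcing h ρinf ρ n s y)) (Ioc 0 1) := by
    have := i1
    rw [IntegrableOn, restrict_slab] at this
    exact this.integral_prod_left
  have hfi : IntegrableOn f (Ioc 0 1) := i1'.add i2
  have hcont : ContinuousOn (fun τ => ∫ s in (0:ℝ)..τ, f s) (uIcc 0 1) :=
    intervalIntegral.continuousOn_primitive_interval (by
      rw [uIcc_of_le zero_le_one, integrableOn_Icc_iff_integrableOn_Ioc]; exact hfi)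
  have h0 := hcont 0 left_mem_uIcc
  rw [ContinuousWithinAt, intervalIntegral.integral_same, uIcc_of_le zero_le_one] at h0
  -- Here ε/4 is allotted to the space-time integrals; another ε/4 goes to the approximation at each
  -- of the two times.
  obtain ⟨t4, ht4, h4⟩ := Metric.tendsto_nhdsWithin_nhds.1 h0 (ε / 4) (by positivity)
  refine ⟨min (min t1 t2) (min (min t3 t4) 1), by positivity, ?_⟩
  have hr : volume.restrict (Ioo (0:ℝ) (min (min t1 t2) (min (min t3 t4) 1)))
      ≤ volume.restrict (Ioi (0:ℝ)) := Measure.restrict_mono Ioo_subset_Ioi_self le_rfl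
  filter_upwards [ae_mono hr (hsol.inequality_init Φ Ψ tΦ tΨ), ae_mono hr (hsol.ae_isFiniteSlice hp hh),
    ae_mono hr (hsol.ae_modifiedEntropy_eq hp hh hρhat hb hdec), ae_restrict_mem measurableSet_Ioo]
    with τ hin hsl hQ hτ
  simp only [mem_Ioo, lt_min_iff] at hτ
  obtain ⟨hτ0, ⟨hτ1, hτ2⟩, ⟨hτ3, hτ4⟩, hτ5⟩ := hτ
  have hτ01 : τ ∈ Icc (0:ℝ) 1 := ⟨hτ0.le, hτ5.le⟩
  have hE : (relEntropy h τ (ρ τ) (n τ) (ρinf τ) 0).toReal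
      ≤ max B (relEntropy h 0 ρ₀ n₀ (ρinf 0) 0).toReal :=
    hsl.2.trans ((le_abs_self _).trans ((hEB τ hτ0.le).trans (le_max_left _ _)))
  obtain ⟨intτ, appτ⟩ := happ χ gφ gΔ gψ hχ.continuous hgφ.continuous hgψ.continuous cgΔ hχ01 hχ1 hχ0
    τ hτ01 (ρ τ) (n τ) hsl.1 hE fun y hy => by
      refine ⟨?_, ?_, ?_⟩
      · refine (norm_sub_le_norm_sub_add_norm_sub _ _ _).trans
          (add_le_add (aφ y hy) (?_ : _ ≤ η / 2)) |>.trans (by linarith)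
        rw [norm_sub_rev]
        exact m1 τ ⟨hτ0.le, hτ1⟩ y hy
      · refine (norm_sub_le_norm_sub_add_norm_sub _ _ _).trans
          (add_le_add (aψ y hy) (?_ : _ ≤ η / 2)) |>.trans (by linarith)
        rw [norm_sub_rev]
        exact m2 τ ⟨hτ0.le, hτ2⟩ y hy
      · rw [norm_sub_rev]
        exact (m3 τ ⟨hτ0.le, hτ3⟩ y hy).trans (by linarith)
  have key := EnvarInequality.slab hp hh hρhat hsol tΦ tΨ le_rfl hτ0.le hin
  rw [hval τ hτ01 _ _ intτ, hval 0 ⟨le_rfl, zero_le_one⟩ _ _ int0] at key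
  have s3 : Ioc 0 τ ⊆ Ioc (0:ℝ) 1 := Ioc_subset_Ioc_right hτ5.le
  have hrhs : (∫ z in Ioc 0 τ ×ˢ (univ : Set (Space d)),
        (massBracket Φ ρ n z.1 z.2 + momentumBracket α p Ψ ρ n z.1 z.2
          - α * (‖n z.1 z.2‖ ^ 2 / ρ z.1 z.2) + referenceForcing h ρinf ρ n z.1 z.2))
      + ∫ s in (0:ℝ)..τ, (Real.exp (d * s) * K (Ψ s) * energyDefect h ρinf ρ n E s
          - (d : ℝ) / 2 * E s) = ∫ s in (0:ℝ)..τ, f s := by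
    rw [← intervalIntegral_integral_eq (f := fun s y => massBracket Φ ρ n s y
        + momentumBracket α p Ψ ρ n s y - α * (‖n s y‖ ^ 2 / ρ s y)
        + referenceForcing h ρinf ρ n s y) hτ0.le (i1.mono_set (prod_mono s3 Subset.rfl)),
      ← intervalIntegral.integral_add]
    · rw [intervalIntegrable_iff_integrableOn_Ioc_of_le hτ0.le]; exact i1'.mono_set s3
    · rw [intervalIntegrable_iff_integrableOn_Ioc_of_le hτ0.le]; exact i2.mono_set s3
  rw [hrhs] at key
  have hsmall := h4 (x := τ) hτ01 (by
    rw [Real.dist_eq, sub_zero, abs_of_pos hτ0]; exact hτ4)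
  rw [Real.dist_eq, sub_zero] at hsmall
  have hinit := (hsl0.shift hp hh hρhat hsol hb hdec le_rfl).2.2
  rw [hQ, initialModifiedEntropy, hinit]
  have a1 := abs_le.1 app0
  have a2 := abs_le.1 appτ
  have a3 := abs_lt.1 hsmall
  linarith [a1.1, a2.2, a3.2]

end Solution

end

section

/-! ### The relative entropy inequality under abstract conditions -/

section Solution

variable {α : ℝ} {p h : ℝ → ℝ} {ρhat ρ₀ : Space d → ℝ} {n₀ : Space d → Space d}
  {K : (Space d → Space d) → ℝ} {ρinf ρ : ℝ → Space d → ℝ} {n : ℝ → Space d → Space d} {E : ℝ → ℝ}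
  {ρb : ℝ → Space d → ℝ} {nb : ℝ → Space d → Space d}

/-- What is needed of a reference pair for the relative entropy inequality. -/
structure IsAdmissible (α : ℝ) (p h : ℝ → ℝ) (K : (Space d → Space d) → ℝ)
    (ρinf ρ : ℝ → Space d → ℝ) (n : ℝ → Space d → Space d) (E : ℝ → ℝ) (ρb : ℝ → Space d → ℝ)
    (nb : ℝ → Space d → Space d) (χ : Space d → ℝ) : Prop where
  isReferencePair : IsReferencePair h ρb nb
  hasMultiplierDecay : HasMultiplierDecay h ρinf ρb nb
  xi_eq : ∀ s, 0 < s → ∀ y, IsState (ρ s y) (n s y) →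
    xi α p h ρ n ρb nb s y = xiForm α p h ρ n ρb nb s y
  flux : ∀ δ T : ℝ, 0 < δ → IntegrableOn (fun z : ℝ × Space d =>
    (p (ρ z.1 z.2) - legendre h (ρb z.1 z.2)) • velocity (ρb z.1 z.2) (nb z.1 z.2))
      (Ioo δ T ×ˢ univ)
  xi_integrable : ∀ δ T : ℝ, 0 < δ → IntegrableOn (fun z : ℝ × Space d =>
    xi α p h ρ n ρb nb z.1 z.2) (Ioo δ T ×ˢ univ)
  truncation : ∀ δ T : ℝ, 0 < δ → δ < T → IsTruncationControlled h K ρinf ρ n E ρb nb χ δ T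
  initial : ∃ δ : ℝ, 0 < δ ∧
    IntegrableOn (fun z : ℝ × Space d => xi α p h ρ n ρb nb z.1 z.2) (Ioo 0 δ ×ˢ univ) ∧
    IntegrableOn (weightedDefect h K ρinf ρ n E ρb nb) (Ioo 0 δ)

lemma Ioo_subset_union {δ : ℝ} (hδ : 0 < δ) (T : ℝ) : Ioo 0 T ⊆ Ioo 0 δ ∪ Ioo (δ / 2) T := by
  intro x hx
  by_cases h : x < δ
  · exact Or.inl ⟨hx.1, h⟩
  · exact Or.inr ⟨by linarith, hx.2⟩

lemma IsAdmissible.integrableOn_xi {χ : Space d → ℝ}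
    (had : IsAdmissible α p h K ρinf ρ n E ρb nb χ) (T : ℝ) :
    IntegrableOn (fun z : ℝ × Space d => xi α p h ρ n ρb nb z.1 z.2) (Ioo 0 T ×ˢ univ) := by
  obtain ⟨δ, hδ, h1, -⟩ := had.initial
  refine (h1.union (had.xi_integrable (δ / 2) T (by positivity))).mono_set ?_
  rw [← union_prod]
  exact prod_mono (Ioo_subset_union hδ T) Subset.rfl

lemma IsAdmissible.integrableOn_weightedDefect {χ : Space d → ℝ} (hχ : IsCutoff χ)
    (hsol : IsEnergyVariationalSolution α p h ρhat ρ₀ n₀ K ρinf ρ n E)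
    (had : IsAdmissible α p h K ρinf ρ n E ρb nb χ) (T : ℝ) :
    IntegrableOn (weightedDefect h K ρinf ρ n E ρb nb) (Ioo 0 T) := by
  obtain ⟨δ, hδ, -, h1⟩ := had.initial
  have h2 := (had.truncation (δ / 2) (max T δ) (by positivity)
    ((by linarith : δ / 2 < δ).trans_le (le_max_right _ _))).integrableOn_weightedDefect hsol
      had.isReferencePair hχ (by positivity)
      ((by linarith : δ / 2 < δ).trans_le (le_max_right _ _))
  refine (h1.union h2).mono_set ?_
  exact (Ioo_subset_union hδ T).trans
    (union_subset_union_right _ (Ioo_subset_Ioo_right (le_max_left _ _)))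

/-- The windows (1/(k+1), k+2) exhaust (0,∞), and countably many exceptional sets are united. The
upper end k + 2 keeps even the window for k = 0 nonempty. -/
lemma IsAdmissible.modifiedEntropy_sub_le {χ : Space d → ℝ} (hχ : IsCutoff χ) (hp : IsPressureLaw p)
    (hh : IsPressurePotential p h) (hρhat : IsAngularLimit ρhat ∨ ∀ y, ρhat y = 0)
    (hsol : IsEnergyVariationalSolution α p h ρhat ρ₀ n₀ K ρinf ρ n E)
    (had : IsAdmissible α p h K ρinf ρ n E ρb nb χ) :
    ∀ᵐ σ ∂(volume.restrict (Ioi (0 : ℝ))), ∀ᵐ τ ∂(volume.restrict (Ioi σ)),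
      modifiedEntropy h ρinf ρ n E ρb nb τ - modifiedEntropy h ρinf ρ n E ρb nb σ
        ≤ ∫ s in σ..τ, (bigXi α p h ρ n ρb nb s + weightedDefect h K ρinf ρ n E ρb nb s
          - ((d : ℝ) / 2 * modifiedEntropy h ρinf ρ n E ρb nb s + dissipation α ρ n ρb nb s)) := by
  have hk : ∀ k : ℕ, ∀ᵐ σ, 1 / ((k : ℝ) + 1) < σ → ∀ᵐ τ ∂(volume.restrict (Ioi σ)), τ < (k : ℝ) + 2 →
      modifiedEntropy h ρinf ρ n E ρb nb τ - modifiedEntropy h ρinf ρ n E ρb nb σ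
        ≤ ∫ s in σ..τ, (bigXi α p h ρ n ρb nb s + weightedDefect h K ρinf ρ n E ρb nb s
          - ((d : ℝ) / 2 * modifiedEntropy h ρinf ρ n E ρb nb s
            + dissipation α ρ n ρb nb s)) := by
    intro k
    have hδ : 0 < 1 / ((k : ℝ) + 1) := by positivity
    have hδT : 1 / ((k : ℝ) + 1) < (k : ℝ) + 2 := by
      have : 1 / ((k : ℝ) + 1) ≤ 1 := by
        rw [div_le_one (by positivity)]; linarith [Nat.cast_nonneg (α := ℝ) k]
      linarith [Nat.cast_nonneg (α := ℝ) k]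
    exact (ae_restrict_iff' measurableSet_Ioi).1 (hsol.relative_entropy_le hp hh hρhat
      had.isReferencePair had.hasMultiplierDecay hδ hδT (had.flux _ _ hδ) (had.xi_integrable _ _ hδ)
      had.xi_eq hχ (had.truncation _ _ hδ hδT))
  filter_upwards [ae_restrict_of_ae (ae_all_iff.2 hk), ae_restrict_mem measurableSet_Ioi] with σ h1 hσ
  have h2 : ∀ k : ℕ, ∀ᵐ τ ∂(volume.restrict (Ioi σ)), 1 / ((k : ℝ) + 1) < σ → τ < (k : ℝ) + 2 →
      modifiedEntropy h ρinf ρ n E ρb nb τ - modifiedEntropy h ρinf ρ n E ρb nb σ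
        ≤ ∫ s in σ..τ, (bigXi α p h ρ n ρb nb s + weightedDefect h K ρinf ρ n E ρb nb s
          - ((d : ℝ) / 2 * modifiedEntropy h ρinf ρ n E ρb nb s
            + dissipation α ρ n ρb nb s)) := by
    intro k
    by_cases hkσ : 1 / ((k : ℝ) + 1) < σ
    · filter_upwards [h1 k hkσ] with τ hτ _ using hτ
    · exact ae_of_all _ fun τ hc => absurd hc hkσ
  filter_upwards [ae_all_iff.2 h2] with τ hτ
  obtain ⟨k₁, hk₁⟩ := exists_nat_one_div_lt (mem_Ioi.1 hσ)
  obtain ⟨k₂, hk₂⟩ := exists_nat_gt τ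
  refine hτ (max k₁ k₂) ?_ ?_
  · refine lt_of_le_of_lt ?_ hk₁
    gcongr
    exact le_max_left _ _
  · have : (k₂ : ℝ) ≤ ((max k₁ k₂ : ℕ) : ℝ) := by exact_mod_cast le_max_right _ _
    linarith

/-- The relative entropy inequality for admissible reference pairs. -/
theorem IsAdmissible.relative_entropy_inequality {χ : Space d → ℝ} (hχ : IsCutoff χ)
    (hp : IsPressureLaw p) (hh : IsPressurePotential p h)
    (hρhat : IsAngularLimit ρhat ∨ ∀ y, ρhat y = 0)
    (hsol : IsEnergyVariationalSolution α p h ρhat ρ₀ n₀ K ρinf ρ n E)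
    (hsl0 : IsFiniteSlice h 0 (ρinf 0) ρ₀ n₀)
    (had : IsAdmissible α p h K ρinf ρ n E ρb nb χ) :
    (relEntropy h 0 ρ₀ n₀ (ρinf 0) 0 ≠ ⊤ ∧ relEntropy h 0 ρ₀ n₀ (ρb 0) (nb 0) ≠ ⊤) ∧
    (∀ᵐ τ ∂(volume.restrict (Ioi (0 : ℝ))),
      relEntropy h τ (ρ τ) (n τ) (ρb τ) (nb τ) ≠ ⊤) ∧
    (∀ T : ℝ,
      IntegrableOn (modifiedEntropy h ρinf ρ n E ρb nb) (Ioo 0 T) ∧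
      IntegrableOn (fun z : ℝ × Space d => ρ z.1 z.2 * ‖relVelocity ρ n ρb nb z.1 z.2‖ ^ 2)
        (Ioo 0 T ×ˢ univ) ∧
      IntegrableOn (Function.uncurry (xi α p h ρ n ρb nb)) (Ioo 0 T ×ˢ univ) ∧
      IntegrableOn (weightedDefect h K ρinf ρ n E ρb nb) (Ioo 0 T)) ∧
    ∀ φ : ℝ → ℝ, ContDiff ℝ 1 φ → HasCompactSupport φ → (∀ τ, 0 ≤ τ → 0 ≤ φ τ) →
      (∫ τ in Ioi (0 : ℝ),
          (-deriv φ τ * modifiedEntropy h ρinf ρ n E ρb nb τ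
            + φ τ * ((d : ℝ) / 2 * modifiedEntropy h ρinf ρ n E ρb nb τ
              + dissipation α ρ n ρb nb τ)))
        ≤ φ 0 * initialModifiedEntropy h ρ₀ n₀ ρinf E ρb nb
          + ∫ τ in Ioi (0 : ℝ),
              φ τ * (bigXi α p h ρ n ρb nb τ + weightedDefect h K ρinf ρ n E ρb nb τ) := by
  have hb := had.isReferencePair
  have hdec := had.hasMultiplierDecay
  have iQ := hsol.integrableOn_modifiedEntropy hp hh hρhat hb hdec
  have iV := hsol.integrableOn_relVelocity hp hh hρhat hb hdec
  have iX := had.integrableOn_xi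
  have iW := had.integrableOn_weightedDefect hχ hsol
  refine ⟨⟨hsl0.ne_top, (hsl0.shift hp hh hρhat hsol hb hdec le_rfl).2.1⟩, ?_,
    fun T => ⟨iQ T, iV T, iX T, iW T⟩, ?_⟩
  · filter_upwards [hsol.ae_isFiniteSlice hp hh, ae_restrict_mem measurableSet_Ioi] with τ h1 h2
    exact (h1.1.shift hp hh hρhat hsol hb hdec (le_of_lt h2)).2.1
  intro φ hφ hφc hφ0
  have iΞ : ∀ T, IntegrableOn (bigXi α p h ρ n ρb nb) (Ioo 0 T) := fun T => by
    have := iX T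
    rw [IntegrableOn, restrict_slab] at this
    exact this.integral_prod_left
  have iD : ∀ T, IntegrableOn (dissipation α ρ n ρb nb) (Ioo 0 T) := fun T => by
    have := iV T
    rw [IntegrableOn, restrict_slab] at this
    exact this.integral_prod_left.const_mul α
  have iA : ∀ T, IntegrableOn (fun τ => bigXi α p h ρ n ρb nb τ
      + weightedDefect h K ρinf ρ n E ρb nb τ) (Ioo 0 T) := fun T => (iΞ T).add (iW T)
  have iB : ∀ T, IntegrableOn (fun τ => (d : ℝ) / 2 * modifiedEntropy h ρinf ρ n E ρb nb τ
      + dissipation α ρ n ρb nb τ) (Ioo 0 T) := fun T => ((iQ T).const_mul _).add (iD T)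
  -- The damping and dissipation terms are put on the right for this step and moved back afterwards,
  -- which is legitimate since each term is integrable on bounded time intervals.
  have key := weak_inequality_of_ae_le iQ (fun T => (iA T).sub (iB T))
    (had.modifiedEntropy_sub_le hχ hp hh hρhat hsol)
    (fun ε hε => hsol.modifiedEntropy_le_initial hp hh hρhat hb hdec hsl0 hε) hφ hφc hφ0
  have j1 := integrableOn_Ioi_mul_of_hasCompactSupport iQ
    (hφ.continuous_deriv (by norm_num)).neg hφc.deriv.neg
  have j2 := integrableOn_Ioi_mul_of_hasCompactSupport iA hφ.continuous hφc
  have j3 := integrableOn_Ioi_mul_of_hasCompactSupport iB hφ.continuous hφc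
  have e1 := integral_add' j1 j3
  have e2 := integral_sub' j2 j3
  have e3 : ∫ τ in Ioi (0:ℝ), φ τ * (((fun τ => bigXi α p h ρ n ρb nb τ
      + weightedDefect h K ρinf ρ n E ρb nb τ) - fun τ => (d : ℝ) / 2 *
        modifiedEntropy h ρinf ρ n E ρb nb τ + dissipation α ρ n ρb nb τ) τ)
      = (∫ τ in Ioi (0:ℝ), φ τ * (bigXi α p h ρ n ρb nb τ + weightedDefect h K ρinf ρ n E ρb nb τ))
        - ∫ τ in Ioi (0:ℝ), φ τ * ((d : ℝ) / 2 * modifiedEntropy h ρinf ρ n E ρb nb τ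
          + dissipation α ρ n ρb nb τ) := by
    rw [← e2]
    refine integral_congr_ae (ae_of_all _ fun τ => ?_)
    simp only [Pi.sub_apply]
    ring
  rw [e3] at key
  refine (le_of_eq e1).trans ?_
  have e4 : ∫ τ in Ioi (0:ℝ), (-deriv φ) τ * modifiedEntropy h ρinf ρ n E ρb nb τ
      = ∫ τ in Ioi (0:ℝ), -deriv φ τ * modifiedEntropy h ρinf ρ n E ρb nb τ := rfl
  rw [e4]
  linarith

end Solution

end

section

/-! ### Reference pairs without vacuum -/

section Positive

lemma tensorDivergence_eq {a b : Space d → Space d} {y : Space d} (ha : DifferentiableAt ℝ a y)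
    (hb : DifferentiableAt ℝ b y) :
    tensorDivergence a b y = fderiv ℝ a y (b y) + divergence b y • a y := by
  ext i
  have h1 : HasFDerivAt (fun z => a z i)
      ((EuclideanSpace.proj i : Space d →L[ℝ] ℝ).comp (fderiv ℝ a y)) y :=
    (EuclideanSpace.proj i : Space d →L[ℝ] ℝ).hasFDerivAt.comp y ha.hasFDerivAt
  simp only [tensorDivergence]
  rw [divergence_smul h1.differentiableAt hb, h1.fderiv]
  simp [mul_comm, add_comm]

lemma inner_gradient_right (f : Space d → ℝ) (y v : Space d) :
    inner ℝ v (gradient f y) = fderiv ℝ f y v := by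
  rw [real_inner_comm, gradient, InnerProductSpace.toDual_symm_apply]

variable {α : ℝ} {p h : ℝ → ℝ} {ρ ρb : ℝ → Space d → ℝ} {n nb : ℝ → Space d → Space d}

lemma isReferencePair_of_pos (hp : IsPressureLaw p) (hh : IsPressurePotential p h)
    (hρb : IsReferenceRegular ρb) (hnb : IsReferenceRegular nb)
    (hpos : ∀ τ, 0 ≤ τ → ∀ y, 0 < ρb τ y) : IsReferencePair h ρb nb where
  nonneg τ hτ y := (hpos τ hτ y).le
  differentiableWithinAt τ hτ y := hh.differentiableWithinAt (hpos τ hτ y)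
  density_continuousOn := hρb.2
  density_contDiffOn := hρb.1
  enthalpy_continuousOn :=
    (contDiffOn_enthalpy hp hh).continuousOn.comp hρb.2 fun z hz => hpos z.1 hz.1 z.2
  enthalpy_contDiffOn :=
    (contDiffOn_enthalpy hp hh).comp hρb.1 fun z hz => hpos z.1 (le_of_lt hz.1) z.2
  velocity_continuousOn := (hρb.2.inv₀ fun z hz => (hpos z.1 hz.1 z.2).ne').smul hnb.2
  velocity_contDiffOn := (hρb.1.inv fun z hz => (hpos z.1 (le_of_lt hz.1) z.2).ne').smul hnb.1

/-- The derivatives of the momentum and of the enthalpy. -/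
lemma reference_derivatives (hp : IsPressureLaw p) (hh : IsPressurePotential p h)
    (hρb : IsReferenceRegular ρb) (hnb : IsReferenceRegular nb)
    (hpos : ∀ τ, 0 ≤ τ → ∀ y, 0 < ρb τ y) {s : ℝ} (hs : 0 < s) (y : Space d) :
    deriv (fun s' => nb s' y) s = ρb s y • deriv (fun s' => velocity (ρb s' y) (nb s' y)) s
        + deriv (fun s' => ρb s' y) s • velocity (ρb s y) (nb s y) ∧
      fderiv ℝ (nb s) y = ρb s y • fderiv ℝ (fun z => velocity (ρb s z) (nb s z)) y
        + (fderiv ℝ (ρb s) y).smulRight (velocity (ρb s y) (nb s y)) ∧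
      deriv (fun s' => enthalpy h (ρb s' y)) s
        = deriv p (ρb s y) / ρb s y * deriv (fun s' => ρb s' y) s ∧
      fderiv ℝ (fun z => enthalpy h (ρb s z)) y
        = (deriv p (ρb s y) / ρb s y) • fderiv ℝ (ρb s) y ∧
      fderiv ℝ (fun z => p (ρb s z)) y = deriv p (ρb s y) • fderiv ℝ (ρb s) y := by
  have hb := isReferencePair_of_pos hp hh hρb hnb hpos
  have hn := IsReferencePair.mem_nhds_slab (z := (s, y)) hs
  have dr := (hρb.1.differentiableOn (by norm_num)).differentiableAt hn
  have dU := (hb.velocity_contDiffOn.differentiableOn (by norm_num)).differentiableAt hn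
  have tr : HasDerivAt (fun s' => ρb s' y) _ s := hasDerivAt_time dr
  have sr : HasFDerivAt (fun z => ρb s z) _ y := hasFDerivAt_space dr
  have tU : HasDerivAt (fun s' => velocity (ρb s' y) (nb s' y)) _ s := hasDerivAt_time dU
  have sU : HasFDerivAt (fun z => velocity (ρb s z) (nb s z)) _ y := hasFDerivAt_space dU
  have hr : 0 < ρb s y := hpos s hs.le y
  rw [← tr.deriv] at tr
  rw [← sr.fderiv] at sr
  rw [← tU.deriv] at tU
  rw [← sU.fderiv] at sU
  have hm : ∀ s' : ℝ, 0 < s' → ∀ z, nb s' z = ρb s' z • velocity (ρb s' z) (nb s' z) :=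
    fun s' hs' z => by
      rw [velocity, smul_smul, mul_inv_cancel₀ (hpos s' hs'.le z).ne', one_smul]
  refine ⟨?_, ?_, ((hasDerivAt_enthalpy hp hh hr).comp s tr).deriv,
    ((hasDerivAt_enthalpy hp hh hr).comp_hasFDerivAt y sr).fderiv,
    ((hp.hasDerivAt hr).comp_hasFDerivAt y sr).fderiv⟩
  · have h1 : (fun s' => nb s' y) =ᶠ[𝓝 s] fun s' => ρb s' y • velocity (ρb s' y) (nb s' y) := by
      filter_upwards [Ioi_mem_nhds hs] with s' hs' using hm s' hs' y
    rw [h1.deriv_eq]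
    exact (tr.smul tU).deriv
  · have h1 : nb s = fun z => ρb s z • velocity (ρb s z) (nb s z) := funext fun z => hm s hs z
    have h2 : fderiv ℝ (nb s) y = fderiv ℝ (fun z => ρb s z • velocity (ρb s z) (nb s z)) y :=
      congrArg (fun f => fderiv ℝ f y) h1
    rw [h2]
    exact (sr.smul sU).fderiv

/-- Substituting n̄ = ρ̄U and the product rule puts the residuals into nonconservative form. The
terms p'(ρ̄)(ρ - ρ̄) div U of ξ₁ and ξ₃ cancel, because h'' = p'/ρ̄ and the mass residual contains
ρ̄ div U. The remaining pressure and enthalpy terms match by the same formula for h''. -/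
lemma xi_eq_xiForm_of_pos (hp : IsPressureLaw p) (hh : IsPressurePotential p h)
    (hρb : IsReferenceRegular ρb) (hnb : IsReferenceRegular nb)
    (hpos : ∀ τ, 0 ≤ τ → ∀ y, 0 < ρb τ y) {s : ℝ} (hs : 0 < s) (y : Space d) :
    xi α p h ρ n ρb nb s y = xiForm α p h ρ n ρb nb s y := by
  have hb := isReferencePair_of_pos hp hh hρb hnb hpos
  have hn := IsReferencePair.mem_nhds_slab (z := (s, y)) hs
  have sm : HasFDerivAt (fun z => nb s z) _ y :=
    hasFDerivAt_space ((hnb.1.differentiableOn (by norm_num)).differentiableAt hn)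
  have sU : HasFDerivAt (fun z => velocity (ρb s z) (nb s z)) _ y := hasFDerivAt_space
    ((hb.velocity_contDiffOn.differentiableOn (by norm_num)).differentiableAt hn)
  have hr : 0 < ρb s y := hpos s hs.le y
  have hm : nb s y = ρb s y • velocity (ρb s y) (nb s y) := by
    rw [velocity, smul_smul, mul_inv_cancel₀ hr.ne', one_smul]
  obtain ⟨e1, e2, e3, e4, e5⟩ := reference_derivatives hp hh hρb hnb hpos hs y
  set r := ρb s y with hr_def
  set U := velocity r (nb s y) with hU
  set r' := deriv (fun s' => ρb s' y) s with hr'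
  set Dr := fderiv ℝ (ρb s) y with hDr
  set U' := deriv (fun s' => velocity (ρb s' y) (nb s' y)) s with hU'
  set DU := fderiv ℝ (fun z => velocity (ρb s z) (nb s z)) y with hDU
  have e6 : divergence (nb s) y = r * divergenceForm d DU + Dr U := by
    rw [divergence_eq, e2, map_add, map_smul, divergenceForm_smulRight, smul_eq_mul]
  have e7 : tensorDivergence (fun z => velocity (ρb s z) (nb s z)) (nb s) y
      = DU (r • U) + (r * divergenceForm d DU + Dr U) • U := by
    rw [tensorDivergence_eq sU.differentiableAt sm.differentiableAt, e6]
    exact congrArg (fun v => DU v + (r * divergenceForm d DU + Dr U) • U) hm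
  have e8 : legendre h r = p r := hh.mul_enthalpy_sub hr
  have e9 : Real.exp (-(d * s)) * Real.exp (d * s) = 1 := by rw [← Real.exp_add]; simp
  have e10 : ∀ v, inner ℝ v (gradient (fun z => p (ρb s z)) y) = deriv p r * Dr v := fun v => by
    rw [inner_gradient_right, e5]; simp
  have e11 : residualMass ρb nb s y
      = r' - Dr ((1 / 2 : ℝ) • y) + (r * divergenceForm d DU + Dr U) := by
    rw [residualMass, e6]
  -- The combination of the two residuals removes the mass balance from the momentum balance:
  -- neither time derivatives of ρ̄ nor the divergence of n̄ survive.
  have e12 : residual α p ρb nb s y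
      = -(r • (U' - DU ((1 / 2 : ℝ) • y) - ((d : ℝ) / 2) • U + DU U))
        - Real.exp (d * s) • (gradient (fun z => p (ρb s z)) y + (α * r) • U) := by
    rw [residual, e11, residualMomentum, e1, e2, e7, ← hr_def, ← hU]
    clear_value U
    rw [hm]
    simp only [add_apply, smul_apply, ContinuousLinearMap.smulRight_apply, map_smul]
    module
  rw [xi, xiOne, xiTwo, xiThree, xiForm, e12, e11, e3, e4, divergence_eq, relPressure,
    ← hr_def, e8, (hasDerivAt_enthalpy hp hh hr).deriv]
  simp only [← hU, ← hU', ← hDU, smul_apply, smul_eq_mul]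
  set w := relVelocity ρ n ρb nb s y
  set q := U' - DU ((1 / 2 : ℝ) • y) - ((d : ℝ) / 2) • U + DU U
  clear_value q
  rw [inner_sub_right, inner_neg_right, real_inner_smul_right, real_inner_smul_right,
    inner_add_right, e10, real_inner_smul_right]
  field_simp
  linear_combination (-(ρ s y * (deriv p r * Dr w + α * r * inner ℝ w U))) * e9

end Positive

end

section

/-! ### Bounds of the error terms -/

/-! ### Continuity and measurability of partial derivatives. -/

section Slices

variable {F : Type*} [NormedAddCommGroup F] [NormedSpace ℝ F] {f : ℝ × Space d → F}

lemma continuousOn_fderiv_space (hf : ContDiffOn ℝ 1 f (Ioi 0 ×ˢ univ)) :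
    ContinuousOn (fun z : ℝ × Space d => fderiv ℝ (fun y => f (z.1, y)) z.2) (Ioi 0 ×ˢ univ) := by
  have ho : IsOpen (Ioi 0 ×ˢ univ : Set (ℝ × Space d)) := isOpen_Ioi.prod isOpen_univ
  refine ((hf.continuousOn_fderiv_of_isOpen ho le_rfl).clm_comp (continuousOn_const
    (c := ContinuousLinearMap.inr ℝ ℝ (Space d)))).congr fun z hz => ?_
  exact (hasFDerivAt_space (s := z.1) (y := z.2) ((hf.differentiableOn (by norm_num)).differentiableAt
    (ho.mem_nhds hz))).fderiv

lemma continuousOn_deriv_time (hf : ContDiffOn ℝ 1 f (Ioi 0 ×ˢ univ)) :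
    ContinuousOn (fun z : ℝ × Space d => deriv (fun s => f (s, z.2)) z.1) (Ioi 0 ×ˢ univ) := by
  have ho : IsOpen (Ioi 0 ×ˢ univ : Set (ℝ × Space d)) := isOpen_Ioi.prod isOpen_univ
  refine ((hf.continuousOn_fderiv_of_isOpen ho le_rfl).clm_apply (continuousOn_const
    (c := ((1 : ℝ), (0 : Space d))))).congr fun z hz => ?_
  exact (hasDerivAt_time (s := z.1) (y := z.2) ((hf.differentiableOn (by norm_num)).differentiableAt
    (ho.mem_nhds hz))).deriv

lemma aestronglyMeasurable_of_continuousOn_Ioi {G : Type*} [NormedAddCommGroup G]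
    {g : ℝ × Space d → G} (hg : ContinuousOn g (Ioi 0 ×ˢ univ)) [SecondCountableTopology G] (T : ℝ) :
    AEStronglyMeasurable g (volume.restrict (Ioo 0 T ×ˢ univ)) :=
  (hg.mono (prod_mono (fun _ hx => hx.1) Subset.rfl)).aestronglyMeasurable
    (measurableSet_Ioo.prod MeasurableSet.univ)

end Slices

variable {α : ℝ} {p h : ℝ → ℝ} {ρ ρb : ℝ → Space d → ℝ} {n nb : ℝ → Space d → Space d}

/-- The size of the coefficients of the error term. -/
def coefficientSize (h : ℝ → ℝ) (ρb : ℝ → Space d → ℝ) (nb : ℝ → Space d → Space d)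
    (z : ℝ × Space d) : ℝ :=
  ‖velocity (ρb z.1 z.2) (nb z.1 z.2)‖
    + ‖fderiv ℝ (fun y => velocity (ρb z.1 y) (nb z.1 y)) z.2‖
    + ‖deriv (fun s => velocity (ρb s z.2) (nb s z.2)) z.1‖
    + ‖fderiv ℝ (fun y => velocity (ρb z.1 y) (nb z.1 y)) z.2 z.2‖
    + ‖fderiv ℝ (fun y => enthalpy h (ρb z.1 y)) z.2‖
    + ‖deriv (fun s => enthalpy h (ρb s z.2)) z.1‖
    + ‖fderiv ℝ (fun y => enthalpy h (ρb z.1 y)) z.2 z.2‖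

lemma coefficientSize_nonneg (z : ℝ × Space d) : 0 ≤ coefficientSize h ρb nb z := by
  unfold coefficientSize; positivity

lemma IsReferencePair.coefficientSize_continuousOn (hb : IsReferencePair h ρb nb) :
    ContinuousOn (coefficientSize h ρb nb) (Ioi 0 ×ˢ univ) := by
  have h1 := continuousOn_fderiv_space hb.velocity_contDiffOn
  have h2 := continuousOn_fderiv_space hb.enthalpy_contDiffOn
  exact (((((hb.velocity_contDiffOn.continuousOn.norm.add h1.norm).add
    (continuousOn_deriv_time hb.velocity_contDiffOn).norm).add
    (h1.clm_apply continuousOn_snd).norm).add h2.norm).add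
    (continuousOn_deriv_time hb.enthalpy_contDiffOn).norm).add (h2.clm_apply continuousOn_snd).norm

lemma IsState.mul_norm_relVelocity_le {s : ℝ} {y : Space d} (hst : IsState (ρ s y) (n s y)) {M : ℝ}
    (hM : 1 ≤ M) (hU : ‖velocity (ρb s y) (nb s y)‖ ≤ M) :
    ρ s y * ‖relVelocity ρ n ρb nb s y‖ ≤ 2 * M * stateSize p ρ n (s, y) ∧
      ρ s y * ‖relVelocity ρ n ρb nb s y‖ ^ 2 ≤ 2 * M ^ 2 * stateSize p ρ n (s, y) := by
  have hρ := hst.nonneg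
  set U := velocity (ρb s y) (nb s y)
  have hk : 0 ≤ ‖n s y‖ ^ 2 / ρ s y := by positivity
  have hS : stateSize p ρ n (s, y)
      = 1 + ρ s y + ‖n s y‖ + ‖n s y‖ ^ 2 / ρ s y + ‖p (ρ s y)‖ := by
    simp only [stateSize, Real.norm_of_nonneg hρ, Real.norm_of_nonneg hk]
  have hp0 := norm_nonneg (p (ρ s y))
  have hn0 := norm_nonneg (n s y)
  constructor
  · have h1 : ρ s y * ‖relVelocity ρ n ρb nb s y‖ ≤ ‖n s y‖ + ρ s y * M := by
      have h2 : ρ s y * ‖velocity (ρ s y) (n s y)‖ = ‖n s y‖ := by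
        conv_rhs => rw [← hst.smul_velocity, norm_smul, Real.norm_of_nonneg hρ]
      rw [← h2, ← mul_add]
      exact mul_le_mul_of_nonneg_left ((norm_sub_le _ _).trans (by gcongr)) hρ
    rw [hS]
    nlinarith
  · have h1 : ρ s y * ‖relVelocity ρ n ρb nb s y‖ ^ 2
        ≤ 2 * (‖n s y‖ ^ 2 / ρ s y) + 2 * (ρ s y * M ^ 2) := by
      rw [← mul_norm_velocity_sq]
      have h2 : ‖relVelocity ρ n ρb nb s y‖ ^ 2 ≤ 2 * ‖velocity (ρ s y) (n s y)‖ ^ 2 + 2 * M ^ 2 := by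
        have h3 : ‖relVelocity ρ n ρb nb s y‖ ≤ ‖velocity (ρ s y) (n s y)‖ + M :=
          (norm_sub_le _ _).trans (by gcongr)
        calc _ ≤ (‖velocity (ρ s y) (n s y)‖ + M) ^ 2 := by gcongr
          _ ≤ _ := by nlinarith [sq_nonneg (‖velocity (ρ s y) (n s y)‖ - M)]
      nlinarith
    have hM2 : 1 ≤ M ^ 2 := one_le_pow₀ hM
    rw [hS]
    nlinarith

lemma abs_sub_six (a b c u v w : ℝ) :
    |-a - b - c - u - v - w| ≤ |a| + |b| + |c| + |u| + |v| + |w| := by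
  refine (abs_sub _ _).trans (add_le_add_left ?_ _)
  refine (abs_sub _ _).trans (add_le_add_left ?_ _)
  refine (abs_sub _ _).trans (add_le_add_left ?_ _)
  refine (abs_sub _ _).trans (add_le_add_left ?_ _)
  refine (abs_sub _ _).trans (add_le_add_left ?_ _)
  rw [abs_neg]

/-- Every term is a velocity or a derivative of the reference data times ρ|w|, ρ|w|², ρ - ρ̄ or p(ρ)
- P(ρ̄), with w = u - U. For bounded reference data each of the latter is at most 2M² times
`stateSize`. -/
lemma IsState.abs_xiForm_le {s : ℝ} {y : Space d} (hs : 0 ≤ s) (hst : IsState (ρ s y) (n s y))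
    {M : ℝ} (hM : 1 ≤ M) (hU : ‖velocity (ρb s y) (nb s y)‖ ≤ M) (hr : |ρb s y| ≤ M)
    (hP : |legendre h (ρb s y)| ≤ M) :
    |xiForm α p h ρ n ρb nb s y| ≤ 2 * M ^ 2 * (4 + 2 * d + |α|)
      * (coefficientSize h ρb nb (s, y) * stateSize p ρ n (s, y)) := by
  obtain ⟨h1, h2⟩ := hst.mul_norm_relVelocity_le (p := p) hM hU
  have hρ := hst.nonneg
  have hk : 0 ≤ ‖n s y‖ ^ 2 / ρ s y := by positivity
  have hS1 : 1 ≤ stateSize p ρ n (s, y) := by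
    unfold stateSize; linarith [norm_nonneg (ρ s y), norm_nonneg (n s y),
      norm_nonneg (p (ρ s y)), norm_nonneg (‖n s y‖ ^ 2 / ρ s y)]
  have hSρ : ρ s y + 1 ≤ stateSize p ρ n (s, y) := by
    unfold stateSize; linarith [le_abs_self (ρ s y), Real.norm_eq_abs (ρ s y), norm_nonneg (n s y),
      norm_nonneg (p (ρ s y)), norm_nonneg (‖n s y‖ ^ 2 / ρ s y)]
  have hSp : |p (ρ s y)| + 1 ≤ stateSize p ρ n (s, y) := by
    unfold stateSize; linarith [norm_nonneg (ρ s y), Real.norm_eq_abs (p (ρ s y)),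
      norm_nonneg (n s y), norm_nonneg (‖n s y‖ ^ 2 / ρ s y)]
  set S := stateSize p ρ n (s, y)
  set w := relVelocity ρ n ρb nb s y
  have he : Real.exp (-(d * s)) ≤ 1 := Real.exp_le_one_iff.2 (by
    have := mul_nonneg (Nat.cast_nonneg (α := ℝ) d) hs; linarith)
  have he0 := (Real.exp_pos (-(d * s))).le
  unfold xiForm coefficientSize
  dsimp only
  set e := Real.exp (-(d * s))
  set U := velocity (ρb s y) (nb s y)
  set DU := fderiv ℝ (fun z => velocity (ρb s z) (nb s z)) y
  set U' := deriv (fun s' => velocity (ρb s' y) (nb s' y)) s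
  set DH := fderiv ℝ (fun z => enthalpy h (ρb s z)) y
  set H' := deriv (fun s' => enthalpy h (ρb s' y)) s
  have hM2 : M ≤ M ^ 2 := by nlinarith
  have hS0 : 0 ≤ S := by linarith
  have hM0 : 0 ≤ M := by linarith
  have hd0 : (0:ℝ) ≤ d := Nat.cast_nonneg d
  have hMS : 2 * M * S ≤ 2 * M ^ 2 * S := by gcongr
  have b1 : |e * ρ s y * inner ℝ w (DU w)| ≤ 2 * M ^ 2 * S * ‖DU‖ := by
    have h3 : |inner ℝ w (DU w)| ≤ ‖DU‖ * ‖w‖ ^ 2 := by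
      refine (abs_real_inner_le_norm _ _).trans ?_
      calc ‖w‖ * ‖DU w‖ ≤ ‖w‖ * (‖DU‖ * ‖w‖) := by gcongr; exact DU.le_opNorm w
        _ = _ := by ring
    rw [abs_mul, abs_mul, abs_of_nonneg he0, abs_of_nonneg hρ]
    calc e * ρ s y * |inner ℝ w (DU w)| ≤ 1 * ρ s y * (‖DU‖ * ‖w‖ ^ 2) := by gcongr
      _ = ‖DU‖ * (ρ s y * ‖w‖ ^ 2) := by ring
      _ ≤ ‖DU‖ * (2 * M ^ 2 * S) := by gcongr
      _ = _ := by ring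
  have b2 : |divergence (fun z => velocity (ρb s z) (nb s z)) y * (p (ρ s y) - legendre h (ρb s y))|
      ≤ 2 * M ^ 2 * S * (d * ‖DU‖) := by
    rw [abs_mul]
    have h3 : |p (ρ s y) - legendre h (ρb s y)| ≤ 2 * M ^ 2 * S := by
      refine (abs_sub _ _).trans ?_
      nlinarith
    calc _ ≤ (d * ‖DU‖) * (2 * M ^ 2 * S) := by gcongr; exact abs_divergence_le _ y
      _ = _ := by ring
  have b3 : ∀ v : Space d, |e * ρ s y * inner ℝ w v| ≤ 2 * M * S * ‖v‖ := by
    intro v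
    rw [abs_mul, abs_mul, abs_of_nonneg he0, abs_of_nonneg hρ]
    calc e * ρ s y * |inner ℝ w v| ≤ 1 * ρ s y * (‖w‖ * ‖v‖) := by
          gcongr; exact abs_real_inner_le_norm _ _
      _ = (ρ s y * ‖w‖) * ‖v‖ := by ring
      _ ≤ 2 * M * S * ‖v‖ := by gcongr
  have b3' : ‖U' - DU ((1 / 2 : ℝ) • y) - ((d : ℝ) / 2) • U + DU U‖
      ≤ M * (‖U'‖ + ‖DU y‖ + d * ‖U‖ + ‖DU‖) := by
    have h3 : ‖DU ((1 / 2 : ℝ) • y)‖ ≤ ‖DU y‖ := by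
      rw [map_smul, norm_smul]
      norm_num
      linarith [norm_nonneg (DU y)]
    have h4 : ‖((d : ℝ) / 2) • U‖ ≤ d * ‖U‖ := by
      rw [norm_smul, Real.norm_of_nonneg (by positivity)]
      gcongr; linarith
    have h5 : ‖DU U‖ ≤ M * ‖DU‖ := (DU.le_opNorm U).trans (by rw [mul_comm]; gcongr)
    have h6 := norm_add_le (U' - DU ((1 / 2 : ℝ) • y) - ((d : ℝ) / 2) • U) (DU U)
    have h7 := norm_sub_le (U' - DU ((1 / 2 : ℝ) • y)) (((d : ℝ) / 2) • U)
    have h8 := norm_sub_le U' (DU ((1 / 2 : ℝ) • y))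
    have h9 : ‖U'‖ + ‖DU y‖ + d * ‖U‖ ≤ M * (‖U'‖ + ‖DU y‖ + d * ‖U‖) :=
      le_mul_of_one_le_left (by positivity) hM
    linarith
  have b3'' : |e * ρ s y * inner ℝ w (U' - DU ((1 / 2 : ℝ) • y) - ((d : ℝ) / 2) • U + DU U)|
      ≤ 2 * M ^ 2 * S * (‖U'‖ + ‖DU y‖ + d * ‖U‖ + ‖DU‖) :=
    (b3 _).trans (by
      calc _ ≤ 2 * M * S * (M * (‖U'‖ + ‖DU y‖ + d * ‖U‖ + ‖DU‖)) := by gcongr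
        _ = _ := by ring)
  have b4 : |ρ s y * DH w| ≤ 2 * M ^ 2 * S * ‖DH‖ := by
    rw [abs_mul, abs_of_nonneg hρ]
    calc ρ s y * |DH w| ≤ ρ s y * (‖DH‖ * ‖w‖) := by gcongr; exact DH.le_opNorm w
      _ = (ρ s y * ‖w‖) * ‖DH‖ := by ring
      _ ≤ 2 * M ^ 2 * S * ‖DH‖ := mul_le_mul_of_nonneg_right (h1.trans hMS) (norm_nonneg _)
  have b5 : |α * (ρ s y * inner ℝ w U)| ≤ 2 * M ^ 2 * S * (|α| * ‖U‖) := by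
    rw [abs_mul, abs_mul, abs_of_nonneg hρ]
    calc |α| * (ρ s y * |inner ℝ w U|) ≤ |α| * (ρ s y * (‖w‖ * ‖U‖)) := by
          gcongr; exact abs_real_inner_le_norm _ _
      _ = (ρ s y * ‖w‖) * (|α| * ‖U‖) := by ring
      _ ≤ 2 * M ^ 2 * S * (|α| * ‖U‖) := mul_le_mul_of_nonneg_right (h1.trans hMS) (by positivity)
  have b6 : |(ρ s y - ρb s y) * (H' - DH ((1 / 2 : ℝ) • y) + DH U)|
      ≤ 2 * M ^ 2 * S * (‖H'‖ + ‖DH y‖ + ‖DH‖) := by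
    have h3 : |ρ s y - ρb s y| ≤ 2 * M * S := by
      refine (abs_sub _ _).trans ?_
      rw [abs_of_nonneg hρ]
      nlinarith
    have h4 : |H' - DH ((1 / 2 : ℝ) • y) + DH U| ≤ M * (‖H'‖ + ‖DH y‖ + ‖DH‖) := by
      have h5 : |DH ((1 / 2 : ℝ) • y)| ≤ ‖DH y‖ := by
        rw [map_smul, smul_eq_mul, abs_mul, ← Real.norm_eq_abs (DH y)]
        norm_num
        linarith [abs_nonneg (DH y)]
      have h6 : |DH U| ≤ M * ‖DH‖ := (DH.le_opNorm U).trans (by rw [mul_comm]; gcongr)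
      have h7 := abs_add_le (H' - DH ((1 / 2 : ℝ) • y)) (DH U)
      have h8 := abs_sub H' (DH ((1 / 2 : ℝ) • y))
      have h9 : ‖H'‖ + ‖DH y‖ ≤ M * (‖H'‖ + ‖DH y‖) := le_mul_of_one_le_left (by positivity) hM
      rw [Real.norm_eq_abs H'] at *
      linarith
    rw [abs_mul]
    calc _ ≤ 2 * M * S * (M * (‖H'‖ + ‖DH y‖ + ‖DH‖)) := by gcongr
      _ = _ := by ring
  have t := abs_sub_six (e * ρ s y * inner ℝ w (DU w))
    (divergence (fun z => velocity (ρb s z) (nb s z)) y * (p (ρ s y) - legendre h (ρb s y)))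
    (e * ρ s y * inner ℝ w (U' - DU ((1 / 2 : ℝ) • y) - ((d : ℝ) / 2) • U + DU U))
    (ρ s y * DH w) (α * (ρ s y * inner ℝ w U))
    ((ρ s y - ρb s y) * (H' - DH ((1 / 2 : ℝ) • y) + DH U))
  refine t.trans ((add_le_add (add_le_add (add_le_add (add_le_add (add_le_add b1 b2) b3'') b4) b5)
    b6).trans ?_)
  have hc : 0 ≤ 2 * M ^ 2 * S := by positivity
  -- Collecting coefficients: the largest ones are 2 + d at the velocity gradient and d + |α| at the
  -- velocity, both covered by 4 + 2d + |α|.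
  have key : ‖DU‖ + d * ‖DU‖ + (‖U'‖ + ‖DU y‖ + d * ‖U‖ + ‖DU‖) + ‖DH‖ + |α| * ‖U‖
      + (‖H'‖ + ‖DH y‖ + ‖DH‖)
      ≤ (4 + 2 * d + |α|) * (‖U‖ + ‖DU‖ + ‖U'‖ + ‖DU y‖ + ‖DH‖ + ‖H'‖ + ‖DH y‖) := by
    have hα := abs_nonneg α
    have a1 := norm_nonneg U
    have a2 := norm_nonneg DU
    have a3 := norm_nonneg U'
    have a4 := norm_nonneg (DU y)
    have a5 := norm_nonneg DH
    have a6 := norm_nonneg H'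
    have a7 := norm_nonneg (DH y)
    have c1 : 0 ≤ (2 * d + |α|) * (‖U'‖ + ‖DU y‖ + ‖DH‖ + ‖H'‖ + ‖DH y‖) := by positivity
    have c2 : 0 ≤ d * ‖DU‖ := by positivity
    have c3 : 0 ≤ |α| * ‖DU‖ := by positivity
    have c4 : 0 ≤ d * ‖U‖ := by positivity
    linarith
  calc _ = 2 * M ^ 2 * S * (‖DU‖ + d * ‖DU‖ + (‖U'‖ + ‖DU y‖ + d * ‖U‖ + ‖DU‖) + ‖DH‖ + |α| * ‖U‖
      + (‖H'‖ + ‖DH y‖ + ‖DH‖)) := by ring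
    _ ≤ 2 * M ^ 2 * S * ((4 + 2 * d + |α|)
        * (‖U‖ + ‖DU‖ + ‖U'‖ + ‖DU y‖ + ‖DH‖ + ‖H'‖ + ‖DH y‖)) := by gcongr
    _ = _ := by ring

section Solution

variable {ρhat ρ₀ : Space d → ℝ} {n₀ : Space d → Space d} {K : (Space d → Space d) → ℝ}
  {ρinf : ℝ → Space d → ℝ} {E : ℝ → ℝ}

lemma IsEnergyVariationalSolution.aestronglyMeasurable_xiForm
    (hsol : IsEnergyVariationalSolution α p h ρhat ρ₀ n₀ K ρinf ρ n E)
    (hh : IsPressurePotential p h) (hb : IsReferencePair h ρb nb) (T : ℝ) :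
    AEStronglyMeasurable (fun z : ℝ × Space d => xiForm α p h ρ n ρb nb z.1 z.2)
      (volume.restrict (Ioo 0 T ×ˢ univ)) := by
  have hsub : Ioo 0 T ⊆ Ici (0:ℝ) := fun x hx => mem_Ici.2 hx.1.le
  set μ : Measure (ℝ × Space d) := volume.restrict (Ioo 0 T ×ˢ univ)
  have mρ : AEStronglyMeasurable (fun z : ℝ × Space d => ρ z.1 z.2) μ :=
    hsol.aestronglyMeasurable_density hsub
  have mn : AEStronglyMeasurable (fun z : ℝ × Space d => n z.1 z.2) μ :=
    hsol.aestronglyMeasurable_momentum hsub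
  have mp : AEStronglyMeasurable (fun z : ℝ × Space d => p (ρ z.1 z.2)) μ :=
    hsol.pressure_locallyIntegrable.aestronglyMeasurable.mono_measure
      (Measure.restrict_mono (prod_mono hsub Subset.rfl) le_rfl)
  have mU : AEStronglyMeasurable (fun z : ℝ × Space d => velocity (ρb z.1 z.2) (nb z.1 z.2)) μ :=
    aestronglyMeasurable_slab hb.velocity_continuousOn hsub measurableSet_Ioo
  have mr : AEStronglyMeasurable (fun z : ℝ × Space d => ρb z.1 z.2) μ :=
    aestronglyMeasurable_slab hb.density_continuousOn hsub measurableSet_Ioo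
  have mP : AEStronglyMeasurable (fun z : ℝ × Space d => legendre h (ρb z.1 z.2)) μ :=
    aestronglyMeasurable_slab (hb.legendre_continuousOn hh) hsub measurableSet_Ioo
  have mDU : AEStronglyMeasurable (fun z : ℝ × Space d =>
      fderiv ℝ (fun y => velocity (ρb z.1 y) (nb z.1 y)) z.2) μ :=
    aestronglyMeasurable_of_continuousOn_Ioi (continuousOn_fderiv_space hb.velocity_contDiffOn) T
  have mDH : AEStronglyMeasurable (fun z : ℝ × Space d =>
      fderiv ℝ (fun y => enthalpy h (ρb z.1 y)) z.2) μ :=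
    aestronglyMeasurable_of_continuousOn_Ioi (continuousOn_fderiv_space hb.enthalpy_contDiffOn) T
  have mU' : AEStronglyMeasurable (fun z : ℝ × Space d =>
      deriv (fun s => velocity (ρb s z.2) (nb s z.2)) z.1) μ :=
    aestronglyMeasurable_of_continuousOn_Ioi (continuousOn_deriv_time hb.velocity_contDiffOn) T
  have mH' : AEStronglyMeasurable (fun z : ℝ × Space d =>
      deriv (fun s => enthalpy h (ρb s z.2)) z.1) μ :=
    aestronglyMeasurable_of_continuousOn_Ioi (continuousOn_deriv_time hb.enthalpy_contDiffOn) T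
  have mw : AEStronglyMeasurable (fun z : ℝ × Space d => relVelocity ρ n ρb nb z.1 z.2) μ :=
    (mρ.aemeasurable.inv.aestronglyMeasurable.smul mn).sub mU
  have me : AEStronglyMeasurable (fun z : ℝ × Space d => Real.exp (-(d * z.1))) μ :=
    (contDiff_exp_neg (d := d) (k := 0)).continuous.aestronglyMeasurable
  have my : AEStronglyMeasurable (fun z : ℝ × Space d => (1 / 2 : ℝ) • z.2) μ :=
    (by fun_prop : Continuous fun z : ℝ × Space d => (1 / 2 : ℝ) • z.2).aestronglyMeasurable
  have mdiv : AEStronglyMeasurable (fun z : ℝ × Space d =>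
      divergence (fun y => velocity (ρb z.1 y) (nb z.1 y)) z.2) μ := by
    simp only [divergence_eq]
    exact (divergenceForm d).continuous.comp_aestronglyMeasurable mDU
  have t1 := (me.mul mρ).mul (mw.inner (𝕜 := ℝ) (aestronglyMeasurable_apply mDU mw))
  have t2 := mdiv.mul (mp.sub mP)
  have t3 := (me.mul mρ).mul (mw.inner (𝕜 := ℝ) (((mU'.sub (aestronglyMeasurable_apply mDU my)).sub
    (mU.const_smul ((d : ℝ) / 2))).add (aestronglyMeasurable_apply mDU mU)))
  have t4 := mρ.mul (aestronglyMeasurable_apply mDH mw)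
  have t5 := (mρ.mul (mw.inner (𝕜 := ℝ) mU)).const_mul α
  have t6 := (mρ.sub mr).mul ((mH'.sub (aestronglyMeasurable_apply mDH my)).add
    (aestronglyMeasurable_apply mDH mU))
  exact ((((t1.neg.sub t2).sub t3).sub t4).sub t5).sub t6

end Solution

end

section

/-! ### Compact perturbations and the vacuum -/

variable {α : ℝ} {p h : ℝ → ℝ} {ρ ρb ρinf : ℝ → Space d → ℝ} {n nb : ℝ → Space d → Space d}

/-- On a compact space-time set the weighted size is bounded by continuity, and that bound times the
volume of the ball controls its integral. -/
lemma hasMultiplierDecay_of_eq_zero (hh : IsPressurePotential p h) (hi : IsReferencePair h ρinf 0)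
    (hb : IsReferencePair h ρb nb) (h0 : ∀ T : ℝ, ∃ R : ℝ, ∀ τ ∈ Icc 0 T, ∀ y, R < ‖y‖ →
      multiplierSize h ρinf ρb nb τ y = 0) : HasMultiplierDecay h ρinf ρb nb := by
  intro T
  obtain ⟨R, hR⟩ := h0 T
  have hc : ContinuousOn (fun z : ℝ × Space d => (1 + ‖z.2‖) * multiplierSize h ρinf ρb nb z.1 z.2)
      (Ici 0 ×ˢ univ) :=
    (by fun_prop : Continuous fun z : ℝ × Space d => 1 + ‖z.2‖).continuousOn.mul
      (multiplierSize_continuousOn hh hi hb)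
  obtain ⟨C, hC, hCb⟩ := exists_bound_of_continuousOn hc T R
  have hbd : ∀ τ ∈ Icc 0 T, ∀ y, (1 + ‖y‖) * multiplierSize h ρinf ρb nb τ y
      ≤ (Metric.closedBall (0 : Space d) R).indicator (fun _ => C) y := by
    intro τ hτ y
    by_cases hy : ‖y‖ ≤ R
    · rw [indicator_of_mem (by simpa using hy)]
      exact (le_abs_self _).trans (hCb τ hτ y hy)
    · rw [indicator_of_notMem (by simpa using hy), hR τ hτ y (not_le.1 hy), mul_zero]
  set V := (volume (Metric.closedBall (0 : Space d) R)).toReal with hV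
  have hV0 : 0 ≤ V := ENNReal.toReal_nonneg
  refine ⟨C + C * V, by positivity, fun τ hτ => ⟨fun y => ?_, ?_⟩⟩
  · refine (hbd τ hτ y).trans ((indicator_le_self' (fun _ _ => hC) y).trans ?_)
    exact le_add_of_nonneg_right (by positivity)
  · calc ∫⁻ y, ENNReal.ofReal ((1 + ‖y‖) * multiplierSize h ρinf ρb nb τ y)
        ≤ ∫⁻ y, (Metric.closedBall (0 : Space d) R).indicator (fun _ => ENNReal.ofReal C) y := by
          refine lintegral_mono fun y => (ENNReal.ofReal_le_ofReal (hbd τ hτ y)).trans ?_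
          by_cases hy : y ∈ Metric.closedBall (0 : Space d) R
          · simp [hy]
          · simp [hy]
      _ = ENNReal.ofReal C * volume (Metric.closedBall (0 : Space d) R) := by
          rw [lintegral_indicator_const measurableSet_closedBall]
      _ = ENNReal.ofReal (C * V) := by
          rw [ENNReal.ofReal_mul hC, hV, ENNReal.ofReal_toReal measure_closedBall_lt_top.ne]
      _ ≤ _ := ENNReal.ofReal_le_ofReal (le_add_of_nonneg_left hC)

section Solution

variable {ρhat ρ₀ : Space d → ℝ} {n₀ : Space d → Space d} {K : (Space d → Space d) → ℝ}
  {E : ℝ → ℝ}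

/-- The error term of a compact perturbation is the forcing term far away from the origin. -/
lemma xiForm_eq_referenceForcing {s : ℝ} {y : Space d} (hst : IsState (ρ s y) (n s y))
    (hy : ∀ᶠ z in 𝓝 y, ρb s z = ρinf s z ∧ nb s z = 0)
    (hs : ∀ᶠ s' in 𝓝 s, ρb s' y = ρinf s' y ∧ nb s' y = 0) :
    xiForm α p h ρ n ρb nb s y = referenceForcing h ρinf ρ n s y := by
  have hU : (fun z => velocity (ρb s z) (nb s z)) =ᶠ[𝓝 y] fun _ => (0 : Space d) := by
    filter_upwards [hy] with z hz
    rw [hz.2, velocity_zero]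
  have hU' : (fun s' => velocity (ρb s' y) (nb s' y)) =ᶠ[𝓝 s] fun _ => (0 : Space d) := by
    filter_upwards [hs] with z hz
    rw [hz.2, velocity_zero]
  have hH : (fun z => enthalpy h (ρb s z)) =ᶠ[𝓝 y] fun z => enthalpy h (ρinf s z) := by
    filter_upwards [hy] with z hz
    rw [hz.1]
  have hH' : (fun s' => enthalpy h (ρb s' y)) =ᶠ[𝓝 s] fun s' => enthalpy h (ρinf s' y) := by
    filter_upwards [hs] with z hz
    rw [hz.1]
  have hw : relVelocity ρ n ρb nb s y = velocity (ρ s y) (n s y) := by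
    rw [relVelocity, hU.eq_of_nhds, sub_zero]
  have hn : n s y = ρ s y • velocity (ρ s y) (n s y) := hst.smul_velocity.symm
  rw [xiForm, divergence_eq, hU.fderiv_eq, hU'.deriv_eq, hH.fderiv_eq, hH'.deriv_eq, hw,
    hU.eq_of_nhds, hy.self_of_nhds.1, referenceForcing]
  conv_rhs => rw [hn, map_smul]
  simp
  ring

/-- The difference between the reference density and the reference state is compactly supported. -/
lemma IsEnergyVariationalSolution.exists_support_radius
    (hsol : IsEnergyVariationalSolution α p h ρhat ρ₀ n₀ K ρinf ρ n E)
    (hcp : IsCompactPerturbation ρhat ρb nb) (T : ℝ) :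
    ∃ R : ℝ, ∀ τ ∈ Icc 0 T, ∀ y, R < ‖y‖ → ρb τ y = ρinf τ y ∧ nb τ y = 0 := by
  obtain ⟨R₁, h1⟩ := hcp.support T
  obtain ⟨R₂, -, h2⟩ := hsol.refdens_limit T
  refine ⟨max R₁ R₂, fun τ hτ y hy => ?_⟩
  obtain ⟨e1, e2⟩ := h1 τ hτ y ((le_max_left _ _).trans_lt hy)
  exact ⟨e1.trans (h2 τ hτ y ((le_max_right _ _).trans_lt hy)).symm, e2⟩

lemma IsEnergyVariationalSolution.integrableOn_stateSize
    (hsol : IsEnergyVariationalSolution α p h ρhat ρ₀ n₀ K ρinf ρ n E) (T R : ℝ) :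
    IntegrableOn (stateSize p ρ n) (Ioo 0 T ×ˢ Metric.closedBall 0 R) :=
  (hsol.locallyIntegrableOn_stateSize.integrableOn_compact_subset
    (fun _ hz => ⟨hz.1.1, mem_univ _⟩ :
      Icc 0 T ×ˢ Metric.closedBall (0 : Space d) R ⊆ Ici 0 ×ˢ univ)
    (isCompact_Icc.prod (isCompact_closedBall _ _))).mono_set
      (prod_mono Ioo_subset_Icc_self Subset.rfl)

/-- On a compact set away from time 0 the coefficients are continuous, hence bounded. They may be
unbounded as τ tends to 0, which explains why integrability near 0 is a separate hypothesis for
compact perturbations. -/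
lemma IsEnergyVariationalSolution.integrableOn_xiForm_closedBall (hp : IsPressureLaw p)
    (hh : IsPressurePotential p h)
    (hsol : IsEnergyVariationalSolution α p h ρhat ρ₀ n₀ K ρinf ρ n E)
    (hb : IsReferencePair h ρb nb) {δ : ℝ} (hδ : 0 < δ) (T R : ℝ) :
    IntegrableOn (fun z : ℝ × Space d => xiForm α p h ρ n ρb nb z.1 z.2)
      (Ioo δ T ×ˢ Metric.closedBall 0 R) := by
  obtain ⟨C₁, h₁, hU⟩ := exists_bound_of_continuousOn hb.velocity_continuousOn T R
  obtain ⟨C₂, h₂, hr⟩ := exists_bound_of_continuousOn hb.density_continuousOn T R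
  obtain ⟨C₃, h₃, hP⟩ := exists_bound_of_continuousOn (hb.legendre_continuousOn hh) T R
  obtain ⟨G, hG⟩ := (isCompact_Icc.prod (isCompact_closedBall (0 : Space d) R)).exists_bound_of_continuousOn
    (hb.coefficientSize_continuousOn.mono fun z hz => ⟨hδ.trans_le hz.1.1, mem_univ _⟩ :
      ContinuousOn (coefficientSize h ρb nb) (Icc δ T ×ˢ Metric.closedBall 0 R))
  set M := 1 + C₁ + C₂ + C₃ with hM
  have hsub : Ioo δ T ×ˢ Metric.closedBall (0 : Space d) R ⊆ Ioo 0 T ×ˢ univ :=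
    prod_mono (fun x hx => ⟨hδ.trans hx.1, hx.2⟩) (subset_univ _)
  have hS : IntegrableOn (stateSize p ρ n) (Ioo δ T ×ˢ Metric.closedBall 0 R) :=
    (hsol.integrableOn_stateSize T R).mono_set
      (prod_mono (fun x hx => ⟨hδ.trans hx.1, hx.2⟩) Subset.rfl)
  refine Integrable.mono' (hS.const_mul (2 * M ^ 2 * (4 + 2 * d + |α|) * |G|))
    ((hsol.aestronglyMeasurable_xiForm hh hb T).mono_measure (Measure.restrict_mono hsub le_rfl)) ?_
  filter_upwards [ae_mono (Measure.restrict_mono hsub le_rfl)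
    (hsol.ae_isState_and_integrableOn hp hh T).1, ae_restrict_mem
      (measurableSet_Ioo.prod measurableSet_closedBall)] with z hst hz
  have hzT : z.1 ∈ Icc 0 T := ⟨(hδ.trans hz.1.1).le, hz.1.2.le⟩
  have hzR : ‖z.2‖ ≤ R := by simpa using hz.2
  have hS0 : 0 ≤ stateSize p ρ n z := by unfold stateSize; positivity
  refine (hst.abs_xiForm_le (M := M) hzT.1 (by linarith) ((hU z.1 hzT z.2 hzR).trans (by linarith))
    ((hr z.1 hzT z.2 hzR).trans (by linarith)) ((hP z.1 hzT z.2 hzR).trans (by linarith))).trans ?_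
  rw [mul_assoc _ |G|]
  gcongr
  exact (le_abs_self _).trans ((hG z ⟨Ioo_subset_Icc_self hz.1, hz.2⟩).trans (le_abs_self _))

/-- Inside the ball the coefficients are bounded; outside, the error term coincides with the
forcing, whose integrability belongs to the definition of a solution. -/
lemma IsEnergyVariationalSolution.integrableOn_xiForm_of_eq (hp : IsPressureLaw p)
    (hh : IsPressurePotential p h)
    (hsol : IsEnergyVariationalSolution α p h ρhat ρ₀ n₀ K ρinf ρ n E)
    (hb : IsReferencePair h ρb nb) {δ T R : ℝ} (hδ : 0 < δ)
    (hR : ∀ τ ∈ Icc 0 T, ∀ y, R < ‖y‖ → ρb τ y = ρinf τ y ∧ nb τ y = 0) :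
    IntegrableOn (fun z : ℝ × Space d => xiForm α p h ρ n ρb nb z.1 z.2) (Ioo δ T ×ˢ univ) := by
  have h1 := hsol.integrableOn_xiForm_closedBall hp hh hb hδ T R
  have hm : MeasurableSet (Ioo δ T ×ˢ (Metric.closedBall (0 : Space d) R)ᶜ) :=
    measurableSet_Ioo.prod measurableSet_closedBall.compl
  have hsub : Ioo δ T ×ˢ (Metric.closedBall (0 : Space d) R)ᶜ ⊆ Ioo 0 T ×ˢ univ :=
    prod_mono (fun x hx => ⟨hδ.trans hx.1, hx.2⟩) (subset_univ _)
  have h2 : IntegrableOn (fun z : ℝ × Space d => xiForm α p h ρ n ρb nb z.1 z.2)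
      (Ioo δ T ×ˢ (Metric.closedBall (0 : Space d) R)ᶜ) := by
    refine ((hsol.forcing_integrable T).mono_set
      (hsub.trans (prod_mono Ioo_subset_Ioc_self Subset.rfl))).congr ?_
    filter_upwards [ae_mono (Measure.restrict_mono hsub le_rfl)
      (hsol.ae_isState_and_integrableOn hp hh T).1, ae_restrict_mem hm] with z hst hz
    have hzR : R < ‖z.2‖ := by simpa using hz.2
    have hzT : z.1 ∈ Ioo 0 T := ⟨hδ.trans hz.1.1, hz.1.2⟩
    refine (xiForm_eq_referenceForcing hst ?_ ?_).symm
    · filter_upwards [(isOpen_lt continuous_const continuous_norm).mem_nhds hzR] with y hy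
      exact hR z.1 (Ioo_subset_Icc_self hzT) y hy
    · filter_upwards [isOpen_Ioo.mem_nhds hzT] with s hs
      exact hR s (Ioo_subset_Icc_self hs) z.2 hzR
  have := h1.union h2
  rwa [← prod_union, union_compl_self] at this

/-- The reference velocity vanishes outside a ball, so local integrability of the pressure is
enough. -/
lemma IsEnergyVariationalSolution.integrableOn_flux_of_eq (hh : IsPressurePotential p h)
    (hsol : IsEnergyVariationalSolution α p h ρhat ρ₀ n₀ K ρinf ρ n E)
    (hb : IsReferencePair h ρb nb) {T R : ℝ} (hR : ∀ τ ∈ Icc 0 T, ∀ y, R < ‖y‖ → nb τ y = 0) :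
    IntegrableOn (fun z : ℝ × Space d =>
      (p (ρ z.1 z.2) - legendre h (ρb z.1 z.2)) • velocity (ρb z.1 z.2) (nb z.1 z.2))
      (Ioo 0 T ×ˢ univ) := by
  have hsub : Ioo 0 T ⊆ Ici (0:ℝ) := fun x hx => mem_Ici.2 hx.1.le
  obtain ⟨C₁, h₁, hU⟩ := exists_bound_of_continuousOn hb.velocity_continuousOn T R
  obtain ⟨C₃, h₃, hP⟩ := exists_bound_of_continuousOn (hb.legendre_continuousOn hh) T R
  have hm : AEStronglyMeasurable (fun z : ℝ × Space d =>
      (p (ρ z.1 z.2) - legendre h (ρb z.1 z.2)) • velocity (ρb z.1 z.2) (nb z.1 z.2))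
      (volume.restrict (Ioo 0 T ×ˢ univ)) :=
    ((hsol.pressure_locallyIntegrable.aestronglyMeasurable.mono_measure
      (Measure.restrict_mono (prod_mono hsub Subset.rfl) le_rfl)).sub
      (aestronglyMeasurable_slab (hb.legendre_continuousOn hh) hsub measurableSet_Ioo)).smul
      (aestronglyMeasurable_slab hb.velocity_continuousOn hsub measurableSet_Ioo)
  refine (integrable_norm_iff hm).1 ?_
  refine integrableOn_of_le_on_compact (C := (1 + C₃) * C₁)
    (isCompact_Icc.prod (isCompact_closedBall (0 : Space d) R) (s := Icc 0 T))
    hsol.locallyIntegrableOn_stateSize hm.norm ?_ ?_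
  · intro z hz _
    have hzR : ‖z.2‖ ≤ R := by simpa using hz.2
    have hS0 : 0 ≤ stateSize p ρ n z := by unfold stateSize; positivity
    have hSp : |p (ρ z.1 z.2)| + 1 ≤ stateSize p ρ n z := by
      unfold stateSize
      linarith [norm_nonneg (ρ z.1 z.2), Real.norm_eq_abs (p (ρ z.1 z.2)),
        norm_nonneg (n z.1 z.2), norm_nonneg (‖n z.1 z.2‖ ^ 2 / ρ z.1 z.2)]
    rw [norm_norm, norm_smul, Real.norm_of_nonneg hS0]
    have h1 : ‖p (ρ z.1 z.2) - legendre h (ρb z.1 z.2)‖ ≤ (1 + C₃) * stateSize p ρ n z := by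
      have h2 := hP z.1 hz.1 z.2 hzR
      refine (norm_sub_le _ _).trans ?_
      rw [Real.norm_eq_abs (p _)]
      nlinarith [abs_nonneg (p (ρ z.1 z.2))]
    calc _ ≤ ((1 + C₃) * stateSize p ρ n z) * C₁ :=
          mul_le_mul h1 (hU z.1 hz.1 z.2 hzR) (norm_nonneg _) (by positivity)
      _ = _ := by ring
  · intro z hz hzT
    have hzR : R < ‖z.2‖ := by
      by_contra hc
      exact hz ⟨Ioo_subset_Icc_self hzT, by simpa using hc⟩
    rw [hR z.1 (Ioo_subset_Icc_self hzT) z.2 hzR, velocity_zero, smul_zero, norm_zero]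

/-- Once N exceeds R/ε, where χ is 1 on the ball of radius ε, the dilated cut-offs equal 1 wherever
the velocity is nonzero. The sequence of truncations is then stationary and a single truncation
dominates. -/
lemma IsEnergyVariationalSolution.isTruncationControlled_of_eq
    (hsol : IsEnergyVariationalSolution α p h ρhat ρ₀ n₀ K ρinf ρ n E)
    (hb : IsReferencePair h ρb nb) {χ : Space d → ℝ} (hχ : IsCutoff χ) {δ T R : ℝ} (hδ : 0 < δ)
    (hδT : δ < T) (hR : ∀ τ ∈ Icc 0 T, ∀ y, R < ‖y‖ → nb τ y = 0) :
    IsTruncationControlled h K ρinf ρ n E ρb nb χ δ T := by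
  obtain ⟨ε, hε, hball⟩ := Metric.eventually_nhds_iff.1 hχ.eventually_eq_one
  obtain ⟨N, hN⟩ := exists_nat_gt (R / ε)
  have heq : ∀ j ≥ N, ∀ s ∈ Ioo δ T,
      (fun y => dilate χ j y • -velocity (ρb s y) (nb s y))
        = fun y => -velocity (ρb s y) (nb s y) := by
    intro j hj s hs
    ext1 y
    by_cases hy : R < ‖y‖
    · rw [hR s ⟨(hδ.trans hs.1).le, hs.2.le⟩ y hy, velocity_zero, neg_zero, smul_zero]
    · have hj' : (N : ℝ) ≤ j := by exact_mod_cast hj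
      have h1 : dilate χ j y = 1 := by
        refine hball ?_
        rw [dist_zero_right, norm_smul, norm_inv, Real.norm_of_nonneg (by positivity),
          inv_mul_lt_iff₀ (by positivity)]
        rw [div_lt_iff₀ hε] at hN
        nlinarith [not_lt.1 hy]
      rw [h1, one_smul]
  have hi := hsol.integrableOn_truncatedDefect hb (dilate_contDiff hχ.contDiff_one N)
    (dilate_hasCompactSupport hχ.hasCompactSupport N) hδ hδT
  refine ⟨?_, _, hi.norm, N, fun j hj => ?_⟩
  · filter_upwards [ae_restrict_mem measurableSet_Ioo] with s hs
    refine tendsto_const_nhds.congr' ?_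
    filter_upwards [eventually_ge_atTop N] with j hj
    rw [heq j hj s hs]
  · filter_upwards [ae_restrict_mem measurableSet_Ioo] with s hs
    rw [heq j hj s hs, heq N le_rfl s hs]

/-- Compact perturbations of a positive reference density are admissible. -/
lemma IsCompactPerturbation.isAdmissible (hp : IsPressureLaw p) (hh : IsPressurePotential p h)
    (hsol : IsEnergyVariationalSolution α p h ρhat ρ₀ n₀ K ρinf ρ n E)
    (hρb : IsReferenceRegular ρb) (hnb : IsReferenceRegular nb)
    (hcp : IsCompactPerturbation ρhat ρb nb)
    (hinit : ∃ δ : ℝ, 0 < δ ∧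
      IntegrableOn (Function.uncurry (xi α p h ρ n ρb nb)) (Ioo 0 δ ×ˢ univ) ∧
      IntegrableOn (weightedDefect h K ρinf ρ n E ρb nb) (Ioo 0 δ))
    {χ : Space d → ℝ} (hχ : IsCutoff χ) : IsAdmissible α p h K ρinf ρ n E ρb nb χ := by
  have hb := isReferencePair_of_pos hp hh hρb hnb hcp.pos
  refine ⟨hb, ?_, fun s hs y _ => xi_eq_xiForm_of_pos hp hh hρb hnb hcp.pos hs y, ?_, ?_, ?_, hinit⟩
  · refine hasMultiplierDecay_of_eq_zero hh (hsol.isReferencePair hh) hb fun T => ?_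
    obtain ⟨R, hR⟩ := hsol.exists_support_radius hcp T
    refine ⟨R, fun τ hτ y hy => ?_⟩
    simp [multiplierSize, densityMultiplier, momentumMultiplier, hR τ hτ y hy, velocity_zero]
  · intro δ T hδ
    obtain ⟨R, hR⟩ := hsol.exists_support_radius hcp T
    exact (hsol.integrableOn_flux_of_eq hh hb fun τ hτ y hy => (hR τ hτ y hy).2).mono_set
      (prod_mono (fun x hx => ⟨hδ.trans hx.1, hx.2⟩) Subset.rfl)
  · intro δ T hδ
    obtain ⟨R, hR⟩ := hsol.exists_support_radius hcp T
    refine (hsol.integrableOn_xiForm_of_eq hp hh hb hδ hR).congr_fun (fun z hz => ?_)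
      (measurableSet_Ioo.prod MeasurableSet.univ)
    exact (xi_eq_xiForm_of_pos hp hh hρb hnb hcp.pos (hδ.trans hz.1.1) z.2).symm
  · intro δ T hδ hδT
    obtain ⟨R, hR⟩ := hsol.exists_support_radius hcp T
    exact hsol.isTruncationControlled_of_eq hb hχ hδ hδT fun τ hτ y hy => (hR τ hτ y hy).2

/-- The internal energy is differentiable at the vacuum. -/
lemma IsVacuumRegular.differentiableWithinAt (hh : IsPressurePotential p h)
    (hv : IsVacuumRegular p) : DifferentiableWithinAt ℝ h (Ici 0) 0 := by
  have hint : IntegrableOn (fun z => p z / z ^ 2) (uIcc 0 1) := by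
    rw [uIcc_of_le zero_le_one, integrableOn_Icc_iff_integrableOn_Ioc]
    exact hv.2
  -- The derivative of h(s)/s is p(s)/s², so the integrability assumption is what gives h(z)/z a
  -- limit at 0.
  have hq : ∀ z ∈ Ioc (0:ℝ) 1, h z / z = h 1 - ∫ s in z..1, p s / s ^ 2 := by
    intro z hz
    have hd : ∀ s ∈ uIcc z 1, HasDerivAt (fun s => h s / s) (p s / s ^ 2) s := by
      intro s hs
      rw [uIcc_of_le hz.2] at hs
      have hs0 : 0 < s := hz.1.trans_le hs.1
      refine ((hh.hasDerivAt hs0).div (hasDerivAt_id s) hs0.ne').congr_deriv ?_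
      rw [← hh.mul_enthalpy_sub hs0]
      simp [mul_comm]
    have hi : IntervalIntegrable (fun s => p s / s ^ 2) volume z 1 := by
      rw [intervalIntegrable_iff_integrableOn_Ioc_of_le hz.2]
      exact hv.2.mono_set (Ioc_subset_Ioc_left hz.1.le)
    rw [intervalIntegral.integral_eq_sub_of_hasDerivAt hd hi]
    simp
  have hlim : Tendsto (fun z => h z / z) (𝓝[>] 0) (𝓝 (h 1 - ∫ s in (0:ℝ)..1, p s / s ^ 2)) := by
    have h1 := (intervalIntegral.continuousOn_primitive_interval_left hint) 0 left_mem_uIcc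
    have h2 : Tendsto (fun z => ∫ s in z..1, p s / s ^ 2) (𝓝[>] 0)
        (𝓝 (∫ s in (0:ℝ)..1, p s / s ^ 2)) := by
      refine h1.tendsto.mono_left ?_
      rw [uIcc_of_le zero_le_one]
      exact nhdsWithin_le_iff.2 (Icc_mem_nhdsGT one_pos)
    refine (h2.const_sub (h 1)).congr' ?_
    filter_upwards [Ioc_mem_nhdsGT (one_pos (α := ℝ))] with z hz using (hq z hz).symm
  -- Continuity of h at 0 together with h(z) = z · (h(z)/z) forces h(0) = 0; the limit of h(z)/z is
  -- then the one-sided derivative.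
  have h0 : h 0 = 0 := by
    have h1 : Tendsto h (𝓝[>] 0) (𝓝 (h 0)) :=
      (hh.continuousOn 0 (mem_Ici.2 le_rfl)).tendsto.mono_left
        (nhdsWithin_mono _ Ioi_subset_Ici_self)
    have h2 : Tendsto (fun z : ℝ => z) (𝓝[>] 0) (𝓝 0) := tendsto_nhdsWithin_of_tendsto_nhds tendsto_id
    have h3 := h2.mul hlim
    rw [zero_mul] at h3
    refine tendsto_nhds_unique h1 (h3.congr' ?_)
    filter_upwards [self_mem_nhdsWithin] with z hz
    exact mul_div_cancel₀ _ (ne_of_gt hz)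
  have hd : HasDerivWithinAt h (h 1 - ∫ s in (0:ℝ)..1, p s / s ^ 2) (Ici 0) 0 := by
    rw [hasDerivWithinAt_iff_tendsto_slope, Ici_sdiff_left]
    refine hlim.congr fun z => ?_
    rw [slope_def_field, h0, sub_zero, sub_zero]
  exact hd.differentiableWithinAt

lemma isReferencePair_vacuum (hd : DifferentiableWithinAt ℝ h (Ici 0) 0)
    (h0 : ∀ τ, 0 ≤ τ → ∀ y, ρb τ y = 0 ∧ nb τ y = 0) : IsReferencePair h ρb nb where
  nonneg τ hτ y := (h0 τ hτ y).1.ge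
  differentiableWithinAt τ hτ y := by rwa [(h0 τ hτ y).1]
  density_continuousOn := continuousOn_const.congr fun z hz => (h0 z.1 hz.1 z.2).1
  density_contDiffOn := contDiffOn_const.congr fun z hz => (h0 z.1 (le_of_lt hz.1) z.2).1
  enthalpy_continuousOn := (continuousOn_const (c := enthalpy h 0)).congr fun z hz => by
    rw [(h0 z.1 hz.1 z.2).1]
  enthalpy_contDiffOn := (contDiffOn_const (c := enthalpy h 0)).congr fun z hz => by
    rw [(h0 z.1 (le_of_lt hz.1) z.2).1]
  velocity_continuousOn := (continuousOn_const (c := (0 : Space d))).congr fun z hz => by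
    rw [(h0 z.1 hz.1 z.2).2, velocity_zero]
  velocity_contDiffOn := (contDiffOn_const (c := (0 : Space d))).congr fun z hz => by
    rw [(h0 z.1 (le_of_lt hz.1) z.2).2, velocity_zero]

lemma xi_vacuum (h0 : ∀ τ, 0 ≤ τ → ∀ y, ρb τ y = 0 ∧ nb τ y = 0) {s : ℝ} (hs : 0 < s)
    (y : Space d) : xi α p h ρ n ρb nb s y = 0 ∧ xiForm α p h ρ n ρb nb s y = 0 := by
  have e1 : ρb s = fun _ => 0 := funext fun z => (h0 s hs.le z).1
  have e2 : nb s = fun _ => 0 := funext fun z => (h0 s hs.le z).2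
  have t1 : (fun s' => ρb s' y) =ᶠ[𝓝 s] fun _ => 0 := by
    filter_upwards [Ioi_mem_nhds hs] with s' hs' using (h0 s' (le_of_lt hs') y).1
  have t2 : (fun s' => enthalpy h (ρb s' y)) =ᶠ[𝓝 s] fun _ => enthalpy h 0 := by
    filter_upwards [t1] with s' hs'
    rw [hs']
  have t3 : (fun s' => velocity (ρb s' y) (nb s' y)) =ᶠ[𝓝 s] fun _ => (0 : Space d) := by
    filter_upwards [Ioi_mem_nhds hs] with s' hs'
    rw [(h0 s' (le_of_lt hs') y).2, velocity_zero]
  constructor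
  · rw [xi, xiOne, xiTwo, xiThree, residualMass, t1.deriv_eq, e1, e2]
    simp [velocity_zero, divergence_eq]
  · rw [xiForm, t2.deriv_eq, t3.deriv_eq, e1, e2]
    simp [velocity_zero, divergence_eq]

/-- The vacuum is admissible if the limit density vanishes. -/
lemma IsVacuumRegular.isAdmissible (hh : IsPressurePotential p h) (hv : IsVacuumRegular p)
    (hsol : IsEnergyVariationalSolution α p h ρhat ρ₀ n₀ K ρinf ρ n E) (hρhat : ∀ y, ρhat y = 0)
    (h0 : ∀ τ, 0 ≤ τ → ∀ y, ρb τ y = 0 ∧ nb τ y = 0) {χ : Space d → ℝ} (hχ : IsCutoff χ) :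
    IsAdmissible α p h K ρinf ρ n E ρb nb χ := by
  have hb := isReferencePair_vacuum (hv.differentiableWithinAt hh) h0
  have hxi : ∀ a T : ℝ, 0 ≤ a → IntegrableOn (fun z : ℝ × Space d => xi α p h ρ n ρb nb z.1 z.2)
      (Ioo a T ×ˢ univ) := fun a T ha =>
    integrableOn_zero.congr_fun (fun z hz => (xi_vacuum h0 (ha.trans_lt hz.1.1) z.2).1.symm)
      (measurableSet_Ioo.prod MeasurableSet.univ)
  have hn0 : ∀ T R : ℝ, ∀ τ ∈ Icc 0 T, ∀ y, R < ‖y‖ → nb τ y = 0 :=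
    fun T R τ hτ y _ => (h0 τ hτ.1 y).2
  -- Scaling the zero field by 2 gives K(0) = 2K(0).
  have hK : K (fun _ => 0) = 0 := by
    have h1 := hsol.weight.homogeneous 2 two_pos (fun _ => 0) ⟨contDiff_const, HasCompactSupport.zero⟩
    simp only [smul_zero] at h1
    linarith
  refine ⟨hb, ?_, fun s hs y _ => ?_, fun δ T hδ => ?_, fun δ T hδ => hxi δ T hδ.le,
    fun δ T hδ hδT => hsol.isTruncationControlled_of_eq hb hχ hδ hδT (hn0 T 0),
    1, one_pos, hxi 0 1 le_rfl, ?_⟩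
  · refine hasMultiplierDecay_of_eq_zero hh (hsol.isReferencePair hh) hb fun T => ?_
    obtain ⟨R, -, hR⟩ := hsol.refdens_limit T
    refine ⟨R, fun τ hτ y hy => ?_⟩
    simp [multiplierSize, densityMultiplier, momentumMultiplier, hR τ hτ y hy, hρhat,
      h0 τ hτ.1 y, velocity_zero]
  · rw [(xi_vacuum h0 hs y).1, (xi_vacuum h0 hs y).2]
  · exact (hsol.integrableOn_flux_of_eq hh hb (hn0 T 0)).mono_set
      (prod_mono (fun x hx => ⟨hδ.trans hx.1, hx.2⟩) Subset.rfl)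
  · refine integrableOn_zero.congr_fun (fun s hs => ?_) measurableSet_Ioo
    have h1 : (fun y => -velocity (ρb s y) (nb s y)) = fun _ => (0 : Space d) := funext fun y => by
      rw [(h0 s hs.1.le y).2, velocity_zero, neg_zero]
    rw [weightedDefect, h1, hK, zero_mul]

end Solution

end

section

/-! ### Functions which are bounded and integrable in space, uniformly in time -/

/-- The slices of `f` at the times in `s` are bounded in `L¹ ∩ L^∞`. -/
def IsUniformlyBounded (f : ℝ × Space d → ℝ) (s : Set ℝ) : Prop :=
  ∃ C : ℝ, 0 ≤ C ∧ ∀ τ ∈ s, AEStronglyMeasurable (fun y => f (τ, y)) ∧ (∀ y, |f (τ, y)| ≤ C) ∧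
    ∫⁻ y, ENNReal.ofReal |f (τ, y)| ≤ ENNReal.ofReal C

namespace IsUniformlyBounded

variable {f g : ℝ × Space d → ℝ} {s : Set ℝ}

lemma add (hf : IsUniformlyBounded f s) (hg : IsUniformlyBounded g s) :
    IsUniformlyBounded (fun z => f z + g z) s := by
  obtain ⟨C, hC, h1⟩ := hf
  obtain ⟨D, hD, h2⟩ := hg
  refine ⟨C + D, by positivity, fun τ hτ => ?_⟩
  obtain ⟨a1, a2, a3⟩ := h1 τ hτ
  obtain ⟨b1, b2, b3⟩ := h2 τ hτ
  refine ⟨a1.add b1, fun y => (abs_add_le _ _).trans (add_le_add (a2 y) (b2 y)), ?_⟩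
  calc ∫⁻ y, ENNReal.ofReal |f (τ, y) + g (τ, y)|
      ≤ ∫⁻ y, (ENNReal.ofReal |f (τ, y)| + ENNReal.ofReal |g (τ, y)|) := by
        refine lintegral_mono fun y => ?_
        rw [← ENNReal.ofReal_add (abs_nonneg _) (abs_nonneg _)]
        exact ENNReal.ofReal_le_ofReal (abs_add_le _ _)
    _ = (∫⁻ y, ENNReal.ofReal |f (τ, y)|) + ∫⁻ y, ENNReal.ofReal |g (τ, y)| :=
        lintegral_add_left' (a1.aemeasurable.abs.ennreal_ofReal) _
    _ ≤ _ := by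
        rw [ENNReal.ofReal_add hC hD]
        exact add_le_add a3 b3

lemma of_le (hg : IsUniformlyBounded g s) {L : ℝ}
    (hm : ∀ τ ∈ s, AEStronglyMeasurable (fun y => f (τ, y)))
    (hle : ∀ τ ∈ s, ∀ y, |f (τ, y)| ≤ L * |g (τ, y)|) : IsUniformlyBounded f s := by
  obtain ⟨C, hC, h1⟩ := hg
  refine ⟨|L| * C, by positivity, fun τ hτ => ?_⟩
  obtain ⟨a1, a2, a3⟩ := h1 τ hτ
  have hle' : ∀ y, |f (τ, y)| ≤ |L| * |g (τ, y)| := fun y =>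
    (hle τ hτ y).trans (by gcongr; exact le_abs_self L)
  refine ⟨hm τ hτ, fun y => (hle' y).trans (by gcongr; exact a2 y), ?_⟩
  calc ∫⁻ y, ENNReal.ofReal |f (τ, y)| ≤ ∫⁻ y, ENNReal.ofReal |L| * ENNReal.ofReal |g (τ, y)| := by
        refine lintegral_mono fun y => ?_
        rw [← ENNReal.ofReal_mul (abs_nonneg _)]
        exact ENNReal.ofReal_le_ofReal (hle' y)
    _ = ENNReal.ofReal |L| * ∫⁻ y, ENNReal.ofReal |g (τ, y)| :=
        lintegral_const_mul' _ _ ENNReal.ofReal_ne_top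
    _ ≤ _ := by
        rw [ENNReal.ofReal_mul (abs_nonneg _)]
        gcongr

lemma indicator_closedBall (R : ℝ) : IsUniformlyBounded
    (fun z : ℝ × Space d => (Metric.closedBall (0 : Space d) R).indicator (fun _ => (1:ℝ)) z.2) s := by
  refine ⟨1 + (volume (Metric.closedBall (0 : Space d) R)).toReal, by positivity, fun τ _ =>
    ⟨(measurable_const.indicator measurableSet_closedBall).aestronglyMeasurable, fun y => ?_, ?_⟩⟩
  · by_cases hy : y ∈ Metric.closedBall (0 : Space d) R <;> simp only [hy, indicator_of_mem,
      indicator_of_notMem, not_false_iff, abs_zero, abs_one]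
    · exact le_add_of_nonneg_right ENNReal.toReal_nonneg
    · positivity
  · calc _ = ∫⁻ y, (Metric.closedBall (0 : Space d) R).indicator (fun _ => 1) y := by
          refine lintegral_congr fun y => ?_
          by_cases hy : y ∈ Metric.closedBall (0 : Space d) R <;> simp [hy]
      _ = volume (Metric.closedBall (0 : Space d) R) := by
          rw [lintegral_indicator_const measurableSet_closedBall, one_mul]
      _ = ENNReal.ofReal (volume (Metric.closedBall (0 : Space d) R)).toReal := by
          rw [ENNReal.ofReal_toReal measure_closedBall_lt_top.ne]
      _ ≤ _ := ENNReal.ofReal_le_ofReal (by linarith)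

/-- By continuity, it suffices to have bounds for a dense set of times. -/
lemma of_subset_closure {D : Set ℝ} (hf : IsUniformlyBounded f D) (hDs : D ⊆ s)
    (hsD : s ⊆ closure D) (hc : ContinuousOn f (s ×ˢ univ)) : IsUniformlyBounded f s := by
  obtain ⟨C, hC, h1⟩ := hf
  refine ⟨C, hC, fun τ hτ => ?_⟩
  have hslice : ∀ σ ∈ s, Continuous fun y => f (σ, y) := fun σ hσ =>
    hc.comp_continuous (by fun_prop) fun _ => ⟨hσ, mem_univ _⟩
  obtain ⟨u, hu, hlim⟩ := mem_closure_iff_seq_limit.1 (hsD hτ)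
  have hy : ∀ y, Tendsto (fun k => f (u k, y)) atTop (𝓝 (f (τ, y))) := fun y => by
    refine (hc (τ, y) ⟨hτ, mem_univ _⟩).tendsto.comp (tendsto_nhdsWithin_iff.2
      ⟨hlim.prodMk_nhds tendsto_const_nhds, Eventually.of_forall fun k => ⟨hDs (hu k), mem_univ _⟩⟩)
  refine ⟨(hslice τ hτ).aestronglyMeasurable, fun y => ?_, ?_⟩
  · exact le_of_tendsto' (hy y).abs fun k => (h1 _ (hu k)).2.1 y
  · have h2 : ∀ y, ENNReal.ofReal |f (τ, y)|
        = liminf (fun k => ENNReal.ofReal |f (u k, y)|) atTop := fun y =>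
      (ENNReal.tendsto_ofReal (hy y).abs).liminf_eq.symm
    simp only [h2]
    -- Fatou's lemma carries the L¹ bound to the limiting time.
    refine (lintegral_liminf_le' fun k => (hslice _ (hDs (hu k))).abs.measurable.ennreal_ofReal.aemeasurable).trans ?_
    refine liminf_le_of_frequently_le' (Frequently.of_forall fun k => (h1 _ (hu k)).2.2)

lemma integrableOn {T : ℝ} (hf : IsUniformlyBounded f (Ioo 0 T))
    (hm : AEStronglyMeasurable f (volume.restrict (Ioo 0 T ×ˢ univ))) :
    IntegrableOn f (Ioo 0 T ×ˢ univ) := by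
  obtain ⟨C, hC, h1⟩ := hf
  rw [restrict_slab] at hm
  rw [IntegrableOn, restrict_slab]
  refine ⟨hm, ?_⟩
  rw [hasFiniteIntegral_iff_enorm, lintegral_prod _ hm.enorm]
  calc ∫⁻ τ in Ioo 0 T, ∫⁻ y, ‖f (τ, y)‖ₑ ≤ ∫⁻ _ in Ioo 0 T, ENNReal.ofReal C := by
        refine setLIntegral_mono' measurableSet_Ioo fun τ hτ => ?_
        simp only [Real.enorm_eq_ofReal_abs]
        exact (h1 τ hτ).2.2
    _ < ⊤ := by
        rw [setLIntegral_const]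
        exact ENNReal.mul_lt_top ENNReal.ofReal_lt_top measure_Ioo_lt_top

end IsUniformlyBounded

lemma ae_iff_forall_of_continuous {f : Space d → ℝ} (hf : Continuous f) {C : ℝ}
    (h : ∀ᵐ y, f y ≤ C) (y : Space d) : f y ≤ C := by
  have h1 : closure {y | f y ≤ C} = univ := (Measure.dense_of_ae h).closure_eq
  have h2 : IsClosed {y | f y ≤ C} := isClosed_le hf continuous_const
  rw [h2.closure_eq] at h1
  exact h1.ge (mem_univ y)

/-- Times satisfying the bounds form a set of full measure, hence a dense set, and continuity
extends the bounds to every time. Continuity in y likewise upgrades the essential supremum to a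
supremum. -/
lemma IsLocBoundedL1Linfty.isUniformlyBounded {F : Type*} [NormedAddCommGroup F]
    {f : ℝ → Space d → F} (hf : IsLocBoundedL1Linfty f)
    (hc : ContinuousOn (fun z : ℝ × Space d => ‖f z.1 z.2‖) (Ioi 0 ×ˢ univ)) (T : ℝ) :
    IsUniformlyBounded (fun z => ‖f z.1 z.2‖) (Ioo 0 T) := by
  obtain ⟨C, hC⟩ := hf T
  have hc' : ContinuousOn (fun z : ℝ × Space d => ‖f z.1 z.2‖) (Ioo 0 T ×ˢ univ) :=
    hc.mono (prod_mono (fun _ hx => hx.1) Subset.rfl)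
  have hP : ∀ᵐ τ, τ ∈ Ioo 0 T → AEStronglyMeasurable (f τ) volume ∧ eLpNorm (f τ) 1 volume ≤ C ∧
      eLpNorm (f τ) ⊤ volume ≤ C := (ae_restrict_iff' measurableSet_Ioo).1 hC
  have hcl := (Measure.dense_of_ae hP).open_subset_closure_inter (isOpen_Ioo (a := (0:ℝ)) (b := T))
  refine IsUniformlyBounded.of_subset_closure ?_ inter_subset_left hcl hc'
  refine ⟨C, C.2, fun τ hτ => ?_⟩
  obtain ⟨h1, h2, h3⟩ := hτ.2 hτ.1
  have hcont : Continuous fun y => ‖f τ y‖ :=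
    hc'.comp_continuous (f := fun y : Space d => (τ, y)) (by fun_prop) fun _ => ⟨hτ.1, mem_univ _⟩
  refine ⟨h1.norm, fun y => ?_, ?_⟩
  · rw [abs_norm]
    refine ae_iff_forall_of_continuous hcont ?_ y
    filter_upwards [ae_le_eLpNormEssSup (f := f τ) (μ := volume)] with y hy
    rw [eLpNorm_exponent_top] at h3
    have := hy.trans h3
    rw [← ofReal_norm] at this
    exact (ENNReal.ofReal_le_coe (a := ‖f τ y‖)).1 this
  · rw [eLpNorm_one_eq_lintegral_enorm] at h2
    simp only [abs_norm, ofReal_norm]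
    simpa using h2

variable {p h : ℝ → ℝ}

/-- The enthalpy and the pressure are Lipschitz continuous away from the vacuum. -/
lemma exists_lipschitz_bound (hp : IsPressureLaw p) (hh : IsPressurePotential p h) {a b : ℝ}
    (ha : 0 < a) : ∃ L : ℝ, 0 ≤ L ∧ ∀ x ∈ Icc a b, |deriv p x / x| ≤ L ∧ ∀ y ∈ Icc a b,
      |enthalpy h x - enthalpy h y| ≤ L * |x - y| ∧ |p x - p y| ≤ L * |x - y| := by
  have hsub : Icc a b ⊆ Ioi 0 := fun x hx => ha.trans_le hx.1
  have hc : ContinuousOn (deriv p) (Icc a b) :=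
    (hp.contDiffOn.continuousOn_deriv_of_isOpen isOpen_Ioi le_rfl).mono hsub
  obtain ⟨C₁, h1⟩ := isCompact_Icc.exists_bound_of_continuousOn hc
  obtain ⟨C₂, h2⟩ := isCompact_Icc.exists_bound_of_continuousOn
    (hc.div continuousOn_id fun x hx => (hsub hx).ne')
  refine ⟨max (max C₁ C₂) 0, le_max_right _ _, fun x hx => ⟨(h2 x hx).trans ?_, fun y hy => ⟨?_, ?_⟩⟩⟩
  · exact (le_max_right _ _).trans (le_max_left _ _)
  · refine (convex_Icc a b).norm_image_sub_le_of_norm_deriv_le (f := enthalpy h)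
      (fun z hz => (hasDerivAt_enthalpy hp hh (hsub hz)).differentiableAt) (fun z hz => ?_) hy hx
    rw [(hasDerivAt_enthalpy hp hh (hsub hz)).deriv]
    exact (h2 z hz).trans ((le_max_right _ _).trans (le_max_left _ _))
  · refine (convex_Icc a b).norm_image_sub_le_of_norm_deriv_le (f := p)
      (fun z hz => (hp.hasDerivAt (hsub hz)).differentiableAt) (fun z hz => ?_) hy hx
    exact (h1 z hz).trans ((le_max_left _ _).trans (le_max_left _ _))

end

section

/-! ### Decaying perturbations -/

section Solution

variable {α : ℝ} {p h : ℝ → ℝ} {ρ ρb ρinf : ℝ → Space d → ℝ} {n nb : ℝ → Space d → Space d}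
  {ρhat ρ₀ : Space d → ℝ} {n₀ : Space d → Space d} {K : (Space d → Space d) → ℝ} {E : ℝ → ℝ}

/-- If ρ̂ vanished, |y|ρ̄ would be bounded, contradicting the positive lower bound of ρ̄. -/
lemma HasReferenceDecay.isAngularLimit (hd : 1 ≤ d)
    (hρhat : IsAngularLimit ρhat ∨ ∀ y, ρhat y = 0) (hdec : HasReferenceDecay ρhat ρb nb) :
    IsAngularLimit ρhat := by
  refine hρhat.resolve_right fun h0 => ?_
  obtain ⟨c, hc, hcb⟩ := hdec.inf_pos
  obtain ⟨C, hC⟩ := hdec.density 1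
  obtain ⟨τ, hτ, h1, h2⟩ := exists_mem_Ioo_of_ae ((ae_restrict_iff' measurableSet_Ioo).1 hC) one_pos
  obtain ⟨-, -, h3⟩ := hτ ⟨h1, h2⟩
  have hle : ∀ᵐ y : Space d, ‖y‖ * c ≤ C := by
    filter_upwards [ae_le_eLpNormEssSup (f := fun y => ‖y‖ * (ρb τ y - ρhat y)) (μ := volume)]
      with y hy
    rw [eLpNorm_exponent_top] at h3
    have h4 := hy.trans h3
    rw [← ofReal_norm, ENNReal.ofReal_le_coe, h0, sub_zero, norm_mul, norm_norm] at h4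
    refine le_trans ?_ h4
    gcongr
    exact (hcb τ h1.le y).trans (le_abs_self _)
  -- A point of norm C/c + 1 gives the contradiction; it exists because the dimension is positive.
  have hall := ae_iff_forall_of_continuous (by fun_prop) hle
    (EuclideanSpace.single ⟨0, hd⟩ (C / c + 1))
  rw [PiLp.norm_single, Real.norm_of_nonneg (by positivity), add_mul,
    div_mul_cancel₀ _ hc.ne'] at hall
  linarith

/-- Boundedness of ρ̂ lets the factor |y| remove the discontinuity at the origin. Only this product
enters the decay condition on the density. -/
lemma IsAngularLimit.continuous_norm_mul (hρ : IsAngularLimit ρhat) :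
    Continuous fun y => ‖y‖ * ρhat y := by
  obtain ⟨c, M, hc, hcM⟩ := hρ.exists_bounds
  refine continuous_iff_continuousAt.2 fun y => ?_
  rcases eq_or_ne y 0 with rfl | hy
  · rw [ContinuousAt, norm_zero, zero_mul]
    refine squeeze_zero_norm (a := fun y => ‖y‖ * |M|) (fun y => ?_) ?_
    · rcases eq_or_ne y 0 with rfl | hy
      · simp
      · obtain ⟨h1, h2⟩ := hcM y hy
        rw [norm_mul, norm_norm, Real.norm_of_nonneg (hc.le.trans h1)]
        gcongr
        exact h2.trans (le_abs_self M)
    · have : Continuous fun y : Space d => ‖y‖ * |M| := by fun_prop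
      simpa using this.tendsto 0
  · exact continuous_norm.continuousAt.mul
      (hρ.contDiffOn.continuousOn.continuousAt (isOpen_compl_singleton.mem_nhds hy))

/-- The function which controls the momentum and the multipliers. -/
def decayBound (ρhat : Space d → ℝ) (ρb : ℝ → Space d → ℝ) (nb : ℝ → Space d → Space d) (R : ℝ)
    (z : ℝ × Space d) : ℝ :=
  (Metric.closedBall (0 : Space d) R).indicator (fun _ => (1:ℝ)) z.2
    + ‖‖z.2‖ * (ρb z.1 z.2 - ρhat z.2)‖ + ‖‖z.2‖ • nb z.1 z.2‖

lemma decayBound_nonneg (R : ℝ) (z : ℝ × Space d) : 0 ≤ decayBound ρhat ρb nb R z := by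
  have : 0 ≤ (Metric.closedBall (0 : Space d) R).indicator (fun _ => (1:ℝ)) z.2 :=
    indicator_nonneg (fun _ _ => zero_le_one) _
  unfold decayBound; positivity

lemma one_le_decayBound {R : ℝ} {z : ℝ × Space d} (hz : ‖z.2‖ ≤ R) :
    1 ≤ decayBound ρhat ρb nb R z := by
  unfold decayBound
  rw [indicator_of_mem (by simpa using hz)]
  linarith [norm_nonneg (‖z.2‖ * (ρb z.1 z.2 - ρhat z.2)), norm_nonneg (‖z.2‖ • nb z.1 z.2)]

lemma le_decayBound {R : ℝ} {z : ℝ × Space d} :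
    ‖z.2‖ * |ρb z.1 z.2 - ρhat z.2| + ‖z.2‖ * ‖nb z.1 z.2‖ ≤ decayBound ρhat ρb nb R z := by
  unfold decayBound
  rw [norm_mul, norm_smul, norm_norm, Real.norm_eq_abs]
  linarith [indicator_nonneg (f := fun _ => (1:ℝ)) (s := Metric.closedBall (0 : Space d) R)
    (fun _ _ => zero_le_one) z.2]

lemma HasReferenceDecay.pos (hdec : HasReferenceDecay ρhat ρb nb) (τ : ℝ) (hτ : 0 ≤ τ)
    (y : Space d) : 0 < ρb τ y := by
  obtain ⟨c, hc, hcb⟩ := hdec.inf_pos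
  exact hc.trans_le (hcb τ hτ y)

lemma HasReferenceDecay.isUniformlyBounded_decayBound (hρ : IsAngularLimit ρhat)
    (hρb : IsReferenceRegular ρb) (hnb : IsReferenceRegular nb)
    (hdec : HasReferenceDecay ρhat ρb nb) (T R : ℝ) :
    IsUniformlyBounded (decayBound ρhat ρb nb R) (Ioo 0 T) := by
  refine ((IsUniformlyBounded.indicator_closedBall R).add
    (hdec.density.isUniformlyBounded ?_ T)).add (hdec.momentum.isUniformlyBounded ?_ T)
  · have h1 : ContinuousOn (fun z : ℝ × Space d => ‖z.2‖ * ρb z.1 z.2 - ‖z.2‖ * ρhat z.2)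
        (Ioi 0 ×ˢ univ) :=
      ((by fun_prop : Continuous fun z : ℝ × Space d => ‖z.2‖).continuousOn.mul
        hρb.1.continuousOn).sub (hρ.continuous_norm_mul.comp continuous_snd).continuousOn
    simpa only [mul_sub] using h1.norm
  · exact (((by fun_prop : Continuous fun z : ℝ × Space d => ‖z.2‖).continuousOn.smul
      hnb.1.continuousOn)).norm

lemma norm_velocity_le {r a : ℝ} (ha : 0 < a) (har : a ≤ r) (m : Space d) :
    ‖velocity r m‖ ≤ a⁻¹ * ‖m‖ := by
  have hr : 0 < r := ha.trans_le har
  rw [velocity, norm_smul, norm_inv, Real.norm_of_nonneg hr.le]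
  gcongr

/-- Away from the vacuum the Legendre value is the pressure, and pressure and enthalpy are
Lipschitz; the kinetic part is quadratic in n̄, one factor being bounded by N. -/
lemma multiplierSize_le (hh : IsPressurePotential p h) {τ : ℝ} (hτ : 0 ≤ τ) {y : Space d}
    {a L N : ℝ} (ha : 0 < a) (h1 : a ≤ ρb τ y) (h2 : a ≤ ρinf τ y) (hL : 0 ≤ L)
    (hH : |enthalpy h (ρb τ y) - enthalpy h (ρinf τ y)| ≤ L * |ρb τ y - ρinf τ y|)
    (hP : |p (ρb τ y) - p (ρinf τ y)| ≤ L * |ρb τ y - ρinf τ y|) (hN : ‖nb τ y‖ ≤ N) :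
    multiplierSize h ρinf ρb nb τ y
      ≤ (2 * L + a⁻¹ * (a⁻¹ * N) + a⁻¹) * (|ρb τ y - ρinf τ y| + ‖nb τ y‖) := by
  have hU := norm_velocity_le ha h1 (nb τ y)
  have hN0 : 0 ≤ N := (norm_nonneg _).trans hN
  have he : Real.exp (-(d * τ)) ≤ 1 := Real.exp_le_one_iff.2 (by
    have := mul_nonneg (Nat.cast_nonneg (α := ℝ) d) hτ; linarith)
  have he0 := (Real.exp_pos (-(d * τ))).le
  have e1 : legendre h (ρb τ y) = p (ρb τ y) := hh.mul_enthalpy_sub (ha.trans_le h1)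
  have e2 : legendre h (ρinf τ y) = p (ρinf τ y) := hh.mul_enthalpy_sub (ha.trans_le h2)
  have b1 : |densityMultiplier h τ (ρinf τ y) (ρb τ y) (nb τ y)|
      ≤ L * |ρb τ y - ρinf τ y| + a⁻¹ * (a⁻¹ * N) * ‖nb τ y‖ := by
    refine (abs_add_le _ _).trans (add_le_add ?_ ?_)
    · rwa [abs_sub_comm]
    · rw [abs_of_nonneg (by positivity)]
      have h3 : ‖velocity (ρb τ y) (nb τ y)‖ ^ 2 ≤ (a⁻¹ * N) * (a⁻¹ * ‖nb τ y‖) := by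
        rw [sq]
        exact mul_le_mul (hU.trans (by gcongr)) hU (norm_nonneg _) (by positivity)
      calc 1 / 2 * Real.exp (-(d * τ)) * ‖velocity (ρb τ y) (nb τ y)‖ ^ 2
          ≤ 1 * 1 * ((a⁻¹ * N) * (a⁻¹ * ‖nb τ y‖)) := by
            gcongr
            norm_num
        _ = _ := by ring
  have b2 : ‖momentumMultiplier τ (ρb τ y) (nb τ y)‖ ≤ a⁻¹ * ‖nb τ y‖ := by
    rw [momentumMultiplier, norm_neg, norm_smul, Real.norm_of_nonneg he0]
    exact (mul_le_of_le_one_left (norm_nonneg _) he).trans hU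
  unfold multiplierSize
  rw [e1, e2]
  have h4 : 0 ≤ (a⁻¹ * (a⁻¹ * N) + a⁻¹) * |ρb τ y - ρinf τ y| := by positivity
  have h5 : 0 ≤ 2 * L * ‖nb τ y‖ := by positivity
  linarith

/-- Uniform bounds of a decaying perturbation. -/
lemma HasReferenceDecay.exists_bounds (hp : IsPressureLaw p) (hh : IsPressurePotential p h)
    (hρ : IsAngularLimit ρhat)
    (hsol : IsEnergyVariationalSolution α p h ρhat ρ₀ n₀ K ρinf ρ n E)
    (hρb : IsReferenceRegular ρb) (hnb : IsReferenceRegular nb)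
    (hdec : HasReferenceDecay ρhat ρb nb) (T : ℝ) :
    ∃ a b L R : ℝ, 0 < a ∧ 0 ≤ L ∧ ∀ τ ∈ Ioo 0 T, ∀ y, ρb τ y ∈ Icc a b ∧ ‖nb τ y‖ ≤ L ∧
      ‖nb τ y‖ ≤ L * decayBound ρhat ρb nb R (τ, y) ∧
      (1 + ‖y‖) * multiplierSize h ρinf ρb nb τ y ≤ L * decayBound ρhat ρb nb R (τ, y) := by
  have hi := hsol.isReferencePair hh
  have hb := isReferencePair_of_pos hp hh hρb hnb hdec.pos
  obtain ⟨c, hc, hcb⟩ := hdec.inf_pos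
  obtain ⟨c', M, hc', hcM⟩ := hρ.exists_bounds
  obtain ⟨R₁, -, hR₁⟩ := hsol.refdens_limit T
  -- Outside this radius ρ_∞ equals ρ̂, and 1 + |y| ≤ 2|y|, so the weights of the decay assumptions
  -- apply. Inside, the indicator in `decayBound` absorbs every bound.
  set R := max R₁ 1 with hR
  obtain ⟨C₁, h₁, hr⟩ := exists_bound_of_continuousOn hρb.2 T R
  obtain ⟨C₂, h₂, hm⟩ := exists_bound_of_continuousOn hnb.2 T R
  obtain ⟨C₃, h₃, hs⟩ := exists_bound_of_continuousOn
    ((by fun_prop : Continuous fun z : ℝ × Space d => 1 + ‖z.2‖).continuousOn.mul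
      (multiplierSize_continuousOn hh hi hb)) T R
  obtain ⟨C₄, h₄, hG⟩ := hdec.isUniformlyBounded_decayBound hρ hρb hnb T R
  obtain ⟨L, hL, hLip⟩ := exists_lipschitz_bound hp hh (a := min c c') (b := C₁ + |M| + C₄)
    (lt_min hc hc')
  set a := min c c'
  have ha : 0 < a := lt_min hc hc'
  set N := C₂ + C₄ with hN
  set Q := 2 * L + a⁻¹ * (a⁻¹ * N) + a⁻¹ with hQ
  have hN0 : 0 ≤ N := by positivity
  have hQ0 : 0 ≤ Q := by positivity
  refine ⟨a, C₁ + |M| + C₄, N + 1 + C₃ + 2 * Q, R, ha, by positivity, fun τ hτ y => ?_⟩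
  have hτ' := Ioo_subset_Icc_self hτ
  have hG0 := decayBound_nonneg (ρhat := ρhat) (ρb := ρb) (nb := nb) R (τ, y)
  have hG1 : decayBound ρhat ρb nb R (τ, y) ≤ C₄ := (le_abs_self _).trans ((hG τ hτ).2.1 y)
  have hac : a ≤ ρb τ y := (min_le_left _ _).trans (hcb τ hτ.1.le y)
  set G := decayBound ρhat ρb nb R (τ, y) with hGdef
  have hM0 := abs_nonneg M
  by_cases hy : ‖y‖ ≤ R
  · have hG2 : 1 ≤ G := one_le_decayBound (z := (τ, y)) hy
    have e1 : ρb τ y ≤ C₁ := (le_abs_self _).trans (hr τ hτ' y hy)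
    have e2 : ‖nb τ y‖ ≤ C₂ := hm τ hτ' y hy
    have e3 : (1 + ‖y‖) * multiplierSize h ρinf ρb nb τ y ≤ C₃ :=
      (le_abs_self _).trans (hs τ hτ' y hy)
    refine ⟨⟨hac, by linarith⟩, by linarith, ?_, ?_⟩
    · nlinarith
    · nlinarith
  · have hyR := not_le.1 hy
    have hy1 : 1 < ‖y‖ := (le_max_right _ _).trans_lt hyR
    have hy0 : y ≠ 0 := norm_pos_iff.1 (by linarith)
    have hG3 : ‖y‖ * |ρb τ y - ρhat y| + ‖y‖ * ‖nb τ y‖ ≤ G := le_decayBound (z := (τ, y))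
    have e0 : ρinf τ y = ρhat y := hR₁ τ hτ' y ((le_max_left _ _).trans_lt hyR)
    obtain ⟨e1, e2⟩ := hcM y hy0
    have e3 : |ρb τ y - ρhat y| ≤ ‖y‖ * |ρb τ y - ρhat y| :=
      le_mul_of_one_le_left (abs_nonneg _) hy1.le
    have e4 : ‖nb τ y‖ ≤ ‖y‖ * ‖nb τ y‖ := le_mul_of_one_le_left (norm_nonneg _) hy1.le
    have e5 := le_abs_self (ρb τ y - ρhat y)
    have e6 := le_abs_self M
    have e7 := norm_nonneg (nb τ y)
    have hmem : ρb τ y ∈ Icc a (C₁ + |M| + C₄) := ⟨hac, by linarith⟩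
    have hmem' : ρinf τ y ∈ Icc a (C₁ + |M| + C₄) := by
      rw [e0]
      exact ⟨(min_le_right _ _).trans e1, by linarith⟩
    have hn1 : ‖nb τ y‖ ≤ N := by linarith [abs_nonneg (ρb τ y - ρhat y)]
    obtain ⟨l1, l2⟩ := (hLip _ hmem).2 _ hmem'
    have key := multiplierSize_le hh hτ.1.le ha hac hmem'.1 hL l1 l2 hn1
    rw [← hQ] at key
    refine ⟨hmem, by linarith, ?_, ?_⟩
    · have : 0 ≤ (N + C₃ + 2 * Q) * G := by positivity
      linarith [abs_nonneg (ρb τ y - ρhat y)]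
    · calc (1 + ‖y‖) * multiplierSize h ρinf ρb nb τ y
          ≤ (2 * ‖y‖) * (Q * (|ρb τ y - ρinf τ y| + ‖nb τ y‖)) := by
            refine mul_le_mul (by linarith) key (multiplierSize_nonneg _ _) (by positivity)
        _ = 2 * Q * (‖y‖ * |ρb τ y - ρhat y| + ‖y‖ * ‖nb τ y‖) := by rw [e0]; ring
        _ ≤ 2 * Q * G := by gcongr
        _ ≤ _ := by
            gcongr
            linarith

lemma HasReferenceDecay.hasMultiplierDecay (hp : IsPressureLaw p) (hh : IsPressurePotential p h)
    (hρ : IsAngularLimit ρhat)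
    (hsol : IsEnergyVariationalSolution α p h ρhat ρ₀ n₀ K ρinf ρ n E)
    (hρb : IsReferenceRegular ρb) (hnb : IsReferenceRegular nb)
    (hdec : HasReferenceDecay ρhat ρb nb) : HasMultiplierDecay h ρinf ρb nb := by
  intro T
  have hi := hsol.isReferencePair hh
  have hb := isReferencePair_of_pos hp hh hρb hnb hdec.pos
  -- The interval (0, T') is nonempty, so its closure contains τ = 0, where the decay hypotheses say
  -- nothing but continuity supplies the bound.
  set T' := max T 1 with hT'
  have hT0 : 0 < T' := one_pos.trans_le (le_max_right _ _)
  obtain ⟨a, b, L, R, ha, hL, hbd⟩ := hdec.exists_bounds hp hh hρ hsol hρb hnb T'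
  have hc : ContinuousOn (fun z : ℝ × Space d => (1 + ‖z.2‖) * multiplierSize h ρinf ρb nb z.1 z.2)
      (Ici 0 ×ˢ univ) :=
    (by fun_prop : Continuous fun z : ℝ × Space d => 1 + ‖z.2‖).continuousOn.mul
      (multiplierSize_continuousOn hh hi hb)
  have hnn : ∀ τ y, 0 ≤ (1 + ‖y‖) * multiplierSize h ρinf ρb nb τ y := fun τ y =>
    mul_nonneg (by positivity) (multiplierSize_nonneg τ y)
  have h1 : IsUniformlyBounded
      (fun z : ℝ × Space d => (1 + ‖z.2‖) * multiplierSize h ρinf ρb nb z.1 z.2) (Ioo 0 T') := by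
    refine (hdec.isUniformlyBounded_decayBound hρ hρb hnb T' R).of_le (L := L)
      (fun τ hτ => (continuous_slice hc hτ.1.le).aestronglyMeasurable) fun τ hτ y => ?_
    rw [abs_of_nonneg (hnn τ y), abs_of_nonneg (decayBound_nonneg R (τ, y))]
    exact (hbd τ hτ y).2.2.2
  obtain ⟨C, hC, h2⟩ := h1.of_subset_closure (s := Icc 0 T') Ioo_subset_Icc_self
    (closure_Ioo hT0.ne).ge (hc.mono (prod_mono (fun _ hx => hx.1) Subset.rfl))
  refine ⟨C, hC, fun τ hτ => ?_⟩
  obtain ⟨-, h3, h4⟩ := h2 τ ⟨hτ.1, hτ.2.trans (le_max_left _ _)⟩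
  refine ⟨fun y => (le_abs_self _).trans (h3 y), ?_⟩
  simpa only [abs_of_nonneg (hnn τ _)] using h4

/-- The coefficients of the error term, in terms of the derivatives of the reference pair. -/
lemma coefficientSize_le (hp : IsPressureLaw p) (hh : IsPressurePotential p h)
    (hρb : IsReferenceRegular ρb) (hnb : IsReferenceRegular nb)
    (hpos : ∀ τ, 0 ≤ τ → ∀ y, 0 < ρb τ y) {s : ℝ} (hs : 0 < s) {y : Space d} {a L N : ℝ}
    (ha : 0 < a) (har : a ≤ ρb s y) (hL : |deriv p (ρb s y) / ρb s y| ≤ L) (hN : ‖nb s y‖ ≤ N) :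
    coefficientSize h ρb nb (s, y) ≤ (a⁻¹ * (1 + a⁻¹ * N) + L) *
      (‖nb s y‖ + ‖fderiv ℝ (ρb s) y‖ + ‖fderiv ℝ (nb s) y‖ + ‖deriv (fun s => ρb s y) s‖
        + ‖deriv (fun s => nb s y) s‖ + ‖fderiv ℝ (ρb s) y y‖ + ‖fderiv ℝ (nb s) y y‖) := by
  obtain ⟨e1, e2, e3, e4, -⟩ := reference_derivatives hp hh hρb hnb hpos hs y
  have hU := norm_velocity_le ha har (nb s y)
  have hL0 : 0 ≤ L := (abs_nonneg _).trans hL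
  have hN0 : 0 ≤ N := (norm_nonneg _).trans hN
  have hUN : ‖velocity (ρb s y) (nb s y)‖ ≤ a⁻¹ * N := hU.trans (by gcongr)
  unfold coefficientSize
  dsimp only
  rw [e3, e4]
  set r := ρb s y
  have hr : 0 < r := ha.trans_le har
  set U := velocity r (nb s y)
  set r' := deriv (fun s' => ρb s' y) s
  set Dr := fderiv ℝ (ρb s) y
  set U' := deriv (fun s' => velocity (ρb s' y) (nb s' y)) s
  set DU := fderiv ℝ (fun z => velocity (ρb s z) (nb s z)) y
  set q := deriv p r / r
  have div : ∀ x B : ℝ, r * x ≤ B → 0 ≤ x → x ≤ a⁻¹ * B := by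
    intro x B hx hx0
    rw [inv_mul_eq_div, le_div_iff₀ ha, mul_comm]
    exact (mul_le_mul_of_nonneg_right har hx0).trans hx
  -- The product rule for n̄ = ρ̄U is solved for the derivative of U, and ρ̄ ≥ a is divided out.
  have b1 : ‖DU‖ ≤ a⁻¹ * (‖fderiv ℝ (nb s) y‖ + ‖Dr‖ * (a⁻¹ * N)) := by
    refine div _ _ ?_ (norm_nonneg _)
    have h1 : r • DU = fderiv ℝ (nb s) y - Dr.smulRight U := by rw [e2]; abel
    calc r * ‖DU‖ = ‖r • DU‖ := by rw [norm_smul, Real.norm_of_nonneg hr.le]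
      _ ≤ ‖fderiv ℝ (nb s) y‖ + ‖Dr.smulRight U‖ := by rw [h1]; exact norm_sub_le _ _
      _ ≤ _ := by rw [ContinuousLinearMap.norm_smulRight_apply]; gcongr
  have b2 : ‖U'‖ ≤ a⁻¹ * (‖deriv (fun s => nb s y) s‖ + ‖r'‖ * (a⁻¹ * N)) := by
    refine div _ _ ?_ (norm_nonneg _)
    have h1 : r • U' = deriv (fun s => nb s y) s - r' • U := by rw [e1]; abel
    calc r * ‖U'‖ = ‖r • U'‖ := by rw [norm_smul, Real.norm_of_nonneg hr.le]
      _ ≤ ‖deriv (fun s => nb s y) s‖ + ‖r' • U‖ := by rw [h1]; exact norm_sub_le _ _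
      _ ≤ _ := by rw [norm_smul]; gcongr
  have b3 : ‖DU y‖ ≤ a⁻¹ * (‖fderiv ℝ (nb s) y y‖ + ‖Dr y‖ * (a⁻¹ * N)) := by
    refine div _ _ ?_ (norm_nonneg _)
    have h1 : r • DU y = fderiv ℝ (nb s) y y - Dr y • U := by
      rw [e2, add_apply, smul_apply, ContinuousLinearMap.smulRight_apply]; abel
    calc r * ‖DU y‖ = ‖r • DU y‖ := by rw [norm_smul, Real.norm_of_nonneg hr.le]
      _ ≤ ‖fderiv ℝ (nb s) y y‖ + ‖Dr y • U‖ := by rw [h1]; exact norm_sub_le _ _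
      _ ≤ _ := by rw [norm_smul]; gcongr
  have b4 : ‖q • Dr‖ ≤ L * ‖Dr‖ := by
    rw [norm_smul]; gcongr; exact hL
  have b5 : ‖q * r'‖ ≤ L * ‖r'‖ := by
    rw [norm_mul]; gcongr; exact hL
  have b6 : ‖(q • Dr) y‖ ≤ L * ‖Dr y‖ := by
    rw [smul_apply, norm_smul]; gcongr; exact hL
  have p1 : 0 ≤ (a⁻¹ * (a⁻¹ * N) + L) * (‖nb s y‖ + ‖fderiv ℝ (nb s) y‖
      + ‖deriv (fun s => nb s y) s‖ + ‖fderiv ℝ (nb s) y y‖) := by positivity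
  have p2 : 0 ≤ a⁻¹ * (‖Dr‖ + ‖r'‖ + ‖Dr y‖) := by positivity
  linarith

end Solution

end

section

/-! ### Admissibility of decaying perturbations -/

section Solution

variable {α : ℝ} {p h : ℝ → ℝ} {ρ ρb ρinf : ℝ → Space d → ℝ} {n nb : ℝ → Space d → Space d}
  {ρhat ρ₀ : Space d → ℝ} {n₀ : Space d → Space d} {K : (Space d → Space d) → ℝ} {E : ℝ → ℝ}

lemma HasReferenceDecay.isUniformlyBounded_coefficientSize (hp : IsPressureLaw p)
    (hh : IsPressurePotential p h) (hρ : IsAngularLimit ρhat)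
    (hsol : IsEnergyVariationalSolution α p h ρhat ρ₀ n₀ K ρinf ρ n E)
    (hρb : IsReferenceRegular ρb) (hnb : IsReferenceRegular nb)
    (hdec : HasReferenceDecay ρhat ρb nb) (T : ℝ) :
    IsUniformlyBounded (coefficientSize h ρb nb) (Ioo 0 T) := by
  have hb := isReferencePair_of_pos hp hh hρb hnb hdec.pos
  obtain ⟨a, b, L, R, ha, hL, hbd⟩ := hdec.exists_bounds hp hh hρ hsol hρb hnb T
  obtain ⟨L', hL', hLip⟩ := exists_lipschitz_bound hp hh (b := b) ha
  have hslice : ∀ {f : ℝ × Space d → ℝ}, ContinuousOn f (Ioi 0 ×ˢ univ) → ∀ τ ∈ Ioo 0 T,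
      AEStronglyMeasurable (fun y => f (τ, y)) := fun hf τ hτ =>
    (hf.comp_continuous (f := fun y : Space d => (τ, y)) (by fun_prop)
      fun _ => ⟨hτ.1, mem_univ _⟩).aestronglyMeasurable
  have cn : ContinuousOn (fun z : ℝ × Space d => ‖nb z.1 z.2‖) (Ioi 0 ×ˢ univ) :=
    hnb.1.continuousOn.norm
  have cDr : ContinuousOn (fun z : ℝ × Space d => fderiv ℝ (ρb z.1) z.2) (Ioi 0 ×ˢ univ) :=
    continuousOn_fderiv_space hρb.1
  have cDn : ContinuousOn (fun z : ℝ × Space d => fderiv ℝ (nb z.1) z.2) (Ioi 0 ×ˢ univ) :=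
    continuousOn_fderiv_space hnb.1
  have cr : ContinuousOn (fun z : ℝ × Space d => deriv (fun s => ρb s z.2) z.1) (Ioi 0 ×ˢ univ) :=
    continuousOn_deriv_time hρb.1
  have cm : ContinuousOn (fun z : ℝ × Space d => deriv (fun s => nb s z.2) z.1) (Ioi 0 ×ˢ univ) :=
    continuousOn_deriv_time hnb.1
  have u1 : IsUniformlyBounded (fun z : ℝ × Space d => ‖nb z.1 z.2‖) (Ioo 0 T) := by
    refine (hdec.isUniformlyBounded_decayBound hρ hρb hnb T R).of_le (L := L) (hslice cn)
      fun τ hτ y => ?_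
    rw [abs_norm, abs_of_nonneg (decayBound_nonneg R (τ, y))]
    exact (hbd τ hτ y).2.2.1
  have hsum := (((((u1.add (hdec.grad_density.isUniformlyBounded cDr.norm T)).add
    (hdec.grad_momentum.isUniformlyBounded cDn.norm T)).add
    (hdec.deriv_density.isUniformlyBounded cr.norm T)).add
    (hdec.deriv_momentum.isUniformlyBounded cm.norm T)).add
    (hdec.radial_density.isUniformlyBounded (cDr.clm_apply continuousOn_snd).norm T)).add
    (hdec.radial_momentum.isUniformlyBounded (cDn.clm_apply continuousOn_snd).norm T)
  refine hsum.of_le (L := a⁻¹ * (1 + a⁻¹ * L) + L') (hslice hb.coefficientSize_continuousOn)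
    fun τ hτ y => ?_
  obtain ⟨h1, h2, -, -⟩ := hbd τ hτ y
  rw [abs_of_nonneg (coefficientSize_nonneg _)]
  refine (coefficientSize_le hp hh hρb hnb hdec.pos hτ.1 ha h1.1 (hLip _ h1).1 h2).trans ?_
  gcongr
  exact le_abs_self _

/-- The γ-law enters here: it lets the relative potential control the pressure globally, where the
definition of a solution gives only local integrability. -/
lemma IsEnergyVariationalSolution.exists_stateSize_le (hp : IsPressureLaw p)
    (hh : IsPressurePotential p h) (hγ : IsGammaLaw p)
    (hρhat : IsAngularLimit ρhat ∨ ∀ y, ρhat y = 0)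
    (hsol : IsEnergyVariationalSolution α p h ρhat ρ₀ n₀ K ρinf ρ n E) (T : ℝ) :
    ∃ C : ℝ, 0 ≤ C ∧ ∀ τ ∈ Icc 0 T, ∀ y, IsState (ρ τ y) (n τ y) →
      stateSize p ρ n (τ, y) ≤ C * (1 + entropyValue h τ (ρ τ y) (n τ y) (ρinf τ y) 0) := by
  have hi := hsol.isReferencePair hh
  obtain ⟨A, hA, hbd⟩ := hsol.exists_state_bounds hp hh hρhat T
  obtain ⟨M, hM, hMb⟩ := hsol.exists_refdens_bound hp hh hρhat T
  obtain ⟨B, hB, hBb⟩ := exists_pressure_le hp hh hγ M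
  refine ⟨1 + A + A + A + B, by positivity, fun τ hτ y hst => ?_⟩
  obtain ⟨h1, h2, h3, h4, h5⟩ := hbd τ hτ y _ _ hst
  obtain ⟨m1, m2, m3⟩ := hMb τ hτ y
  have h6 := hBb _ _ (hi.nonneg τ hτ.1 y) m1 m2 m3 hst.nonneg (hi.differentiableWithinAt τ hτ.1 y)
  set e := entropyValue h τ (ρ τ y) (n τ y) (ρinf τ y) 0
  have h7 : B * (1 + relPotential h (ρ τ y) (ρinf τ y)) ≤ B * (1 + e) := by gcongr
  have hk : 0 ≤ ‖n τ y‖ ^ 2 / ρ τ y := div_nonneg (by positivity) hst.nonneg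
  simp only [stateSize]
  rw [Real.norm_of_nonneg hst.nonneg, Real.norm_of_nonneg hk, Real.norm_eq_abs (p _)]
  linarith

/-- A uniformly bounded coefficient times the size of the state is integrable. -/
lemma IsEnergyVariationalSolution.integrableOn_of_le_stateSize {F : Type*} [NormedAddCommGroup F]
    (hp : IsPressureLaw p) (hh : IsPressurePotential p h) (hγ : IsGammaLaw p)
    (hρhat : IsAngularLimit ρhat ∨ ∀ y, ρhat y = 0)
    (hsol : IsEnergyVariationalSolution α p h ρhat ρ₀ n₀ K ρinf ρ n E) {T : ℝ}
    {g : ℝ × Space d → ℝ} (hg : IsUniformlyBounded g (Ioo 0 T)) (hg0 : ∀ z, 0 ≤ g z)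
    (hgm : AEStronglyMeasurable g (volume.restrict (Ioo 0 T ×ˢ univ))) {f : ℝ × Space d → F}
    (hfm : AEStronglyMeasurable f (volume.restrict (Ioo 0 T ×ˢ univ))) {C : ℝ} (hC : 0 ≤ C)
    (hle : ∀ τ ∈ Ioo 0 T, ∀ y, IsState (ρ τ y) (n τ y) →
      ‖f (τ, y)‖ ≤ C * (g (τ, y) * stateSize p ρ n (τ, y))) : IntegrableOn f (Ioo 0 T ×ˢ univ) := by
  obtain ⟨A, hA, hAb⟩ := hsol.exists_stateSize_le hp hh hγ hρhat T
  obtain ⟨hst, hent⟩ := hsol.ae_isState_and_integrableOn hp hh T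
  obtain ⟨B, hB, hBb⟩ := id hg
  -- The L¹ bound of the coefficient is used against the constant in the bound for `stateSize`, and
  -- its sup bound against the entropy.
  refine Integrable.mono' (((hg.integrableOn hgm).const_mul (C * A)).add
    (hent.norm.const_mul (C * A * B))) hfm ?_
  filter_upwards [hst, ae_restrict_mem (measurableSet_Ioo.prod MeasurableSet.univ)] with z hz hzT
  set e := entropyValue h z.1 (ρ z.1 z.2) (n z.1 z.2) (ρinf z.1 z.2) 0 with he
  have h1 : stateSize p ρ n z ≤ A * (1 + ‖e‖) :=
    (hAb z.1 (Ioo_subset_Icc_self hzT.1) z.2 hz).trans (by gcongr; exact le_abs_self _)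
  have h2 : g z ≤ B := (le_abs_self _).trans ((hBb z.1 hzT.1).2.1 z.2)
  calc ‖f z‖ ≤ C * (g z * stateSize p ρ n z) := hle z.1 hzT.1 z.2 hz
    _ ≤ C * (g z * (A * (1 + ‖e‖))) := by
        gcongr
        exact hg0 z
    _ = C * A * g z + C * A * (g z * ‖e‖) := by ring
    _ ≤ C * A * g z + C * A * (B * ‖e‖) := by gcongr
    _ = _ := by simp only [Pi.add_apply, ← he]; ring

/-- The coefficients are bounded in L¹ ∩ L^∞ down to τ = 0, so, in contrast to compact
perturbations, no separate hypothesis near the initial time is needed. -/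
lemma HasReferenceDecay.integrableOn_xiForm_and_flux (hp : IsPressureLaw p)
    (hh : IsPressurePotential p h) (hγ : IsGammaLaw p) (hρ : IsAngularLimit ρhat)
    (hsol : IsEnergyVariationalSolution α p h ρhat ρ₀ n₀ K ρinf ρ n E)
    (hρb : IsReferenceRegular ρb) (hnb : IsReferenceRegular nb)
    (hdec : HasReferenceDecay ρhat ρb nb) (T : ℝ) :
    IntegrableOn (fun z : ℝ × Space d => xiForm α p h ρ n ρb nb z.1 z.2) (Ioo 0 T ×ˢ univ) ∧
      IntegrableOn (fun z : ℝ × Space d =>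
        (p (ρ z.1 z.2) - legendre h (ρb z.1 z.2)) • velocity (ρb z.1 z.2) (nb z.1 z.2))
        (Ioo 0 T ×ˢ univ) := by
  have hsub : Ioo 0 T ⊆ Ici (0:ℝ) := fun x hx => mem_Ici.2 hx.1.le
  have hb := isReferencePair_of_pos hp hh hρb hnb hdec.pos
  obtain ⟨a, b, L, R, ha, hL, hbd⟩ := hdec.exists_bounds hp hh hρ hsol hρb hnb T
  obtain ⟨P, hP⟩ := isCompact_Icc.exists_bound_of_continuousOn
    (hp.continuousOn.mono fun x (hx : x ∈ Icc a b) => mem_Ici.2 (ha.le.trans hx.1))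
  have hcs := hdec.isUniformlyBounded_coefficientSize hp hh hρ hsol hρb hnb T
  have hcm := aestronglyMeasurable_of_continuousOn_Ioi hb.coefficientSize_continuousOn T
  set M := 1 + |b| + |P| + a⁻¹ * L with hM
  have hM1 : 1 ≤ M := by
    have : 0 ≤ a⁻¹ * L := by positivity
    linarith [abs_nonneg b, abs_nonneg P]
  have key : ∀ τ ∈ Ioo 0 T, ∀ y, ‖velocity (ρb τ y) (nb τ y)‖ ≤ M ∧ |ρb τ y| ≤ M ∧
      |legendre h (ρb τ y)| ≤ M := by
    intro τ hτ y
    obtain ⟨h1, h2, -, -⟩ := hbd τ hτ y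
    have h3 : 0 ≤ a⁻¹ * L := by positivity
    have hr := hdec.pos τ hτ.1.le y
    have e1 : legendre h (ρb τ y) = p (ρb τ y) := hh.mul_enthalpy_sub hr
    refine ⟨?_, ?_, ?_⟩
    · have h4 : a⁻¹ * ‖nb τ y‖ ≤ a⁻¹ * L := by gcongr
      linarith [norm_velocity_le ha h1.1 (nb τ y), abs_nonneg b, abs_nonneg P]
    · rw [abs_of_pos hr]
      linarith [h1.2, le_abs_self b, abs_nonneg P]
    · rw [e1]
      have := hP _ h1
      rw [Real.norm_eq_abs] at this
      linarith [le_abs_self P, abs_nonneg b]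
  constructor
  · refine hsol.integrableOn_of_le_stateSize hp hh hγ (Or.inl hρ) hcs coefficientSize_nonneg hcm
      (hsol.aestronglyMeasurable_xiForm hh hb T) (C := 2 * M ^ 2 * (4 + 2 * d + |α|))
      (by positivity) fun τ hτ y hst => ?_
    obtain ⟨k1, k2, k3⟩ := key τ hτ y
    exact hst.abs_xiForm_le hτ.1.le hM1 k1 k2 k3
  · have hfm : AEStronglyMeasurable (fun z : ℝ × Space d =>
        (p (ρ z.1 z.2) - legendre h (ρb z.1 z.2)) • velocity (ρb z.1 z.2) (nb z.1 z.2))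
        (volume.restrict (Ioo 0 T ×ˢ univ)) :=
      ((hsol.pressure_locallyIntegrable.aestronglyMeasurable.mono_measure
        (Measure.restrict_mono (prod_mono hsub Subset.rfl) le_rfl)).sub
        (aestronglyMeasurable_slab (hb.legendre_continuousOn hh) hsub measurableSet_Ioo)).smul
        (aestronglyMeasurable_slab hb.velocity_continuousOn hsub measurableSet_Ioo)
    refine hsol.integrableOn_of_le_stateSize hp hh hγ (Or.inl hρ) hcs coefficientSize_nonneg hcm
      hfm (C := M) (by positivity) fun τ hτ y _ => ?_
    obtain ⟨-, -, k3⟩ := key τ hτ y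
    have h1 : ‖velocity (ρb τ y) (nb τ y)‖ ≤ coefficientSize h ρb nb (τ, y) := by
      unfold coefficientSize
      simp only [add_assoc]
      exact le_add_of_nonneg_right (by positivity)
    have h2 : |p (ρ τ y)| + 1 ≤ stateSize p ρ n (τ, y) := by
      unfold stateSize
      linarith [norm_nonneg (ρ τ y), Real.norm_eq_abs (p (ρ τ y)), norm_nonneg (n τ y),
        norm_nonneg (‖n τ y‖ ^ 2 / ρ τ y)]
    have h3 : ‖p (ρ τ y) - legendre h (ρb τ y)‖ ≤ M * stateSize p ρ n (τ, y) := by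
      refine (norm_sub_le _ _).trans ?_
      rw [Real.norm_eq_abs (p _), Real.norm_eq_abs (legendre _ _)]
      nlinarith [abs_nonneg (p (ρ τ y))]
    rw [norm_smul]
    calc _ ≤ (M * stateSize p ρ n (τ, y)) * coefficientSize h ρb nb (τ, y) :=
          mul_le_mul h3 h1 (norm_nonneg _) ((norm_nonneg _).trans h3)
      _ = _ := by ring

lemma IsEnergyVariationalSolution.exists_energyDefect_bound (hp : IsPressureLaw p)
    (hh : IsPressurePotential p h)
    (hsol : IsEnergyVariationalSolution α p h ρhat ρ₀ n₀ K ρinf ρ n E) :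
    ∃ B : ℝ, 0 ≤ B ∧ ∀ᵐ s ∂(volume.restrict (Ioi (0 : ℝ))), |energyDefect h ρinf ρ n E s| ≤ B := by
  obtain ⟨B, hB, hEB⟩ := hsol.exists_energy_bound
  refine ⟨B, hB, ?_⟩
  filter_upwards [hsol.ae_isFiniteSlice hp hh, ae_restrict_mem measurableSet_Ioi] with s h1 hs
  have h2 : 0 ≤ (relEntropy h s (ρ s) (n s) (ρinf s) 0).toReal := ENNReal.toReal_nonneg
  rw [energyDefect, abs_of_nonneg (by linarith [h1.2])]
  linarith [le_abs_self (E s), hEB s (le_of_lt hs)]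

/-- The values of the regularity weight on truncated velocity fields. -/
lemma IsTruncationStable.truncation (hp : IsPressureLaw p) (hh : IsPressurePotential p h)
    (hK : IsTruncationStable K)
    (hsol : IsEnergyVariationalSolution α p h ρhat ρ₀ n₀ K ρinf ρ n E)
    (hb : IsReferencePair h ρb nb) {T : ℝ}
    (hcs : IsUniformlyBounded (coefficientSize h ρb nb) (Ioo 0 T)) {χ : Space d → ℝ}
    (hχ : IsCutoff χ) :
    (∀ s ∈ Ioo 0 T, Tendsto (fun j => K fun y => dilate χ j y • -velocity (ρb s y) (nb s y)) atTop
      (𝓝 (K fun y => -velocity (ρb s y) (nb s y)))) ∧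
    ∃ G : ℝ, ∀ᵐ s ∂(volume.restrict (Ioo 0 T)), ∀ j,
      ‖K (fun y => dilate χ j y • -velocity (ρb s y) (nb s y)) * energyDefect h ρinf ρ n E s‖
        ≤ G := by
  obtain ⟨B, hB, hBb⟩ := hcs
  obtain ⟨Cχ, hCχ, hχb⟩ := hχ.exists_fderiv_dilate_le
  obtain ⟨C, hC⟩ := hK.bounded
  obtain ⟨D, hD, hDb⟩ := hsol.exists_energyDefect_bound hp hh
  have hU : ∀ s ∈ Ioo 0 T, ContDiff ℝ 1 fun y => -velocity (ρb s y) (nb s y) := fun s hs =>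
    (contDiff_slice hb.velocity_contDiffOn hs.1).neg
  have hbd : ∀ s ∈ Ioo 0 T, ∀ y, ‖-velocity (ρb s y) (nb s y)‖ ≤ B ∧
      ‖fderiv ℝ (fun y => -velocity (ρb s y) (nb s y)) y‖ ≤ B := by
    intro s hs y
    have h1 : coefficientSize h ρb nb (s, y) ≤ B := (le_abs_self _).trans ((hBb s hs).2.1 y)
    unfold coefficientSize at h1
    dsimp only at h1
    rw [fderiv_fun_neg, norm_neg, norm_neg]
    set F := fderiv ℝ (fun y => velocity (ρb s y) (nb s y)) y
    set F' := fderiv ℝ (fun y => enthalpy h (ρb s y)) y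
    have t1 := norm_nonneg (velocity (ρb s y) (nb s y))
    have t2 := norm_nonneg F
    have t3 := norm_nonneg (deriv (fun s => velocity (ρb s y) (nb s y)) s)
    have t4 := norm_nonneg (F y)
    have t5 := norm_nonneg F'
    have t6 := norm_nonneg (deriv (fun s => enthalpy h (ρb s y)) s)
    have t7 := norm_nonneg (F' y)
    constructor <;> linarith
  refine ⟨fun s hs => hK.tendsto _ (hU s hs) ⟨B, hbd s hs⟩ χ hχ.contDiff hχ.hasCompactSupport
    hχ.mem_Icc hχ.eventually_eq_one, |C| * (B + Cχ * B) * D, ?_⟩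
  filter_upwards [ae_mono (Measure.restrict_mono Ioo_subset_Ioi_self le_rfl) hDb,
    ae_restrict_mem measurableSet_Ioo] with s hsD hs j
  have ht : IsTestField fun y => dilate χ j y • -velocity (ρb s y) (nb s y) :=
    ⟨(dilate_contDiff hχ.contDiff_one j).smul (hU s hs),
      (dilate_hasCompactSupport hχ.hasCompactSupport j).smul_right⟩
  -- By the product rule B + Cχ B bounds the truncated velocity and its gradient, uniformly in the
  -- dilation parameter and in time.
  have hKle := hC _ ht (B + Cχ * B) fun y => by
    obtain ⟨h1, h2⟩ := hbd s hs y
    have h3 : ‖dilate χ j y‖ ≤ 1 := by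
      have := hχ.mem_Icc (((j : ℝ) + 1)⁻¹ • y)
      exact (Real.norm_of_nonneg this.1).le.trans this.2
    have h4 : ‖fderiv ℝ (dilate χ j) y‖ ≤ Cχ := (hχb j y).trans (mul_le_of_le_one_right hCχ
      (inv_le_one_of_one_le₀ (by linarith [Nat.cast_nonneg (α := ℝ) j])))
    constructor
    · rw [norm_smul]
      exact (mul_le_of_le_one_left (norm_nonneg _) h3).trans (h1.trans
        (le_add_of_nonneg_right (by positivity)))
    · rw [fderiv_fun_smul ((dilate_contDiff hχ.contDiff_one j).differentiable (by norm_num) y)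
        ((hU s hs).differentiable (by norm_num) y)]
      refine (norm_add_le _ _).trans (add_le_add ?_ ?_)
      · rw [norm_smul]
        exact (mul_le_of_le_one_left (norm_nonneg _) h3).trans h2
      · rw [ContinuousLinearMap.norm_smulRight_apply]
        gcongr
  rw [norm_mul, Real.norm_of_nonneg (hsol.weight.nonneg _ ht), Real.norm_eq_abs]
  gcongr
  exact hKle.trans (by gcongr; exact le_abs_self C)

/-- Decaying perturbations are admissible. -/
lemma HasReferenceDecay.isAdmissible (hp : IsPressureLaw p) (hh : IsPressurePotential p h)
    (hγ : IsGammaLaw p) (hρ : IsAngularLimit ρhat)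
    (hsol : IsEnergyVariationalSolution α p h ρhat ρ₀ n₀ K ρinf ρ n E)
    (hρb : IsReferenceRegular ρb) (hnb : IsReferenceRegular nb)
    (hdec : HasReferenceDecay ρhat ρb nb) (hK : IsTruncationStable K) {χ : Space d → ℝ}
    (hχ : IsCutoff χ) : IsAdmissible α p h K ρinf ρ n E ρb nb χ := by
  have hb := isReferencePair_of_pos hp hh hρb hnb hdec.pos
  have hxi : ∀ s, 0 < s → ∀ y, xi α p h ρ n ρb nb s y = xiForm α p h ρ n ρb nb s y :=
    fun s hs y => xi_eq_xiForm_of_pos hp hh hρb hnb hdec.pos hs y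
  have hint : ∀ T : ℝ, IntegrableOn (fun z : ℝ × Space d => xi α p h ρ n ρb nb z.1 z.2)
      (Ioo 0 T ×ˢ univ) := fun T =>
    (hdec.integrableOn_xiForm_and_flux hp hh hγ hρ hsol hρb hnb T).1.congr_fun
      (fun z hz => (hxi z.1 hz.1.1 z.2).symm) (measurableSet_Ioo.prod MeasurableSet.univ)
  have hmono : ∀ {δ T : ℝ}, 0 < δ → Ioo δ T ×ˢ (univ : Set (Space d)) ⊆ Ioo 0 T ×ˢ univ :=
    fun hδ => prod_mono (Ioo_subset_Ioo_left hδ.le) Subset.rfl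
  have htr : ∀ T : ℝ, _ := fun T => hK.truncation hp hh hsol hb
    (hdec.isUniformlyBounded_coefficientSize hp hh hρ hsol hρb hnb T) hχ
  have hcontrol : ∀ δ T : ℝ, 0 < δ → δ < T →
      IsTruncationControlled h K ρinf ρ n E ρb nb χ δ T := by
    intro δ T hδ _
    obtain ⟨ht, G, hG⟩ := htr T
    refine ⟨?_, fun _ => G, integrableOn_const (by simp), 0, fun j _ => ?_⟩
    · filter_upwards [ae_restrict_mem measurableSet_Ioo] with s hs
        using ht s ⟨hδ.trans hs.1, hs.2⟩
    · filter_upwards [ae_mono (Measure.restrict_mono (Ioo_subset_Ioo_left hδ.le) le_rfl) hG]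
        with s hs using hs j
  refine ⟨hb, hdec.hasMultiplierDecay hp hh hρ hsol hρb hnb, fun s hs y _ => hxi s hs y,
    fun δ T hδ => (hdec.integrableOn_xiForm_and_flux hp hh hγ hρ hsol hρb hnb T).2.mono_set
      (hmono hδ), fun δ T hδ => (hint T).mono_set (hmono hδ), hcontrol, 1, one_pos, hint 1, ?_⟩
  -- Measurability is known only away from time 0, so (0, 1) is exhausted by the intervals (1/(k+2),
  -- 1); the shift by 2 keeps all of them nonempty.
  have hmeas : AEStronglyMeasurable (weightedDefect h K ρinf ρ n E ρb nb)
      (volume.restrict (Ioo 0 1)) := by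
    have h1 : Ioo (0:ℝ) 1 = ⋃ k : ℕ, Ioo (1 / ((k : ℝ) + 2)) 1 := by
      ext s
      simp only [mem_iUnion, mem_Ioo]
      constructor
      · rintro ⟨h0, h1⟩
        obtain ⟨k, hk⟩ := exists_nat_one_div_lt h0
        refine ⟨k, lt_of_le_of_lt ?_ hk, h1⟩
        gcongr
        norm_num
      · rintro ⟨k, hk, h1⟩
        exact ⟨lt_trans (by positivity) hk, h1⟩
    rw [h1, aestronglyMeasurable_iUnion_iff]
    intro k
    have hk : 1 / ((k : ℝ) + 2) < 1 := by
      rw [div_lt_one (by positivity)]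
      linarith [Nat.cast_nonneg (α := ℝ) k]
    exact ((hcontrol _ 1 (by positivity) hk).integrableOn_weightedDefect hsol hb hχ (by positivity)
      hk).aestronglyMeasurable
  obtain ⟨ht, G, hG⟩ := htr 1
  refine Integrable.of_bound hmeas G ?_
  filter_upwards [hG, ae_restrict_mem measurableSet_Ioo] with s hs1 hs
  exact le_of_tendsto' ((ht s hs).mul_const (energyDefect h ρinf ρ n E s)).norm hs1

end Solution

end

end DampedEuler

end

theorem mainTheorem8 {d : ℕ} (hd : 1 ≤ d) (α : ℝ) (hα : 0 ≤ α)
    (p h : ℝ → ℝ) (hp : IsPressureLaw p) (hh : IsPressurePotential p h)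
    (ρhat : Space d → ℝ) (hρhat : IsAngularLimit ρhat ∨ ∀ y, ρhat y = 0)
    (ρ₀ : Space d → ℝ) (n₀ : Space d → Space d) (K : (Space d → Space d) → ℝ)
    (ρinf ρ : ℝ → Space d → ℝ) (n : ℝ → Space d → Space d) (E : ℝ → ℝ)
    (hsol : IsEnergyVariationalSolution α p h ρhat ρ₀ n₀ K ρinf ρ n E)
    (ρb : ℝ → Space d → ℝ) (nb : ℝ → Space d → Space d)
    (hρb : IsReferenceRegular ρb) (hnb : IsReferenceRegular nb)
    (hcase :
      -- case (a)
      (((IsAngularLimit ρhat ∧ IsCompactPerturbation ρhat ρb nb ∧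
            -- the right-hand side of the inequality is integrable near `τ = 0`
            ∃ δ : ℝ, 0 < δ ∧
              IntegrableOn (Function.uncurry (xi α p h ρ n ρb nb)) (Ioo 0 δ ×ˢ univ) ∧
              IntegrableOn (weightedDefect h K ρinf ρ n E ρb nb) (Ioo 0 δ)) ∨
          ((∀ y, ρhat y = 0) ∧ (∀ τ, 0 ≤ τ → ∀ y, ρb τ y = 0 ∧ nb τ y = 0) ∧
            IsVacuumRegular p)) ∨
      -- case (b)
        (IsGammaLaw p ∧ HasReferenceDecay ρhat ρb nb ∧ IsTruncationStable K))) :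
    -- all terms of the inequality are well defined
    (relEntropy h 0 ρ₀ n₀ (ρinf 0) 0 ≠ ⊤ ∧ relEntropy h 0 ρ₀ n₀ (ρb 0) (nb 0) ≠ ⊤) ∧
    (∀ᵐ τ ∂(volume.restrict (Ioi (0 : ℝ))),
      relEntropy h τ (ρ τ) (n τ) (ρb τ) (nb τ) ≠ ⊤) ∧
    (∀ T : ℝ,
      IntegrableOn (modifiedEntropy h ρinf ρ n E ρb nb) (Ioo 0 T) ∧
      IntegrableOn (fun z : ℝ × Space d => ρ z.1 z.2 * ‖relVelocity ρ n ρb nb z.1 z.2‖ ^ 2)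
        (Ioo 0 T ×ˢ univ) ∧
      IntegrableOn (Function.uncurry (xi α p h ρ n ρb nb)) (Ioo 0 T ×ˢ univ) ∧
      IntegrableOn (weightedDefect h K ρinf ρ n E ρb nb) (Ioo 0 T)) ∧
    -- the relative entropy inequality
    ∀ φ : ℝ → ℝ, ContDiff ℝ 1 φ → HasCompactSupport φ → (∀ τ, 0 ≤ τ → 0 ≤ φ τ) →
      (∫ τ in Ioi (0 : ℝ),
          (-deriv φ τ * modifiedEntropy h ρinf ρ n E ρb nb τ
            + φ τ * ((d : ℝ) / 2 * modifiedEntropy h ρinf ρ n E ρb nb τ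
              + dissipation α ρ n ρb nb τ)))
        ≤ φ 0 * initialModifiedEntropy h ρ₀ n₀ ρinf E ρb nb
          + ∫ τ in Ioi (0 : ℝ),
              φ τ * (bigXi α p h ρ n ρb nb τ + weightedDefect h K ρinf ρ n E ρb nb τ) := by
  obtain ⟨χ, hχ⟩ := exists_isCutoff (d := d)
  rcases hcase with (⟨hlim, hcp, hinit⟩ | ⟨hlim, h0, hv⟩) | ⟨hγ, hdec, hK⟩
  · exact (hcp.isAdmissible hp hh hsol hρb hnb hinit hχ).relative_entropy_inequality hχ hp hh hρhat
      hsol (hsol.isFiniteSlice_init hd hp hh (Or.inl hlim))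
  · exact (hv.isAdmissible hh hsol hlim h0 hχ).relative_entropy_inequality hχ hp hh hρhat hsol
      (hsol.isFiniteSlice_init hd hp hh (Or.inr ⟨hlim, hv.differentiableWithinAt hh⟩))
  -- The decay conditions exclude a vanishing limit density, so the initial slice is treated as in
  -- the positive case.
  · have hlim := hdec.isAngularLimit hd hρhat
    exact (hdec.isAdmissible hp hh hγ hlim hsol hρb hnb hK hχ).relative_entropy_inequality hχ hp hh
      hρhat hsol (hsol.isFiniteSlice_init hd hp hh (Or.inl hlim))
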